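/- Let $0<\rho<\rho'$ be real numbers and let $$\mathbb T=\Big\{(x,y,z)\in\mathbb R^3 : \big(\rho'-\sqrt{x^2+y^2}\big)^2+z^2\le\rho^2\Big\}$$ be the solid torus obtained by rotating a disc of radius $\rho$, with centre at distance $\rho'$ from the $z$-axis, about the $z$-axis. For $R>1$ put $$\mathcal N(R)=\#\{\vec n\in\mathbb Z^3 : R^{-1}\vec n\in\mathbb T\},\qquad \mathcal M(R)=2\pi^2\rho^2\rho'R^3+4\pi\rho\rho'R^2\sum_{n=1}^\infty\frac{J_1(2\pi\rho Rn)}{n},$$ where $J_1(x)=\frac1\pi\int_0^\pi\cos(\theta-x\sin\theta)\,d\theta$ is the Bessel function of the first kind of order $1$. Then $\mathcal N(R)$ is finite and the series converges absolutely for every $R>1$, and for every $\epsilon>0$ there is a constant $C$, depending only on $\rho$, $\rho'$ and $\epsilon$, such that $$|\mathcal N(R)-\mathcal M(R)|\le C\,R^{4/3+\epsilon}\qquad\text{for all } R>1.$$ -/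

import Mathlib

/-- The Bessel function of the first kind of integer order `k`, given by Bessel's integral
`J_k(x) = (1 / π) ∫_0^π cos (k θ - x sin θ) dθ`. -/
noncomputable def besselJ (k : ℤ) (x : ℝ) : ℝ :=
  (1 / Real.pi) * ∫ θ in (0 : ℝ)..Real.pi, Real.cos ((k : ℝ) * θ - x * Real.sin θ)

/-- The solid torus in `ℝ³` with tube radius `ρ` and central radius `ρ'`, whose axis is the
third coordinate axis. -/
def solidTorus (ρ ρ' : ℝ) : Set (Fin 3 → ℝ) :=
  {p | (ρ' - Real.sqrt (p 0 ^ 2 + p 1 ^ 2)) ^ 2 + p 2 ^ 2 ≤ ρ ^ 2}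

/-- The integer points `n` such that `R⁻¹ n` lies in the solid torus. -/
def torusLatticePoints (ρ ρ' R : ℝ) : Set (Fin 3 → ℤ) :=
  {n | R⁻¹ • (fun i => (n i : ℝ)) ∈ solidTorus ρ ρ'}

/-- The number of integer points in the `R`-dilate of the solid torus. -/
noncomputable def torusCount (ρ ρ' R : ℝ) : ℕ :=
  (torusLatticePoints ρ ρ' R).ncard

/-- The `n`-th term, for `n = k + 1 ≥ 1`, of the series of Bessel functions
in the secondary main term. -/
noncomputable def torusBesselTerm (ρ R : ℝ) (k : ℕ) : ℝ :=
  besselJ 1 (2 * Real.pi * ρ * R * ((k : ℝ) + 1)) / ((k : ℝ) + 1)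

/-- The main term
`2 π² ρ² ρ' R³ + 4 π ρ ρ' R² ∑_{n ≥ 1} J₁(2 π ρ R n) / n`. -/
noncomputable def torusMainTerm (ρ ρ' R : ℝ) : ℝ :=
  2 * Real.pi ^ 2 * ρ ^ 2 * ρ' * R ^ 3
    + 4 * Real.pi * ρ * ρ' * R ^ 2 * ∑' k : ℕ, torusBesselTerm ρ R k

/-!
The indicator function of the dilated torus is smoothed by convolution with a bump of width
`δ = R ^ (-2/3)`. Since moving a point by `δ` changes the tube radius by at most `2 δ`
(`mem_torusSet_of_abs_sub_le`), the lattice point count lies between the smoothed counts for the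
tube radii `a = ρ R ± 2 δ`, and Poisson summation turns these into absolutely convergent sums of the
Fourier transform of the torus over `ℤ³`, cut off smoothly at frequency `1 / δ`
(`exists_fourier_weight`).

The frequencies on the axis of the torus give the main term: there the Fourier transform is a
multiple of `J₁(2 π a l) / l` (`setIntegral_torusSet_ee_axis`), and removing the cutoff and the
change of radius costs `O(R ^ (4/3))` (`exists_norm_tsum_axis_sub_le`).

At a frequency at distance `q = √k` from the axis and of length `s = √m`, stationary phase on the
meridian circle together with the asymptotics of `J₁` shows that the Fourier transform is a
combination of terms of size about `R q ^ (-1/2) s ^ (-3/2)` with phases `± q A ± a s`, up to a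
small error (`exists_torusHat_asymptotic`); here `A = ρ' R`. Only the factor `e(a s) = e(a √m)`
depends on the sign and size of the height `ν` in an essential way, and it is a function of
`m = k + ν²`. For `m` in a dyadic block, the sum over `ν` with `k` fixed is the `k`-th Fourier
coefficient of the product of `∑ₘ e(a √m + m θ)` and a quadratic exponential sum `∑ c_ν e(-ν² θ)`.
Bessel's inequality and Cauchy–Schwarz in `θ` bound its mean square over `k` by fourth moments of
the two factors (`sum_norm_rowSum_sq_le`). The fourth moment of the second counts solutions of
`n₁² + n₂² = n₃² + n₄²` (`card_sqQuads_le`). The fourth moment of the first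
(`integral_norm_sqrtSum_pow_four_le`) is localised in `θ` by a Fejér kernel; there the sum splits
into pieces, one for each integer near the increments of the phase, each piece is bounded by the van
der Corput or the Kuzmin–Landau inequality, and the interaction of four pieces is controlled by the
number of near-coincidences `1/x₁² + 1/x₂² ≈ 1/x₃² + 1/x₄²` (`sum_volume_nearSet_le`). The outcome
is `norm_sum_box_le`, which leaves `R ^ (4/3 + ε)` for all off-axis frequencies up to
`R ^ (2/3 + ε)` (`exists_norm_sum_planeBox_torusFourier_le`). The rapid decay of the cutoff disposes
of the larger frequencies (`norm_tsum_sub_axis_sub_box_le`).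
-/

open MeasureTheory

/-! ### Exponential sums: the Kuzmin–Landau and van der Corput inequalities -/

/-- The additive character `e(x) = exp (2 π i x)`. -/
noncomputable def ee (x : ℝ) : ℂ := Complex.exp (2 * Real.pi * x * Complex.I)

lemma ee_add (x y : ℝ) : ee (x + y) = ee x * ee y := by
  unfold ee; rw [← Complex.exp_add]; push_cast; ring_nf

lemma ee_zero : ee 0 = 1 := by simp [ee]

lemma ee_eq (x : ℝ) : ee x = Complex.exp ((2 * Real.pi * x : ℝ) * Complex.I) := by
  unfold ee; push_cast; rfl

lemma norm_ee (x : ℝ) : ‖ee x‖ = 1 := by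
  rw [ee_eq]; exact Complex.norm_exp_ofReal_mul_I _

lemma ee_int (n : ℤ) : ee n = 1 := by
  rw [ee, Complex.exp_eq_one_iff]; exact ⟨n, by push_cast; ring⟩

lemma ee_add_int (x : ℝ) (n : ℤ) : ee (x + n) = ee x := by
  rw [ee_add, ee_int, mul_one]

lemma ee_neg (x : ℝ) : ee (-x) = (starRingEnd ℂ) (ee x) := by
  rw [ee_eq, ee_eq, ← Complex.exp_conj, map_mul, Complex.conj_ofReal, Complex.conj_I]
  congr 1; push_cast; ring

lemma ee_eq_cos_add_sin (x : ℝ) :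
    ee x = Real.cos (2 * Real.pi * x) + Real.sin (2 * Real.pi * x) * Complex.I := by
  rw [ee_eq, Complex.exp_mul_I]; push_cast; rfl

@[fun_prop]
lemma continuous_ee : Continuous ee := by unfold ee; fun_prop

/-- The identity `1 / (1 - e(x)) = 1/2 + (i/2) cot (π x)`. -/
lemma half_add_cot_mul_one_sub_ee {x : ℝ} (hx : Real.sin (Real.pi * x) ≠ 0) :
    ((1 / 2 : ℂ) + (Real.cos (Real.pi * x) / (2 * Real.sin (Real.pi * x)) : ℝ) * Complex.I)
      * (1 - ee x) = 1 := by
  rw [ee_eq_cos_add_sin, show 2 * Real.pi * x = 2 * (Real.pi * x) by ring, Real.cos_two_mul,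
    Real.sin_two_mul]
  have h2 := Real.sin_sq_add_cos_sq (Real.pi * x)
  apply Complex.ext
  · simp only [Complex.mul_re, Complex.add_re, Complex.sub_re, Complex.one_re, Complex.mul_im,
      Complex.add_im, Complex.sub_im, Complex.one_im, Complex.ofReal_re, Complex.ofReal_im,
      Complex.I_re, Complex.I_im, Complex.ofReal_mul, Complex.ofReal_sub,
      Complex.ofReal_one, Complex.div_ofNat_re, Complex.div_ofNat_im, Complex.ofReal_ofNat,
      Complex.re_ofNat, Complex.im_ofNat, pow_two]
    field_simp
    nlinarith
  · simp only [Complex.mul_re, Complex.add_re, Complex.sub_re, Complex.one_re, Complex.mul_im,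
      Complex.add_im, Complex.sub_im, Complex.one_im, Complex.ofReal_re, Complex.ofReal_im,
      Complex.I_re, Complex.I_im, Complex.ofReal_mul, Complex.ofReal_sub,
      Complex.ofReal_one, Complex.div_ofNat_re, Complex.div_ofNat_im, Complex.ofReal_ofNat,
      Complex.re_ofNat, Complex.im_ofNat, pow_two]
    field_simp
    linear_combination (-2 * Real.cos (Real.pi * x)) * h2

lemma cot_antitone {x y : ℝ} (hx : 0 < x) (hxy : x ≤ y) (hy : y < 1) :
    Real.cos (Real.pi * y) / (2 * Real.sin (Real.pi * y)) ≤
      Real.cos (Real.pi * x) / (2 * Real.sin (Real.pi * x)) := by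
  have hpi := Real.pi_pos
  have h1 : 0 < Real.sin (Real.pi * x) :=
    Real.sin_pos_of_pos_of_lt_pi (by positivity) (by nlinarith)
  have h2 : 0 < Real.sin (Real.pi * y) :=
    Real.sin_pos_of_pos_of_lt_pi (by nlinarith) (by nlinarith)
  have h3 : 0 ≤ Real.sin (Real.pi * y - Real.pi * x) :=
    Real.sin_nonneg_of_nonneg_of_le_pi (by nlinarith) (by nlinarith)
  rw [Real.sin_sub] at h3
  rw [div_le_div_iff₀ (by positivity) (by positivity)]
  nlinarith

lemma two_mul_le_sin_pi_mul {x d : ℝ} (hd : 0 < d) (h1 : d ≤ x) (h2 : x ≤ 1 - d) :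
    2 * d ≤ Real.sin (Real.pi * x) := by
  have hpi := Real.pi_pos
  rcases le_total x (1 / 2) with h | h
  · have := Real.mul_le_sin (x := Real.pi * x) (by nlinarith) (by nlinarith)
    have h3 : 2 / Real.pi * (Real.pi * x) = 2 * x := by field_simp
    linarith
  · have := Real.mul_le_sin (x := Real.pi * (1 - x)) (by nlinarith) (by nlinarith)
    have h3 : 2 / Real.pi * (Real.pi * (1 - x)) = 2 * (1 - x) := by field_simp
    have h4 : Real.sin (Real.pi * (1 - x)) = Real.sin (Real.pi * x) := by
      rw [show Real.pi * (1 - x) = Real.pi - Real.pi * x by ring, Real.sin_pi_sub]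
    linarith

/-- Kuzmin–Landau inequality on an interval of integers. -/
lemma norm_sum_Ico_ee_le {f : ℕ → ℝ} {p q : ℕ} {d : ℝ} (h : ℤ) (hd : 0 < d)
    (hlow : ∀ n ∈ Finset.Ico p q, h + d ≤ f (n + 1) - f n)
    (hupp : ∀ n ∈ Finset.Ico p q, f (n + 1) - f n ≤ h + 1 - d)
    (hanti : ∀ n, n ∈ Finset.Ico p q → n + 1 ∈ Finset.Ico p q →
      f (n + 2) - f (n + 1) ≤ f (n + 1) - f n) :
    ‖∑ n ∈ Finset.Ico p q, ee (f n)‖ ≤ 1 / d := by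
  -- `w n = 1 / (1 - e(f (n + 1) - f n))` turns `e(f n)` into a difference, and `w = 1/2 + i c` with
  -- `c` half the cotangent of `π` times the increment, so the monotonicity of the increments bounds
  -- the total variation of `w`.
  set c : ℕ → ℝ := fun n => Real.cos (Real.pi * (f (n + 1) - f n - h)) /
    (2 * Real.sin (Real.pi * (f (n + 1) - f n - h))) with hc
  set w : ℕ → ℂ := fun n => (1 / 2 : ℂ) + (c n : ℝ) * Complex.I with hw
  have hsin : ∀ n ∈ Finset.Ico p q, 2 * d ≤ Real.sin (Real.pi * (f (n + 1) - f n - h)) := by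
    intro n hn
    exact two_mul_le_sin_pi_mul hd (by linarith [hlow n hn]) (by linarith [hupp n hn])
  have hwmul : ∀ n ∈ Finset.Ico p q, w n * (1 - ee (f (n + 1) - f n)) = 1 := by
    intro n hn
    have h1 := half_add_cot_mul_one_sub_ee (x := f (n + 1) - f n - h)
      (by linarith [hsin n hn])
    have h2 : ee (f (n + 1) - f n - h) = ee (f (n + 1) - f n) := by
      rw [← ee_add_int (f (n + 1) - f n - h) h]; congr 1; ring
    rw [h2] at h1
    exact h1
  have hstep : ∀ n ∈ Finset.Ico p q, ee (f (n + 1)) * w n = ee (f n) * (w n - 1) := by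
    intro n hn
    have h1 : ee (f (n + 1)) = ee (f n) * ee (f (n + 1) - f n) := by
      rw [← ee_add]; congr 1; ring
    rw [h1]
    linear_combination (-ee (f n)) * hwmul n hn
  have hcb : ∀ n ∈ Finset.Ico p q, |c n| ≤ 1 / (4 * d) := by
    intro n hn
    have h1 := hsin n hn
    simp only [hc]
    rw [abs_div, abs_of_pos (a := 2 * Real.sin _) (by linarith)]
    exact div_le_div₀ zero_le_one (Real.abs_cos_le_one _) (by linarith) (by linarith)
  have hwb : ∀ n ∈ Finset.Ico p q, ‖w n‖ ≤ 1 / (4 * d) := by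
    intro n hn
    have h1 := hsin n hn
    have h2 : ‖w n‖ ^ 2 = (1 / (2 * Real.sin (Real.pi * (f (n + 1) - f n - h)))) ^ 2 := by
      rw [← Complex.normSq_eq_norm_sq, hw, Complex.normSq_apply]
      simp only [Complex.add_re, Complex.add_im, Complex.mul_re, Complex.mul_im,
        Complex.ofReal_re, Complex.ofReal_im, Complex.I_re, Complex.I_im, Complex.one_re,
        Complex.one_im, Complex.div_ofNat_re, Complex.div_ofNat_im, hc]
      have h3 := Real.sin_sq_add_cos_sq (Real.pi * (f (n + 1) - f n - h))
      have h4 : Real.sin (Real.pi * (f (n + 1) - f n - h)) ≠ 0 := by linarith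
      field_simp
      nlinarith
    have h3 : ‖w n‖ = 1 / (2 * Real.sin (Real.pi * (f (n + 1) - f n - h))) := by
      rw [← abs_of_nonneg (norm_nonneg (w n)), ← abs_of_pos
        (a := 1 / (2 * Real.sin (Real.pi * (f (n + 1) - f n - h))))
        (one_div_pos.mpr (by linarith))]
      exact (sq_eq_sq_iff_abs_eq_abs _ _).mp h2
    rw [h3]
    exact one_div_le_one_div_of_le (by linarith) (by linarith)
  have key : ∀ k : ℕ, p + k + 1 ≤ q →
      ‖∑ n ∈ Finset.Ico p (p + k + 1), ee (f n) + ee (f (p + k + 1)) * w (p + k)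
        - ee (f p) * w p‖ ≤ c (p + k) - c p := by
    intro k
    induction k with
    | zero =>
      intro hk
      have hp : p ∈ Finset.Ico p q := by simp; omega
      simp only [add_zero, Nat.Ico_succ_singleton, Finset.sum_singleton, sub_self]
      rw [hstep p hp]
      have : ee (f p) + ee (f p) * (w p - 1) - ee (f p) * w p = 0 := by ring
      rw [this, norm_zero]
    | succ k ih =>
      intro hk
      have ih := ih (by omega)
      have hm1 : p + k ∈ Finset.Ico p q := by simp; omega
      have hm2 : p + k + 1 ∈ Finset.Ico p q := by simp; omega
      have hmono : c (p + k) ≤ c (p + k + 1) := by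
        apply cot_antitone
        · linarith [hlow _ hm2]
        · linarith [hanti _ hm1 hm2]
        · linarith [hupp _ hm1]
      rw [show p + (k + 1) = p + k + 1 by ring, Finset.sum_Ico_succ_top (by omega), hstep _ hm2]
      have h3 : ∑ n ∈ Finset.Ico p (p + k + 1), ee (f n) + ee (f (p + k + 1))
          + ee (f (p + k + 1)) * (w (p + k + 1) - 1) - ee (f p) * w p
          = (∑ n ∈ Finset.Ico p (p + k + 1), ee (f n) + ee (f (p + k + 1)) * w (p + k)
            - ee (f p) * w p) + ee (f (p + k + 1)) * (((c (p + k + 1) - c (p + k) : ℝ) : ℂ)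
              * Complex.I) := by
        simp only [hw]; push_cast; ring
      rw [h3]
      refine (norm_add_le _ _).trans ?_
      rw [norm_mul, norm_mul, norm_ee, Complex.norm_I, Complex.norm_real, Real.norm_eq_abs,
        abs_of_nonneg (by linarith)]
      linarith
  rcases Nat.lt_or_ge p q with hpq | hpq
  · obtain ⟨k, rfl⟩ : ∃ k, q = p + k + 1 := ⟨q - p - 1, by omega⟩
    have h1 := key k le_rfl
    have hp : p ∈ Finset.Ico p (p + k + 1) := by simp
    have hq : p + k ∈ Finset.Ico p (p + k + 1) := by simp
    have h2 := hwb _ hp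
    have h3 := hwb _ hq
    have h4 := abs_le.mp (hcb _ hp)
    have h5 := abs_le.mp (hcb _ hq)
    have h6 : ∑ n ∈ Finset.Ico p (p + k + 1), ee (f n) =
        (∑ n ∈ Finset.Ico p (p + k + 1), ee (f n) + ee (f (p + k + 1)) * w (p + k)
          - ee (f p) * w p) - ee (f (p + k + 1)) * w (p + k) + ee (f p) * w p := by ring
    rw [h6]
    refine (norm_add_le _ _).trans ?_
    refine (add_le_add_left (norm_sub_le _ _) _).trans ?_
    rw [norm_mul, norm_mul, norm_ee, norm_ee, one_mul, one_mul]
    have h7 : 1 / d = 4 * (1 / (4 * d)) := by field_simp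
    linarith
  · rw [Finset.Ico_eq_empty (by omega)]
    simp only [Finset.sum_empty, norm_zero]
    positivity

/-- A finite set of natural numbers without gaps is an interval. -/
lemma exists_eq_Ico_of_ordConnected {s : Finset ℕ}
    (hs : ∀ a ∈ s, ∀ b ∈ s, ∀ n, a ≤ n → n ≤ b → n ∈ s) : ∃ p q, s = Finset.Ico p q := by
  rcases s.eq_empty_or_nonempty with rfl | hne
  · exact ⟨0, 0, by simp⟩
  · refine ⟨s.min' hne, s.max' hne + 1, ?_⟩
    ext n
    rw [Finset.mem_Ico, Nat.lt_succ_iff]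
    exact ⟨fun h => ⟨s.min'_le n h, s.le_max' n h⟩,
      fun h => hs _ (s.min'_mem hne) _ (s.max'_mem hne) n h.1 h.2⟩

/-- Kuzmin–Landau inequality on a gap-free set of integers. -/
lemma norm_sum_ee_le_of_ordConnected {f : ℕ → ℝ} {s : Finset ℕ} {d : ℝ} (h : ℤ) (hd : 0 < d)
    (hs : ∀ a ∈ s, ∀ b ∈ s, ∀ n, a ≤ n → n ≤ b → n ∈ s)
    (hlow : ∀ n ∈ s, h + d ≤ f (n + 1) - f n)
    (hupp : ∀ n ∈ s, f (n + 1) - f n ≤ h + 1 - d)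
    (hanti : ∀ n, n ∈ s → n + 1 ∈ s → f (n + 2) - f (n + 1) ≤ f (n + 1) - f n) :
    ‖∑ n ∈ s, ee (f n)‖ ≤ 1 / d := by
  obtain ⟨p, q, rfl⟩ := exists_eq_Ico_of_ordConnected hs
  exact norm_sum_Ico_ee_le h hd hlow hupp hanti

/-- A gap-free set of integers on which a sequence with steps at most `-l` stays in a window of
length `W` has at most `W / l + 1` elements. -/
lemma card_le_of_steps {g : ℕ → ℝ} {s : Finset ℕ} {l y W : ℝ} (hl : 0 < l) (hW : 0 ≤ W)
    (hs : ∀ a ∈ s, ∀ b ∈ s, ∀ n, a ≤ n → n ≤ b → n ∈ s)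
    (hlow : ∀ n ∈ s, y ≤ g n) (hupp : ∀ n ∈ s, g n ≤ y + W)
    (hstep : ∀ n, n ∈ s → n + 1 ∈ s → g (n + 1) + l ≤ g n) :
    (s.card : ℝ) ≤ W / l + 1 := by
  obtain ⟨p, q, rfl⟩ := exists_eq_Ico_of_ordConnected hs
  rcases Nat.lt_or_ge p q with hpq | hpq
  · obtain ⟨k, rfl⟩ : ∃ k, q = p + k + 1 := ⟨q - p - 1, by omega⟩
    have key : ∀ j, j ≤ k → g (p + j) + j * l ≤ g p := by
      intro j
      induction j with
      | zero => intro _; simp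
      | succ j ih =>
        intro hj
        have h1 := ih (by omega)
        have h2 := hstep (p + j) (by simp; omega) (by simp; omega)
        push_cast
        rw [show p + (j + 1) = p + j + 1 by ring]
        linarith
    have h1 := key k le_rfl
    have h2 := hlow (p + k) (by simp)
    have h3 := hupp p (by simp)
    simp only [Nat.card_Ico]
    rw [show p + k + 1 - p = k + 1 by omega]
    push_cast
    have : (k : ℝ) ≤ W / l := by rw [le_div_iff₀ hl]; linarith
    linarith
  · rw [Finset.Ico_eq_empty (by omega)]
    simp only [Finset.card_empty, Nat.cast_zero]
    positivity

/-- Van der Corput's second derivative test for sequences whose increments stay in a window of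
length one. -/
lemma norm_sum_ee_le_of_steps {f : ℕ → ℝ} {s : Finset ℕ} {l y : ℝ} (hl : 0 < l) (hl1 : l ≤ 1)
    (hs : ∀ a ∈ s, ∀ b ∈ s, ∀ n, a ≤ n → n ≤ b → n ∈ s)
    (hlow : ∀ n ∈ s, y ≤ f (n + 1) - f n) (hupp : ∀ n ∈ s, f (n + 1) - f n ≤ y + 1)
    (hstep : ∀ n, n ∈ s → n + 1 ∈ s → f (n + 2) - f (n + 1) + l ≤ f (n + 1) - f n) :
    ‖∑ n ∈ s, ee (f n)‖ ≤ 10 / Real.sqrt l := by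
  set g : ℕ → ℝ := fun n => f (n + 1) - f n with hg
  have hsq : 0 < Real.sqrt l := Real.sqrt_pos.mpr hl
  have hsq1 : Real.sqrt l ≤ 1 := (Real.sqrt_le_sqrt hl1).trans_eq Real.sqrt_one
  have hsql : Real.sqrt l * Real.sqrt l = l := Real.mul_self_sqrt hl.le
  set D := Real.sqrt l / 2 with hD
  set h : ℤ := ⌊y⌋ + 1 with hh
  have hy1 : (h : ℝ) - 1 ≤ y := by rw [hh]; push_cast; linarith [Int.floor_le y]
  have hy2 : y < h := by rw [hh]; push_cast; linarith [Int.lt_floor_add_one y]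
  have hgap : ∀ a ∈ s, ∀ b ∈ s, a ≤ b → g b ≤ g a := by
    intro a ha b hb hab
    obtain ⟨j, rfl⟩ := Nat.exists_eq_add_of_le hab
    clear hab
    induction j with
    | zero => exact le_rfl
    | succ j ih =>
      have hm : a + j ∈ s := hs a ha _ hb _ (by omega) (by omega)
      have h1 := hstep (a + j) hm hb
      have h2 := ih hm
      simp only [hg] at *
      rw [show a + (j + 1) = a + j + 1 by ring]
      rw [show a + j + 1 + 1 = a + j + 2 by ring] at *
      linarith
  have hoc : ∀ u v : ℝ, ∀ a ∈ s.filter (fun n => u ≤ g n ∧ g n ≤ v),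
      ∀ b ∈ s.filter (fun n => u ≤ g n ∧ g n ≤ v), ∀ n, a ≤ n → n ≤ b →
        n ∈ s.filter (fun n => u ≤ g n ∧ g n ≤ v) := by
    intro u v a ha b hb n han hnb
    rw [Finset.mem_filter] at *
    have hn := hs a ha.1 b hb.1 n han hnb
    exact ⟨hn, hb.2.1.trans (hgap n hn b hb.1 hnb), (hgap a ha.1 n hn han).trans ha.2.2⟩
  have hoc' : ∀ u v : ℝ, ∀ a ∈ s.filter (fun n => u < g n ∧ g n < v),
      ∀ b ∈ s.filter (fun n => u < g n ∧ g n < v), ∀ n, a ≤ n → n ≤ b →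
        n ∈ s.filter (fun n => u < g n ∧ g n < v) := by
    intro u v a ha b hb n han hnb
    rw [Finset.mem_filter] at *
    have hn := hs a ha.1 b hb.1 n han hnb
    exact ⟨hn, hb.2.1.trans_le (hgap n hn b hb.1 hnb),
      (hgap a ha.1 n hn han).trans_lt ha.2.2⟩
  -- points whose increment is within `D` of an integer
  have hnear : ∀ u : ℝ, ‖∑ n ∈ s.filter (fun n => u - D < g n ∧ g n < u + D), ee (f n)‖
      ≤ 2 / Real.sqrt l := by
    intro u
    refine (norm_sum_le _ _).trans ?_
    simp only [norm_ee, Finset.sum_const, nsmul_eq_mul, mul_one]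
    have h1 := card_le_of_steps (g := g) (y := u - D) (W := 2 * D) hl (by positivity)
      (hoc' (u - D) (u + D))
      (fun n hn => (Finset.mem_filter.mp hn).2.1.le)
      (fun n hn => by linarith [(Finset.mem_filter.mp hn).2.2])
      (fun n hn hn1 => hstep n (Finset.mem_filter.mp hn).1 (Finset.mem_filter.mp hn1).1)
    have h2 : 2 * D / l = 1 / Real.sqrt l := by
      rw [hD, div_eq_div_iff hl.ne' hsq.ne']; nlinarith
    have h3 : 1 ≤ 1 / Real.sqrt l := by rw [le_div_iff₀ hsq]; linarith
    have h4 : 2 / Real.sqrt l = 1 / Real.sqrt l + 1 / Real.sqrt l := by ring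
    linarith
  -- Between two integers the Kuzmin–Landau inequality applies; `D` balances the two contributions.
  have hfar : ∀ j : ℤ, ‖∑ n ∈ s.filter (fun n => (j : ℝ) + D ≤ g n ∧ g n ≤ j + 1 - D), ee (f n)‖
      ≤ 2 / Real.sqrt l := by
    intro j
    have h1 := norm_sum_ee_le_of_ordConnected (f := f) (d := D) j (by positivity)
      (hoc (j + D) (j + 1 - D))
      (fun n hn => (Finset.mem_filter.mp hn).2.1)
      (fun n hn => (Finset.mem_filter.mp hn).2.2)
      (fun n hn hn1 => by
        have := hstep n (Finset.mem_filter.mp hn).1 (Finset.mem_filter.mp hn1).1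
        linarith)
    rw [hD, one_div_div] at h1
    exact h1
  have hsplit : ∑ n ∈ s, ee (f n) =
      ∑ n ∈ s.filter (fun n => ((h : ℝ) - 1) - D < g n ∧ g n < ((h : ℝ) - 1) + D), ee (f n)
      + ∑ n ∈ s.filter (fun n => ((h - 1 : ℤ) : ℝ) + D ≤ g n ∧ g n ≤ ((h - 1 : ℤ) : ℝ) + 1 - D),
        ee (f n)
      + ∑ n ∈ s.filter (fun n => (h : ℝ) - D < g n ∧ g n < (h : ℝ) + D), ee (f n)
      + ∑ n ∈ s.filter (fun n => (h : ℝ) + D ≤ g n ∧ g n ≤ (h : ℝ) + 1 - D), ee (f n)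
      + ∑ n ∈ s.filter (fun n => ((h : ℝ) + 1) - D < g n ∧ g n < ((h : ℝ) + 1) + D),
        ee (f n) := by
    simp only [Finset.sum_filter, ← Finset.sum_add_distrib]
    refine Finset.sum_congr rfl fun n hn => ?_
    have h1 : y ≤ g n := hlow n hn
    have h2 : g n ≤ y + 1 := hupp n hn
    have hD0 : 0 < D := by positivity
    have hD1 : D ≤ 1 / 2 := by rw [hD]; linarith
    push_cast
    rcases lt_or_ge (g n) (h - 1 + D) with c1 | c1
    · rw [if_pos ⟨by linarith, c1⟩, if_neg (by intro hx; linarith [hx.1]),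
        if_neg (by intro hx; linarith [hx.1]), if_neg (by intro hx; linarith [hx.1]),
        if_neg (by intro hx; linarith [hx.1])]; simp
    rcases le_or_gt (g n) (h - D) with c2 | c2
    · rw [if_neg (by intro hx; linarith [hx.2]), if_pos ⟨c1, by linarith⟩,
        if_neg (by intro hx; linarith [hx.1]), if_neg (by intro hx; linarith [hx.1]),
        if_neg (by intro hx; linarith [hx.1])]; simp
    rcases lt_or_ge (g n) (h + D) with c3 | c3
    · rw [if_neg (by intro hx; linarith [hx.2]), if_neg (by intro hx; linarith [hx.2]),
        if_pos ⟨c2, c3⟩, if_neg (by intro hx; linarith [hx.1]),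
        if_neg (by intro hx; linarith [hx.1])]; simp
    rcases le_or_gt (g n) (h + 1 - D) with c4 | c4
    · rw [if_neg (by intro hx; linarith [hx.2]), if_neg (by intro hx; linarith [hx.2]),
        if_neg (by intro hx; linarith [hx.2]), if_pos ⟨c3, c4⟩,
        if_neg (by intro hx; linarith [hx.1])]; simp
    · rw [if_neg (by intro hx; linarith [hx.2]), if_neg (by intro hx; linarith [hx.2]),
        if_neg (by intro hx; linarith [hx.2]), if_neg (by intro hx; linarith [hx.2]),
        if_pos ⟨c4, by linarith⟩]; simp
  rw [hsplit]
  have e1 := hnear ((h : ℝ) - 1)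
  have e2 := hfar (h - 1)
  have e3 := hnear (h : ℝ)
  have e4 := hfar h
  have e5 := hnear ((h : ℝ) + 1)
  refine (norm_add_le _ _).trans ?_
  refine (add_le_add_left (norm_add_le _ _) _).trans ?_
  refine (add_le_add_left (add_le_add_left (norm_add_le _ _) _) _).trans ?_
  refine (add_le_add_left (add_le_add_left (add_le_add_left (norm_add_le _ _) _) _) _).trans ?_
  have : 10 / Real.sqrt l = 2 / Real.sqrt l + 2 / Real.sqrt l + 2 / Real.sqrt l
    + 2 / Real.sqrt l + 2 / Real.sqrt l := by ring
  linarith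

/-! ### Counting near-coincidences among sums of two inverse squares -/

/-- The shifts `t` for which `h₁ - t, …, h₄ - t` all lie in `[P, 3P]` and
`(h₁ - t)⁻² + (h₂ - t)⁻²` is within `η` of `(h₃ - t)⁻² + (h₄ - t)⁻²`. -/
def nearSet (P η : ℝ) (h : ℤ × ℤ × ℤ × ℤ) : Set ℝ :=
  {t | (P ≤ h.1 - t ∧ h.1 - t ≤ 3 * P) ∧ (P ≤ h.2.1 - t ∧ h.2.1 - t ≤ 3 * P) ∧
    (P ≤ h.2.2.1 - t ∧ h.2.2.1 - t ≤ 3 * P) ∧ (P ≤ h.2.2.2 - t ∧ h.2.2.2 - t ≤ 3 * P) ∧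
    |1 / (h.1 - t) ^ 2 + 1 / (h.2.1 - t) ^ 2 - 1 / (h.2.2.1 - t) ^ 2 - 1 / (h.2.2.2 - t) ^ 2|
      ≤ η}

/-- The same near-coincidence, parametrised by the smallest of the four numbers and the
distances of the others to it. -/
def nearGapSet (P η : ℝ) (r p q : ℕ) : Set ℝ :=
  {u | P ≤ u ∧ u ≤ 3 * P ∧ u + r ≤ 3 * P ∧ u + p ≤ 3 * P ∧ u + q ≤ 3 * P ∧
    |1 / u ^ 2 + 1 / (u + r) ^ 2 - 1 / (u + p) ^ 2 - 1 / (u + q) ^ 2| ≤ η}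

/-- The second mixed difference of `u ↦ u⁻²` with steps `p`, `q` is `O(p q / P ⁴)` on `[P, ∞)`. -/
lemma second_difference_inv_sq_bounds {P u p q : ℝ} (hP : 0 < P) (hu : P ≤ u) (hp : 0 ≤ p)
    (hq : 0 ≤ q) :
    |1 / u ^ 2 + 1 / (u + p + q) ^ 2 - 1 / (u + p) ^ 2 - 1 / (u + q) ^ 2|
      ≤ 6 * (p * q) / P ^ 4 := by
  have hu0 : 0 < u := by linarith
  have h2 : 0 < u + p := by linarith
  have h3 : 0 < u + q := by linarith
  have h4 : 0 < u + p + q := by linarith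
  set x := 1 / u with hx
  set y := 1 / (u + p) with hy
  set x' := 1 / (u + q) with hx'
  set y' := 1 / (u + p + q) with hy'
  have e1 : 1 / u ^ 2 + 1 / (u + p + q) ^ 2 - 1 / (u + p) ^ 2 - 1 / (u + q) ^ 2
      = p * (x * y * (x + y) - x' * y' * (x' + y')) := by
    rw [hx, hy, hx', hy']; field_simp; ring
  have exx : x - x' = q * (x * x') := by rw [hx, hx']; field_simp; ring
  have eyy : y - y' = q * (y * y') := by rw [hy, hy']; field_simp; ring
  have bx : x ≤ 1 / P := one_div_le_one_div_of_le hP hu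
  have by' : y ≤ 1 / P := one_div_le_one_div_of_le hP (by linarith)
  have bx' : x' ≤ 1 / P := one_div_le_one_div_of_le hP (by linarith)
  have by'' : y' ≤ 1 / P := one_div_le_one_div_of_le hP (by linarith)
  have x0 : 0 < x := one_div_pos.mpr hu0
  have y0 : 0 < y := one_div_pos.mpr h2
  have x0' : 0 < x' := one_div_pos.mpr h3
  have y0' : 0 < y' := one_div_pos.mpr h4
  set z := 1 / P with hz
  have z0 : 0 < z := one_div_pos.mpr hP
  have dx0 : 0 ≤ x - x' := by rw [exx]; positivity
  have dy0 : 0 ≤ y - y' := by rw [eyy]; positivity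
  have dx : x - x' ≤ q * z ^ 2 := by rw [exx, pow_two]; gcongr
  have dy : y - y' ≤ q * z ^ 2 := by rw [eyy, pow_two]; gcongr
  have e2 : x * y * (x + y) - x' * y' * (x' + y') =
      (x - x') * ((x + x') * y) + (y - y') * (x' * x') + ((x - x') * (y * y)
        + (y - y') * ((y + y') * x')) := by ring
  have hb : x * y * (x + y) - x' * y' * (x' + y') ≤ 6 * q * z ^ 4 := by
    rw [e2]
    calc _ ≤ (q * z ^ 2) * ((z + z) * z) + (q * z ^ 2) * (z * z) + ((q * z ^ 2) * (z * z)
        + (q * z ^ 2) * ((z + z) * z)) := by gcongr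
      _ = 6 * q * z ^ 4 := by ring
  have hb0 : 0 ≤ x * y * (x + y) - x' * y' * (x' + y') := by rw [e2]; positivity
  rw [e1, abs_of_nonneg (by positivity)]
  have e3 : 6 * (p * q) / P ^ 4 = p * (6 * q * z ^ 4) := by rw [hz]; field_simp
  rw [e3]
  gcongr

/-- The largest gap is determined, up to `O(1 + p q / P)`, by the two middle ones. -/
lemma gap_le_of_mem_nearGapSet {P η u : ℝ} {r p q : ℕ} (hP : 0 < P) (hη : η * P ^ 3 ≤ 200)
    (hu : u ∈ nearGapSet P η r p q) :
    |(r : ℝ) - (p + q)| ≤ 5800 * (1 + p * q / P) := by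
  obtain ⟨h1, h2, h3, h4, h5, h6⟩ := hu
  have hp : (0 : ℝ) ≤ p := by positivity
  have hq : (0 : ℝ) ≤ q := by positivity
  have hr : (0 : ℝ) ≤ r := by positivity
  -- With `p + q` in place of `r` the near-coincidence is replaced by a second difference, so
  -- `(u + r)⁻²` and `(u + p + q)⁻²` are close.
  have hsd := second_difference_inv_sq_bounds hP h1 hp hq
  set x : ℝ := u + r with hx
  set y : ℝ := u + p + q with hy
  have hxP : P ≤ x := by linarith
  have hyP : P ≤ y := by linarith
  have hx3 : x ≤ 3 * P := h3
  have hy5 : y ≤ 5 * P := by linarith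
  have hx0 : 0 < x := by linarith
  have hy0 : 0 < y := by linarith
  have hd : |1 / x ^ 2 - 1 / y ^ 2| ≤ η + 6 * (p * q) / P ^ 4 := by
    have : 1 / x ^ 2 - 1 / y ^ 2 = (1 / u ^ 2 + 1 / x ^ 2 - 1 / (u + p) ^ 2 - 1 / (u + q) ^ 2)
      - (1 / u ^ 2 + 1 / y ^ 2 - 1 / (u + p) ^ 2 - 1 / (u + q) ^ 2) := by ring
    rw [this]
    exact (abs_sub _ _).trans (add_le_add h6 hsd)
  have e : 1 / x ^ 2 - 1 / y ^ 2 = (y - x) * (1 / (x * y ^ 2) + 1 / (x ^ 2 * y)) := by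
    field_simp; ring
  have hl : 1 / (29 * P ^ 3) ≤ 1 / (x * y ^ 2) + 1 / (x ^ 2 * y) := by
    have a1 : 1 / (75 * P ^ 3) ≤ 1 / (x * y ^ 2) := by
      apply one_div_le_one_div_of_le (by positivity)
      calc x * y ^ 2 ≤ (3 * P) * (5 * P) ^ 2 := by gcongr
        _ = 75 * P ^ 3 := by ring
    have a2 : 1 / (45 * P ^ 3) ≤ 1 / (x ^ 2 * y) := by
      apply one_div_le_one_div_of_le (by positivity)
      calc x ^ 2 * y ≤ (3 * P) ^ 2 * (5 * P) := by gcongr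
        _ = 45 * P ^ 3 := by ring
    have a3 : 1 / (29 * P ^ 3) ≤ 1 / (75 * P ^ 3) + 1 / (45 * P ^ 3) := by
      rw [div_add_div _ _ (by positivity) (by positivity), div_le_div_iff₀ (by positivity)
        (by positivity)]
      have : 0 < P ^ 3 * P ^ 3 := by positivity
      nlinarith
    linarith
  rw [e, abs_mul, abs_of_pos (a := 1 / (x * y ^ 2) + 1 / (x ^ 2 * y)) (by positivity)] at hd
  have hd2 : |y - x| * (1 / (29 * P ^ 3)) ≤ η + 6 * (p * q) / P ^ 4 :=
    (mul_le_mul_of_nonneg_left hl (abs_nonneg _)).trans hd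
  rw [mul_one_div, div_le_iff₀ (by positivity)] at hd2
  have e4 : |(r : ℝ) - (p + q)| = |y - x| := by
    rw [abs_sub_comm]; congr 1; rw [hx, hy]; ring
  rw [e4]
  refine hd2.trans ?_
  have e5 : (η + 6 * (p * q) / P ^ 4) * (29 * P ^ 3) = 29 * (η * P ^ 3) + 174 * (p * q / P) := by
    field_simp; ring
  rw [e5]
  have : 0 ≤ (p : ℝ) * q / P := by positivity
  linarith

/-- The function `(x² + x y + y²) / (x + y)`, which satisfies
`x³ - y³ = (x² - y²) * cubeSlope x y`. -/
noncomputable def cubeSlope (x y : ℝ) : ℝ := (x ^ 2 + x * y + y ^ 2) / (x + y)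

lemma cubeSlope_comm (x y : ℝ) : cubeSlope x y = cubeSlope y x := by
  unfold cubeSlope; rw [add_comm x y]; congr 1; ring

lemma sq_sub_sq_mul_cubeSlope {x y : ℝ} (h : x + y ≠ 0) :
    (x ^ 2 - y ^ 2) * cubeSlope x y = x ^ 3 - y ^ 3 := by
  unfold cubeSlope; field_simp; ring

lemma cubeSlope_sub_ge {x x' y s : ℝ} (hs : 0 < s) (hx : s ≤ x') (hxx : x' ≤ x)
    (hy0 : 0 < y) (hy : y ≤ 3 * s) :
    7 / 16 * (x - x') ≤ cubeSlope x y - cubeSlope x' y := by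
  have e : cubeSlope x y - cubeSlope x' y = (x - x') * (1 - y ^ 2 / ((x + y) * (x' + y))) := by
    have : x + y ≠ 0 := by linarith
    have : x' + y ≠ 0 := by linarith
    unfold cubeSlope; field_simp; ring
  rw [e]
  have h1 : y ^ 2 / ((x + y) * (x' + y)) ≤ 9 / 16 := by
    have a1 : 4 / 3 * y ≤ x + y := by linarith
    have a2 : 4 / 3 * y ≤ x' + y := by linarith
    have a3 : 0 < x + y := by linarith
    have a4 : 0 < x' + y := by linarith
    rw [div_le_iff₀ (by positivity)]
    have := mul_le_mul a1 a2 (by positivity) a3.le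
    linarith
  have := mul_le_mul_of_nonneg_left (a := x - x') (b := 7 / 16)
    (c := 1 - y ^ 2 / ((x + y) * (x' + y))) (by linarith) (by linarith)
  linarith

/-- Near a coincidence `v₁² + v₄² ≈ v₂² + v₃²` with `v₁` the largest, the sum of cubes on the
side of `v₁` wins by a definite amount. -/
lemma cube_sum_lower_bound {P η v1 v2 v3 v4 p q : ℝ} (hP : 0 < P) (hη : 0 < η)
    (h1 : v1 ≤ 1 / P) (h2 : 1 / (3 * P) ≤ v2) (h3 : 1 / (3 * P) ≤ v3) (h4 : 1 / (3 * P) ≤ v4)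
    (hp : 0 < p) (hq : 0 < q) (hp2 : p ≤ 2 * P)
    (h12 : p / (9 * P ^ 2) ≤ v1 - v2) (h13 : q / (9 * P ^ 2) ≤ v1 - v3)
    (hn : |v1 ^ 2 + v4 ^ 2 - v2 ^ 2 - v3 ^ 2| ≤ 2 * η) (hpq : 2300 * η * P ^ 4 ≤ p * q) :
    p * q / (600 * P ^ 5) ≤ v1 ^ 3 + v4 ^ 3 - v2 ^ 3 - v3 ^ 3 := by
  set s := 1 / (3 * P) with hs
  have hs0 : 0 < s := by positivity
  have hPs : 1 / P = 3 * s := by rw [hs]; field_simp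
  have hP1 : P = 1 / (3 * s) := by rw [hs]; field_simp
  have e9 : ∀ t : ℝ, t / (9 * P ^ 2) = t * s ^ 2 := by
    intro t; rw [hs]; field_simp; ring
  rw [e9] at h12 h13
  rw [hPs] at h1
  obtain ⟨hn1, hn2⟩ := abs_le.mp hn
  have q13 : q * s ^ 2 * (2 * s) ≤ v1 ^ 2 - v3 ^ 2 := by
    have : v1 ^ 2 - v3 ^ 2 = (v1 - v3) * (v1 + v3) := by ring
    rw [this]
    have hh : 0 < q * s ^ 2 := by positivity
    exact mul_le_mul h13 (by linarith) (by positivity) (by linarith)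
  have q12 : p * s ^ 2 * (2 * s) ≤ v1 ^ 2 - v2 ^ 2 := by
    have : v1 ^ 2 - v2 ^ 2 = (v1 - v2) * (v1 + v2) := by ring
    rw [this]
    have hh : 0 < p * s ^ 2 := by positivity
    exact mul_le_mul h12 (by linarith) (by positivity) (by linarith)
  have hpqs : 2300 * η ≤ 81 * (p * q) * s ^ 4 := by
    have e1 : p * q * s ^ 4 * 81 = p * q / P ^ 4 := by rw [hs]; field_simp; ring
    have e2 : 2300 * η = 2300 * η * P ^ 4 / P ^ 4 := by field_simp
    rw [e2]
    calc _ ≤ p * q / P ^ 4 := by gcongr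
      _ = _ := by rw [← e1]; ring
  have hps : p * (3 * s) ≤ 2 := by
    rw [hP1] at hp2
    rw [mul_one_div, le_div_iff₀ (by positivity)] at hp2
    exact hp2
  have h42 : v4 ≤ v2 := by
    by_contra hlt
    push Not at hlt
    have hv2 : 0 ≤ v2 := by linarith
    have a1 : v2 ^ 2 ≤ v4 ^ 2 := by gcongr
    have a2 : q * s ^ 2 * (2 * s) ≤ 2 * η := by linarith
    have a3 : p * q * s ^ 4 ≤ η * (2 / 3) := by
      have : p * q * s ^ 4 = (q * s ^ 2 * (2 * s)) * (p * (3 * s)) / 6 := by ring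
      rw [this]
      have : (q * s ^ 2 * (2 * s)) * (p * (3 * s)) ≤ (2 * η) * 2 := by gcongr
      linarith
    linarith
  have hqs : 0 < q * s ^ 2 := by positivity
  have hps2 : 0 < p * s ^ 2 := by positivity
  have k1 := cubeSlope_sub_ge hs0 h3 (by linarith) (by linarith) (by linarith : v2 ≤ 3 * s)
    (x := v1)
  have k2 := cubeSlope_sub_ge hs0 h4 h42 (by linarith) (by linarith : v3 ≤ 3 * s)
  rw [cubeSlope_comm v2 v3, cubeSlope_comm v4 v3] at k2
  have k3 : cubeSlope v3 v4 ≤ 6 * s := by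
    unfold cubeSlope
    rw [div_le_iff₀ (by linarith)]
    have hv3 : v3 ≤ 3 * s := by linarith
    have hv4 : v4 ≤ 3 * s := by linarith
    have hv : (v3 + v4) * (v3 + v4) ≤ 6 * s * (v3 + v4) :=
      mul_le_mul_of_nonneg_right (by linarith) (by linarith)
    have : 0 ≤ v3 * v4 := mul_nonneg (by linarith) (by linarith)
    linarith
  have k4 : 0 ≤ cubeSlope v3 v4 := by
    unfold cubeSlope
    have : 0 < v3 := by linarith
    have : 0 < v4 := by linarith
    positivity
  have i1 := sq_sub_sq_mul_cubeSlope (x := v1) (y := v2) (by linarith)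
  have i2 := sq_sub_sq_mul_cubeSlope (x := v3) (y := v4) (by linarith)
  have e : v1 ^ 3 + v4 ^ 3 - v2 ^ 3 - v3 ^ 3 =
      (v1 ^ 2 - v2 ^ 2) * (cubeSlope v1 v2 - cubeSlope v3 v4)
        + (v1 ^ 2 + v4 ^ 2 - v2 ^ 2 - v3 ^ 2) * cubeSlope v3 v4 := by
    linear_combination (-1 : ℝ) * i1 + i2
  rw [e]
  have l1 : 7 / 16 * (q * s ^ 2) ≤ cubeSlope v1 v2 - cubeSlope v3 v4 := by linarith
  have l2 : (p * s ^ 2 * (2 * s)) * (7 / 16 * (q * s ^ 2)) ≤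
      (v1 ^ 2 - v2 ^ 2) * (cubeSlope v1 v2 - cubeSlope v3 v4) :=
    mul_le_mul q12 l1 (by positivity) (le_trans (by positivity) q12)
  have l3 : -(2 * η) * (6 * s) ≤ (v1 ^ 2 + v4 ^ 2 - v2 ^ 2 - v3 ^ 2) * cubeSlope v3 v4 := by
    have m1 : (2 * η) * cubeSlope v3 v4 ≤ (2 * η) * (6 * s) := by gcongr
    have m2 : -(2 * η) * cubeSlope v3 v4 ≤
        (v1 ^ 2 + v4 ^ 2 - v2 ^ 2 - v3 ^ 2) * cubeSlope v3 v4 :=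
      mul_le_mul_of_nonneg_right (by linarith) k4
    linarith
  have e5 : p * q / (600 * P ^ 5) = 243 / 600 * (p * q * s ^ 5) := by
    rw [hs]; field_simp; ring
  rw [e5]
  have l4 : 2300 * η * s ≤ 81 * (p * q) * s ^ 4 * s := by gcongr
  have l5 : 0 ≤ p * q * s ^ 5 := by positivity
  linarith

/-- Points of a near-coincidence set are confined to a short interval: there the derivative in `u`
of `u⁻² + (u + r)⁻² - (u + p)⁻² - (u + q)⁻²`, twice a difference of sums of inverse cubes, is at least
of order `p q / P ⁵` in absolute value. -/
lemma sub_le_of_mem_nearGapSet {P η u v : ℝ} {r p q : ℕ} (hP : 0 < P) (hη : 0 < η)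
    (hp : 0 < p) (hq : 0 < q) (hpq : 2300 * η * P ^ 4 ≤ p * q)
    (hu : u ∈ nearGapSet P η r p q) (hv : v ∈ nearGapSet P η r p q) (huv : u ≤ v) :
    v - u ≤ 750 * η * P ^ 5 / (p * q) := by
  obtain ⟨u1, u2, u3, u4, u5, u6⟩ := hu
  obtain ⟨v1, v2, v3, v4, v5, v6⟩ := hv
  have hpR : (0 : ℝ) < p := by exact_mod_cast hp
  have hqR : (0 : ℝ) < q := by exact_mod_cast hq
  have hrR : (0 : ℝ) ≤ r := by positivity
  by_contra hlt
  push Not at hlt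
  have huv' : 0 < v - u := lt_of_le_of_lt (by positivity) hlt
  rw [div_lt_iff₀ (by positivity)] at hlt
  set Φ : ℝ → ℝ := fun w => 1 / w ^ 2 + 1 / (w + r) ^ 2 - 1 / (w + p) ^ 2 - 1 / (w + q) ^ 2
    with hΦ
  set Φ' : ℝ → ℝ := fun w =>
    -2 * ((1 / w) ^ 3 + (1 / (w + r)) ^ 3 - (1 / (w + p)) ^ 3 - (1 / (w + q)) ^ 3) with hΦ'
  have hder : ∀ w, 0 < w → HasDerivAt Φ (Φ' w) w := by
    intro w hw
    have base : ∀ t : ℝ, 0 ≤ t →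
        HasDerivAt (fun w : ℝ => 1 / (w + t) ^ 2) (-2 * (1 / (w + t)) ^ 3) w := by
      intro t ht
      have hne : w + t ≠ 0 := by linarith
      have h1 : HasDerivAt (fun w : ℝ => (w + t) ^ 2) (2 * (w + t) * 1) w := by
        simpa using ((hasDerivAt_id w).add_const t).fun_pow 2
      have h2 := h1.fun_inv (pow_ne_zero 2 hne)
      simp only [one_div]
      refine h2.congr_deriv ?_
      field_simp
    have b0 : HasDerivAt (fun w : ℝ => 1 / w ^ 2) (-2 * (1 / w) ^ 3) w := by
      simpa using base 0 le_rfl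
    have := ((b0.fun_add (base r hrR)).fun_sub (base p hpR.le)).fun_sub (base q hqR.le)
    refine this.congr_deriv ?_
    simp only [hΦ']; ring
  obtain ⟨u6a, u6b⟩ := abs_le.mp u6
  obtain ⟨v6a, v6b⟩ := abs_le.mp v6
  -- the line from `(u, Φ u)` to `(v, -3η/2)` lies above the graph of `Φ`
  set k := (Φ u + 3 / 2 * η) / (v - u) with hk
  have hk0 : 0 ≤ k := div_nonneg (by simp only [hΦ]; linarith) huv'.le
  have hklt : k < p * q / (300 * P ^ 5) := by
    rw [hk, div_lt_div_iff₀ huv' (by positivity)]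
    have : Φ u ≤ η := u6b
    have h5 : 0 < P ^ 5 := by positivity
    nlinarith
  have hB : ∀ w ∈ Set.Icc u v, Φ w ≤ Φ u - k * (w - u) := by
    have hcont : ContinuousOn Φ (Set.Icc u v) := fun w hw =>
      (hder w (by linarith [hw.1])).continuousAt.continuousWithinAt
    have hlin : ∀ w : ℝ, HasDerivAt (fun w => Φ u - k * (w - u)) (-k) w := by
      intro w
      have := ((((hasDerivAt_id w).sub_const u).const_mul k).const_sub (Φ u))
      simpa using this
    intro w hw
    refine image_le_of_deriv_right_lt_deriv_boundary (f := Φ) (f' := Φ') hcont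
      (fun x hx => (hder x (by linarith [hx.1])).hasDerivWithinAt) (by simp) hlin ?_ hw
    intro x hx hxe
    have hx1 : u ≤ x := hx.1
    have hx2 : x < v := hx.2
    have hBlow : -(3 / 2 * η) ≤ Φ u - k * (x - u) := by
      have : k * (x - u) ≤ k * (v - u) := by gcongr
      rw [hk, div_mul_cancel₀ _ huv'.ne'] at this
      linarith
    have hBupp : Φ u - k * (x - u) ≤ η := by
      have : 0 ≤ k * (x - u) := mul_nonneg hk0 (by linarith)
      have : Φ u ≤ η := u6b
      linarith
    have hxP : P ≤ x := by linarith
    have hx0 : 0 < x := by linarith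
    have key := cube_sum_lower_bound (v1 := 1 / x) (v2 := 1 / (x + p)) (v3 := 1 / (x + q))
      (v4 := 1 / (x + r)) hP hη (one_div_le_one_div_of_le hP hxP)
      (one_div_le_one_div_of_le (by linarith) (by linarith))
      (one_div_le_one_div_of_le (by linarith) (by linarith))
      (one_div_le_one_div_of_le (by linarith) (by linarith)) hpR hqR (by linarith)
      (by
        have : 1 / x - 1 / (x + p) = p / (x * (x + p)) := by field_simp; ring
        rw [this]
        apply div_le_div_of_nonneg_left hpR.le (by positivity)
        calc x * (x + p) ≤ (3 * P) * (3 * P) := by gcongr <;> linarith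
          _ = 9 * P ^ 2 := by ring)
      (by
        have : 1 / x - 1 / (x + q) = q / (x * (x + q)) := by field_simp; ring
        rw [this]
        apply div_le_div_of_nonneg_left hqR.le (by positivity)
        calc x * (x + q) ≤ (3 * P) * (3 * P) := by gcongr <;> linarith
          _ = 9 * P ^ 2 := by ring)
      (by
        simp only [one_div_pow]
        have : Φ x = Φ u - k * (x - u) := hxe
        rw [abs_le]
        simp only [hΦ] at this hBlow hBupp ⊢
        constructor <;> linarith) hpq
    simp only [hΦ']
    have e6 : (p : ℝ) * q / (300 * P ^ 5) = 2 * (p * q / (600 * P ^ 5)) := by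
      field_simp; ring
    linarith
  have := hB v ⟨huv, le_rfl⟩
  rw [hk, div_mul_cancel₀ _ huv'.ne'] at this
  have h8 : -η ≤ Φ v := v6a
  linarith

lemma nearGapSet_subset (P η : ℝ) (r p q : ℕ) : nearGapSet P η r p q ⊆ Set.Icc P (3 * P) :=
  fun _ hu => ⟨hu.1, hu.2.1⟩

lemma volume_nearGapSet_ne_top (P η : ℝ) (r p q : ℕ) : volume (nearGapSet P η r p q) ≠ ⊤ :=
  measure_ne_top_of_subset (nearGapSet_subset P η r p q) (by simp)

lemma volume_nearGapSet_le {P η : ℝ} (hP : 0 < P) (r p q : ℕ) :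
    volume.real (nearGapSet P η r p q) ≤ 2 * P := by
  refine (measureReal_mono (nearGapSet_subset P η r p q) (by simp)).trans ?_
  rw [Real.volume_real_Icc_of_le (by linarith)]
  linarith

/-- The confinement to a short interval as a bound for the measure. If `p q` is so small that it
says nothing, the length `2 P` of the whole range serves. -/
lemma volume_nearGapSet_le_div {P η : ℝ} (hP : 0 < P) (hη : 0 < η) {r p q : ℕ} (hp : 0 < p)
    (hq : 0 < q) :
    volume.real (nearGapSet P η r p q) ≤ 4600 * η * P ^ 5 / (p * q) := by
  have hpR : (0 : ℝ) < p := by exact_mod_cast hp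
  have hqR : (0 : ℝ) < q := by exact_mod_cast hq
  rcases le_or_gt (2300 * η * P ^ 4) ((p : ℝ) * q) with h | h
  · have hd : Metric.ediam (nearGapSet P η r p q)
        ≤ ENNReal.ofReal (750 * η * P ^ 5 / (p * q)) := by
      refine Metric.ediam_le fun u hu v hv => ?_
      rw [edist_dist, Real.dist_eq]
      apply ENNReal.ofReal_le_ofReal
      rcases le_total u v with huv | huv
      · rw [abs_sub_comm, abs_of_nonneg (by linarith)]
        exact sub_le_of_mem_nearGapSet hP hη hp hq h hu hv huv
      · rw [abs_of_nonneg (by linarith)]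
        exact sub_le_of_mem_nearGapSet hP hη hp hq h hv hu huv
    have h2 := (Real.volume_le_diam (nearGapSet P η r p q)).trans hd
    have h3 := ENNReal.toReal_mono ENNReal.ofReal_ne_top h2
    rw [ENNReal.toReal_ofReal (by positivity)] at h3
    refine h3.trans ?_
    gcongr
    norm_num
  · refine (volume_nearGapSet_le hP r p q).trans ?_
    rw [le_div_iff₀ (by positivity)]
    calc 2 * P * ((p : ℝ) * q) ≤ 2 * P * (2300 * η * P ^ 4) := by gcongr
      _ = 4600 * η * P ^ 5 := by ring

lemma sum_inv_succ_le (n : ℕ) :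
    ∑ p ∈ Finset.range n, 1 / ((p : ℝ) + 1) ≤ 2 * Real.sqrt n := by
  induction n with
  | zero => simp
  | succ n ih =>
    rw [Finset.sum_range_succ]
    push_cast
    set s := Real.sqrt n
    set t := Real.sqrt (n + 1)
    have hs : s ^ 2 = n := Real.sq_sqrt (by positivity)
    have ht : t ^ 2 = n + 1 := Real.sq_sqrt (by positivity)
    have ht1 : 1 ≤ t := Real.one_le_sqrt.mpr (by linarith [n.cast_nonneg (α := ℝ)])
    have hs0 : 0 ≤ s := Real.sqrt_nonneg _
    have : 1 / ((n : ℝ) + 1) ≤ 2 * (t - s) := by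
      rw [← ht, div_le_iff₀ (by positivity)]
      have hst : s ≤ t := Real.sqrt_le_sqrt (by linarith)
      have h1 : (t - s) * (t + s) = 1 := by nlinarith
      have h2 : (t - s) * (t + s) ≤ (t - s) * (2 * t) :=
        mul_le_mul_of_nonneg_left (by linarith) (by linarith)
      have h3 : (t - s) * (2 * t) ≤ (t - s) * (2 * t ^ 2) :=
        mul_le_mul_of_nonneg_left (by nlinarith) (by linarith)
      linarith
    linarith

/-- For given middle gaps the largest gap takes `O(1 + p q / P)` values. -/
lemma sum_volume_nearGapSet_le {P η V : ℝ} (hP : 0 < P) (hη : η * P ^ 3 ≤ 200) (n p q : ℕ)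
    (hV0 : 0 ≤ V) (hV : ∀ r, volume.real (nearGapSet P η r p q) ≤ V) :
    ∑ r ∈ Finset.range n, volume.real (nearGapSet P η r p q)
      ≤ 11601 * (1 + p * q / P) * V := by
  set W : ℝ := 5800 * (1 + p * q / P) with hW
  have hz : (0 : ℝ) ≤ p * q / P := by positivity
  have hzero : ∀ r ∈ Finset.range n, volume.real (nearGapSet P η r p q) ≠ 0 →
      |(r : ℝ) - (p + q)| ≤ W := by
    intro r _ hr
    have hne : (nearGapSet P η r p q).Nonempty := by
      by_contra hc
      rw [Set.not_nonempty_iff_eq_empty] at hc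
      rw [hc] at hr
      simp at hr
    obtain ⟨u, hu⟩ := hne
    exact gap_le_of_mem_nearGapSet hP hη hu
  rw [← Finset.sum_filter_of_ne hzero]
  have hcard : (((Finset.range n).filter fun r : ℕ => |(r : ℝ) - (p + q)| ≤ W).card : ℝ)
      ≤ 2 * W + 1 := by
    have hsub : ((Finset.range n).filter fun r : ℕ => |(r : ℝ) - (p + q)| ≤ W).map
        Nat.castEmbedding ⊆ Finset.Icc ((p + q : ℤ) - ⌊W⌋) ((p + q : ℤ) + ⌊W⌋) := by
      intro z hz
      rw [Finset.mem_map] at hz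
      obtain ⟨r, hr, rfl⟩ := hz
      rw [Finset.mem_filter] at hr
      obtain ⟨h1, h2⟩ := abs_le.mp hr.2
      rw [Finset.mem_Icc]
      simp only [Nat.castEmbedding_apply]
      constructor
      · have : (p + q : ℤ) - r ≤ ⌊W⌋ := by
          rw [Int.le_floor]; push_cast; linarith
        linarith
      · have : (r : ℤ) - (p + q) ≤ ⌊W⌋ := by
          rw [Int.le_floor]; push_cast; linarith
        linarith
    have h1 := Finset.card_le_card hsub
    rw [Finset.card_map, Int.card_Icc] at h1
    have hfl : (0 : ℤ) ≤ ⌊W⌋ := Int.floor_nonneg.mpr (by positivity)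
    have h2 : (((Finset.range n).filter fun r : ℕ => |(r : ℝ) - (p + q)| ≤ W).card : ℤ)
        ≤ 2 * ⌊W⌋ + 1 := by omega
    have h3 : (((Finset.range n).filter fun r : ℕ => |(r : ℝ) - (p + q)| ≤ W).card : ℝ)
        ≤ 2 * (⌊W⌋ : ℝ) + 1 := by exact_mod_cast h2
    linarith [Int.floor_le W]
  calc _ ≤ ∑ r ∈ (Finset.range n).filter fun r : ℕ => |(r : ℝ) - (p + q)| ≤ W, V :=
        Finset.sum_le_sum fun r _ => hV r
    _ ≤ (2 * W + 1) * V := by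
        rw [Finset.sum_const, nsmul_eq_mul]
        gcongr
    _ ≤ _ := by
        gcongr
        rw [hW]; linarith

/-- Summed over all gaps: `p q = 0` contributes the diagonal `P²`, and the terms `η P ⁵ / (p q)`
and `η P ⁴` for the `O(1 + p q / P)` values of `r` add up to `η P ⁶`. The logarithms from
`∑ 1 / (p q)` are absorbed in the surplus power of `P`. -/
lemma sum_volume_nearGapSet_total_le {P η : ℝ} (hP : 1 ≤ P) (hη : 0 < η)
    (hηP : η * P ^ 3 ≤ 200) {n : ℕ} (hn : (n : ℝ) ≤ 2 * P + 1) :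
    ∑ p ∈ Finset.range n, ∑ q ∈ Finset.range n, ∑ r ∈ Finset.range n,
      volume.real (nearGapSet P η r p q) ≤ 10 ^ 10 * (P ^ 2 + η * P ^ 6) := by
  have hP0 : 0 < P := by linarith
  set K := 11601 * (4600 * η * P ^ 5) with hK
  have hK0 : 0 < K := by positivity
  -- one term of the bound for each of the cases `p = 0`, `q = 0`, `p q > 0`
  have hterm : ∀ p q : ℕ, ∑ r ∈ Finset.range n, volume.real (nearGapSet P η r p q) ≤
      (if p = 0 then 11601 * (2 * P) else 0) + (if q = 0 then 11601 * (2 * P) else 0)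
      + 4 * K * (1 / ((p : ℝ) + 1) * (1 / ((q : ℝ) + 1))) + K * (1 / P) := by
    intro p q
    have hpos : (0 : ℝ) ≤ 4 * K * (1 / ((p : ℝ) + 1) * (1 / ((q : ℝ) + 1))) := by positivity
    have hpos2 : (0 : ℝ) ≤ K * (1 / P) := by positivity
    by_cases h0 : p = 0 ∨ q = 0
    · have h1 := sum_volume_nearGapSet_le hP0 hηP n p q (by positivity)
        (fun r => volume_nearGapSet_le hP0 r p q)
      have h2 : (p : ℝ) * q = 0 := by rcases h0 with rfl | rfl <;> simp
      rw [h2] at h1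
      simp only [zero_div, add_zero, mul_one] at h1
      have h3 : 11601 * (2 * P) ≤ (if p = 0 then 11601 * (2 * P) else 0)
          + (if q = 0 then 11601 * (2 * P) else 0) := by
        rcases h0 with rfl | rfl
        · rw [if_pos rfl]
          have : 0 ≤ (if q = 0 then 11601 * (2 * P) else 0) := by split_ifs <;> positivity
          linarith
        · rw [if_pos rfl (c := (0 : ℕ) = 0)]
          have : 0 ≤ (if p = 0 then 11601 * (2 * P) else 0) := by split_ifs <;> positivity
          linarith
      linarith
    · push Not at h0
      have hp := Nat.pos_of_ne_zero h0.1
      have hq := Nat.pos_of_ne_zero h0.2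
      have hpR : (1 : ℝ) ≤ p := by exact_mod_cast hp
      have hqR : (1 : ℝ) ≤ q := by exact_mod_cast hq
      have h1 := sum_volume_nearGapSet_le hP0 hηP n p q (by positivity)
        (fun r => volume_nearGapSet_le_div hP0 hη hp hq)
      rw [if_neg h0.1, if_neg h0.2]
      have h2 : 11601 * (1 + (p : ℝ) * q / P) * (4600 * η * P ^ 5 / (p * q))
          = K * (1 / (p * q)) + K * (1 / P) := by
        rw [hK]; field_simp
      have h3 : 1 / ((p : ℝ) * q) ≤ 4 * (1 / ((p : ℝ) + 1) * (1 / ((q : ℝ) + 1))) := by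
        rw [one_div_mul_one_div, mul_one_div, div_le_div_iff₀ (by positivity) (by positivity)]
        nlinarith
      have h4 : K * (1 / ((p : ℝ) * q)) ≤ K * (4 * (1 / ((p : ℝ) + 1) * (1 / ((q : ℝ) + 1)))) := by
        gcongr
      linarith
  refine (Finset.sum_le_sum fun p _ => Finset.sum_le_sum fun q _ => hterm p q).trans ?_
  have hH := sum_inv_succ_le n
  have hH0 : 0 ≤ ∑ p ∈ Finset.range n, 1 / ((p : ℝ) + 1) :=
    Finset.sum_nonneg fun _ _ => by positivity
  have hHH : (∑ p ∈ Finset.range n, 1 / ((p : ℝ) + 1)) ^ 2 ≤ 4 * n := by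
    calc _ ≤ (2 * Real.sqrt n) ^ 2 := by gcongr
      _ = 4 * n := by rw [mul_pow, Real.sq_sqrt (by positivity)]; norm_num
  have hif : ∀ c : ℝ, 0 ≤ c → ∑ p ∈ Finset.range n, (if p = 0 then c else 0) ≤ c := by
    intro c hc
    rw [Finset.sum_ite_eq']
    split_ifs <;> linarith
  simp only [Finset.sum_add_distrib, Finset.sum_const, Finset.card_range, nsmul_eq_mul,
    ← Finset.mul_sum]
  rw [← Finset.sum_mul, ← pow_two]
  have h1 := hif (11601 * (2 * P)) (by positivity)
  have hn0 : (0 : ℝ) ≤ n := by positivity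
  have hn3 : (n : ℝ) ≤ 3 * P := by linarith
  have h2 : (n : ℝ) * ∑ p ∈ Finset.range n, (if p = 0 then 11601 * (2 * P) else 0)
      ≤ (3 * P) * (11601 * (2 * P)) := by gcongr
  have h3 : 4 * K * (∑ p ∈ Finset.range n, 1 / ((p : ℝ) + 1)) ^ 2 ≤ 4 * K * (4 * (3 * P)) := by
    gcongr
    linarith
  have h4 : (n : ℝ) * (n * (K * (1 / P))) ≤ (3 * P) * ((3 * P) * (K * (1 / P))) := by gcongr
  have h5 : (3 * P) * ((3 * P) * (K * (1 / P))) = 9 * K * P := by field_simp; ring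
  have h6 : K * P = 11601 * 4600 * (η * P ^ 6) := by rw [hK]; ring
  have h7 : 0 ≤ η * P ^ 6 := by positivity
  have h8 : 0 ≤ P ^ 2 := sq_nonneg P
  linarith

lemma nearSet_swap_left (P η : ℝ) (a b c d : ℤ) :
    nearSet P η (a, b, c, d) = nearSet P η (b, a, c, d) := by
  ext t
  simp only [nearSet, Set.mem_ofPred_eq]
  rw [add_comm (1 / ((a : ℝ) - t) ^ 2)]
  tauto

lemma nearSet_swap_sides (P η : ℝ) (a b c d : ℤ) :
    nearSet P η (a, b, c, d) = nearSet P η (c, d, a, b) := by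
  ext t
  simp only [nearSet, Set.mem_ofPred_eq]
  rw [← abs_neg]
  rw [show -(1 / ((a : ℝ) - t) ^ 2 + 1 / (b - t) ^ 2 - 1 / (c - t) ^ 2 - 1 / (d - t) ^ 2)
    = 1 / ((c : ℝ) - t) ^ 2 + 1 / (d - t) ^ 2 - 1 / (a - t) ^ 2 - 1 / (b - t) ^ 2 by ring]
  tauto

lemma volume_real_preimage_sub_left (c : ℝ) (s : Set ℝ) :
    volume.real ((fun t => c - t) ⁻¹' s) = volume.real s := by
  unfold Measure.real
  congr 1
  exact (Measure.measurePreserving_sub_left volume c).measure_preimage_equiv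
    (f := MeasurableEquiv.subLeft c) s

lemma measurableSet_nearGapSet (P η : ℝ) (r p q : ℕ) : MeasurableSet (nearGapSet P η r p q) := by
  unfold nearGapSet
  measurability

/-- Summing over integer translates unfolds the integral over a unit interval. -/
lemma sum_volume_nearSet_translates_le (P η : ℝ) (B : Finset ℤ) (r p q : ℕ) :
    ∑ h ∈ B, volume.real (nearSet P η (h, h + r, h + p, h + q) ∩ Set.Ioc 0 1)
      ≤ volume.real (nearGapSet P η r p q) := by
  have h1 : ∀ h : ℤ, volume.real (nearSet P η (h, h + r, h + p, h + q) ∩ Set.Ioc 0 1)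
      = volume.real (nearGapSet P η r p q ∩ Set.Ico ((h : ℝ) - 1) h) := by
    intro h
    rw [← volume_real_preimage_sub_left (h : ℝ)
      (nearGapSet P η r p q ∩ Set.Ico ((h : ℝ) - 1) h)]
    congr 1
    ext t
    simp only [nearSet, nearGapSet, Set.mem_inter_iff, Set.mem_preimage, Set.mem_ofPred_eq,
      Set.mem_Ioc, Set.mem_Ico]
    push_cast
    have e : ∀ x : ℕ, (h : ℝ) + x - t = h - t + x := fun x => by ring
    simp only [e]
    constructor
    · rintro ⟨⟨⟨a, b⟩, ⟨c, d⟩, ⟨e1, f⟩, ⟨g, i⟩, j⟩, k, l⟩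
      exact ⟨⟨a, b, d, f, i, j⟩, by linarith, by linarith⟩
    · rintro ⟨⟨a, b, d, f, i, j⟩, k, l⟩
      have hr : (0 : ℝ) ≤ r := by positivity
      have hp : (0 : ℝ) ≤ p := by positivity
      have hq : (0 : ℝ) ≤ q := by positivity
      exact ⟨⟨⟨a, b⟩, ⟨by linarith, d⟩, ⟨by linarith, f⟩, ⟨by linarith, i⟩, j⟩, by linarith,
        by linarith⟩
  simp only [h1]
  rw [← measureReal_biUnion_finset (h := fun _ _ => measure_ne_top_of_subset
    Set.inter_subset_left (volume_nearGapSet_ne_top P η r p q))]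
  · refine measureReal_mono ?_ (volume_nearGapSet_ne_top P η r p q)
    exact Set.iUnion₂_subset fun _ _ => Set.inter_subset_left
  · intro a _ b _ hab
    refine Set.disjoint_left.mpr fun x hx hy => hab ?_
    have h2 := hx.2
    have h3 := hy.2
    rw [Set.mem_Ico] at h2 h3
    have i1 : (a : ℝ) < b + 1 := by linarith
    have i2 : (b : ℝ) < a + 1 := by linarith
    have i1 : a < b + 1 := by exact_mod_cast i1
    have i2 : b < a + 1 := by exact_mod_cast i2
    omega
  · exact fun h _ => (measurableSet_nearGapSet P η r p q).inter measurableSet_Ico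

/-- A nonnegative function of four integers with the symmetries of `a + b = c + d` is summed, up to
a factor four, over the quadruples whose first entry is the smallest. -/
lemma sum_quadruple_le_four_mul {w : ℤ × ℤ × ℤ × ℤ → ℝ} (hw : ∀ t, 0 ≤ w t)
    (h1 : ∀ a b c d, w (a, b, c, d) = w (b, a, c, d))
    (h2 : ∀ a b c d, w (a, b, c, d) = w (c, d, a, b)) (B : Finset ℤ) :
    ∑ t ∈ B ×ˢ B ×ˢ B ×ˢ B, w t ≤
      4 * ∑ t ∈ B ×ˢ B ×ˢ B ×ˢ B,
        if t.1 ≤ t.2.1 ∧ t.1 ≤ t.2.2.1 ∧ t.1 ≤ t.2.2.2 then w t else 0 := by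
  set m : ℤ × ℤ × ℤ × ℤ → ℝ := fun t =>
    if t.1 ≤ t.2.1 ∧ t.1 ≤ t.2.2.1 ∧ t.1 ≤ t.2.2.2 then w t else 0 with hm
  have hm0 : ∀ t, 0 ≤ m t := fun t => by simp only [hm]; split_ifs <;> simp [hw]
  have hle : ∀ t, w t ≤ m t + m (t.2.1, t.1, t.2.2.1, t.2.2.2) + m (t.2.2.1, t.2.2.2, t.1, t.2.1)
      + m (t.2.2.2, t.2.2.1, t.1, t.2.1) := by
    rintro ⟨a, b, c, d⟩
    have n1 := hm0 (a, b, c, d)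
    have n2 := hm0 (b, a, c, d)
    have n3 := hm0 (c, d, a, b)
    have n4 := hm0 (d, c, a, b)
    by_cases c1 : a ≤ b ∧ a ≤ c ∧ a ≤ d
    · have : m (a, b, c, d) = w (a, b, c, d) := if_pos c1
      simp only; linarith
    by_cases c2 : b ≤ a ∧ b ≤ c ∧ b ≤ d
    · have : m (b, a, c, d) = w (b, a, c, d) := if_pos c2
      simp only; linarith [h1 a b c d]
    by_cases c3 : c ≤ d ∧ c ≤ a ∧ c ≤ b
    · have : m (c, d, a, b) = w (c, d, a, b) := if_pos c3
      simp only; linarith [h2 a b c d]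
    · have c4 : d ≤ c ∧ d ≤ a ∧ d ≤ b := by omega
      have : m (d, c, a, b) = w (d, c, a, b) := if_pos c4
      simp only; linarith [h2 a b c d, h1 c d a b]
  refine (Finset.sum_le_sum fun t _ => hle t).trans ?_
  simp only [Finset.sum_add_distrib]
  have s2 : ∑ t ∈ B ×ˢ B ×ˢ B ×ˢ B, m (t.2.1, t.1, t.2.2.1, t.2.2.2)
      = ∑ t ∈ B ×ˢ B ×ˢ B ×ˢ B, m t :=
    Finset.sum_nbij' (fun t => (t.2.1, t.1, t.2.2.1, t.2.2.2))
      (fun t => (t.2.1, t.1, t.2.2.1, t.2.2.2)) (by simp; tauto) (by simp; tauto)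
      (by simp) (by simp) (by simp)
  have s3 : ∑ t ∈ B ×ˢ B ×ˢ B ×ˢ B, m (t.2.2.1, t.2.2.2, t.1, t.2.1)
      = ∑ t ∈ B ×ˢ B ×ˢ B ×ˢ B, m t :=
    Finset.sum_nbij' (fun t => (t.2.2.1, t.2.2.2, t.1, t.2.1))
      (fun t => (t.2.2.1, t.2.2.2, t.1, t.2.1)) (by simp; tauto) (by simp; tauto)
      (by simp) (by simp) (by simp)
  have s4 : ∑ t ∈ B ×ˢ B ×ˢ B ×ˢ B, m (t.2.2.2, t.2.2.1, t.1, t.2.1)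
      = ∑ t ∈ B ×ˢ B ×ˢ B ×ˢ B, m t :=
    Finset.sum_nbij' (fun t => (t.2.2.2, t.2.2.1, t.1, t.2.1))
      (fun t => (t.2.2.1, t.2.2.2, t.2.1, t.1)) (by simp; tauto) (by simp; tauto)
      (by simp) (by simp) (by simp)
  rw [s2, s3, s4]
  linarith

/-- Mean value over shifts of the number of near-coincidences among sums of two inverse squares:
besides the diagonal `P²` only the expected number `η P⁶` occurs. -/
theorem sum_volume_nearSet_le {P η : ℝ} (hP : 1 ≤ P) (hη : 0 < η) (hηP : η * P ^ 3 ≤ 200)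
    (B : Finset ℤ) :
    ∑ t ∈ B ×ˢ B ×ˢ B ×ˢ B, volume.real (nearSet P η t ∩ Set.Ioc 0 1)
      ≤ 4 * 10 ^ 10 * (P ^ 2 + η * P ^ 6) := by
  refine (sum_quadruple_le_four_mul (fun t => measureReal_nonneg)
    (fun a b c d => by rw [nearSet_swap_left]) (fun a b c d => by rw [nearSet_swap_sides])
    B).trans ?_
  rw [mul_assoc]
  refine mul_le_mul_of_nonneg_left ?_ (by norm_num)
  set n := ⌊2 * P⌋₊ + 1 with hn
  have hnP : (n : ℝ) ≤ 2 * P + 1 := by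
    rw [hn]; push_cast; linarith [Nat.floor_le (show (0 : ℝ) ≤ 2 * P by linarith)]
  refine le_trans ?_ (sum_volume_nearGapSet_total_le hP hη hηP hnP)
  rw [← Finset.sum_filter]
  set φ : ℤ × ℕ × ℕ × ℕ → ℤ × ℤ × ℤ × ℤ := fun s => (s.1, s.1 + s.2.1, s.1 + s.2.2.1, s.1 + s.2.2.2)
    with hφ
  set T := B ×ˢ Finset.range n ×ˢ Finset.range n ×ˢ Finset.range n with hT
  have hinj : Set.InjOn φ T := by
    rintro ⟨a, b, c, d⟩ _ ⟨a', b', c', d'⟩ _ h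
    simp only [hφ, Prod.mk.injEq] at h
    obtain ⟨rfl, h2, h3, h4⟩ := h
    simp only [Prod.mk.injEq, true_and]
    omega
  have hstep : ∑ t ∈ (B ×ˢ B ×ˢ B ×ˢ B).filter
        (fun t => t.1 ≤ t.2.1 ∧ t.1 ≤ t.2.2.1 ∧ t.1 ≤ t.2.2.2),
        volume.real (nearSet P η t ∩ Set.Ioc 0 1)
      ≤ ∑ t ∈ T.image φ, volume.real (nearSet P η t ∩ Set.Ioc 0 1) := by
    rw [← Finset.sum_filter_ne_zero]
    refine Finset.sum_le_sum_of_subset_of_nonneg ?_ fun _ _ _ => measureReal_nonneg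
    rintro ⟨a, b, c, d⟩ ht
    simp only [Finset.mem_filter, Finset.mem_product] at ht
    obtain ⟨⟨⟨ha, hb, hc, hd⟩, hab, hac, had⟩, hne⟩ := ht
    have hne' : (nearSet P η (a, b, c, d) ∩ Set.Ioc 0 1).Nonempty := by
      by_contra hcon
      rw [Set.not_nonempty_iff_eq_empty] at hcon
      rw [hcon] at hne
      simp at hne
    obtain ⟨t, ⟨⟨⟨a1, a2⟩, ⟨b1, b2⟩, ⟨c1, c2⟩, ⟨d1, d2⟩, -⟩, -⟩⟩ := hne'
    simp only at a1 a2 b1 b2 c1 c2 d1 d2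
    have hgap : ∀ x : ℤ, a ≤ x → (x : ℝ) - t ≤ 3 * P → (x - a).toNat < n := by
      intro x hx hx3
      rw [hn, Nat.lt_succ_iff]
      apply Nat.le_floor
      have : (((x - a).toNat : ℤ) : ℝ) = x - a := by
        rw [Int.toNat_of_nonneg (by omega)]; push_cast; ring
      rw [Int.cast_natCast] at this
      rw [this]; linarith
    rw [Finset.mem_image]
    refine ⟨(a, (b - a).toNat, (c - a).toNat, (d - a).toNat), ?_, ?_⟩
    · simp only [hT, Finset.mem_product, Finset.mem_range]
      exact ⟨ha, hgap b hab b2, hgap c hac c2, hgap d had d2⟩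
    · simp only [hφ, Prod.mk.injEq]
      refine ⟨trivial, ?_, ?_, ?_⟩ <;> (rw [Int.toNat_of_nonneg (by omega)]; ring)
  refine hstep.trans ?_
  rw [Finset.sum_image hinj, hT, Finset.sum_product_right]
  simp only [hφ]
  refine (Finset.sum_le_sum fun s _ =>
    sum_volume_nearSet_translates_le P η B s.1 s.2.1 s.2.2).trans ?_
  rw [Finset.sum_product_right, Finset.sum_product]

/-! ### Fourth moments localised by the Fejér kernel -/

lemma hasDerivAt_ee (x : ℝ) : HasDerivAt ee (2 * Real.pi * Complex.I * ee x) x := by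
  have h1 : HasDerivAt (fun x : ℝ => 2 * Real.pi * (x : ℂ) * Complex.I)
      (2 * Real.pi * Complex.I) x := by
    have := ((Complex.ofRealCLM.hasDerivAt (x := x)).const_mul (2 * Real.pi : ℂ)).mul_const
      Complex.I
    simpa using this
  have h2 := h1.cexp
  unfold ee
  convert h2 using 1
  ring

/-- Orthogonality of integer frequencies over any interval of length one. -/
lemma integral_ee_int_mul (c : ℝ) (n : ℤ) :
    ∫ t in c..(c + 1), ee (n * t) = if n = 0 then 1 else 0 := by
  split_ifs with h
  · simp [h, ee_zero]
  · have hn : (n : ℂ) ≠ 0 := by exact_mod_cast h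
    have hpi : (Real.pi : ℂ) ≠ 0 := by exact_mod_cast Real.pi_ne_zero
    have hder : ∀ t ∈ Set.uIcc c (c + 1), HasDerivAt
        (fun t : ℝ => ee (n * t) / (2 * Real.pi * Complex.I * n)) (ee (n * t)) t := by
      intro t _
      have h1 : HasDerivAt (fun t : ℝ => (n : ℝ) * t) n t := by
        simpa using (hasDerivAt_id t).const_mul (n : ℝ)
      have h2 := (((hasDerivAt_ee (n * t)).scomp t h1).div_const (2 * Real.pi * Complex.I * n))
      refine h2.congr_deriv ?_
      simp only [Complex.real_smul]
      push_cast
      field_simp [Complex.I_ne_zero]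
    rw [intervalIntegral.integral_eq_sub_of_hasDerivAt hder
      ((by fun_prop : Continuous fun t : ℝ => ee (n * t)).intervalIntegrable _ _)]
    have : ee (n * (c + 1)) = ee (n * c) := by
      rw [mul_add, mul_one, ee_add_int]
    rw [this, sub_self]

/-- The mean value of a trigonometric polynomial is the sum of its constant coefficients. -/
lemma integral_sum_ee {ι : Type*} (s : Finset ι) (b : ι → ℂ) (n : ι → ℤ) (c : ℝ) :
    ∫ t in c..(c + 1), ∑ i ∈ s, b i * ee (n i * t) = ∑ i ∈ s, if n i = 0 then b i else 0 := by
  rw [intervalIntegral.integral_finsetSum fun i _ =>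
    (by fun_prop : Continuous fun t : ℝ => b i * ee (n i * t)).intervalIntegrable _ _]
  refine Finset.sum_congr rfl fun i _ => ?_
  rw [intervalIntegral.integral_const_mul, integral_ee_int_mul]
  split_ifs <;> simp

/-- The Fejér kernel of order `N`, with period one. -/
noncomputable def fejer (N : ℕ) (t : ℝ) : ℝ := ‖∑ j ∈ Finset.range N, ee (j * t)‖ ^ 2 / N

@[fun_prop]
lemma continuous_fejer (N : ℕ) : Continuous (fejer N) := by unfold fejer; fun_prop

lemma fejer_nonneg (N : ℕ) (t : ℝ) : 0 ≤ fejer N t := by unfold fejer; positivity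

lemma fejer_eq_sum (N : ℕ) (t : ℝ) : (fejer N t : ℂ) =
    ∑ j ∈ Finset.range N ×ˢ Finset.range N, (1 / N : ℂ) * ee (((j.1 : ℤ) - j.2 : ℤ) * t) := by
  unfold fejer
  push_cast
  rw [← Complex.mul_conj', map_sum, Finset.sum_mul_sum, Finset.sum_product, Finset.sum_div]
  refine Finset.sum_congr rfl fun i _ => ?_
  rw [Finset.sum_div]
  refine Finset.sum_congr rfl fun j _ => ?_
  rw [← ee_neg, ← ee_add, one_div_mul_eq_div]
  congr 2; ring

lemma integral_fejer {N : ℕ} (hN : 0 < N) (c : ℝ) : ∫ t in c..(c + 1), fejer N t = 1 := by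
  have h : ((∫ t in c..(c + 1), fejer N t : ℝ) : ℂ) = 1 := by
    rw [← intervalIntegral.integral_ofReal]
    simp only [fejer_eq_sum]
    rw [integral_sum_ee, Finset.sum_product]
    simp only [sub_eq_zero, Nat.cast_inj]
    have hN' : (N : ℂ) ≠ 0 := by exact_mod_cast hN.ne'
    simp only [Finset.sum_ite_eq]
    rw [Finset.sum_congr rfl fun x hx => if_pos hx]
    simp [hN']
  exact_mod_cast h

lemma fejer_le {N : ℕ} {t : ℝ} (ht0 : t ≠ 0) (ht : |t| ≤ 1 / 2) :
    fejer N t ≤ 1 / (N * t ^ 2) := by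
  have key : ∀ s : ℝ, 0 < s → s ≤ 1 / 2 → ‖∑ j ∈ Finset.range N, ee (j * s)‖ ≤ 1 / s := by
    intro s hs hs2
    rw [Finset.range_eq_Ico]
    refine norm_sum_Ico_ee_le (f := fun j : ℕ => (j : ℝ) * s) 0 hs ?_ ?_ ?_ <;>
    · intros; push_cast; linarith
  have h : ‖∑ j ∈ Finset.range N, ee (j * t)‖ ≤ 1 / |t| := by
    rcases lt_or_gt_of_ne ht0 with h | h
    · have h1 := key (-t) (by linarith) (by rwa [abs_of_neg h] at ht)
      rw [abs_of_neg h]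
      convert h1 using 1
      rw [← Complex.norm_conj, map_sum]
      congr 1
      refine Finset.sum_congr rfl fun j _ => ?_
      rw [← ee_neg]; congr 1; ring
    · rw [abs_of_pos h] at ht ⊢
      exact key t h ht
  unfold fejer
  calc _ ≤ (1 / |t|) ^ 2 / N := by gcongr
    _ = 1 / (N * t ^ 2) := by rw [one_div_pow, sq_abs, div_div, mul_comm]

/-- The part of the trigonometric polynomial with coefficients `b` on `S` whose frequencies carry
the label `h`. -/
noncomputable def labelSum (S : Finset ℕ) (b : ℕ → ℂ) (lab : ℕ → ℤ) (h : ℤ) (t : ℝ) : ℂ :=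
  ∑ m ∈ S.filter (fun m => lab m = h), b m * ee (m * t)

@[fun_prop]
lemma continuous_labelSum (S : Finset ℕ) (b : ℕ → ℂ) (lab : ℕ → ℤ) (h : ℤ) :
    Continuous (labelSum S b lab h) := by unfold labelSum; fun_prop

/-- Frequencies `m₁ + m₂ - m₃ - m₄` of absolute value at least `N` are killed by the Fejér
kernel of order `N`. -/
lemma integral_fejer_mul_eq_zero {N : ℕ} {S : Finset ℕ} {b : ℕ → ℂ} {lab : ℕ → ℤ}
    {h1 h2 h3 h4 : ℤ} (c : ℝ)
    (hfar : ∀ m1 ∈ S, ∀ m2 ∈ S, ∀ m3 ∈ S, ∀ m4 ∈ S, lab m1 = h1 → lab m2 = h2 → lab m3 = h3 →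
      lab m4 = h4 → (N : ℤ) ≤ |(m1 : ℤ) + m2 - m3 - m4|) :
    ∫ t in c..(c + 1), (fejer N t : ℂ) * (labelSum S b lab h1 t * labelSum S b lab h2 t *
      ((starRingEnd ℂ) (labelSum S b lab h3 t) * (starRingEnd ℂ) (labelSum S b lab h4 t))) = 0 := by
  set A : ℤ → Finset ℕ := fun h => S.filter (fun m => lab m = h) with hA
  have hexp : ∀ t : ℝ, (fejer N t : ℂ) * (labelSum S b lab h1 t * labelSum S b lab h2 t *
      ((starRingEnd ℂ) (labelSum S b lab h3 t) * (starRingEnd ℂ) (labelSum S b lab h4 t)))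
      = ∑ x ∈ (Finset.range N ×ˢ Finset.range N) ×ˢ ((A h1 ×ˢ A h2) ×ˢ (A h3 ×ˢ A h4)),
        ((1 / N : ℂ) * ((b x.2.1.1 * b x.2.1.2) * ((starRingEnd ℂ) (b x.2.2.1) *
          (starRingEnd ℂ) (b x.2.2.2)))) *
        ee ((((x.1.1 : ℤ) - x.1.2) + ((x.2.1.1 : ℤ) + x.2.1.2 - x.2.2.1 - x.2.2.2) : ℤ) * t) := by
    intro t
    rw [fejer_eq_sum]
    simp only [labelSum, map_sum, map_mul, ← ee_neg]
    rw [Finset.sum_mul_sum, Finset.sum_mul_sum, ← Finset.sum_product', ← Finset.sum_product',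
      Finset.sum_mul_sum, ← Finset.sum_product', Finset.sum_mul_sum, ← Finset.sum_product']
    refine Finset.sum_congr rfl fun x _ => ?_
    have : ((((x.1.1 : ℤ) - x.1.2) + ((x.2.1.1 : ℤ) + x.2.1.2 - x.2.2.1 - x.2.2.2) : ℤ) : ℝ) * t
        = ((x.1.1 : ℤ) - x.1.2 : ℤ) * t + ((x.2.1.1 * t + x.2.1.2 * t)
          + (-(x.2.2.1 * t) + -(x.2.2.2 * t))) := by push_cast; ring
    rw [this, ee_add, ee_add, ee_add, ee_add]
    ring
  simp only [hexp]
  rw [integral_sum_ee]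
  refine Finset.sum_eq_zero fun x hx => ?_
  rw [if_neg]
  intro h0
  simp only [Finset.mem_product, hA, Finset.mem_filter, Finset.mem_range] at hx
  obtain ⟨⟨hj1, hj2⟩, ⟨⟨a1, a2⟩, b1, b2⟩, ⟨c1, c2⟩, d1, d2⟩ := hx
  have := hfar _ a1 _ b1 _ c1 _ d1 a2 b2 c2 d2
  rcases abs_cases ((x.2.1.1 : ℤ) + x.2.1.2 - x.2.2.1 - x.2.2.2) with h | h <;> omega

/-- Fourth moment of a trigonometric polynomial split according to labels, against the Fejér
kernel: only quadruples of labels in `Rel`, which contains all those with a near-coincidence of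
frequencies, contribute. -/
lemma integral_fejer_mul_norm_pow_four_le {N : ℕ} {S : Finset ℕ} {b : ℕ → ℂ} {lab : ℕ → ℤ}
    {H : Finset ℤ} (hH : ∀ m ∈ S, lab m ∈ H) {G : ℝ} (c : ℝ)
    (hG : ∀ h ∈ H, ∫ t in c..(c + 1), fejer N t * ‖labelSum S b lab h t‖ ^ 4 ≤ G)
    (Rel : ℤ × ℤ × ℤ × ℤ → Prop) [DecidablePred Rel]
    (hRel : ∀ m1 ∈ S, ∀ m2 ∈ S, ∀ m3 ∈ S, ∀ m4 ∈ S, |(m1 : ℤ) + m2 - m3 - m4| < N →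
      Rel (lab m1, lab m2, lab m3, lab m4)) :
    ∫ t in c..(c + 1), fejer N t * ‖∑ m ∈ S, b m * ee (m * t)‖ ^ 4
      ≤ ∑ x ∈ H ×ˢ H ×ˢ H ×ˢ H, if Rel x then G else 0 := by
  set L : ℤ → ℝ → ℂ := labelSum S b lab with hL
  have hLc : ∀ h, Continuous (L h) := fun h => continuous_labelSum S b lab h
  have hsum : ∀ t : ℝ, ∑ m ∈ S, b m * ee (m * t) = ∑ h ∈ H, L h t := by
    intro t
    simp only [hL, labelSum]
    rw [Finset.sum_fiberwise_of_maps_to hH]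
  have hexp : ∀ t : ℝ, ((fejer N t * ‖∑ m ∈ S, b m * ee (m * t)‖ ^ 4 : ℝ) : ℂ)
      = ∑ x ∈ H ×ˢ H ×ˢ H ×ˢ H, (fejer N t : ℂ) * (L x.1 t * L x.2.1 t *
        ((starRingEnd ℂ) (L x.2.2.1 t) * (starRingEnd ℂ) (L x.2.2.2 t))) := by
    intro t
    rw [hsum]
    push_cast
    have : (‖∑ h ∈ H, L h t‖ : ℂ) ^ 4 = (∑ h ∈ H, L h t) * ((∑ h ∈ H, L h t) *
        ((∑ h ∈ H, (starRingEnd ℂ) (L h t)) * (∑ h ∈ H, (starRingEnd ℂ) (L h t)))) := by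
      rw [← map_sum]
      have h2 := Complex.mul_conj' (∑ h ∈ H, L h t)
      linear_combination (-(‖∑ h ∈ H, L h t‖ : ℂ) ^ 2
        - (∑ h ∈ H, L h t) * (starRingEnd ℂ) (∑ h ∈ H, L h t)) * h2
    rw [this, Finset.sum_mul_sum H H (fun h => (starRingEnd ℂ) (L h t)), ← Finset.sum_product',
      Finset.sum_mul_sum, ← Finset.sum_product', Finset.sum_mul_sum, ← Finset.sum_product',
      Finset.mul_sum]
    refine Finset.sum_congr rfl fun x _ => ?_
    ring
  have hI : ((∫ t in c..(c + 1), fejer N t * ‖∑ m ∈ S, b m * ee (m * t)‖ ^ 4 : ℝ) : ℂ)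
      = ∑ x ∈ H ×ˢ H ×ˢ H ×ˢ H, ∫ t in c..(c + 1), (fejer N t : ℂ) * (L x.1 t * L x.2.1 t *
        ((starRingEnd ℂ) (L x.2.2.1 t) * (starRingEnd ℂ) (L x.2.2.2 t))) := by
    rw [← intervalIntegral.integral_ofReal]
    simp only [hexp]
    rw [intervalIntegral.integral_finsetSum]
    intro x _
    have h1 := hLc x.1
    have h2 := hLc x.2.1
    have h3 := Complex.continuous_conj.comp (hLc x.2.2.1)
    have h4 := Complex.continuous_conj.comp (hLc x.2.2.2)
    exact ((Complex.continuous_ofReal.comp (continuous_fejer N)).mul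
      ((h1.mul h2).mul (h3.mul h4))).intervalIntegrable _ _
  have hnn : 0 ≤ ∫ t in c..(c + 1), fejer N t * ‖∑ m ∈ S, b m * ee (m * t)‖ ^ 4 :=
    intervalIntegral.integral_nonneg (by linarith) fun t _ =>
      mul_nonneg (fejer_nonneg N t) (by positivity)
  have hnorm : ∫ t in c..(c + 1), fejer N t * ‖∑ m ∈ S, b m * ee (m * t)‖ ^ 4
      = ‖((∫ t in c..(c + 1), fejer N t * ‖∑ m ∈ S, b m * ee (m * t)‖ ^ 4 : ℝ) : ℂ)‖ := by
    rw [Complex.norm_real, Real.norm_eq_abs, abs_of_nonneg hnn]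
  rw [hnorm, hI]
  refine (norm_sum_le _ _).trans (Finset.sum_le_sum fun x hx => ?_)
  simp only [Finset.mem_product] at hx
  obtain ⟨x1, x2, x3, x4⟩ := hx
  split_ifs with hR
  · have hint : ∀ h, IntervalIntegrable (fun t => fejer N t * ‖L h t‖ ^ 4) volume c (c + 1) :=
      fun h => ((continuous_fejer N).mul ((hLc h).norm.pow 4)).intervalIntegrable _ _
    have hbound : ∀ t ∈ Set.Icc c (c + 1), ‖(fejer N t : ℂ) * (L x.1 t * L x.2.1 t *
        ((starRingEnd ℂ) (L x.2.2.1 t) * (starRingEnd ℂ) (L x.2.2.2 t)))‖ ≤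
        (1 / 4) * (fejer N t * ‖L x.1 t‖ ^ 4 + fejer N t * ‖L x.2.1 t‖ ^ 4
          + fejer N t * ‖L x.2.2.1 t‖ ^ 4 + fejer N t * ‖L x.2.2.2 t‖ ^ 4) := by
      intro t _
      simp only [norm_mul, Complex.norm_conj, Complex.norm_real, Real.norm_eq_abs,
        abs_of_nonneg (fejer_nonneg N t)]
      set p := ‖L x.1 t‖
      set q := ‖L x.2.1 t‖
      set r := ‖L x.2.2.1 t‖
      set s := ‖L x.2.2.2 t‖
      have h1 : p * q * (r * s) ≤ 1 / 4 * (p ^ 4 + q ^ 4 + r ^ 4 + s ^ 4) := by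
        nlinarith [sq_nonneg (p * q - r * s), sq_nonneg (p ^ 2 - q ^ 2), sq_nonneg (r ^ 2 - s ^ 2)]
      have h2 := mul_le_mul_of_nonneg_left h1 (fejer_nonneg N t)
      linarith
    refine (intervalIntegral.norm_integral_le_of_norm_le (by linarith)
      (Filter.Eventually.of_forall fun t ht => hbound t ⟨ht.1.le, ht.2⟩)
      (((((hint _).add (hint _)).add (hint _)).add (hint _)).const_mul _)).trans ?_
    rw [intervalIntegral.integral_const_mul, intervalIntegral.integral_add
      (((hint _).add (hint _)).add (hint _)) (hint _), intervalIntegral.integral_add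
      ((hint _).add (hint _)) (hint _), intervalIntegral.integral_add (hint _) (hint _)]
    linarith [hG _ x1, hG _ x2, hG _ x3, hG _ x4]
  · rw [integral_fejer_mul_eq_zero c, norm_zero]
    intro m1 hm1 m2 hm2 m3 hm3 m4 hm4 e1 e2 e3 e4
    by_contra hlt
    push Not at hlt
    have := hRel m1 hm1 m2 hm2 m3 hm3 m4 hm4 hlt
    rw [e1, e2, e3, e4] at this
    exact hR this

/-- Averaging over translates against the Fejér kernel does not change the mean of a continuous
function of period one. -/
lemma integral_eq_integral_fejer_translates {N : ℕ} (hN : 0 < N) {f : ℝ → ℝ} (hf : Continuous f)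
    (hper : Function.Periodic f 1) (c : ℝ) :
    ∫ t in (0 : ℝ)..1, f t = ∫ u in (0 : ℝ)..1, ∫ t in c..(c + 1), fejer N t * f (u + t) := by
  have hswap : ∫ u in (0 : ℝ)..1, ∫ t in c..(c + 1), fejer N t * f (u + t)
      = ∫ t in c..(c + 1), ∫ u in (0 : ℝ)..1, fejer N t * f (u + t) := by
    have hc : c ≤ c + 1 := by linarith
    simp only [intervalIntegral.integral_of_le zero_le_one, intervalIntegral.integral_of_le hc]
    apply integral_integral_swap
    rw [Measure.prod_restrict]
    have hcont : Continuous (Function.uncurry fun u t : ℝ => fejer N t * f (u + t)) := by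
      unfold Function.uncurry; fun_prop
    exact (hcont.continuousOn.integrableOn_compact (isCompact_Icc.prod isCompact_Icc)).mono_set
      (Set.prod_mono Set.Ioc_subset_Icc_self Set.Ioc_subset_Icc_self)
  rw [hswap]
  have h1 : ∀ t : ℝ, ∫ u in (0 : ℝ)..1, fejer N t * f (u + t)
      = fejer N t * ∫ u in (0 : ℝ)..1, f u := by
    intro t
    rw [intervalIntegral.integral_const_mul, intervalIntegral.integral_comp_add_right]
    have := hper.intervalIntegral_add_eq t 0
    rw [zero_add] at this
    rw [zero_add, add_comm, this]
  simp only [h1]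
  rw [intervalIntegral.integral_mul_const, integral_fejer hN, one_mul]

/-! ### The fourth moment of `∑ e(a √m + m θ)` over a dyadic block -/

/-- The increments `a (√(m+1) - √m)` of the phase `a √m`. -/
noncomputable def sqrtStep (a : ℝ) (m : ℕ) : ℝ := a * (Real.sqrt (m + 1) - Real.sqrt m)

lemma sqrtStep_eq (a : ℝ) (m : ℕ) :
    sqrtStep a m = a / (Real.sqrt (m + 1) + Real.sqrt m) := by
  have h1 : (0 : ℝ) ≤ m := by positivity
  have hs : 0 < Real.sqrt (m + 1) + Real.sqrt m := by positivity
  unfold sqrtStep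
  rw [eq_div_iff hs.ne']
  have e1 := Real.sq_sqrt (show (0 : ℝ) ≤ m + 1 by positivity)
  have e2 := Real.sq_sqrt h1
  linear_combination a * e1 - a * e2

lemma sqrtStep_antitone {a : ℝ} (ha : 0 ≤ a) {m n : ℕ} (h : m ≤ n) :
    sqrtStep a n ≤ sqrtStep a m := by
  rw [sqrtStep_eq, sqrtStep_eq]
  have hmn : (m : ℝ) ≤ n := by exact_mod_cast h
  gcongr

/-- The increments over the block `[M, 2 M)` have the size of `P = a / (4 √M)`. -/
lemma sqrtStep_mem {a P : ℝ} {M m : ℕ} (haP : a = 4 * P * Real.sqrt M) (hP : 0 < P)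
    (hM : 1 ≤ M) (h1 : M ≤ m) (h2 : m < 2 * M) :
    1.4 * P ≤ sqrtStep a m ∧ sqrtStep a m ≤ 2 * P := by
  have hMm : (M : ℝ) ≤ m := by exact_mod_cast h1
  have hM0 : (0 : ℝ) < M := by exact_mod_cast hM
  have hm2 : (m : ℝ) + 1 ≤ 2 * M := by exact_mod_cast h2
  have hs0 : 0 < Real.sqrt M := Real.sqrt_pos.mpr hM0
  have a1 : Real.sqrt M ≤ Real.sqrt m := Real.sqrt_le_sqrt hMm
  have a2 : Real.sqrt M ≤ Real.sqrt (m + 1) := Real.sqrt_le_sqrt (by linarith)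
  have up : ∀ y : ℝ, y ≤ 2 * M → Real.sqrt y ≤ 1.42 * Real.sqrt M := by
    intro y hy
    apply Real.sqrt_le_iff.mpr
    refine ⟨by positivity, ?_⟩
    rw [mul_pow, Real.sq_sqrt hM0.le]
    nlinarith
  have b1 := up m (by linarith)
  have b2 := up (m + 1) hm2
  rw [sqrtStep_eq, haP]
  constructor
  · rw [le_div_iff₀ (by linarith)]
    have : 1.4 * P * (Real.sqrt (m + 1) + Real.sqrt m) ≤ 1.4 * P * (2.84 * Real.sqrt M) := by
      gcongr; linarith
    have h3 : 0 < P * Real.sqrt M := by positivity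
    nlinarith
  · rw [div_le_iff₀ (by linarith)]
    have : 2 * P * (2 * Real.sqrt M) ≤ 2 * P * (Real.sqrt (m + 1) + Real.sqrt m) := by
      gcongr; linarith
    linarith

/-- The increments decrease by at least a multiple of `a M ^ (-3/2)`. -/
lemma sqrtStep_succ_add_le {a : ℝ} (ha : 0 < a) {M m : ℕ} (hM : 1 ≤ M) (h2 : m + 1 < 2 * M) :
    sqrtStep a (m + 1) + a / (24 * (M * Real.sqrt M)) ≤ sqrtStep a m := by
  have hM0 : (0 : ℝ) < M := by exact_mod_cast hM
  have hM1 : (1 : ℝ) ≤ M := by exact_mod_cast hM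
  have hm2 : (m : ℝ) + 2 ≤ 2 * M := by exact_mod_cast h2
  have hs0 : 0 < Real.sqrt M := Real.sqrt_pos.mpr hM0
  have up : ∀ y : ℝ, y ≤ 2 * M → Real.sqrt y ≤ 1.42 * Real.sqrt M := by
    intro y hy
    apply Real.sqrt_le_iff.mpr
    refine ⟨by positivity, ?_⟩
    rw [mul_pow, Real.sq_sqrt hM0.le]
    nlinarith
  rw [sqrtStep_eq, sqrtStep_eq]
  push_cast
  rw [show (m : ℝ) + 1 + 1 = m + 2 by ring]
  set s0 := Real.sqrt m
  set s1 := Real.sqrt (m + 1)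
  set s2 := Real.sqrt (m + 2)
  have c0 : 0 ≤ s0 := Real.sqrt_nonneg _
  have c1 : 0 < s1 := Real.sqrt_pos.mpr (by positivity)
  have c2 : 0 < s2 := Real.sqrt_pos.mpr (by positivity)
  have q0 : s0 ^ 2 = m := Real.sq_sqrt (by positivity)
  have q2 : s2 ^ 2 = m + 2 := Real.sq_sqrt (by positivity)
  have b0 := up m (by linarith)
  have b1 := up (m + 1) (by linarith)
  have b2 := up (m + 2) hm2
  have hdiff : a / (s1 + s0) - a / (s2 + s1) = 2 * a / ((s1 + s0) * (s2 + s1) * (s2 + s0)) := by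
    rw [div_sub_div _ _ (by positivity) (by positivity), div_eq_div_iff (by positivity)
      (by positivity)]
    linear_combination a * (s1 + s0) * (s2 + s1) * (q2 - q0)
  have hle : a / (24 * (M * Real.sqrt M)) ≤ 2 * a / ((s1 + s0) * (s2 + s1) * (s2 + s0)) := by
    rw [div_le_div_iff₀ (by positivity) (by positivity)]
    have : (s1 + s0) * (s2 + s1) * (s2 + s0) ≤ (2.84 * Real.sqrt M) * (2.84 * Real.sqrt M)
        * (2.84 * Real.sqrt M) := by
      gcongr <;> linarith
    have h3 : (2.84 * Real.sqrt M) * (2.84 * Real.sqrt M) * (2.84 * Real.sqrt M)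
        ≤ 48 * (M * Real.sqrt M) := by
      have e := Real.mul_self_sqrt hM0.le
      have : 0 < M * Real.sqrt M := by positivity
      have e2 : (2.84 * Real.sqrt M) * (2.84 * Real.sqrt M) * (2.84 * Real.sqrt M)
        = 2.84 ^ 3 * ((Real.sqrt M * Real.sqrt M) * Real.sqrt M) := by ring
      rw [e2, e]
      norm_num
      nlinarith
    have := mul_le_mul_of_nonneg_left (this.trans h3) ha.le
    linarith
  linarith

/-- The integer `m` is recovered from the increment: `m ≈ a² / (4 step²)`. This is how additive
relations between the `m` become relations between inverse squares. -/
lemma abs_sub_sq_div_sqrtStep_le {a : ℝ} (ha : 0 < a) (m : ℕ) :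
    |(m : ℝ) - a ^ 2 / 4 * (1 / sqrtStep a m ^ 2)| ≤ 1 := by
  rw [sqrtStep_eq]
  set s0 := Real.sqrt m
  set s1 := Real.sqrt (m + 1)
  have c0 : 0 ≤ s0 := Real.sqrt_nonneg _
  have c1 : 0 < s1 := Real.sqrt_pos.mpr (by positivity)
  have q0 : s0 ^ 2 = m := Real.sq_sqrt (by positivity)
  have q1 : s1 ^ 2 = m + 1 := Real.sq_sqrt (by positivity)
  have h01 : s0 ≤ s1 := Real.sqrt_le_sqrt (by linarith)
  have e : a ^ 2 / 4 * (1 / (a / (s1 + s0)) ^ 2) = (s1 + s0) ^ 2 / 4 := by field_simp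
  rw [e, abs_le]
  constructor <;> nlinarith

/-- The signed distance of `a (√(m+1) - √m) + θ` to the nearest integer. -/
noncomputable def sqrtDev (a θ : ℝ) (m : ℕ) : ℝ := sqrtStep a m + θ - round (sqrtStep a m + θ)

/-- The dyadic size of the distance `sqrtDev a θ m`, in units of `1 / N`. -/
noncomputable def sqrtLevel (N : ℕ) (a θ : ℝ) (m : ℕ) : ℕ := Nat.clog 2 ⌈(N : ℝ) * |sqrtDev a θ m|⌉₊

/-- The integers of `[M, x)` at level `i` for which the increment of the phase lies above
(`σ = true`) or not above (`σ = false`) the nearest integer. -/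
noncomputable def sqrtClass (N : ℕ) (a θ : ℝ) (M x i : ℕ) (σ : Bool) : Finset ℕ :=
  (Finset.Ico M x).filter fun m => sqrtLevel N a θ m = i ∧ (0 < sqrtDev a θ m ↔ σ = true)

lemma abs_sqrtDev_le (a θ : ℝ) (m : ℕ) : |sqrtDev a θ m| ≤ 1 / 2 := abs_sub_round _

lemma abs_sqrtDev_le_of_level {N : ℕ} (hN : 0 < N) {a θ : ℝ} {m i : ℕ}
    (h : sqrtLevel N a θ m = i) : |sqrtDev a θ m| ≤ 2 ^ i / N := by
  have hN' : (0 : ℝ) < N := by exact_mod_cast hN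
  rw [le_div_iff₀ hN', mul_comm]
  have h1 := Nat.le_pow_clog one_lt_two ⌈(N : ℝ) * |sqrtDev a θ m|⌉₊
  rw [← h]
  refine (Nat.le_ceil _).trans ?_
  unfold sqrtLevel
  exact_mod_cast h1

lemma lt_abs_sqrtDev_of_level {N : ℕ} (hN : 0 < N) {a θ : ℝ} {m i : ℕ} (hi : 1 ≤ i)
    (h : sqrtLevel N a θ m = i) : 2 ^ i / (2 * N) < |sqrtDev a θ m| := by
  have hN' : (0 : ℝ) < N := by exact_mod_cast hN
  rw [div_lt_iff₀ (by positivity)]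
  have h2 : 1 < ⌈(N : ℝ) * |sqrtDev a θ m|⌉₊ := by
    by_contra hc
    push Not at hc
    have := Nat.clog_of_right_le_one hc 2
    unfold sqrtLevel at h
    omega
  have h1 := Nat.pow_pred_clog_lt_self one_lt_two h2
  have h3 : 2 ^ (i - 1) < ⌈(N : ℝ) * |sqrtDev a θ m|⌉₊ := by
    rw [← h]; exact h1
  rw [Nat.lt_ceil] at h3
  push_cast at h3
  obtain ⟨j, rfl⟩ : ∃ j, i = j + 1 := ⟨i - 1, by omega⟩
  simp only [Nat.add_sub_cancel] at h3
  rw [pow_succ]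
  linarith

/-- The members of a class with a given nearest integer `h` form an interval, since the increments
are monotone and stay on one side of `h`. -/
lemma sqrtClass_label_ordConnected {N : ℕ} {a θ : ℝ} (ha : 0 ≤ a) {M x i : ℕ} {σ : Bool} {h : ℤ} :
    ∀ p ∈ (sqrtClass N a θ M x i σ).filter (fun m => round (sqrtStep a m + θ) = h),
    ∀ q ∈ (sqrtClass N a θ M x i σ).filter (fun m => round (sqrtStep a m + θ) = h),
    ∀ n, p ≤ n → n ≤ q →
      n ∈ (sqrtClass N a θ M x i σ).filter (fun m => round (sqrtStep a m + θ) = h) := by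
  intro p hp q hq n hpn hnq
  simp only [sqrtClass, Finset.mem_filter, Finset.mem_Ico] at *
  obtain ⟨⟨⟨p1, p2⟩, p3, p4⟩, p5⟩ := hp
  obtain ⟨⟨⟨q1, q2⟩, q3, q4⟩, q5⟩ := hq
  have s1 := sqrtStep_antitone ha hpn
  have s2 := sqrtStep_antitone ha hnq
  have hrm : ∀ u v : ℝ, u ≤ v → round u ≤ round v := by
    intro u v huv
    rw [round_eq, round_eq]
    exact Int.floor_mono (by linarith)
  have hr : round (sqrtStep a n + θ) = h := by
    have r1 := hrm _ _ (add_le_add_left s1 θ)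
    have r2 := hrm _ _ (add_le_add_left s2 θ)
    omega
  have d1 : sqrtDev a θ n ≤ sqrtDev a θ p := by
    unfold sqrtDev; rw [hr, p5]; linarith
  have d2 : sqrtDev a θ q ≤ sqrtDev a θ n := by
    unfold sqrtDev; rw [hr, q5]; linarith
  have hlev : ∀ u v : ℕ, |sqrtDev a θ u| ≤ |sqrtDev a θ v| →
      sqrtLevel N a θ u ≤ sqrtLevel N a θ v := by
    intro u v huv
    unfold sqrtLevel
    apply Nat.clog_mono_right
    apply Nat.ceil_mono
    gcongr
  refine ⟨⟨⟨by omega, by omega⟩, ?_⟩, hr⟩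
  cases σ with
  | true =>
    simp only [iff_true] at p4 q4 ⊢
    have hn : 0 < sqrtDev a θ n := by linarith
    refine ⟨?_, hn⟩
    have l1 := hlev n p (by rw [abs_of_pos hn, abs_of_pos p4]; exact d1)
    have l2 := hlev q n (by rw [abs_of_pos hn, abs_of_pos q4]; exact d2)
    omega
  | false =>
    simp only [Bool.false_eq_true, iff_false, not_lt] at p4 q4 ⊢
    have hn : sqrtDev a θ n ≤ 0 := by linarith
    refine ⟨?_, hn⟩
    have l1 := hlev p n (by rw [abs_of_nonpos hn, abs_of_nonpos p4]; linarith)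
    have l2 := hlev n q (by rw [abs_of_nonpos hn, abs_of_nonpos q4]; linarith)
    omega

/-- The phase of the exponential sum, translated by `θ`, as coefficients of a trigonometric
polynomial. -/
noncomputable def sqrtCoeff (a θ : ℝ) (m : ℕ) : ℂ := ee (a * Real.sqrt m + m * θ)

lemma labelSum_sqrtCoeff (S : Finset ℕ) (a θ : ℝ) (lab : ℕ → ℤ) (h : ℤ) (t : ℝ) :
    labelSum S (sqrtCoeff a θ) lab h t =
      ∑ m ∈ S.filter (fun m => lab m = h), ee (a * Real.sqrt m + m * θ + m * t) := by
  unfold labelSum sqrtCoeff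
  refine Finset.sum_congr rfl fun m _ => ?_
  rw [← ee_add]

lemma sqrt_phase_step (a θ t : ℝ) (n : ℕ) :
    (a * Real.sqrt (n + 1 : ℕ) + (n + 1 : ℕ) * θ + (n + 1 : ℕ) * t)
      - (a * Real.sqrt n + n * θ + n * t) = sqrtStep a n + θ + t := by
  unfold sqrtStep; push_cast; ring

/-- Van der Corput's bound for one label. -/
lemma norm_labelSum_le {N : ℕ} {a θ : ℝ} (ha : 0 < a) {M x i : ℕ} (hM : 1 ≤ M) (hx : x ≤ 2 * M)
    (haM : a ≤ M * Real.sqrt M) (σ : Bool) (h : ℤ) (t : ℝ) :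
    ‖labelSum (sqrtClass N a θ M x i σ) (sqrtCoeff a θ) (fun m => round (sqrtStep a m + θ)) h t‖
      ≤ 10 / Real.sqrt (a / (24 * (M * Real.sqrt M))) := by
  have hM0 : (0 : ℝ) < M := by exact_mod_cast hM
  have hs0 : 0 < Real.sqrt M := Real.sqrt_pos.mpr hM0
  have hpos : 0 < M * Real.sqrt M := by positivity
  rw [labelSum_sqrtCoeff]
  refine norm_sum_ee_le_of_steps (f := fun m : ℕ => a * Real.sqrt m + m * θ + m * t)
    (y := h + t - 1 / 2) (by positivity) ?_ (sqrtClass_label_ordConnected ha.le) ?_ ?_ ?_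
  · rw [div_le_one (by positivity)]; linarith
  · intro n hn
    rw [sqrt_phase_step]
    have h1 := (abs_le.mp (abs_sqrtDev_le a θ n)).1
    rw [← (Finset.mem_filter.mp hn).2]
    unfold sqrtDev at h1
    linarith
  · intro n hn
    rw [sqrt_phase_step]
    have h1 := (abs_le.mp (abs_sqrtDev_le a θ n)).2
    rw [← (Finset.mem_filter.mp hn).2]
    unfold sqrtDev at h1
    linarith
  · intro n hn hn1
    rw [sqrt_phase_step, sqrt_phase_step]
    have hn1' := (Finset.mem_filter.mp hn1).1
    simp only [sqrtClass, Finset.mem_filter, Finset.mem_Ico] at hn1'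
    have := sqrtStep_succ_add_le ha hM (m := n) (by omega)
    linarith

/-- Away from the stationary point and for small translations the Kuzmin–Landau inequality is
stronger. -/
lemma norm_labelSum_le_of_small {N : ℕ} (hN : 0 < N) {a θ : ℝ} (ha : 0 < a) {M x i : ℕ}
    (hi : 1 ≤ i) (σ : Bool) (h : ℤ) {t : ℝ} (ht : |t| ≤ 2 ^ i / (4 * N)) :
    ‖labelSum (sqrtClass N a θ M x i σ) (sqrtCoeff a θ) (fun m => round (sqrtStep a m + θ)) h t‖
      ≤ 4 * N / 2 ^ i := by
  have hN' : (0 : ℝ) < N := by exact_mod_cast hN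
  rw [labelSum_sqrtCoeff]
  set D : ℝ := 2 ^ i / (4 * N) with hD
  have hD0 : 0 < D := by positivity
  have e1 : 4 * N / 2 ^ i = 1 / D := by rw [hD, one_div_div]
  rw [e1]
  obtain ⟨t1, t2⟩ := abs_le.mp ht
  have h2D : (2 : ℝ) ^ i / (2 * N) = 2 * D := by rw [hD]; field_simp; norm_num
  have hmem : ∀ n ∈ (sqrtClass N a θ M x i σ).filter (fun m => round (sqrtStep a m + θ) = h),
      2 * D < |sqrtStep a n + θ - h| ∧ |sqrtStep a n + θ - h| ≤ 1 / 2 ∧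
        (0 < sqrtStep a n + θ - h ↔ σ = true) := by
    intro n hn
    obtain ⟨hn1, hn2⟩ := Finset.mem_filter.mp hn
    simp only [sqrtClass, Finset.mem_filter] at hn1
    have b1 := lt_abs_sqrtDev_of_level hN hi hn1.2.1
    have b2 := abs_sqrtDev_le a θ n
    have b3 := hn1.2.2
    unfold sqrtDev at b1 b2 b3
    rw [hn2] at b1 b2 b3
    rw [h2D] at b1
    exact ⟨b1, b2, b3⟩
  have hanti : ∀ n, sqrtStep a (n + 1) ≤ sqrtStep a n := fun n =>
    sqrtStep_antitone ha.le (Nat.le_succ n)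
  cases σ with
  | true =>
    refine norm_sum_ee_le_of_ordConnected (f := fun m : ℕ => a * Real.sqrt m + m * θ + m * t)
      h hD0 (sqrtClass_label_ordConnected ha.le) ?_ ?_ ?_
    · intro n hn
      rw [sqrt_phase_step]
      obtain ⟨c1, c2, c3⟩ := hmem n hn
      have c4 := c3.mpr rfl
      rw [abs_of_pos c4] at c1 c2
      linarith
    · intro n hn
      rw [sqrt_phase_step]
      obtain ⟨c1, c2, c3⟩ := hmem n hn
      have c4 := c3.mpr rfl
      rw [abs_of_pos c4] at c1 c2
      linarith
    · intro n _ _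
      rw [sqrt_phase_step, sqrt_phase_step]
      linarith [hanti n]
  | false =>
    refine norm_sum_ee_le_of_ordConnected (f := fun m : ℕ => a * Real.sqrt m + m * θ + m * t)
      (h - 1) hD0 (sqrtClass_label_ordConnected ha.le) ?_ ?_ ?_
    · intro n hn
      rw [sqrt_phase_step]
      obtain ⟨c1, c2, c3⟩ := hmem n hn
      have c4 : sqrtStep a n + θ - h ≤ 0 := not_lt.mp fun hc => by simpa using c3.mp hc
      rw [abs_of_nonpos c4] at c1 c2
      push_cast
      linarith
    · intro n hn
      rw [sqrt_phase_step]
      obtain ⟨c1, c2, c3⟩ := hmem n hn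
      have c4 : sqrtStep a n + θ - h ≤ 0 := not_lt.mp fun hc => by simpa using c3.mp hc
      rw [abs_of_nonpos c4] at c1 c2
      push_cast
      linarith
    · intro n _ _
      rw [sqrt_phase_step, sqrt_phase_step]
      linarith [hanti n]

lemma integral_one_div_sq_add_sq_le {D : ℝ} (hD : 0 < D) (c : ℝ) :
    ∫ t in c..(c + 1), 1 / (t ^ 2 + D ^ 2) ≤ 4 / D := by
  have hder : ∀ t ∈ Set.uIcc c (c + 1),
      HasDerivAt (fun t => Real.arctan (t / D) / D) (1 / (t ^ 2 + D ^ 2)) t := by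
    intro t _
    have h1 : HasDerivAt (fun t : ℝ => t / D) (1 / D) t := (hasDerivAt_id t).div_const D
    refine (h1.arctan.div_const D).congr_deriv ?_
    field_simp
    ring
  rw [intervalIntegral.integral_eq_sub_of_hasDerivAt hder]
  · rw [← sub_div]
    gcongr
    have h1 := Real.arctan_lt_pi_div_two ((c + 1) / D)
    have h2 := Real.neg_pi_div_two_lt_arctan (c / D)
    linarith [Real.pi_lt_four]
  · refine Continuous.intervalIntegrable ?_ _ _
    refine continuous_const.div (by fun_prop) fun t => by positivity

/-- Fourth moment of one piece against the Fejér kernel. At level `0` van der Corput's bound is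
used; at level `i` the Kuzmin–Landau inequality gains `2 ^ i` for `|t|` small, and the Fejér kernel is
small for the other `t`. -/
lemma integral_fejer_labelSum_le {N : ℕ} (hN : 0 < N) {a θ : ℝ} (ha : 0 < a) {M x i : ℕ}
    (hM : 1 ≤ M) (hx : x ≤ 2 * M) (haM : a ≤ M * Real.sqrt M)
    (hNM : M * Real.sqrt M / a ≤ N ^ 2) (σ : Bool) (h : ℤ) :
    ∫ t in (-1 / 2 : ℝ)..(-1 / 2 + 1), fejer N t * ‖labelSum (sqrtClass N a θ M x i σ)
      (sqrtCoeff a θ) (fun m => round (sqrtStep a m + θ)) h t‖ ^ 4 ≤ 3 * 10 ^ 8 * N ^ 4 / 2 ^ i := by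
  have hM0 : (0 : ℝ) < M := by exact_mod_cast hM
  have hs0 : 0 < Real.sqrt M := Real.sqrt_pos.mpr hM0
  have hN' : (0 : ℝ) < N := by exact_mod_cast hN
  set F : ℝ → ℂ := labelSum (sqrtClass N a θ M x i σ)
      (sqrtCoeff a θ) (fun m => round (sqrtStep a m + θ)) h with hF
  have hFc : Continuous F := continuous_labelSum _ _ _ _
  set A : ℝ := 5760000 * N ^ 4 with hA
  have hA0 : 0 < A := by positivity
  have hFA : ∀ t, ‖F t‖ ^ 4 ≤ A := by
    intro t
    have h1 := norm_labelSum_le (N := N) (θ := θ) (i := i) ha hM hx haM σ h t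
    set l := a / (24 * (M * Real.sqrt M)) with hl
    have hl0 : 0 < l := by positivity
    have h2 : ‖F t‖ ^ 4 ≤ (10 / Real.sqrt l) ^ 4 := by gcongr
    have h3 : (10 / Real.sqrt l) ^ 4 = 10000 * (1 / l) ^ 2 := by
      rw [div_pow, show Real.sqrt l ^ 4 = (Real.sqrt l ^ 2) ^ 2 by ring, Real.sq_sqrt hl0.le]
      field_simp; norm_num
    have h4 : 1 / l ≤ 24 * N ^ 2 := by
      have : 1 / l = 24 * (M * Real.sqrt M / a) := by rw [hl]; field_simp
      rw [this]; linarith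
    have h5 : (1 / l) ^ 2 ≤ (24 * N ^ 2) ^ 2 := by gcongr
    rw [hA]
    calc _ ≤ _ := h2
      _ = 10000 * (1 / l) ^ 2 := h3
      _ ≤ 10000 * (24 * N ^ 2) ^ 2 := by gcongr
      _ = _ := by ring
  have hint : ∀ f : ℝ → ℝ, Continuous f → IntervalIntegrable f volume (-1 / 2) (-1 / 2 + 1) :=
    fun f hf => hf.intervalIntegrable _ _
  rcases Nat.eq_zero_or_pos i with rfl | hi
  · calc _ ≤ ∫ t in (-1 / 2 : ℝ)..(-1 / 2 + 1), fejer N t * A := by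
          refine intervalIntegral.integral_mono_on (by norm_num) (hint _ (by fun_prop))
            (hint _ (by fun_prop)) fun t _ => ?_
          exact mul_le_mul_of_nonneg_left (hFA t) (fejer_nonneg N t)
      _ = A := by rw [intervalIntegral.integral_mul_const, integral_fejer hN, one_mul]
      _ ≤ _ := by
          rw [hA, pow_zero, div_one]
          have : (0 : ℝ) < (N : ℝ) ^ 4 := by positivity
          nlinarith
  · set D : ℝ := 2 ^ i / (2 * N) with hD
    have hD0 : 0 < D := by positivity
    have hpt : ∀ t ∈ Set.Icc (-1 / 2 : ℝ) (-1 / 2 + 1), fejer N t * ‖F t‖ ^ 4 ≤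
        fejer N t * (256 * N ^ 4 / 2 ^ i) + (5 * A / N) * (1 / (t ^ 2 + D ^ 2)) := by
      intro t ht
      have hfn := fejer_nonneg N t
      rcases le_or_gt |t| (2 ^ i / (4 * N)) with h1 | h1
      · have h2 := norm_labelSum_le_of_small (M := M) (x := x) (θ := θ) hN ha hi σ h h1
        have h3 : ‖F t‖ ^ 4 ≤ 256 * N ^ 4 / 2 ^ i := by
          calc ‖F t‖ ^ 4 ≤ (4 * (N : ℝ) / 2 ^ i) ^ 4 := by gcongr
            _ = 256 * (N : ℝ) ^ 4 / (2 ^ i) ^ 4 := by rw [div_pow]; ring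
            _ ≤ 256 * (N : ℝ) ^ 4 / 2 ^ i := by
                gcongr
                exact le_self_pow₀ (one_le_pow₀ (by norm_num)) (by norm_num)
        have h4 := mul_le_mul_of_nonneg_left h3 hfn
        have h5 : 0 ≤ (5 * A / N) * (1 / (t ^ 2 + D ^ 2)) := by positivity
        linarith
      · have ht0 : t ≠ 0 := by
          intro h0
          rw [h0, abs_zero] at h1
          exact absurd h1 (not_lt.mpr (by positivity))
        have htt : |t| ≤ 1 / 2 := abs_le.mpr ⟨by linarith [ht.1], by linarith [ht.2]⟩
        have h2 := fejer_le (N := N) ht0 htt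
        have hDt : D ^ 2 ≤ 4 * t ^ 2 := by
          have : D ≤ 2 * |t| := by
            have : D = 2 * (2 ^ i / (4 * N)) := by rw [hD]; field_simp; norm_num
            linarith
          calc D ^ 2 ≤ (2 * |t|) ^ 2 := by gcongr
            _ = 4 * t ^ 2 := by rw [mul_pow, sq_abs]; norm_num
        have h3 : 1 / (N * t ^ 2) ≤ 5 / N * (1 / (t ^ 2 + D ^ 2)) := by
          rw [div_mul_div_comm, mul_one, div_le_div_iff₀ (by positivity) (by positivity)]
          nlinarith
        have h4 : fejer N t * ‖F t‖ ^ 4 ≤ (5 / N * (1 / (t ^ 2 + D ^ 2))) * A :=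
          mul_le_mul (h2.trans h3) (hFA t) (by positivity) (by positivity)
        have h5 : 0 ≤ fejer N t * (256 * N ^ 4 / 2 ^ i) := by positivity
        have h6 : (5 / N * (1 / (t ^ 2 + D ^ 2))) * A = (5 * A / N) * (1 / (t ^ 2 + D ^ 2)) := by
          ring
        linarith
    have hc2 : Continuous fun t : ℝ => 1 / (t ^ 2 + D ^ 2) :=
      continuous_const.div (by fun_prop) fun t => by positivity
    calc _ ≤ ∫ t in (-1 / 2 : ℝ)..(-1 / 2 + 1), (fejer N t * (256 * N ^ 4 / 2 ^ i)
            + (5 * A / N) * (1 / (t ^ 2 + D ^ 2))) :=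
          intervalIntegral.integral_mono_on (by norm_num) (hint _ (by fun_prop))
            (hint _ (by fun_prop)) hpt
      _ = 256 * N ^ 4 / 2 ^ i + (5 * A / N) *
            ∫ t in (-1 / 2 : ℝ)..(-1 / 2 + 1), 1 / (t ^ 2 + D ^ 2) := by
          rw [intervalIntegral.integral_add (hint _ (by fun_prop)) (hint _ (by fun_prop)),
            intervalIntegral.integral_mul_const, integral_fejer hN, one_mul,
            intervalIntegral.integral_const_mul]
      _ ≤ 256 * N ^ 4 / 2 ^ i + (5 * A / N) * (4 / D) := by
          gcongr
          exact integral_one_div_sq_add_sq_le hD0 _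
      _ = (256 + 40 * 5760000) * N ^ 4 / 2 ^ i := by
          rw [hA, hD]; field_simp; ring
      _ ≤ _ := by gcongr; norm_num

/-- Frequencies `m₁ + m₂ - m₃ - m₄` below `N` force a near-coincidence of inverse squares of the
labels. -/
lemma mem_nearSet_of_close {N : ℕ} (hN : 0 < N) {a P θ : ℝ} (hP : 2 ≤ P) {M i : ℕ}
    (hM : 1 ≤ M) (haP : a = 4 * P * Real.sqrt M) (hNM : M * Real.sqrt M / a ≤ N ^ 2)
    {x : ℕ} (hx : x ≤ 2 * M) {σ : Bool} {m1 m2 m3 m4 : ℕ}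
    (h1 : m1 ∈ sqrtClass N a θ M x i σ) (h2 : m2 ∈ sqrtClass N a θ M x i σ)
    (h3 : m3 ∈ sqrtClass N a θ M x i σ) (h4 : m4 ∈ sqrtClass N a θ M x i σ)
    (hc : |(m1 : ℤ) + m2 - m3 - m4| < N) :
    θ ∈ nearSet P (600 * (2 ^ i * N) / a ^ 2) (round (sqrtStep a m1 + θ),
      round (sqrtStep a m2 + θ), round (sqrtStep a m3 + θ), round (sqrtStep a m4 + θ)) := by
  have hM0 : (0 : ℝ) < M := by exact_mod_cast hM
  have hs0 : 0 < Real.sqrt M := Real.sqrt_pos.mpr hM0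
  have hN' : (1 : ℝ) ≤ N := by exact_mod_cast hN
  have hP0 : 0 < P := by linarith
  have ha : 0 < a := by rw [haP]; positivity
  have hss := Real.mul_self_sqrt hM0.le
  have hw : a ^ 2 / P ^ 3 ≤ 64 * N ^ 2 := by
    have : a ^ 2 / P ^ 3 = 64 * (M * Real.sqrt M / a) := by
      rw [haP]; field_simp; norm_num
    rw [this]; linarith
  have hpt : ∀ m ∈ sqrtClass N a θ M x i σ,
      P ≤ round (sqrtStep a m + θ) - θ ∧ round (sqrtStep a m + θ) - θ ≤ 3 * P ∧
        |(m : ℝ) - a ^ 2 / 4 * (1 / ((round (sqrtStep a m + θ) : ℝ) - θ) ^ 2)|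
          ≤ (1 + 32 * (2 ^ i * (N : ℝ)) : ℝ) := by
    intro m hm
    simp only [sqrtClass, Finset.mem_filter, Finset.mem_Ico] at hm
    obtain ⟨⟨hm1, hm2⟩, hm3, -⟩ := hm
    obtain ⟨g1, g2⟩ := sqrtStep_mem haP hP0 hM hm1 (by omega)
    have d1 := abs_sqrtDev_le a θ m
    have d2 := abs_sqrtDev_le_of_level hN hm3
    have d3 := abs_sub_sq_div_sqrtStep_le ha m
    set g := sqrtStep a m with hg
    set u := (round (g + θ) : ℝ) - θ with hu
    have hd : sqrtDev a θ m = g - u := by unfold sqrtDev; rw [hu]; ring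
    rw [hd] at d1 d2
    obtain ⟨d1a, d1b⟩ := abs_le.mp d1
    have hu1 : P ≤ u := by linarith
    have hg1 : P ≤ g := by linarith
    refine ⟨hu1, by linarith, ?_⟩
    have hu0 : 0 < u := by linarith
    have hg0 : 0 < g := by linarith
    have e1 : 1 / g ^ 2 - 1 / u ^ 2 = (u - g) * (1 / (g ^ 2 * u) + 1 / (g * u ^ 2)) := by
      field_simp; ring
    have e2 : 1 / (g ^ 2 * u) + 1 / (g * u ^ 2) ≤ 2 / P ^ 3 := by
      have b1 : 1 / (g ^ 2 * u) ≤ 1 / P ^ 3 := by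
        apply one_div_le_one_div_of_le (by positivity)
        calc P ^ 3 = P ^ 2 * P := by ring
          _ ≤ g ^ 2 * u := by gcongr
      have b2 : 1 / (g * u ^ 2) ≤ 1 / P ^ 3 := by
        apply one_div_le_one_div_of_le (by positivity)
        calc P ^ 3 = P * P ^ 2 := by ring
          _ ≤ g * u ^ 2 := by gcongr
      have : 2 / P ^ 3 = 1 / P ^ 3 + 1 / P ^ 3 := by ring
      linarith
    have e3 : |a ^ 2 / 4 * (1 / g ^ 2) - a ^ 2 / 4 * (1 / u ^ 2)| ≤ (32 * (2 ^ i * (N : ℝ)) : ℝ) := by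
      rw [← mul_sub, e1, abs_mul, abs_mul, abs_of_pos (show (0 : ℝ) < a ^ 2 / 4 by positivity),
        abs_of_pos (show 0 < 1 / (g ^ 2 * u) + 1 / (g * u ^ 2) by positivity), abs_sub_comm]
      calc a ^ 2 / 4 * (|g - u| * (1 / (g ^ 2 * u) + 1 / (g * u ^ 2)))
          ≤ a ^ 2 / 4 * ((2 ^ i / N) * (2 / P ^ 3)) := by gcongr
        _ = (a ^ 2 / P ^ 3) * (2 ^ i / N / 2) := by ring
        _ ≤ (64 * N ^ 2) * (2 ^ i / N / 2) := by gcongr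
        _ = 32 * (2 ^ i * N) := by field_simp; norm_num
    have e4 : (m : ℝ) - a ^ 2 / 4 * (1 / u ^ 2) = ((m : ℝ) - a ^ 2 / 4 * (1 / g ^ 2))
      + (a ^ 2 / 4 * (1 / g ^ 2) - a ^ 2 / 4 * (1 / u ^ 2)) := by ring
    rw [e4]
    exact (abs_add_le _ _).trans (add_le_add d3 e3)
  obtain ⟨a1, a2, a3⟩ := hpt m1 h1
  obtain ⟨b1, b2, b3⟩ := hpt m2 h2
  obtain ⟨c1, c2, c3⟩ := hpt m3 h3
  obtain ⟨d1, d2, d3⟩ := hpt m4 h4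
  refine ⟨⟨a1, a2⟩, ⟨b1, b2⟩, ⟨c1, c2⟩, ⟨d1, d2⟩, ?_⟩
  simp only
  set v1 := 1 / ((round (sqrtStep a m1 + θ) : ℝ) - θ) ^ 2
  set v2 := 1 / ((round (sqrtStep a m2 + θ) : ℝ) - θ) ^ 2
  set v3 := 1 / ((round (sqrtStep a m3 + θ) : ℝ) - θ) ^ 2
  set v4 := 1 / ((round (sqrtStep a m4 + θ) : ℝ) - θ) ^ 2
  have hcR : |(m1 : ℝ) + m2 - m3 - m4| ≤ N := by exact_mod_cast hc.le
  have h2i : (1 : ℝ) ≤ 2 ^ i := one_le_pow₀ (by norm_num)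
  have hNi : (N : ℝ) ≤ 2 ^ i * N := by nlinarith
  have hmain : |a ^ 2 / 4 * (v1 + v2 - v3 - v4)| ≤ (150 * (2 ^ i * (N : ℝ)) : ℝ) := by
    rw [abs_le] at a3 b3 c3 d3 hcR ⊢
    constructor <;> linarith
  rw [abs_mul, abs_of_pos (show (0 : ℝ) < a ^ 2 / 4 by positivity)] at hmain
  rw [le_div_iff₀ (by positivity)]
  linarith

/-- The exponential sum with phase `a √m`, as a trigonometric polynomial in `θ`. -/
noncomputable def sqrtSum (a : ℝ) (M x : ℕ) (θ : ℝ) : ℂ :=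
  ∑ m ∈ Finset.Ico M x, ee (a * Real.sqrt m + m * θ)

@[fun_prop]
lemma continuous_sqrtSum (a : ℝ) (M x : ℕ) : Continuous (sqrtSum a M x) := by
  unfold sqrtSum; fun_prop

lemma pow_four_sum_le {ι : Type*} (s : Finset ι) (f : ι → ℝ) :
    (∑ i ∈ s, f i) ^ 4 ≤ (s.card : ℝ) ^ 3 * ∑ i ∈ s, f i ^ 4 := by
  have h1 := sq_sum_le_card_mul_sum_sq (s := s) (f := f)
  have h2 := sq_sum_le_card_mul_sum_sq (s := s) (f := fun i => f i ^ 2)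
  calc (∑ i ∈ s, f i) ^ 4 = ((∑ i ∈ s, f i) ^ 2) ^ 2 := by ring
    _ ≤ (s.card * ∑ i ∈ s, f i ^ 2) ^ 2 := by gcongr
    _ = (s.card : ℝ) ^ 2 * (∑ i ∈ s, f i ^ 2) ^ 2 := by ring
    _ ≤ (s.card : ℝ) ^ 2 * (s.card * ∑ i ∈ s, (f i ^ 2) ^ 2) := by gcongr
    _ = (s.card : ℝ) ^ 3 * ∑ i ∈ s, f i ^ 4 := by
        simp only [← pow_mul]; ring

lemma sqrtLevel_le (N : ℕ) (a θ : ℝ) (m : ℕ) : sqrtLevel N a θ m ≤ Nat.clog 2 N := by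
  unfold sqrtLevel
  apply Nat.clog_mono_right
  rw [Nat.ceil_le]
  have := abs_sqrtDev_le a θ m
  have hN : (0 : ℝ) ≤ N := by positivity
  nlinarith

open Classical in
/-- The fourth moment localised at `θ`, in terms of the near-coincidence sets. -/
lemma integral_fejer_sqrtSum_le {N : ℕ} (hN : 0 < N) {a P : ℝ} (hP : 2 ≤ P) {M x : ℕ}
    (hM : 1 ≤ M) (hx : x ≤ 2 * M) (haP : a = 4 * P * Real.sqrt M) (haM : a ≤ M * Real.sqrt M)
    (hNM : M * Real.sqrt M / a ≤ N ^ 2) {θ : ℝ} (hθ : θ ∈ Set.Icc (0 : ℝ) 1) (H : Finset ℤ)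
    (hH : H = Finset.Icc 0 ⌈3 * P + 1⌉) :
    ∫ t in (-1 / 2 : ℝ)..(-1 / 2 + 1), fejer N t * ‖sqrtSum a M x (θ + t)‖ ^ 4
      ≤ (2 * (Nat.clog 2 N + 1 : ℕ)) ^ 3 * ∑ i ∈ Finset.range (Nat.clog 2 N + 1),
        2 * ((3 * 10 ^ 8 * N ^ 4 / 2 ^ i) * ∑ h ∈ H ×ˢ H ×ˢ H ×ˢ H,
          (nearSet P (600 * (2 ^ i * N) / a ^ 2) h).indicator (fun _ => (1 : ℝ)) θ) := by
  have hP0 : 0 < P := by linarith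
  have hM0 : (0 : ℝ) < M := by exact_mod_cast hM
  have ha : 0 < a := by rw [haP]; positivity
  set I := Nat.clog 2 N + 1 with hI
  set Q : Finset (ℕ × Bool) := Finset.range I ×ˢ Finset.univ with hQ
  have hQc : Q.card = 2 * I := by simp [hQ, mul_comm]
  set F : ℕ × Bool → ℝ → ℂ := fun c t =>
    ∑ m ∈ sqrtClass N a θ M x c.1 c.2, sqrtCoeff a θ m * ee (m * t) with hF
  have hFc : ∀ c, Continuous (F c) := fun c => by simp only [hF]; fun_prop
  have hsplit : ∀ t, sqrtSum a M x (θ + t) = ∑ c ∈ Q, F c t := by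
    intro t
    have h1 : sqrtSum a M x (θ + t) =
        ∑ m ∈ Finset.Ico M x, sqrtCoeff a θ m * ee (m * t) := by
      unfold sqrtSum sqrtCoeff
      refine Finset.sum_congr rfl fun m _ => ?_
      rw [← ee_add]; congr 1; ring
    rw [h1, ← Finset.sum_fiberwise_of_maps_to (t := Q)
      (g := fun m => (sqrtLevel N a θ m, decide (0 < sqrtDev a θ m)))]
    · refine Finset.sum_congr rfl fun c _ => ?_
      simp only [hF]
      refine Finset.sum_congr ?_ fun _ _ => rfl
      ext m
      simp only [sqrtClass, Finset.mem_filter, Prod.ext_iff]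
      have : (decide (0 < sqrtDev a θ m) = c.2) ↔ (0 < sqrtDev a θ m ↔ c.2 = true) := by
        cases c.2 <;> simp
      rw [this]
    · intro m _
      simp only [hQ, Finset.mem_product, Finset.mem_range, Finset.mem_univ, and_true, hI]
      exact Nat.lt_succ_of_le (sqrtLevel_le N a θ m)
  have hint : ∀ c, IntervalIntegrable (fun t => fejer N t * ‖F c t‖ ^ 4) volume (-1 / 2)
      (-1 / 2 + 1) := fun c =>
    ((continuous_fejer N).mul ((hFc c).norm.pow 4)).intervalIntegrable _ _
  have hclass : ∀ c : ℕ × Bool, ∫ t in (-1 / 2 : ℝ)..(-1 / 2 + 1), fejer N t * ‖F c t‖ ^ 4 ≤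
      (3 * 10 ^ 8 * N ^ 4 / 2 ^ c.1) * ∑ h ∈ H ×ˢ H ×ˢ H ×ˢ H,
          (nearSet P (600 * (2 ^ c.1 * N) / a ^ 2) h).indicator (fun _ => (1 : ℝ)) θ := by
    intro c
    have h1 := integral_fejer_mul_norm_pow_four_le (N := N) (S := sqrtClass N a θ M x c.1 c.2)
      (b := sqrtCoeff a θ) (lab := fun m => round (sqrtStep a m + θ)) (H := H)
      (G := 3 * 10 ^ 8 * N ^ 4 / 2 ^ c.1) ?_ (-1 / 2)
      (fun h _ => integral_fejer_labelSum_le hN ha hM hx haM hNM c.2 h)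
      (fun h => θ ∈ nearSet P (600 * (2 ^ c.1 * N) / a ^ 2) h)
      (fun m1 hm1 m2 hm2 m3 hm3 m4 hm4 hc =>
        mem_nearSet_of_close hN hP hM haP hNM hx hm1 hm2 hm3 hm4 hc)
    · refine h1.trans (le_of_eq ?_)
      rw [Finset.mul_sum]
      refine Finset.sum_congr rfl fun h _ => ?_
      rw [Set.indicator_apply]
      split_ifs <;> simp
    · intro m hm
      rw [hH, Finset.mem_Icc]
      simp only [sqrtClass, Finset.mem_filter, Finset.mem_Ico] at hm
      obtain ⟨g1, g2⟩ := sqrtStep_mem haP hP0 hM hm.1.1 (by omega)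
      obtain ⟨d1, d2⟩ := abs_le.mp (abs_sqrtDev_le a θ m)
      unfold sqrtDev at d1 d2
      constructor
      · have : (0 : ℝ) ≤ round (sqrtStep a m + θ) := by linarith [hθ.1]
        exact_mod_cast this
      · have : (round (sqrtStep a m + θ) : ℝ) ≤ ⌈3 * P + 1⌉ :=
          le_trans (by linarith [hθ.2]) (Int.le_ceil _)
        exact_mod_cast this
  calc _ ≤ ∫ t in (-1 / 2 : ℝ)..(-1 / 2 + 1),
        ((2 * I : ℕ) : ℝ) ^ 3 * ∑ c ∈ Q, fejer N t * ‖F c t‖ ^ 4 := by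
        refine intervalIntegral.integral_mono_on (by norm_num)
          (Continuous.intervalIntegrable (by fun_prop) _ _)
          (Continuous.intervalIntegrable ?_ _ _) fun t _ => ?_
        · exact continuous_const.mul (continuous_finsetSum _ fun c _ =>
            (continuous_fejer N).mul ((hFc c).norm.pow 4))
        · rw [← Finset.mul_sum, mul_left_comm]
          refine mul_le_mul_of_nonneg_left ?_ (fejer_nonneg N t)
          rw [hsplit, ← hQc]
          refine le_trans ?_ (pow_four_sum_le Q fun c => ‖F c t‖)
          gcongr
          exact norm_sum_le _ _
    _ = ((2 * I : ℕ) : ℝ) ^ 3 * ∑ c ∈ Q, ∫ t in (-1 / 2 : ℝ)..(-1 / 2 + 1),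
          fejer N t * ‖F c t‖ ^ 4 := by
        rw [intervalIntegral.integral_const_mul, intervalIntegral.integral_finsetSum
          fun c _ => hint c]
    _ ≤ ((2 * I : ℕ) : ℝ) ^ 3 * ∑ c ∈ Q, (3 * 10 ^ 8 * N ^ 4 / 2 ^ c.1) *
          ∑ h ∈ H ×ˢ H ×ˢ H ×ˢ H,
          (nearSet P (600 * (2 ^ c.1 * N) / a ^ 2) h).indicator (fun _ => (1 : ℝ)) θ := by
        gcongr with c _
        exact hclass c
    _ = _ := by
        rw [hQ, Finset.sum_product]
        simp only [Finset.sum_const, Finset.card_univ, Fintype.card_bool, nsmul_eq_mul]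
        push_cast
        rfl

lemma measurableSet_nearSet (P η : ℝ) (h : ℤ × ℤ × ℤ × ℤ) : MeasurableSet (nearSet P η h) := by
  unfold nearSet
  measurability

lemma sqrtSum_periodic (a : ℝ) (M x : ℕ) : Function.Periodic (sqrtSum a M x) 1 := by
  intro θ
  unfold sqrtSum
  refine Finset.sum_congr rfl fun m _ => ?_
  have := ee_add_int (a * Real.sqrt m + m * θ) m
  rw [← this]; congr 1; push_cast; ring

lemma intervalIntegrable_fun_sum {ι : Type*} (s : Finset ι) {f : ι → ℝ → ℝ} {a b : ℝ}
    (h : ∀ i ∈ s, IntervalIntegrable (f i) volume a b) :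
    IntervalIntegrable (fun x => ∑ i ∈ s, f i x) volume a b := by
  have e : (fun x => ∑ i ∈ s, f i x) = ∑ i ∈ s, f i := by ext x; simp
  rw [e]
  exact IntervalIntegrable.sum s h

set_option maxHeartbeats 1000000 in
/-- Fourth moment of the exponential sum with phase `a √m` over a part of a dyadic block. -/
theorem integral_norm_sqrtSum_pow_four_le {a : ℝ} {M x : ℕ} (hM : 1 ≤ M) (hx : x ≤ 2 * M)
    (haM : a ≤ M * Real.sqrt M) (hMa : 8 * Real.sqrt M ≤ a) :
    ∫ θ in (0 : ℝ)..1, ‖sqrtSum a M x θ‖ ^ 4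
      ≤ 10 ^ 22 * (Nat.clog 2 (2 * M) + 1) ^ 4 * (M ^ 2 + a ^ (3 / 2 : ℝ) * M ^ (3 / 4 : ℝ)) := by
  have hM0 : (0 : ℝ) < M := by exact_mod_cast hM
  have hM1 : (1 : ℝ) ≤ M := by exact_mod_cast hM
  set s := Real.sqrt M with hs
  have hs0 : 0 < s := Real.sqrt_pos.mpr hM0
  have hss : s ^ 2 = M := Real.sq_sqrt hM0.le
  have ha : 0 < a := lt_of_lt_of_le (by positivity) hMa
  -- `P` is the size of the increments. The number `N ≈ (M ^ (3/2) / a) ^ (1/2)` is the length scale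
  -- on which the phase is stationary near an integer increment.
  set P := a / (4 * s) with hP
  have haP : a = 4 * P * s := by rw [hP]; field_simp
  have hP2 : 2 ≤ P := by rw [hP, le_div_iff₀ (by positivity)]; linarith
  have hP0 : 0 < P := by linarith
  set w := M * s / a with hw
  have hw1 : 1 ≤ w := by rw [hw, le_div_iff₀ ha]; linarith
  have hw0 : 0 < w := by linarith
  have hwP : w = M / (4 * P) := by rw [hw, haP]; field_simp
  set r := Real.sqrt w with hr
  have hr1 : 1 ≤ r := Real.one_le_sqrt.mpr hw1
  have hrr : r ^ 2 = w := Real.sq_sqrt hw0.le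
  set N := ⌈r⌉₊ with hNdef
  have hNr : r ≤ N := Nat.le_ceil r
  have hN2 : (N : ℝ) ≤ 2 * r := by
    have := Nat.ceil_lt_add_one (show 0 ≤ r by linarith)
    linarith
  have hN : 0 < N := Nat.ceil_pos.mpr (by linarith)
  have hN0 : (0 : ℝ) < N := by exact_mod_cast hN
  have hNM : M * s / a ≤ (N : ℝ) ^ 2 := by
    rw [← hw, ← hrr]; gcongr
  set H : Finset ℤ := Finset.Icc 0 ⌈3 * P + 1⌉ with hH
  set I := Nat.clog 2 N + 1 with hI
  have hI0 : (1 : ℝ) ≤ I := by rw [hI]; push_cast; linarith [Nat.cast_nonneg (α := ℝ) (Nat.clog 2 N)]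
  -- the levels that occur are at most `log N`
  have h2i : ∀ i ∈ Finset.range I, (2 : ℝ) ^ i ≤ 2 * N := by
    intro i hi
    rw [Finset.mem_range, hI, Nat.lt_succ_iff] at hi
    have h1 : 2 ^ i ≤ 2 * N := by
      refine (Nat.pow_le_pow_right (by norm_num) hi).trans ?_
      rcases Nat.lt_or_ge 1 N with h | h
      · have := Nat.pow_pred_clog_lt_self one_lt_two h
        have hc : 0 < Nat.clog 2 N := Nat.clog_pos one_lt_two h
        obtain ⟨j, hj⟩ : ∃ j, Nat.clog 2 N = j + 1 := ⟨Nat.clog 2 N - 1, by omega⟩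
        rw [hj, Nat.pred_succ] at this
        rw [hj, pow_succ]; omega
      · have : N = 1 := by omega
        rw [this]; simp
    exact_mod_cast h1
  have hper : Function.Periodic (fun θ => ‖sqrtSum a M x θ‖ ^ 4) 1 := fun θ => by
    simp only [sqrtSum_periodic a M x θ]
  rw [integral_eq_integral_fejer_translates hN (by fun_prop) hper (-1 / 2)]
  have hindint : ∀ (η : ℝ) (h : ℤ × ℤ × ℤ × ℤ), IntervalIntegrable
      ((nearSet P η h).indicator (fun _ => (1 : ℝ))) volume 0 1 := by
    intro η h
    rw [intervalIntegrable_iff_integrableOn_Ioc_of_le zero_le_one]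
    exact (integrableOn_const (by simp)).indicator (measurableSet_nearSet P η h)
  have hind : ∀ (η : ℝ) (h : ℤ × ℤ × ℤ × ℤ),
      ∫ θ in (0 : ℝ)..1, (nearSet P η h).indicator (fun _ => (1 : ℝ)) θ
        = volume.real (nearSet P η h ∩ Set.Ioc 0 1) := by
    intro η h
    rw [intervalIntegral.integral_of_le zero_le_one, integral_indicator (measurableSet_nearSet P η h),
      Measure.restrict_restrict (measurableSet_nearSet P η h)]
    simp
  have hsumint : ∀ i, IntervalIntegrable (fun θ => ∑ h ∈ H ×ˢ H ×ˢ H ×ˢ H,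
      (nearSet P (600 * (2 ^ i * N) / a ^ 2) h).indicator (fun _ => (1 : ℝ)) θ) volume 0 1 :=
    fun i => intervalIntegrable_fun_sum _ fun h _ => hindint _ h
  calc _ ≤ ∫ θ in (0 : ℝ)..1, (2 * (I : ℝ)) ^ 3 * ∑ i ∈ Finset.range I,
        2 * ((3 * 10 ^ 8 * N ^ 4 / 2 ^ i) * ∑ h ∈ H ×ˢ H ×ˢ H ×ˢ H,
          (nearSet P (600 * (2 ^ i * N) / a ^ 2) h).indicator (fun _ => (1 : ℝ)) θ) := by
        refine intervalIntegral.integral_mono_on zero_le_one ?_ ?_ fun θ hθ =>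
          integral_fejer_sqrtSum_le hN hP2 hM hx haP haM hNM hθ H hH
        · apply Continuous.intervalIntegrable
          apply intervalIntegral.continuous_parametric_intervalIntegral_of_continuous'
          fun_prop
        · exact (intervalIntegrable_fun_sum _ fun i _ =>
            ((hsumint i).const_mul _).const_mul _).const_mul _
    _ = (2 * (I : ℝ)) ^ 3 * ∑ i ∈ Finset.range I, 2 * ((3 * 10 ^ 8 * N ^ 4 / 2 ^ i) *
          ∑ h ∈ H ×ˢ H ×ˢ H ×ˢ H,
            volume.real (nearSet P (600 * (2 ^ i * N) / a ^ 2) h ∩ Set.Ioc 0 1)) := by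
        rw [intervalIntegral.integral_const_mul, intervalIntegral.integral_finsetSum
          fun i _ => ((hsumint i).const_mul _).const_mul _]
        congr 1
        refine Finset.sum_congr rfl fun i _ => ?_
        rw [intervalIntegral.integral_const_mul, intervalIntegral.integral_const_mul,
          intervalIntegral.integral_finsetSum fun h _ => hindint _ h]
        simp only [hind]
    _ ≤ (2 * (I : ℝ)) ^ 3 * ∑ i ∈ Finset.range I, 2 * ((3 * 10 ^ 8 * N ^ 4 / 2 ^ i) *
          (4 * 10 ^ 10 * (P ^ 2 + (600 * (2 ^ i * N) / a ^ 2) * P ^ 6))) := by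
        gcongr with i hi
        refine sum_volume_nearSet_le (by linarith) (by positivity) ?_ H
        have e : 600 * (2 ^ i * N) / a ^ 2 * P ^ 3 = 75 / 8 * (2 ^ i * N) / w := by
          rw [hwP, haP, ← hss]; field_simp; norm_num
        rw [e, div_le_iff₀ hw0]
        have : (2 : ℝ) ^ i * N ≤ (2 * (2 * r)) * (2 * r) := by
          have := h2i i hi
          gcongr
          linarith
        linarith
    _ ≤ (2 * (I : ℝ)) ^ 3 * ∑ i ∈ Finset.range I, 2 * (3 * 10 ^ 8 *
          (4 * 10 ^ 10 * (M ^ 2 + 5 * (a ^ (3 / 2 : ℝ) * M ^ (3 / 4 : ℝ))))) := by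
        refine mul_le_mul_of_nonneg_left (Finset.sum_le_sum fun i hi =>
          mul_le_mul_of_nonneg_left ?_ (by norm_num)) (by positivity)
        have e1 : (3 * 10 ^ 8 * N ^ 4 / 2 ^ i) *
            (4 * 10 ^ 10 * (P ^ 2 + (600 * (2 ^ i * N) / a ^ 2) * P ^ 6))
            = 3 * 10 ^ 8 * (4 * 10 ^ 10 * (N ^ 4 * P ^ 2 / 2 ^ i
              + 600 * (N ^ 5 * P ^ 6 / a ^ 2))) := by
          field_simp
        rw [e1]
        have hNr4 : (N : ℝ) ^ 4 ≤ 16 * w ^ 2 := by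
          calc (N : ℝ) ^ 4 ≤ (2 * r) ^ 4 := by gcongr
            _ = 16 * (r ^ 2) ^ 2 := by ring
            _ = 16 * w ^ 2 := by rw [hrr]
        have hNr5 : (N : ℝ) ^ 5 ≤ 32 * r ^ 5 := by
          calc (N : ℝ) ^ 5 ≤ (2 * r) ^ 5 := by gcongr
            _ = 32 * r ^ 5 := by ring
        have f1 : (N : ℝ) ^ 4 * P ^ 2 / 2 ^ i ≤ M ^ 2 := by
          calc (N : ℝ) ^ 4 * P ^ 2 / 2 ^ i ≤ (N : ℝ) ^ 4 * P ^ 2 :=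
                div_le_self (by positivity) (one_le_pow₀ (by norm_num))
            _ ≤ 16 * w ^ 2 * P ^ 2 := by gcongr
            _ = M ^ 2 := by rw [hwP]; field_simp; norm_num
        have f2 : 600 * ((N : ℝ) ^ 5 * P ^ 6 / a ^ 2) ≤ 5 * (a ^ (3 / 2 : ℝ) * M ^ (3 / 4 : ℝ)) := by
          have g1 : 32 * r ^ 5 * P ^ 6 / a ^ 2 = r ^ 3 * P ^ 3 / 2 := by
            have : a ^ 2 = 64 * P ^ 3 * r ^ 2 := by
              rw [hrr, hwP, haP, mul_pow, hss]; field_simp; norm_num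
            rw [this]; field_simp; norm_num
          have g2 : a ^ (3 / 2 : ℝ) * (M : ℝ) ^ (3 / 4 : ℝ) = 64 * (r ^ 3 * P ^ 3) := by
            have h1 : r * P = (a * s) ^ (1 / 2 : ℝ) / 4 := by
              rw [← Real.sqrt_eq_rpow, eq_div_iff (by norm_num), eq_comm, Real.sqrt_eq_iff_mul_self_eq
                (by positivity) (by positivity)]
              have : w * P = M / 4 := by rw [hwP]; field_simp
              symm
              calc r * P * 4 * (r * P * 4) = 16 * (r ^ 2 * P) * P := by ring
                _ = 16 * (M / 4) * P := by rw [hrr, this]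
                _ = a * s := by rw [haP, ← hss]; ring
            have h2 : r ^ 3 * P ^ 3 = (r * P) ^ 3 := by ring
            rw [h2, h1, div_pow, ← Real.rpow_natCast, ← Real.rpow_mul (by positivity),
              Real.mul_rpow ha.le hs0.le]
            have h3 : s ^ (3 / 2 : ℝ) = (M : ℝ) ^ (3 / 4 : ℝ) := by
              rw [hs, Real.sqrt_eq_rpow, ← Real.rpow_mul hM0.le]; norm_num
            norm_num
            norm_num at h3
            rw [h3]; ring
          calc 600 * ((N : ℝ) ^ 5 * P ^ 6 / a ^ 2) ≤ 600 * (32 * r ^ 5 * P ^ 6 / a ^ 2) := by gcongr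
            _ = 300 * (r ^ 3 * P ^ 3) := by rw [g1]; ring
            _ ≤ 5 * (64 * (r ^ 3 * P ^ 3)) := by
                have : 0 < r ^ 3 * P ^ 3 := by positivity
                linarith
            _ = _ := by rw [g2]
        gcongr
    _ ≤ _ := by
        rw [Finset.sum_const, Finset.card_range, nsmul_eq_mul]
        have hIM : (I : ℝ) ≤ Nat.clog 2 (2 * M) + 1 := by
          have hNM2 : N ≤ 2 * M := by
            have h1 : (N : ℝ) ≤ 2 * M := by
              have : r ≤ M := by
                have : w ≤ M ^ 2 := by
                  rw [hwP]
                  calc (M : ℝ) / (4 * P) ≤ M := div_le_self hM0.le (by linarith)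
                    _ ≤ M ^ 2 := by nlinarith
                calc r ≤ Real.sqrt (M ^ 2) := Real.sqrt_le_sqrt this
                  _ = M := Real.sqrt_sq hM0.le
              linarith
            exact_mod_cast h1
          rw [hI]; push_cast
          have := Nat.clog_mono_right 2 hNM2
          have : (Nat.clog 2 N : ℝ) ≤ Nat.clog 2 (2 * M) := by exact_mod_cast this
          linarith
        have hX : 0 ≤ a ^ (3 / 2 : ℝ) * (M : ℝ) ^ (3 / 4 : ℝ) := by positivity
        set X := a ^ (3 / 2 : ℝ) * (M : ℝ) ^ (3 / 4 : ℝ)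
        calc (2 * (I : ℝ)) ^ 3 * (I * (2 * (3 * 10 ^ 8 * (4 * 10 ^ 10 * (M ^ 2 + 5 * X)))))
            = 192 * 10 ^ 18 * (I : ℝ) ^ 4 * (M ^ 2 + 5 * X) := by ring
          _ ≤ 192 * 10 ^ 18 * (I : ℝ) ^ 4 * (5 * (M ^ 2 + X)) := by
              gcongr; linarith [sq_nonneg (M : ℝ)]
          _ ≤ 10 ^ 22 * (I : ℝ) ^ 4 * (M ^ 2 + X) := by
              have : 0 ≤ (I : ℝ) ^ 4 * (M ^ 2 + X) := by positivity
              linarith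
          _ ≤ _ := by gcongr

/-! ### Sums of two squares in mean square -/

lemma sum_Icc_one_div_le (N : ℕ) : ∑ s ∈ Finset.Icc 1 N, 1 / (s : ℝ) ≤ 1 + Real.log N := by
  have h := harmonic_le_one_add_log N
  rw [harmonic_eq_sum_Icc] at h
  push_cast at h
  simpa only [one_div] using h

/-- Solutions of `x y = z w` in positive integers up to `N`, through the parametrisation
`x = g s`, `z = g t`, `y = t h`, `w = s h`. -/
lemma card_mul_eq_mul_le (N : ℕ) :
    (((Finset.Icc 1 N ×ˢ Finset.Icc 1 N ×ˢ Finset.Icc 1 N ×ˢ Finset.Icc 1 N).filter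
      fun q => q.1 * q.2.1 = q.2.2.1 * q.2.2.2).card : ℝ) ≤ N ^ 2 * (1 + Real.log N) ^ 2 := by
  set J := Finset.Icc 1 N with hJ
  set P : Finset (Σ _ : ℕ × ℕ, ℕ × ℕ) := (J ×ˢ J).sigma
    (fun p => Finset.Icc 1 (N / max p.1 p.2) ×ˢ Finset.Icc 1 (N / max p.1 p.2)) with hP
  have hsub : ((J ×ˢ J ×ˢ J ×ˢ J).filter fun q => q.1 * q.2.1 = q.2.2.1 * q.2.2.2) ⊆
      P.image fun u => (u.2.1 * u.1.1, u.1.2 * u.2.2, u.2.1 * u.1.2, u.1.1 * u.2.2) := by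
    rintro ⟨x, y, z, w⟩ hq
    simp only [hJ, Finset.mem_filter, Finset.mem_product, Finset.mem_Icc] at hq
    obtain ⟨⟨⟨hx, hxN⟩, ⟨hy, hyN⟩, ⟨hz, hzN⟩, ⟨hw, hwN⟩⟩, he⟩ := hq
    have hg : 0 < Nat.gcd x z := Nat.gcd_pos_of_pos_left _ hx
    obtain ⟨g, s, t, hg0, hst, hxs, hzt⟩ := Nat.exists_coprime' hg
    subst hxs hzt
    have hs : 0 < s := Nat.pos_of_mul_pos_right hx
    have ht : 0 < t := Nat.pos_of_mul_pos_right hz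
    have he' : s * y = t * w := by
      apply Nat.eq_of_mul_eq_mul_left hg0
      nlinarith
    have hty : t ∣ y := (Nat.Coprime.dvd_of_dvd_mul_left hst.symm (Dvd.intro _ he'.symm))
    obtain ⟨h, rfl⟩ := hty
    have hwh : w = s * h := by
      apply Nat.eq_of_mul_eq_mul_left ht
      nlinarith
    subst hwh
    have hh : 0 < h := Nat.pos_of_mul_pos_left hy
    simp only [hP, hJ, Finset.mem_image, Finset.mem_sigma, Finset.mem_product, Finset.mem_Icc]
    have hm : 0 < max s t := lt_max_of_lt_left hs
    refine ⟨⟨(s, t), (g, h)⟩, ⟨⟨⟨hs, by nlinarith⟩, ⟨ht, by nlinarith⟩⟩, ⟨hg0, ?_⟩, ⟨hh, ?_⟩⟩, ?_⟩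
    · rw [Nat.le_div_iff_mul_le hm]
      rcases max_cases s t with ⟨e, -⟩ | ⟨e, -⟩ <;> rw [e] <;> nlinarith
    · rw [Nat.le_div_iff_mul_le hm]
      rcases max_cases s t with ⟨e, -⟩ | ⟨e, -⟩ <;> rw [e] <;> nlinarith
    · ext <;> simp [mul_comm]
  have hcard : (P.card : ℝ) ≤ ∑ p ∈ J ×ˢ J, (N : ℝ) ^ 2 * (1 / (p.1 : ℝ) * (1 / (p.2 : ℝ))) := by
    rw [hP, Finset.card_sigma]
    push_cast
    refine Finset.sum_le_sum fun p hp => ?_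
    simp only [hJ, Finset.mem_product, Finset.mem_Icc] at hp
    have h1 : (0 : ℝ) < p.1 := by exact_mod_cast hp.1.1
    have h2 : (0 : ℝ) < p.2 := by exact_mod_cast hp.2.1
    simp only [Finset.card_product, Nat.card_Icc, Nat.add_sub_cancel]
    push_cast
    have hb : ((N / max p.1 p.2 : ℕ) : ℝ) ≤ N / max (p.1 : ℝ) p.2 := by
      have := @Nat.cast_div_le ℝ _ _ _ N (max p.1 p.2)
      rwa [Nat.cast_max] at this
    have hm : 0 < max (p.1 : ℝ) p.2 := lt_max_of_lt_left h1
    calc ((N / max p.1 p.2 : ℕ) : ℝ) * (N / max p.1 p.2 : ℕ)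
        ≤ (N / max (p.1 : ℝ) p.2) * (N / max (p.1 : ℝ) p.2) := by gcongr
      _ ≤ (N / p.1) * (N / p.2) := by
          gcongr
          · exact le_max_left _ _
          · exact le_max_right _ _
      _ = _ := by ring
  have hsum := sum_Icc_one_div_le N
  have hsum0 : 0 ≤ ∑ s ∈ Finset.Icc 1 N, 1 / (s : ℝ) := Finset.sum_nonneg fun _ _ => by positivity
  calc _ ≤ (P.card : ℝ) := by
        exact_mod_cast (Finset.card_le_card hsub).trans Finset.card_image_le
    _ ≤ _ := hcard
    _ = (N : ℝ) ^ 2 * (∑ s ∈ Finset.Icc 1 N, 1 / (s : ℝ)) ^ 2 := by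
        rw [← Finset.mul_sum, Finset.sum_product, sq (∑ s ∈ Finset.Icc 1 N, 1 / (s : ℝ)),
          Finset.sum_mul_sum]
    _ ≤ _ := by gcongr

/-- Pairs of representations as a sum of two squares, in the box `|nᵢ| ≤ V`. -/
noncomputable def sqQuads (V : ℕ) : Finset (ℤ × ℤ × ℤ × ℤ) :=
  (Finset.Icc (-V : ℤ) V ×ˢ Finset.Icc (-V : ℤ) V ×ˢ Finset.Icc (-V : ℤ) V ×ˢ
    Finset.Icc (-V : ℤ) V).filter
      fun n => n.1 ^ 2 + n.2.1 ^ 2 = n.2.2.1 ^ 2 + n.2.2.2 ^ 2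

/-- The equation is factored as `(n₁ - n₃) (n₁ + n₃) = (n₄ - n₂) (n₄ + n₂)`. The solutions with both
sides zero are in `Z1`, the others come from solutions of `x y = z w` and are in `Z2`. -/
lemma card_sqQuads_le {V : ℕ} (hV : 1 ≤ V) :
    ((sqQuads V).card : ℝ) ≤ 2000 * V ^ 2 * (1 + Real.log (2 * V)) ^ 2 := by
  set J := Finset.Icc (-V : ℤ) V with hJ
  set B : Finset Bool := Finset.univ
  set D : Finset (ℕ × ℕ × ℕ × ℕ) := (Finset.Icc 1 (2 * V) ×ˢ Finset.Icc 1 (2 * V) ×ˢ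
    Finset.Icc 1 (2 * V) ×ˢ Finset.Icc 1 (2 * V)).filter
      fun q => q.1 * q.2.1 = q.2.2.1 * q.2.2.2 with hD
  have hJc : J.card = 2 * V + 1 := by simp [hJ]; omega
  -- signs, encoded as booleans
  set sg : Bool → ℤ := fun b => if b then 1 else -1 with hsg
  set Z1 : Finset (ℤ × ℤ × ℤ × ℤ) := (J ×ˢ J ×ˢ B ×ˢ B).image
    fun u => (u.1, u.2.1, sg u.2.2.1 * u.1, sg u.2.2.2 * u.2.1) with hZ1
  set Z2 : Finset (ℤ × ℤ × ℤ × ℤ) := (D ×ˢ B ×ˢ B ×ˢ B ×ˢ B).image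
    fun u => ((sg u.2.1 * u.1.1 + sg u.2.2.1 * u.1.2.1) / 2,
      (sg u.2.2.2.2 * u.1.2.2.2 - sg u.2.2.2.1 * u.1.2.2.1) / 2,
      (sg u.2.2.1 * u.1.2.1 - sg u.2.1 * u.1.1) / 2,
      (sg u.2.2.2.2 * u.1.2.2.2 + sg u.2.2.2.1 * u.1.2.2.1) / 2) with hZ2
  have hsgn : ∀ x : ℤ, ∃ b, x = sg b * x.natAbs := by
    intro x
    rcases le_total 0 x with h | h
    · exact ⟨true, by simp only [hsg, if_true]; omega⟩
    · exact ⟨false, by simp only [hsg, Bool.false_eq_true, if_false]; omega⟩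
  have hsub : sqQuads V ⊆ Z1 ∪ Z2 := by
    rintro ⟨n1, n2, n3, n4⟩ hn
    simp only [sqQuads, Finset.mem_filter, Finset.mem_product] at hn
    obtain ⟨⟨h1, h2, h3, h4⟩, he⟩ := hn
    rw [Finset.mem_union]
    have hf : (n1 - n3) * (n1 + n3) = (n4 - n2) * (n4 + n2) := by linarith [he]
    by_cases h0 : (n1 - n3) * (n1 + n3) = 0
    · left
      rw [hZ1, Finset.mem_image]
      have h0' : (n4 - n2) * (n4 + n2) = 0 := by rw [← hf]; exact h0
      have e1 : ∃ b, n3 = sg b * n1 := by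
        rcases mul_eq_zero.mp h0 with h | h
        · exact ⟨true, by simp [hsg]; omega⟩
        · exact ⟨false, by simp [hsg]; omega⟩
      have e2 : ∃ b, n4 = sg b * n2 := by
        rcases mul_eq_zero.mp h0' with h | h
        · exact ⟨true, by simp [hsg]; omega⟩
        · exact ⟨false, by simp [hsg]; omega⟩
      obtain ⟨b1, e1⟩ := e1
      obtain ⟨b2, e2⟩ := e2
      refine ⟨(n1, n2, b1, b2), ?_, ?_⟩
      · simp only [B, Finset.mem_product, Finset.mem_univ, and_true]
        exact ⟨h1, h2⟩
      · simp [e1, e2]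
    · right
      have h0' : (n4 - n2) * (n4 + n2) ≠ 0 := by rw [← hf]; exact h0
      obtain ⟨p1, p2⟩ := mul_ne_zero_iff.mp h0
      obtain ⟨p3, p4⟩ := mul_ne_zero_iff.mp h0'
      obtain ⟨b1, e1⟩ := hsgn (n1 - n3)
      obtain ⟨b2, e2⟩ := hsgn (n1 + n3)
      obtain ⟨b3, e3⟩ := hsgn (n4 - n2)
      obtain ⟨b4, e4⟩ := hsgn (n4 + n2)
      rw [hZ2, Finset.mem_image]
      refine ⟨(((n1 - n3).natAbs, (n1 + n3).natAbs, (n4 - n2).natAbs, (n4 + n2).natAbs),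
        b1, b2, b3, b4), ?_, ?_⟩
      · simp only [Finset.mem_Icc] at h1 h2 h3 h4
        simp only [hD, B, Finset.mem_product, Finset.mem_filter, Finset.mem_Icc, Finset.mem_univ,
          and_true]
        refine ⟨⟨⟨by omega, by omega⟩, ⟨by omega, by omega⟩, ⟨by omega, by omega⟩,
          by omega, by omega⟩, ?_⟩
        rw [← Int.natAbs_mul, ← Int.natAbs_mul, hf]
      · simp only [← e1, ← e2, ← e3, ← e4]
        ext <;> simp only <;> omega
  have hZ1c : Z1.card ≤ (2 * V + 1) * ((2 * V + 1) * (2 * 2)) := by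
    refine Finset.card_image_le.trans (le_of_eq ?_)
    simp [Finset.card_product, hJc, B]
  have hZ2c : Z2.card ≤ D.card * 16 := by
    refine Finset.card_image_le.trans (le_of_eq ?_)
    simp [Finset.card_product, B]
  have hDc := card_mul_eq_mul_le (2 * V)
  have hV' : (1 : ℝ) ≤ V := by exact_mod_cast hV
  have hlog : 0 ≤ Real.log (2 * V) := Real.log_nonneg (by linarith)
  have htot : ((sqQuads V).card : ℝ) ≤ (2 * V + 1) * ((2 * V + 1) * (2 * 2)) + D.card * 16 := by
    exact_mod_cast (Finset.card_le_card hsub).trans ((Finset.card_union_le _ _).trans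
      (add_le_add hZ1c hZ2c))
  push_cast at hDc
  have hl2 : 1 ≤ (1 + Real.log (2 * V)) ^ 2 := by nlinarith
  calc ((sqQuads V).card : ℝ) ≤ _ := htot
    _ ≤ (3 * V) * ((3 * V) * (2 * 2)) + ((2 * V : ℝ) ^ 2 * (1 + Real.log (2 * V)) ^ 2) * 16 := by
        gcongr <;> linarith
    _ = 36 * V ^ 2 * 1 + 64 * V ^ 2 * (1 + Real.log (2 * V)) ^ 2 := by ring
    _ ≤ 36 * V ^ 2 * (1 + Real.log (2 * V)) ^ 2 + 64 * V ^ 2 * (1 + Real.log (2 * V)) ^ 2 := by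
        gcongr
    _ ≤ _ := by nlinarith [sq_nonneg ((V : ℝ) * (1 + Real.log (2 * V)))]

/-! ### Mean squares over the distance to the axis -/

/-- Bessel's inequality for finite trigonometric sums with integer frequencies. -/
lemma sum_norm_sq_fiber_le {ι : Type*} [DecidableEq ι] (s : Finset ι) (b : ι → ℂ) (n : ι → ℤ)
    (K : Finset ℤ) :
    ∑ k ∈ K, ‖∑ i ∈ s with n i = k, b i‖ ^ 2
      ≤ ∫ θ in (0 : ℝ)..1, ‖∑ i ∈ s, b i * ee (n i * θ)‖ ^ 2 := by
  have h1 : ((∫ θ in (0 : ℝ)..1, ‖∑ i ∈ s, b i * ee (n i * θ)‖ ^ 2 : ℝ) : ℂ)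
      = ∑ p ∈ s ×ˢ s, if n p.1 - n p.2 = 0 then b p.1 * (starRingEnd ℂ) (b p.2) else 0 := by
    have := integral_sum_ee (s ×ˢ s) (fun p => b p.1 * (starRingEnd ℂ) (b p.2))
      (fun p => n p.1 - n p.2) 0
    rw [zero_add] at this
    rw [← this, ← intervalIntegral.integral_ofReal]
    refine intervalIntegral.integral_congr fun θ _ => ?_
    push_cast
    rw [← Complex.mul_conj', map_sum, Finset.sum_mul_sum, Finset.sum_product]
    refine Finset.sum_congr rfl fun i _ => Finset.sum_congr rfl fun j _ => ?_
    rw [map_mul, ← ee_neg]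
    have : ((n i - n j : ℝ)) * θ = n i * θ + -(n j * θ) := by ring
    rw [this, ee_add]; ring
  have h2 : ((∑ k ∈ K ∪ s.image n, ‖∑ i ∈ s with n i = k, b i‖ ^ 2 : ℝ) : ℂ)
      = ∑ p ∈ s ×ˢ s, if n p.1 - n p.2 = 0 then b p.1 * (starRingEnd ℂ) (b p.2) else 0 := by
    push_cast
    have : ∀ k, (‖∑ i ∈ s with n i = k, b i‖ : ℂ) ^ 2 = ∑ p ∈ s ×ˢ s,
        if n p.1 = k then (if n p.2 = k then b p.1 * (starRingEnd ℂ) (b p.2) else 0) else 0 := by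
      intro k
      rw [← Complex.mul_conj', map_sum, Finset.sum_filter, Finset.sum_filter, Finset.sum_mul_sum,
        Finset.sum_product]
      refine Finset.sum_congr rfl fun i _ => Finset.sum_congr rfl fun j _ => ?_
      split_ifs <;> simp
    simp only [this]
    rw [Finset.sum_comm]
    refine Finset.sum_congr rfl fun p hp => ?_
    rw [Finset.sum_ite_eq, if_pos (Finset.mem_union_right _ (Finset.mem_image_of_mem _
      (Finset.mem_product.mp hp).1))]
    simp only [sub_eq_zero, eq_comm]
  have h3 : ∑ k ∈ K ∪ s.image n, ‖∑ i ∈ s with n i = k, b i‖ ^ 2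
      = ∫ θ in (0 : ℝ)..1, ‖∑ i ∈ s, b i * ee (n i * θ)‖ ^ 2 := by
    exact_mod_cast h2.trans h1.symm
  rw [← h3]
  exact Finset.sum_le_sum_of_subset_of_nonneg Finset.subset_union_left fun _ _ _ => by positivity

lemma integral_mul_le_sqrt_mul_sqrt {F G : ℝ → ℝ} (hF : Continuous F) (hG : Continuous G)
    {A B : ℝ} (hA : 0 < A) (hB : 0 < B) (hFA : ∫ θ in (0 : ℝ)..1, F θ ^ 2 ≤ A)
    (hGB : ∫ θ in (0 : ℝ)..1, G θ ^ 2 ≤ B) :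
    ∫ θ in (0 : ℝ)..1, F θ * G θ ≤ Real.sqrt A * Real.sqrt B := by
  have hA' := Real.sqrt_pos.mpr hA
  have hB' := Real.sqrt_pos.mpr hB
  set t := Real.sqrt B / Real.sqrt A with ht
  have ht0 : 0 < t := by positivity
  calc ∫ θ in (0 : ℝ)..1, F θ * G θ
      ≤ ∫ θ in (0 : ℝ)..1, (t / 2 * F θ ^ 2 + 1 / (2 * t) * G θ ^ 2) := by
        refine intervalIntegral.integral_mono_on zero_le_one
          (Continuous.intervalIntegrable (by fun_prop) _ _)
          (Continuous.intervalIntegrable (by fun_prop) _ _) fun θ _ => ?_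
        have : t / 2 * F θ ^ 2 + 1 / (2 * t) * G θ ^ 2 - F θ * G θ
            = (t * F θ - G θ) ^ 2 / (2 * t) := by field_simp; ring
        have : 0 ≤ (t * F θ - G θ) ^ 2 / (2 * t) := by positivity
        linarith
    _ = t / 2 * (∫ θ in (0 : ℝ)..1, F θ ^ 2) + 1 / (2 * t) * ∫ θ in (0 : ℝ)..1, G θ ^ 2 := by
        rw [intervalIntegral.integral_add (Continuous.intervalIntegrable (by fun_prop) _ _)
          (Continuous.intervalIntegrable (by fun_prop) _ _), intervalIntegral.integral_const_mul,
          intervalIntegral.integral_const_mul]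
    _ ≤ t / 2 * A + 1 / (2 * t) * B := by gcongr
    _ = Real.sqrt A * Real.sqrt B := by
        have hA2 := Real.sq_sqrt hA.le
        have hB2 := Real.sq_sqrt hB.le
        rw [ht]; field_simp; rw [hA2, hB2]; ring

lemma sum_mul_sum_eq_sum_product {ι κ : Type*} (s : Finset ι) (t : Finset κ) (f : ι → ℂ)
    (g : κ → ℂ) : (∑ i ∈ s, f i) * ∑ j ∈ t, g j = ∑ p ∈ s ×ˢ t, f p.1 * g p.2 := by
  rw [Finset.sum_mul_sum, Finset.sum_product]

/-- Fourth moment of a quadratic exponential sum. -/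
lemma integral_norm_theta_pow_four_le {V : ℕ} (W : Finset ℤ) (hW : W ⊆ Finset.Icc (-V : ℤ) V)
    (c : ℤ → ℂ) (hc : ∀ ν, ‖c ν‖ ≤ 1) :
    ∫ θ in (0 : ℝ)..1, ‖∑ ν ∈ W, c ν * ee ((-(ν ^ 2) : ℤ) * θ)‖ ^ 4 ≤ (sqQuads V).card := by
  have h1 : ((∫ θ in (0 : ℝ)..1, ‖∑ ν ∈ W, c ν * ee ((-(ν ^ 2) : ℤ) * θ)‖ ^ 4 : ℝ) : ℂ)
      = ∑ p ∈ W ×ˢ W ×ˢ W ×ˢ W,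
        if (-(p.1 ^ 2) - p.2.1 ^ 2 + p.2.2.1 ^ 2 + p.2.2.2 ^ 2 : ℤ) = 0 then
          c p.1 * c p.2.1 * (starRingEnd ℂ) (c p.2.2.1) * (starRingEnd ℂ) (c p.2.2.2) else 0 := by
    have := integral_sum_ee (W ×ˢ W ×ˢ W ×ˢ W) (fun p => c p.1 * c p.2.1 *
      (starRingEnd ℂ) (c p.2.2.1) * (starRingEnd ℂ) (c p.2.2.2))
      (fun p => -(p.1 ^ 2) - p.2.1 ^ 2 + p.2.2.1 ^ 2 + p.2.2.2 ^ 2) 0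
    rw [zero_add] at this
    rw [← this, ← intervalIntegral.integral_ofReal]
    refine intervalIntegral.integral_congr fun θ _ => ?_
    set f := ∑ ν ∈ W, c ν * ee ((-(ν ^ 2) : ℤ) * θ) with hf
    have e1 : ((‖f‖ ^ 4 : ℝ) : ℂ) = f * (f * ((starRingEnd ℂ) f * (starRingEnd ℂ) f)) := by
      push_cast
      have := Complex.mul_conj' f
      calc (‖f‖ : ℂ) ^ 4 = ((‖f‖ : ℂ) ^ 2) ^ 2 := by ring
        _ = _ := by rw [← this]; ring
    have e2 : (starRingEnd ℂ) f = ∑ ν ∈ W, (starRingEnd ℂ) (c ν) * ee ((ν ^ 2 : ℤ) * θ) := by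
      rw [hf, map_sum]
      refine Finset.sum_congr rfl fun ν _ => ?_
      rw [map_mul, ← ee_neg]; congr 2; push_cast; ring
    rw [e1, e2, hf]
    rw [sum_mul_sum_eq_sum_product, sum_mul_sum_eq_sum_product, sum_mul_sum_eq_sum_product]
    refine Finset.sum_congr rfl fun p _ => ?_
    have : ((-(p.1 ^ 2) - p.2.1 ^ 2 + p.2.2.1 ^ 2 + p.2.2.2 ^ 2 : ℤ) : ℝ) * θ
        = (-(p.1 ^ 2) : ℤ) * θ + ((-(p.2.1 ^ 2) : ℤ) * θ + ((p.2.2.1 ^ 2 : ℤ) * θ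
          + (p.2.2.2 ^ 2 : ℤ) * θ)) := by push_cast; ring
    rw [this, ee_add, ee_add, ee_add]
    ring
  have h2 : ‖((∫ θ in (0 : ℝ)..1, ‖∑ ν ∈ W, c ν * ee ((-(ν ^ 2) : ℤ) * θ)‖ ^ 4 : ℝ) : ℂ)‖
      ≤ (sqQuads V).card := by
    rw [h1, ← Finset.sum_filter]
    calc _ ≤ ∑ p ∈ W ×ˢ W ×ˢ W ×ˢ W with
          (-(p.1 ^ 2) - p.2.1 ^ 2 + p.2.2.1 ^ 2 + p.2.2.2 ^ 2 : ℤ) = 0, (1 : ℝ) := by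
          refine norm_sum_le_of_le _ fun p _ => ?_
          rw [norm_mul, norm_mul, norm_mul, RCLike.norm_conj, RCLike.norm_conj]
          calc _ ≤ (1 : ℝ) * 1 * 1 * 1 := by gcongr <;> exact hc _
            _ = 1 := by norm_num
      _ ≤ _ := by
          rw [Finset.sum_const, nsmul_eq_mul, mul_one]
          have : (W ×ˢ W ×ˢ W ×ˢ W).filter (fun p =>
              (-(p.1 ^ 2) - p.2.1 ^ 2 + p.2.2.1 ^ 2 + p.2.2.2 ^ 2 : ℤ) = 0) ⊆ sqQuads V := by
            intro p hp
            simp only [Finset.mem_filter, Finset.mem_product] at hp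
            simp only [sqQuads, Finset.mem_filter, Finset.mem_product]
            exact ⟨⟨hW hp.1.1, hW hp.1.2.1, hW hp.1.2.2.1, hW hp.1.2.2.2⟩, by linarith [hp.2]⟩
          exact_mod_cast Finset.card_le_card this
  rw [Complex.norm_real] at h2
  exact (le_abs_self _).trans h2

/-- The part in `M ≤ m < x`, `m = k + ν²`, of the sum over the third coordinate `ν` of
the phases `a √m`, for a given squared distance `k` to the axis. -/
noncomputable def rowSum (a : ℝ) (W : Finset ℤ) (c : ℤ → ℂ) (M x k : ℕ) : ℂ :=
  ∑ ν ∈ W, if k + ν.natAbs ^ 2 ∈ Finset.Ico M x then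
    c ν * ee (a * Real.sqrt ((k + ν.natAbs ^ 2 : ℕ))) else 0

/-- The row sum at `k` is the coefficient of `e(k θ)` in the product of the two exponential sums, as
`k = m - ν²`, so Bessel's inequality bounds the mean square. -/
lemma sum_norm_rowSum_sq_le_integral (a : ℝ) (W : Finset ℤ) (c : ℤ → ℂ) (M x : ℕ) (K : ℕ) :
    ∑ k ∈ Finset.range K, ‖rowSum a W c M x k‖ ^ 2 ≤ ∫ θ in (0 : ℝ)..1,
      ‖sqrtSum a M x θ‖ ^ 2 * ‖∑ ν ∈ W, c ν * ee ((-(ν ^ 2) : ℤ) * θ)‖ ^ 2 := by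
  have h := sum_norm_sq_fiber_le (Finset.Ico M x ×ˢ W)
    (fun p => ee (a * Real.sqrt p.1) * c p.2) (fun p => (p.1 : ℤ) - p.2 ^ 2)
    ((Finset.range K).map Nat.castEmbedding)
  rw [Finset.sum_map] at h
  refine le_trans (le_of_eq ?_) (h.trans (le_of_eq ?_))
  · refine Finset.sum_congr rfl fun k _ => ?_
    congr 2
    rw [rowSum, Finset.sum_filter, Finset.sum_product_right]
    refine Finset.sum_congr rfl fun ν _ => ?_
    have e : ∀ m : ℕ, ((m : ℤ) - ν ^ 2 = Nat.castEmbedding k) ↔ k + ν.natAbs ^ 2 = m := by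
      intro m
      simp only [Nat.castEmbedding_apply]
      have := Int.natAbs_sq ν
      zify
      rw [sq_abs]
      constructor <;> intro h <;> linarith
    simp only [e]
    rw [Finset.sum_ite_eq]
    split_ifs <;> ring
  · refine intervalIntegral.integral_congr fun θ _ => ?_
    rw [← mul_pow, ← norm_mul]
    congr 2
    rw [sqrtSum, sum_mul_sum_eq_sum_product]
    refine Finset.sum_congr rfl fun p _ => ?_
    have : (((p.1 : ℤ) - p.2 ^ 2 : ℤ) : ℝ) * θ = p.1 * θ + (-(p.2 ^ 2) : ℤ) * θ := by
      push_cast; ring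
    rw [this, ee_add, ee_add]; ring

/-- Mean square of the row sums: Cauchy–Schwarz and the two fourth moments if `a ≤ M ^ (3/2)`, and
the trivial bound for each row sum otherwise. -/
theorem sum_norm_rowSum_sq_le {a : ℝ} {M x : ℕ} (hM : 1 ≤ M) (hx : x ≤ 2 * M)
    (hMa : 8 * Real.sqrt M ≤ a) {W : Finset ℤ} (hW : W ⊆ Finset.Icc (-(Nat.sqrt (2 * M)) : ℤ)
      (Nat.sqrt (2 * M))) {c : ℤ → ℂ} (hc : ∀ ν, ‖c ν‖ ≤ 1) :
    ∑ k ∈ Finset.range (2 * M), ‖rowSum a W c M x k‖ ^ 2 ≤ 10 ^ 15 *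
      (Nat.clog 2 (2 * M) + 1 : ℕ) ^ 3 *
        (a ^ (1 / 3 : ℝ) * M ^ (1 / 2 : ℝ) + M ^ (3 / 4 : ℝ)) ^ 2 := by
  have hM0 : (0 : ℝ) < M := by exact_mod_cast hM
  have hM1 : (1 : ℝ) ≤ M := by exact_mod_cast hM
  have ha : 0 < a := lt_of_lt_of_le (by positivity) hMa
  set V := Nat.sqrt (2 * M) with hV
  have hVM : ((V : ℝ)) ^ 2 ≤ 2 * M := by exact_mod_cast Nat.sqrt_le' (2 * M)
  have hV1 : 1 ≤ V := Nat.sqrt_pos.mpr (by omega)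
  have hV1' : (1 : ℝ) ≤ V := by exact_mod_cast hV1
  set L : ℕ := Nat.clog 2 (2 * M) + 1 with hL
  have hL1 : (1 : ℝ) ≤ L := by rw [hL]; push_cast; linarith [Nat.cast_nonneg (α := ℝ) (Nat.clog 2 (2 * M))]
  -- All powers of `a` and `M` that occur are natural powers of `α` and `μ`.
  set α := a ^ (1 / 12 : ℝ) with hα
  set μ := (M : ℝ) ^ (1 / 8 : ℝ) with hμ
  have hα0 : 0 < α := by positivity
  have hμ1 : 1 ≤ μ := Real.one_le_rpow hM1 (by norm_num)
  have hμ0 : 0 < μ := by linarith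
  have pα : ∀ n : ℕ, a ^ ((n : ℝ) / 12) = α ^ n := fun n => by
    rw [hα, ← Real.rpow_natCast, ← Real.rpow_mul ha.le]; congr 1; ring
  have pμ : ∀ n : ℕ, (M : ℝ) ^ ((n : ℝ) / 8) = μ ^ n := fun n => by
    rw [hμ, ← Real.rpow_natCast, ← Real.rpow_mul hM0.le]; congr 1; ring
  have α4 : a ^ (1 / 3 : ℝ) = α ^ 4 := by rw [← pα]; norm_num
  have α18 : a ^ (3 / 2 : ℝ) = α ^ 18 := by rw [← pα]; norm_num
  have α12 : a = α ^ 12 := by rw [← pα]; norm_num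
  have μ8 : (M : ℝ) = μ ^ 8 := by rw [← pμ]; norm_num
  have μ4 : (M : ℝ) ^ (1 / 2 : ℝ) = μ ^ 4 := by rw [← pμ]; norm_num
  have μ6 : (M : ℝ) ^ (3 / 4 : ℝ) = μ ^ 6 := by rw [← pμ]; norm_num
  have hsM : Real.sqrt M = μ ^ 4 := by rw [Real.sqrt_eq_rpow, μ4]
  rcases le_or_gt a (M * Real.sqrt M) with haM | haM
  · have h4 := integral_norm_sqrtSum_pow_four_le hM hx haM hMa
    have hα : α ≤ μ := by
      rw [hsM, μ8, ← pow_add] at haM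
      nth_rewrite 1 [α12] at haM
      exact le_of_pow_le_pow_left₀ (by norm_num) hμ0.le haM
    have hth := integral_norm_theta_pow_four_le W hW c hc
    have hQ := card_sqQuads_le hV1
    have hlog : 1 + Real.log (2 * V) ≤ 2 * L := by
      have h1 : 2 * V ≤ 2 ^ L := by
        have : V ≤ 2 * M := Nat.sqrt_le_self _
        have := Nat.le_pow_clog one_lt_two (2 * M)
        rw [hL, pow_succ]; omega
      have h2 : Real.log (2 * V) ≤ L * Real.log 2 := by
        rw [← Real.log_pow]
        apply Real.log_le_log (by linarith)
        exact_mod_cast h1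
      have : Real.log 2 ≤ 1 := by linarith [Real.log_two_lt_d9]
      linarith [mul_le_of_le_one_right (by linarith : (0 : ℝ) ≤ L) this]
    have hlog0 : 0 ≤ Real.log (2 * V) := Real.log_nonneg (by linarith)
    have hB : ((sqQuads V).card : ℝ) ≤ 16000 * M * L ^ 2 := by
      calc _ ≤ _ := hQ
        _ ≤ 2000 * (2 * M) * (2 * L) ^ 2 := by gcongr
        _ = _ := by ring
    have hL' : ((Nat.clog 2 (2 * M) : ℝ) + 1) = L := by rw [hL]; push_cast; ring
    rw [hL'] at h4
    have key := integral_mul_le_sqrt_mul_sqrt (F := fun θ => ‖sqrtSum a M x θ‖ ^ 2)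
      (G := fun θ => ‖∑ ν ∈ W, c ν * ee ((-(ν ^ 2) : ℤ) * θ)‖ ^ 2) (by fun_prop)
      ((continuous_finsetSum _ fun ν _ => by fun_prop).norm.pow 2)
      (A := 10 ^ 22 * L ^ 4 * (M ^ 2 + a ^ (3 / 2 : ℝ) * M ^ (3 / 4 : ℝ)))
      (B := 16000 * M * L ^ 2) (by positivity) (by positivity)
      (by simp only [← pow_mul]; exact h4) (by simp only [← pow_mul]; exact hth.trans hB)
    refine (sum_norm_rowSum_sq_le_integral a W c M x (2 * M)).trans (key.trans ?_)
    rw [← Real.sqrt_mul (by positivity)]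
    apply Real.sqrt_le_iff.mpr
    refine ⟨by positivity, ?_⟩
    rw [α18, μ6, α4, μ4, μ8]
    calc 10 ^ 22 * (L : ℝ) ^ 4 * ((μ ^ 8) ^ 2 + α ^ 18 * μ ^ 6) * (16000 * μ ^ 8 * L ^ 2)
        = 16 * 10 ^ 25 * L ^ 6 * (μ ^ 24 + α ^ 16 * μ ^ 14 * α ^ 2) := by ring
      _ ≤ 16 * 10 ^ 25 * L ^ 6 * (μ ^ 24 + α ^ 16 * μ ^ 14 * μ ^ 2) := by gcongr
      _ = 16 * 10 ^ 25 * L ^ 6 * ((μ ^ 6) ^ 4 + (α ^ 4 * μ ^ 4) ^ 4) := by ring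
      _ ≤ 16 * 10 ^ 25 * L ^ 6 * (α ^ 4 * μ ^ 4 + μ ^ 6) ^ 4 := by
          gcongr
          have h1 : 0 < α ^ 4 * μ ^ 4 := by positivity
          have h2 : 0 < μ ^ 6 := by positivity
          have : 0 ≤ 4 * (α ^ 4 * μ ^ 4) ^ 3 * μ ^ 6 + 6 * (α ^ 4 * μ ^ 4) ^ 2 * (μ ^ 6) ^ 2
            + 4 * (α ^ 4 * μ ^ 4) * (μ ^ 6) ^ 3 := by positivity
          linarith
      _ ≤ 10 ^ 30 * L ^ 6 * (α ^ 4 * μ ^ 4 + μ ^ 6) ^ 4 := by gcongr; norm_num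
      _ = (10 ^ 15 * L ^ 3 * (α ^ 4 * μ ^ 4 + μ ^ 6) ^ 2) ^ 2 := by ring
  · have hα : μ ≤ α := by
      rw [hsM, μ8, ← pow_add] at haM
      nth_rewrite 1 [α12] at haM
      exact le_of_pow_le_pow_left₀ (by norm_num) hα0.le haM.le
    have hWc : (W.card : ℝ) ≤ 3 * V := by
      have := Finset.card_le_card hW
      rw [Int.card_Icc] at this
      have h2 : W.card ≤ 3 * V := by omega
      exact_mod_cast h2
    have hrow : ∀ k, ‖rowSum a W c M x k‖ ^ 2 ≤ 18 * M := by
      intro k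
      have h1 : ‖rowSum a W c M x k‖ ≤ W.card := by
        unfold rowSum
        refine (norm_sum_le _ _).trans ((Finset.sum_le_sum (g := fun _ => (1 : ℝ)) fun ν _ =>
          ?_).trans (by simp))
        split_ifs
        · rw [norm_mul, norm_ee, mul_one]; exact hc ν
        · simp
      calc _ ≤ (3 * (V : ℝ)) ^ 2 := by gcongr; exact h1.trans hWc
        _ = 9 * V ^ 2 := by ring
        _ ≤ 9 * (2 * M) := by gcongr
        _ = _ := by ring
    calc _ ≤ ∑ k ∈ Finset.range (2 * M), 18 * (M : ℝ) := Finset.sum_le_sum fun k _ => hrow k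
      _ = 36 * (μ ^ 8 * μ ^ 8) := by
          rw [Finset.sum_const, Finset.card_range, nsmul_eq_mul, ← μ8]; push_cast; ring
      _ ≤ 36 * (α ^ 8 * μ ^ 8) := by gcongr
      _ = 36 * (α ^ 4 * μ ^ 4) ^ 2 := by ring
      _ ≤ 36 * (α ^ 4 * μ ^ 4 + μ ^ 6) ^ 2 := by
          gcongr; linarith [show 0 < μ ^ 6 by positivity]
      _ ≤ 10 ^ 15 * L ^ 3 * (α ^ 4 * μ ^ 4 + μ ^ 6) ^ 2 := by
          gcongr
          have : (1 : ℝ) ≤ (L : ℝ) ^ 3 := one_le_pow₀ hL1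
          linarith
      _ = _ := by rw [α4, μ4, μ6]

/-! ### The exponential sum over a box of frequencies -/

/-- The squared length of a planar integer vector. -/
def normSqNat (ξ : ℤ × ℤ) : ℕ := ξ.1.natAbs ^ 2 + ξ.2.natAbs ^ 2

lemma cast_normSqNat (ξ : ℤ × ℤ) : (normSqNat ξ : ℝ) = (ξ.1 : ℝ) ^ 2 + (ξ.2 : ℝ) ^ 2 := by
  simp [normSqNat, Nat.cast_natAbs, sq_abs]

lemma normSqNat_pos {ξ : ℤ × ℤ} (h : ξ ≠ 0) : 0 < normSqNat ξ := by
  unfold normSqNat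
  by_contra h0
  apply h
  have h1 : ξ.1.natAbs ^ 2 = 0 := by omega
  have h2 : ξ.2.natAbs ^ 2 = 0 := by omega
  ext
  · simpa using h1
  · simpa using h2

/-- The mean square of the number of representations by a sum of two squares counts pairs of
representations. -/
lemma sum_sq_card_le (B : Finset (ℤ × ℤ)) (V : ℕ) :
    ∑ k ∈ Finset.Icc 1 (V ^ 2), (B.filter fun ξ => normSqNat ξ = k).card ^ 2 ≤ (sqQuads V).card := by
  have h1 : ∀ k ∈ Finset.Icc 1 (V ^ 2), (B.filter fun ξ => normSqNat ξ = k).card ^ 2 ≤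
      ((sqQuads V).filter fun n => normSqNat (n.1, n.2.1) = k).card := by
    intro k hk
    rw [sq, ← Finset.card_product]
    refine Finset.card_le_card_of_injOn (fun u => (u.1.1, u.1.2, u.2.1, u.2.2)) ?_ ?_
    · intro u hu
      simp only [Finset.coe_product, Set.mem_prod, Finset.mem_coe, Finset.mem_filter] at hu
      rw [Finset.mem_Icc] at hk
      obtain ⟨⟨-, h1⟩, -, h2⟩ := hu
      have hb : ∀ ξ : ℤ × ℤ, normSqNat ξ = k → ξ.1 ∈ Finset.Icc (-V : ℤ) V ∧
          ξ.2 ∈ Finset.Icc (-V : ℤ) V := by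
        intro ξ hξ
        unfold normSqNat at hξ
        have a1 : ξ.1.natAbs ≤ V := by nlinarith
        have a2 : ξ.2.natAbs ≤ V := by nlinarith
        simp only [Finset.mem_Icc]
        omega
      simp only [Finset.mem_coe, Finset.mem_filter, sqQuads, Finset.mem_product]
      refine ⟨⟨⟨(hb _ h1).1, (hb _ h1).2, (hb _ h2).1, (hb _ h2).2⟩, ?_⟩, h1⟩
      have := h1.trans h2.symm
      unfold normSqNat at this
      zify at this
      simpa only [sq_abs] using this
    · intro u _ v _ h
      simp only [Prod.mk.injEq] at h
      ext <;> simp [h]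
  refine (Finset.sum_le_sum h1).trans ?_
  rw [← Finset.card_biUnion]
  · apply Finset.card_le_card
    intro n hn
    simp only [Finset.mem_biUnion, Finset.mem_filter] at hn
    obtain ⟨_, _, h, _⟩ := hn
    exact h
  · intro i _ j _ hij
    rw [Function.onFun, Finset.disjoint_left]
    intro n h1 h2
    simp only [Finset.mem_filter] at h1 h2
    exact hij (h1.2.symm.trans h2.2)

/-- The weight `k ^ (-1/2)` is dominated by `∑ⱼ 2 ^ (1 - j)` over the `j` with `k ≤ 4 ^ j`, which
leaves the unweighted counts at the scales `2 ^ j`. -/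
lemma sum_sq_card_div_sqrt_le (B : Finset (ℤ × ℤ)) {M : ℕ} (hM : 1 ≤ M) :
    ∑ k ∈ Finset.Ico 1 (2 * M), ((B.filter fun ξ => normSqNat ξ = k).card : ℝ) ^ 2 / Real.sqrt k
      ≤ 96000 * Real.sqrt M * (Nat.clog 2 (2 * M) + 1 : ℕ) ^ 2 := by
  set r : ℕ → ℝ := fun k => ((B.filter fun ξ => normSqNat ξ = k).card : ℝ) with hr
  set J := Nat.clog 4 (2 * M) + 1 with hJ
  set L := Nat.clog 2 (2 * M) + 1 with hL
  have hM1 : (1 : ℝ) ≤ M := by exact_mod_cast hM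
  have hJL : J ≤ L := by
    have : Nat.clog 4 (2 * M) ≤ Nat.clog 2 (2 * M) := Nat.clog_anti_left one_lt_two (by norm_num)
    omega
  have hpt : ∀ k ∈ Finset.Ico 1 (2 * M), r k ^ 2 / Real.sqrt k ≤
      ∑ j ∈ Finset.range J, 2 / 2 ^ j * (if k ∈ Finset.Icc 1 ((2 ^ j) ^ 2) then r k ^ 2 else 0) := by
    intro k hk
    rw [Finset.mem_Ico] at hk
    have hk0 : (0 : ℝ) < k := by exact_mod_cast hk.1
    set j := Nat.clog 4 k with hj
    have hjJ : j ∈ Finset.range J := by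
      rw [Finset.mem_range, hJ, Nat.lt_succ_iff]
      exact Nat.clog_mono_right _ hk.2.le
    have h4 : ∀ j : ℕ, (2 ^ j) ^ 2 = 4 ^ j := fun j => by
      rw [← pow_mul, mul_comm, pow_mul]; norm_num
    have hkj : k ≤ (2 ^ j) ^ 2 := by
      rw [h4]; exact Nat.le_pow_clog (by norm_num) k
    have hj2 : (2 ^ j) ^ 2 ≤ 4 * k := by
      rw [h4]
      rcases Nat.lt_or_ge 1 k with h | h
      · have h1 := Nat.pow_pred_clog_lt_self (b := 4) (by norm_num) h
        have h2 : 0 < Nat.clog 4 k := Nat.clog_pos (by norm_num) h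
        obtain ⟨i, hi⟩ : ∃ i, Nat.clog 4 k = i + 1 := ⟨Nat.clog 4 k - 1, by omega⟩
        rw [hi, Nat.pred_succ] at h1
        rw [hj, hi, pow_succ]; omega
      · have : k = 1 := by omega
        rw [hj, this]; simp
    have hs : (2 : ℝ) ^ j ≤ 2 * Real.sqrt k := by
      have h1 : ((2 : ℝ) ^ j) ^ 2 ≤ 4 * k := by exact_mod_cast hj2
      have h2 := Real.sq_sqrt hk0.le
      apply le_of_sq_le_sq _ (by positivity)
      rw [mul_pow, h2]; linarith
    have hs0 : 0 < Real.sqrt k := Real.sqrt_pos.mpr hk0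
    refine le_trans ?_ (Finset.single_le_sum (f := fun j => 2 / 2 ^ j *
      (if k ∈ Finset.Icc 1 ((2 ^ j) ^ 2) then r k ^ 2 else 0)) (fun i _ => ?_) hjJ)
    · rw [if_pos (Finset.mem_Icc.mpr ⟨hk.1, hkj⟩), div_mul_eq_mul_div, div_le_div_iff₀ hs0
        (by positivity)]
      nlinarith [sq_nonneg (r k)]
    · positivity
  have hlog : ∀ j ∈ Finset.range J, ((sqQuads (2 ^ j)).card : ℝ) ≤ 2000 * (2 ^ j) ^ 2 * (2 * L) ^ 2 := by
    intro j hj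
    rw [Finset.mem_range] at hj
    have h := card_sqQuads_le (V := 2 ^ j) Nat.one_le_two_pow
    refine h.trans ?_
    push_cast
    have h2 : (2 : ℝ) * 2 ^ j = 2 ^ (j + 1) := by rw [pow_succ]; ring
    have h3 : 1 + Real.log (2 * 2 ^ j) ≤ 2 * L := by
      rw [h2, Real.log_pow]
      have : Real.log 2 ≤ 1 := by linarith [Real.log_two_lt_d9]
      have h4 : ((j + 1 : ℕ) : ℝ) ≤ L := by exact_mod_cast (by omega : j + 1 ≤ L)
      have h5 : (1 : ℝ) ≤ L := by exact_mod_cast (by omega : 1 ≤ L)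
      nlinarith [Nat.cast_nonneg (α := ℝ) (j + 1)]
    have h0 : 0 ≤ 1 + Real.log (2 * 2 ^ j) := by
      rw [h2, Real.log_pow]
      have : 0 ≤ Real.log 2 := Real.log_nonneg (by norm_num)
      positivity
    gcongr
  calc _ ≤ ∑ k ∈ Finset.Ico 1 (2 * M), ∑ j ∈ Finset.range J,
        2 / 2 ^ j * (if k ∈ Finset.Icc 1 ((2 ^ j) ^ 2) then r k ^ 2 else 0) :=
        Finset.sum_le_sum hpt
    _ = ∑ j ∈ Finset.range J, 2 / 2 ^ j * ∑ k ∈ Finset.Ico 1 (2 * M),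
        (if k ∈ Finset.Icc 1 ((2 ^ j) ^ 2) then r k ^ 2 else 0) := by
        rw [Finset.sum_comm]; simp only [Finset.mul_sum]
    _ ≤ ∑ j ∈ Finset.range J, (2 : ℝ) / 2 ^ j * (2000 * (2 ^ j) ^ 2 * (2 * (L : ℝ)) ^ 2) := by
        refine Finset.sum_le_sum fun j hj => mul_le_mul_of_nonneg_left ?_ (by positivity)
        refine le_trans ?_ (hlog j hj)
        rw [← Finset.sum_filter]
        calc _ ≤ ∑ k ∈ Finset.Icc 1 ((2 ^ j) ^ 2), r k ^ 2 := by
              refine Finset.sum_le_sum_of_subset_of_nonneg ?_ fun _ _ _ => by positivity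
              intro k hk
              exact (Finset.mem_filter.mp hk).2
          _ ≤ _ := by
              have := sum_sq_card_le B (2 ^ j)
              simp only [hr]
              exact_mod_cast this
    _ = 16000 * L ^ 2 * ∑ j ∈ Finset.range J, (2 : ℝ) ^ j := by
        rw [Finset.mul_sum]
        refine Finset.sum_congr rfl fun j _ => ?_
        field_simp; ring
    _ ≤ 16000 * L ^ 2 * (6 * Real.sqrt M) := by
        gcongr
        rw [geom_sum_eq (by norm_num)]
        have h1 : ((2 : ℝ) ^ J) ^ 2 ≤ 32 * M := by
          have : (2 ^ J) ^ 2 ≤ 32 * M := by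
            rw [← pow_mul, mul_comm, pow_mul, hJ]
            have h1 := Nat.pow_pred_clog_lt_self (b := 4) (x := 2 * M) (by norm_num) (by omega)
            have h2 : 0 < Nat.clog 4 (2 * M) := Nat.clog_pos (by norm_num) (by omega)
            obtain ⟨i, hi⟩ : ∃ i, Nat.clog 4 (2 * M) = i + 1 := ⟨Nat.clog 4 (2 * M) - 1, by omega⟩
            rw [hi, Nat.pred_succ] at h1
            rw [hi, pow_succ, pow_succ]; norm_num; omega
          exact_mod_cast this
        have h2 := Real.sq_sqrt (show (0 : ℝ) ≤ M by positivity)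
        have h3 : (2 : ℝ) ^ J ≤ 6 * Real.sqrt M := by
          apply le_of_sq_le_sq _ (by positivity)
          rw [mul_pow, h2]; linarith
        linarith
    _ = _ := by ring

lemma rowSum_eq_zero {a : ℝ} {W : Finset ℤ} {c : ℤ → ℂ} {M x k : ℕ} (h : x ≤ k) :
    rowSum a W c M x k = 0 := by
  unfold rowSum
  refine Finset.sum_eq_zero fun ν _ => if_neg ?_
  rw [Finset.mem_Ico]; omega

lemma rowSum_inter (a : ℝ) (W : Finset ℤ) (c : ℤ → ℂ) {M x k : ℕ} (hx : x ≤ 2 * M) :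
    rowSum a W c M x k = rowSum a (W ∩ Finset.Icc (-(Nat.sqrt (2 * M)) : ℤ) (Nat.sqrt (2 * M)))
      c M x k := by
  unfold rowSum
  symm
  refine Finset.sum_subset Finset.inter_subset_left fun ν hν hν' => if_neg ?_
  intro h
  apply hν'
  rw [Finset.mem_inter]
  refine ⟨hν, ?_⟩
  rw [Finset.mem_Ico] at h
  have : ν.natAbs ≤ Nat.sqrt (2 * M) := by
    rw [Nat.le_sqrt']; omega
  rw [Finset.mem_Icc]; omega

/-- Sum of the row sums over the first two coordinates of the frequency. -/
lemma sum_norm_rowSum_le {a : ℝ} {M x : ℕ} (hM : 1 ≤ M) (hx : x ≤ 2 * M)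
    (hMa : 8 * Real.sqrt M ≤ a) {W : Finset ℤ} {c : ℤ → ℂ} (hc : ∀ ν, ‖c ν‖ ≤ 1)
    {B : Finset (ℤ × ℤ)} (hB : ∀ ξ ∈ B, ξ ≠ 0) :
    ∑ ξ ∈ B, (normSqNat ξ : ℝ) ^ (-(1 / 4) : ℝ) * ‖rowSum a W c M x (normSqNat ξ)‖
      ≤ 10 ^ 10 * (Nat.clog 2 (2 * M) + 1 : ℕ) ^ 3 * M ^ (1 / 4 : ℝ) *
        (a ^ (1 / 3 : ℝ) * M ^ (1 / 2 : ℝ) + M ^ (3 / 4 : ℝ)) := by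
  have hM0 : (0 : ℝ) < M := by exact_mod_cast hM
  have ha : 0 < a := lt_of_lt_of_le (by positivity) hMa
  set L : ℕ := Nat.clog 2 (2 * M) + 1 with hL
  have hL1 : (1 : ℝ) ≤ L := by exact_mod_cast (by omega : 1 ≤ L)
  set Y := a ^ (1 / 3 : ℝ) * M ^ (1 / 2 : ℝ) + (M : ℝ) ^ (3 / 4 : ℝ) with hY
  have hY0 : 0 < Y := by positivity
  set s : ℕ → ℝ := fun k => ‖rowSum a W c M x k‖ with hs
  set r : ℕ → ℝ := fun k => ((B.filter fun ξ => normSqNat ξ = k).card : ℝ) with hr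
  have h1 : ∑ ξ ∈ B, (normSqNat ξ : ℝ) ^ (-(1 / 4) : ℝ) * s (normSqNat ξ)
      = ∑ k ∈ Finset.Ico 1 (2 * M), r k * ((k : ℝ) ^ (-(1 / 4) : ℝ)) * s k := by
    rw [← Finset.sum_filter_add_sum_filter_not B (fun ξ => normSqNat ξ ∈ Finset.Ico 1 (2 * M))]
    have h0 : ∑ ξ ∈ B with ¬ normSqNat ξ ∈ Finset.Ico 1 (2 * M),
        (normSqNat ξ : ℝ) ^ (-(1 / 4) : ℝ) * s (normSqNat ξ) = 0 := by
      refine Finset.sum_eq_zero fun ξ hξ => ?_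
      rw [Finset.mem_filter, Finset.mem_Ico] at hξ
      have := normSqNat_pos (hB ξ hξ.1)
      have h2 : x ≤ normSqNat ξ := by omega
      simp only [hs]
      rw [rowSum_eq_zero h2, norm_zero, mul_zero]
    rw [h0, add_zero, ← Finset.sum_fiberwise_of_maps_to (t := Finset.Ico 1 (2 * M))
      (g := normSqNat) (fun ξ hξ => (Finset.mem_filter.mp hξ).2)]
    refine Finset.sum_congr rfl fun k hk => ?_
    rw [Finset.sum_congr rfl (g := fun _ => (k : ℝ) ^ (-(1 / 4) : ℝ) * s k)
      (fun ξ hξ => by rw [(Finset.mem_filter.mp hξ).2]), Finset.sum_const, nsmul_eq_mul,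
      Finset.filter_filter, mul_assoc]
    congr 3
    ext ξ
    simp only [Finset.mem_filter]
    constructor
    · rintro ⟨h1, -, h2⟩; exact ⟨h1, h2⟩
    · rintro ⟨h1, h2⟩; exact ⟨h1, h2 ▸ hk, h2⟩
  have hS := sum_sq_card_div_sqrt_le B hM
  have hT : ∑ k ∈ Finset.Ico 1 (2 * M), s k ^ 2 ≤ 10 ^ 15 * L ^ 3 * Y ^ 2 := by
    refine le_trans ?_ (sum_norm_rowSum_sq_le hM hx hMa (W := W ∩ Finset.Icc
      (-(Nat.sqrt (2 * M)) : ℤ) (Nat.sqrt (2 * M))) Finset.inter_subset_right hc)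
    simp only [← rowSum_inter a W c hx]
    refine Finset.sum_le_sum_of_subset_of_nonneg ?_ fun _ _ _ => by positivity
    rw [Finset.range_eq_Ico]
    exact Finset.Ico_subset_Ico_left (by norm_num)
  rw [h1]
  have hCS := Finset.sum_mul_sq_le_sq_mul_sq (Finset.Ico 1 (2 * M))
    (fun k => r k * ((k : ℝ) ^ (-(1 / 4) : ℝ))) s
  have hS' : ∑ k ∈ Finset.Ico 1 (2 * M), (r k * ((k : ℝ) ^ (-(1 / 4) : ℝ))) ^ 2
      ≤ 96000 * Real.sqrt M * L ^ 2 := by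
    refine le_trans (le_of_eq ?_) hS
    refine Finset.sum_congr rfl fun k _ => ?_
    have e : ((k : ℝ) ^ (-(1 / 4) : ℝ)) ^ 2 = (Real.sqrt k)⁻¹ := by
      rw [← Real.rpow_natCast _ 2, ← Real.rpow_mul (by positivity), Real.sqrt_eq_rpow,
        ← Real.rpow_neg (by positivity)]
      norm_num
    rw [mul_pow, e, div_eq_mul_inv]
  have hM4 : ((M : ℝ) ^ (1 / 4 : ℝ)) ^ 2 = Real.sqrt M := by
    rw [← Real.rpow_natCast _ 2, ← Real.rpow_mul (by positivity), Real.sqrt_eq_rpow]; norm_num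
  apply le_of_sq_le_sq _ (by positivity)
  calc _ ≤ _ := hCS
    _ ≤ (96000 * Real.sqrt M * L ^ 2) * (10 ^ 15 * L ^ 3 * Y ^ 2) := by gcongr
    _ = 96 * 10 ^ 18 * L ^ 5 * (Real.sqrt M * Y ^ 2) := by ring
    _ ≤ 10 ^ 20 * L ^ 6 * (Real.sqrt M * Y ^ 2) := by
        gcongr <;> norm_num
    _ = _ := by rw [← hM4]; ring

/-- Partial summation of a row sum against a weight in `m = k + ν²`. -/
lemma sum_weight_mul_eq (a : ℝ) (W : Finset ℤ) (c : ℤ → ℂ) (M k : ℕ) (g : ℕ → ℝ) :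
    ∑ ν ∈ W, (if k + ν.natAbs ^ 2 ∈ Finset.Ico M (2 * M) then
      c ν * (g (k + ν.natAbs ^ 2) : ℂ) * ee (a * Real.sqrt ((k + ν.natAbs ^ 2 : ℕ))) else 0)
      = g (2 * M) * rowSum a W c M (2 * M) k - ∑ x ∈ Finset.Ico M (2 * M),
        ((g (x + 1) - g x : ℝ) : ℂ) * rowSum a W c M (x + 1) k := by
  unfold rowSum
  simp only [Finset.mul_sum]
  rw [Finset.sum_comm, ← Finset.sum_sub_distrib]
  refine Finset.sum_congr rfl fun ν _ => ?_
  set m := k + ν.natAbs ^ 2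
  by_cases hm : m ∈ Finset.Ico M (2 * M)
  · rw [if_pos hm, if_pos hm]
    rw [Finset.mem_Ico] at hm
    have h1 : ∀ x, (m ∈ Finset.Ico M (x + 1)) ↔ m ≤ x := fun x => by
      rw [Finset.mem_Ico]; omega
    simp only [h1, mul_ite, mul_zero]
    rw [← Finset.sum_filter]
    have h2 : (Finset.Ico M (2 * M)).filter (fun x => m ≤ x) = Finset.Ico m (2 * M) := by
      ext x; simp only [Finset.mem_filter, Finset.mem_Ico]; omega
    rw [h2, ← Finset.sum_mul]
    have h3 : ∑ x ∈ Finset.Ico m (2 * M), ((g (x + 1) - g x : ℝ) : ℂ) = g (2 * M) - g m := by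
      rw [← Complex.ofReal_sum, Finset.sum_Ico_sub g hm.2.le]; push_cast; rfl
    rw [h3]; ring
  · rw [if_neg hm, if_neg hm]
    have : ∑ x ∈ Finset.Ico M (2 * M), ((g (x + 1) - g x : ℝ) : ℂ) *
        (if m ∈ Finset.Ico M (x + 1) then c ν * ee (a * Real.sqrt (m : ℕ)) else 0) = 0 := by
      refine Finset.sum_eq_zero fun x hx => ?_
      rw [if_neg, mul_zero]
      intro h
      rw [Finset.mem_Ico] at hx h hm
      omega
    rw [this]; simp

/-- The amplitude with which a frequency at squared distance `k` from the axis and of squared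
length `m` contributes to the count. -/
noncomputable def amplitude (a A σ : ℝ) (k : ℕ) (m : ℕ) : ℝ :=
  (m : ℝ) ^ (-(3 / 4) : ℝ) * Real.sqrt (A + σ * a * Real.sqrt (k / m))

lemma le_of_le_one_sub_mul {a A κ : ℝ} (ha : 0 < a) (hκ0 : 0 < κ) (hκ1 : κ ≤ 1)
    (haA : a ≤ (1 - κ) * A) : 0 < A ∧ a ≤ A := by
  have hA : 0 < A := by
    by_contra h
    push Not at h
    nlinarith
  exact ⟨hA, by nlinarith⟩

lemma amplitude_radicand_mem {a A σ κ : ℝ} (ha : 0 < a) (hκ0 : 0 < κ) (hκ1 : κ ≤ 1)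
    (haA : a ≤ (1 - κ) * A) (hσ : |σ| ≤ 1) {k m : ℕ} (hk : 1 ≤ k) (hkm : k ≤ m) :
    κ * A ≤ A + σ * a * Real.sqrt (k / m) ∧ A + σ * a * Real.sqrt (k / m) ≤ 2 * A := by
  have hm0 : (0 : ℝ) < m := by exact_mod_cast (by omega : 0 < m)
  have hkm' : (k : ℝ) ≤ m := by exact_mod_cast hkm
  have h1 : Real.sqrt ((k : ℝ) / m) ≤ 1 := by
    rw [← Real.sqrt_one]; exact Real.sqrt_le_sqrt ((div_le_one hm0).mpr hkm')
  have h0 := Real.sqrt_nonneg ((k : ℝ) / m)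
  obtain ⟨hA, haA'⟩ := le_of_le_one_sub_mul ha hκ0 hκ1 haA
  have h2 : |σ * a * Real.sqrt (k / m)| ≤ a := by
    rw [abs_mul, abs_mul, abs_of_pos ha, abs_of_nonneg h0]
    calc |σ| * a * Real.sqrt (k / m) ≤ 1 * a * 1 := by gcongr
      _ = a := by ring
  obtain ⟨h3, h4⟩ := abs_le.mp h2
  constructor <;> nlinarith

lemma abs_amplitude_le {a A σ κ : ℝ} (ha : 0 < a) (hκ0 : 0 < κ) (hκ1 : κ ≤ 1)
    (haA : a ≤ (1 - κ) * A) (hσ : |σ| ≤ 1) {M k m : ℕ} (hM : 1 ≤ M) (hk : 1 ≤ k) (hkm : k ≤ m) (hMm : M ≤ m) :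
    |amplitude a A σ k m| ≤ 2 * Real.sqrt (A / κ) * (M : ℝ) ^ (-(3 / 4) : ℝ) := by
  obtain ⟨h1, h2⟩ := amplitude_radicand_mem ha hκ0 hκ1 haA hσ hk hkm
  have hA : 0 ≤ A := by nlinarith
  have hM0 : (0 : ℝ) < M := by exact_mod_cast hM
  have hMm' : (M : ℝ) ≤ m := by exact_mod_cast hMm
  unfold amplitude
  rw [abs_of_nonneg (by positivity), mul_comm]
  gcongr ?_ * ?_
  · have : (2 : ℝ) * Real.sqrt (A / κ) = Real.sqrt (4 * (A / κ)) := by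
      rw [Real.sqrt_mul (by norm_num), show (4 : ℝ) = 2 ^ 2 by norm_num, Real.sqrt_sq (by norm_num)]
    rw [this]
    apply Real.sqrt_le_sqrt
    have : A ≤ A / κ := le_div_self hA hκ0 hκ1
    linarith
  · exact Real.rpow_le_rpow_of_nonpos hM0 hMm' (by norm_num)

set_option maxHeartbeats 600000 in
/-- The amplitude varies slowly in `m`, as needed for partial summation. -/
lemma abs_amplitude_succ_sub_le {a A σ κ : ℝ} (ha : 0 < a) (hκ0 : 0 < κ) (hκ1 : κ ≤ 1)
    (haA : a ≤ (1 - κ) * A) (hσ : |σ| ≤ 1) {M k m : ℕ} (hM : 1 ≤ M) (hk : 1 ≤ k) (hkm : k ≤ m) (hMm : M ≤ m) :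
    |amplitude a A σ k (m + 1) - amplitude a A σ k m|
      ≤ 2 * Real.sqrt (A / κ) * (M : ℝ) ^ (-(7 / 4) : ℝ) := by
  obtain ⟨h1, h2⟩ := amplitude_radicand_mem ha hκ0 hκ1 haA hσ hk hkm
  obtain ⟨h1', h2'⟩ := amplitude_radicand_mem ha hκ0 hκ1 haA hσ hk (hkm.trans (Nat.le_succ m))
  have hM0 : (0 : ℝ) < M := by exact_mod_cast hM
  have hMm' : (M : ℝ) ≤ m := by exact_mod_cast hMm
  have hm0 : (0 : ℝ) < m := by linarith
  have hk0 : (0 : ℝ) < k := by exact_mod_cast hk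
  have hkm' : (k : ℝ) ≤ m := by exact_mod_cast hkm
  obtain ⟨hA, haA'⟩ := le_of_le_one_sub_mul ha hκ0 hκ1 haA
  set u := A + σ * a * Real.sqrt (k / m) with hu
  set u' := A + σ * a * Real.sqrt (k / ((m + 1 : ℕ) : ℝ)) with hu'
  set p := (m : ℝ) ^ (-(3 / 4) : ℝ) with hp
  set p' := ((m + 1 : ℕ) : ℝ) ^ (-(3 / 4) : ℝ) with hp'
  have hp0 : 0 < p := by positivity
  have hp0' : 0 < p' := by positivity
  have hpp : p' ≤ p := Real.rpow_le_rpow_of_nonpos hm0 (by push_cast; linarith) (by norm_num)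
  have hdp : p - p' ≤ p / m := by
    have e : p' = p * ((m : ℝ) / (m + 1)) ^ (3 / 4 : ℝ) := by
      rw [hp, hp', Real.div_rpow hm0.le (by positivity), Real.rpow_neg hm0.le,
        Real.rpow_neg (by positivity)]
      push_cast
      have : (m : ℝ) ^ (3 / 4 : ℝ) ≠ 0 := by positivity
      field_simp
    have h3 : (m : ℝ) / (m + 1) ≤ ((m : ℝ) / (m + 1)) ^ (3 / 4 : ℝ) := by
      apply Real.self_le_rpow_of_le_one (by positivity) _ (by norm_num)
      rw [div_le_one (by positivity)]; linarith
    have h4 : p * ((m : ℝ) / (m + 1)) ≤ p' := by rw [e]; gcongr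
    have h5 : p - p * ((m : ℝ) / (m + 1)) = p / (m + 1) := by field_simp; ring
    have h6 : p / (m + 1) ≤ p / m := by gcongr; linarith
    linarith
  -- the radicand moves by at most `a / m`
  have hdu : |u' - u| ≤ a / m := by
    set s := Real.sqrt m with hs
    set s' := Real.sqrt ((m + 1 : ℕ) : ℝ) with hs'
    have hs0 : 0 < s := Real.sqrt_pos.mpr hm0
    have hss' : s ≤ s' := Real.sqrt_le_sqrt (by push_cast; linarith)
    have hs2 : s ^ 2 = m := Real.sq_sqrt hm0.le
    have hs2' : s' ^ 2 = m + 1 := by rw [hs', Real.sq_sqrt (by positivity)]; push_cast; ring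
    have hks : Real.sqrt k ≤ s := Real.sqrt_le_sqrt hkm'
    have e : u' - u = σ * (a * (Real.sqrt k * (1 / s' - 1 / s))) := by
      rw [hu, hu', Real.sqrt_div hk0.le, Real.sqrt_div hk0.le]; ring
    have hneg : 1 / s' ≤ 1 / s := one_div_le_one_div_of_le hs0 hss'
    have h3 : 1 / s - 1 / s' ≤ 1 / (s * m) := by
      have hs0' : 0 < s' := hs0.trans_le hss'
      rw [div_sub_div _ _ hs0.ne' hs0'.ne', div_le_div_iff₀ (by positivity) (by positivity),
        ← hs2]
      have h4 : (s' - s) * (s' + s) = 1 := by linear_combination hs2' - hs2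
      have h5 : (s' - s) * s ≤ (s' - s) * (s' + s) :=
        mul_le_mul_of_nonneg_left (by linarith) (by linarith)
      rw [h4] at h5
      linarith [mul_le_mul_of_nonneg_left h5 (sq_nonneg s), mul_le_mul_of_nonneg_left hss' hs0.le]
    rw [e, abs_mul, abs_mul, abs_of_pos ha, abs_mul, abs_of_nonneg (Real.sqrt_nonneg _),
      abs_of_nonpos (show 1 / s' - 1 / s ≤ 0 by linarith)]
    have hneg' : 0 ≤ -(1 / s' - 1 / s) := by linarith
    calc |σ| * (a * (Real.sqrt k * -(1 / s' - 1 / s)))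
        ≤ 1 * (a * (s * (1 / (s * m)))) := by
          gcongr
          linarith
      _ = a / m := by field_simp
  have hsu : |Real.sqrt u' - Real.sqrt u| ≤ Real.sqrt (A / κ) / (2 * m) := by
    have hκA : 0 < κ * A := by positivity
    have hru : Real.sqrt (κ * A) ≤ Real.sqrt u := Real.sqrt_le_sqrt h1
    have hru' : Real.sqrt (κ * A) ≤ Real.sqrt u' := Real.sqrt_le_sqrt h1'
    have hr0 := Real.sqrt_pos.mpr hκA
    have e : (Real.sqrt u' - Real.sqrt u) * (Real.sqrt u' + Real.sqrt u) = u' - u := by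
      have e1 := Real.sq_sqrt (show 0 ≤ u by linarith)
      have e1' := Real.sq_sqrt (show 0 ≤ u' by linarith)
      linear_combination e1' - e1
    have e2 : |Real.sqrt u' - Real.sqrt u| * (2 * Real.sqrt (κ * A)) ≤ a / m := by
      calc _ ≤ |Real.sqrt u' - Real.sqrt u| * |Real.sqrt u' + Real.sqrt u| := by
            gcongr; rw [abs_of_nonneg (by positivity)]; linarith
        _ = |u' - u| := by rw [← abs_mul, e]
        _ ≤ _ := hdu
    have e3 : Real.sqrt (A / κ) * Real.sqrt (κ * A) = A := by
      rw [← Real.sqrt_mul (by positivity), Real.sqrt_eq_iff_mul_self_eq (by positivity) hA.le]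
      field_simp
    have e4 : Real.sqrt (A / κ) / (2 * m) * (2 * Real.sqrt (κ * A)) = A / m := by
      calc _ = Real.sqrt (A / κ) * Real.sqrt (κ * A) / m := by ring
        _ = _ := by rw [e3]
    have e5 : a / m ≤ A / m := by gcongr
    exact le_of_mul_le_mul_right ((e2.trans e5).trans e4.ge) (by positivity)
  have hAκ : A ≤ A / κ := le_div_self hA.le hκ0 hκ1
  have hsu2 : Real.sqrt u' ≤ 3 / 2 * Real.sqrt (A / κ) := by
    rw [Real.sqrt_le_left (by positivity), mul_pow, Real.sq_sqrt (by positivity)]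
    linarith
  have hp74 : p / m ≤ (M : ℝ) ^ (-(7 / 4) : ℝ) := by
    have : p / m = (m : ℝ) ^ (-(7 / 4) : ℝ) := by
      rw [hp, ← Real.rpow_sub_one hm0.ne']; norm_num
    rw [this]
    exact Real.rpow_le_rpow_of_nonpos hM0 hMm' (by norm_num)
  have e : amplitude a A σ k (m + 1) - amplitude a A σ k m
      = (p' - p) * Real.sqrt u' + p * (Real.sqrt u' - Real.sqrt u) := by
    unfold amplitude; ring
  rw [e]
  calc _ ≤ |p' - p| * Real.sqrt u' + p * |Real.sqrt u' - Real.sqrt u| := by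
        refine (abs_add_le _ _).trans (le_of_eq ?_)
        rw [abs_mul, abs_mul, abs_of_pos hp0, abs_of_nonneg (Real.sqrt_nonneg u')]
    _ ≤ p / m * (3 / 2 * Real.sqrt (A / κ)) + p * (Real.sqrt (A / κ) / (2 * m)) := by
        gcongr
        rw [abs_sub_comm, abs_of_nonneg (by linarith)]; exact hdp
    _ = 2 * Real.sqrt (A / κ) * (p / m) := by field_simp; ring
    _ ≤ _ := by gcongr

/-- One dyadic block of squared lengths: partial summation in `m` removes the amplitude, and leaves
the row sums over `M ≤ m < x`, `x ≤ 2 M`. -/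
lemma norm_sum_block_le {a A σ κ : ℝ} (hκ0 : 0 < κ) (hκ1 : κ ≤ 1) (haA : a ≤ (1 - κ) * A)
    (hσ : |σ| ≤ 1) {M : ℕ} (hM : 1 ≤ M) (hMa : 8 * Real.sqrt M ≤ a) (W : Finset ℤ) {c : ℤ → ℂ}
    (hc : ∀ ν, ‖c ν‖ ≤ 1) {B : Finset (ℤ × ℤ)} (hB : ∀ ξ ∈ B, ξ ≠ 0) {d : ℤ × ℤ → ℂ}
    (hd : ∀ ξ, ‖d ξ‖ ≤ 1) :
    ‖∑ ξ ∈ B, d ξ * ((normSqNat ξ : ℝ) ^ (-(1 / 4) : ℝ) : ℝ) * ∑ ν ∈ W,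
      (if normSqNat ξ + ν.natAbs ^ 2 ∈ Finset.Ico M (2 * M) then
        c ν * (amplitude a A σ (normSqNat ξ) (normSqNat ξ + ν.natAbs ^ 2) : ℂ) *
          ee (a * Real.sqrt ((normSqNat ξ + ν.natAbs ^ 2 : ℕ))) else 0)‖
      ≤ 4 * 10 ^ 10 * Real.sqrt (A / κ) * (Nat.clog 2 (2 * M) + 1 : ℕ) ^ 3 *
        (a ^ (1 / 3 : ℝ) + (M : ℝ) ^ (1 / 4 : ℝ)) := by
  have hM0 : (0 : ℝ) < M := by exact_mod_cast hM
  have ha : 0 < a := lt_of_lt_of_le (by positivity) hMa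
  set L : ℕ := Nat.clog 2 (2 * M) + 1 with hL
  set G := 2 * Real.sqrt (A / κ) with hG
  have hG0 : 0 ≤ G := by positivity
  set D : ℝ := 10 ^ 10 * L ^ 3 * M ^ (1 / 4 : ℝ) *
        (a ^ (1 / 3 : ℝ) * M ^ (1 / 2 : ℝ) + M ^ (3 / 4 : ℝ)) with hD
  set w : ℤ × ℤ → ℝ := fun ξ => (normSqNat ξ : ℝ) ^ (-(1 / 4) : ℝ) with hw
  have hw0 : ∀ ξ, 0 ≤ w ξ := fun ξ => by positivity
  have hDx : ∀ x ≤ 2 * M, ∑ ξ ∈ B, w ξ * ‖rowSum a W c M x (normSqNat ξ)‖ ≤ D :=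
    fun x hx => sum_norm_rowSum_le hM hx hMa hc hB
  have hpt : ∀ ξ ∈ B, ‖d ξ * (w ξ : ℂ) * ∑ ν ∈ W,
      (if normSqNat ξ + ν.natAbs ^ 2 ∈ Finset.Ico M (2 * M) then
        c ν * (amplitude a A σ (normSqNat ξ) (normSqNat ξ + ν.natAbs ^ 2) : ℂ) *
          ee (a * Real.sqrt ((normSqNat ξ + ν.natAbs ^ 2 : ℕ))) else 0)‖ ≤
      G * (M : ℝ) ^ (-(3 / 4) : ℝ) * (w ξ * ‖rowSum a W c M (2 * M) (normSqNat ξ)‖) +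
        ∑ x ∈ Finset.Ico M (2 * M), G * (M : ℝ) ^ (-(7 / 4) : ℝ) *
          (w ξ * ‖rowSum a W c M (x + 1) (normSqNat ξ)‖) := by
    intro ξ hξ
    set k := normSqNat ξ
    have hk : 1 ≤ k := normSqNat_pos (hB ξ hξ)
    rw [sum_weight_mul_eq, norm_mul, norm_mul, Complex.norm_real, Real.norm_of_nonneg (hw0 ξ)]
    have h1 : ‖(amplitude a A σ k (2 * M) : ℂ) * rowSum a W c M (2 * M) k‖
        ≤ G * (M : ℝ) ^ (-(3 / 4) : ℝ) * ‖rowSum a W c M (2 * M) k‖ := by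
      rw [norm_mul, Complex.norm_real, Real.norm_eq_abs]
      rcases Nat.lt_or_ge (2 * M) k with h | h
      · rw [rowSum_eq_zero h.le]; simp
      · gcongr
        exact abs_amplitude_le ha hκ0 hκ1 haA hσ hM hk h (by omega)
    have h2 : ∀ x ∈ Finset.Ico M (2 * M),
        ‖((amplitude a A σ k (x + 1) - amplitude a A σ k x : ℝ) : ℂ) * rowSum a W c M (x + 1) k‖
        ≤ G * (M : ℝ) ^ (-(7 / 4) : ℝ) * ‖rowSum a W c M (x + 1) k‖ := by
      intro x hx
      rw [Finset.mem_Ico] at hx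
      rw [norm_mul, Complex.norm_real, Real.norm_eq_abs]
      rcases Nat.lt_or_ge x k with h | h
      · rw [rowSum_eq_zero h]; simp
      · gcongr
        exact abs_amplitude_succ_sub_le ha hκ0 hκ1 haA hσ hM hk h hx.1
    calc _ ≤ 1 * w ξ * (G * (M : ℝ) ^ (-(3 / 4) : ℝ) * ‖rowSum a W c M (2 * M) k‖ +
          ∑ x ∈ Finset.Ico M (2 * M), G * (M : ℝ) ^ (-(7 / 4) : ℝ) *
            ‖rowSum a W c M (x + 1) k‖) := by
          have := hw0 ξ
          gcongr
          · exact hd ξ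
          · refine (norm_sub_le _ _).trans (add_le_add h1 ?_)
            exact norm_sum_le_of_le _ h2
      _ = _ := by
          rw [mul_add, Finset.mul_sum]
          congr 1
          · ring
          · exact Finset.sum_congr rfl fun x _ => by ring
  calc _ ≤ _ := norm_sum_le_of_le _ hpt
    _ = G * (M : ℝ) ^ (-(3 / 4) : ℝ) * ∑ ξ ∈ B, w ξ * ‖rowSum a W c M (2 * M) (normSqNat ξ)‖ +
        ∑ x ∈ Finset.Ico M (2 * M), G * (M : ℝ) ^ (-(7 / 4) : ℝ) *
          ∑ ξ ∈ B, w ξ * ‖rowSum a W c M (x + 1) (normSqNat ξ)‖ := by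
        rw [Finset.sum_add_distrib, Finset.sum_comm]
        simp only [Finset.mul_sum]
    _ ≤ G * (M : ℝ) ^ (-(3 / 4) : ℝ) * D +
        ∑ x ∈ Finset.Ico M (2 * M), G * (M : ℝ) ^ (-(7 / 4) : ℝ) * D := by
        gcongr with x hx
        · exact hDx _ le_rfl
        · rw [Finset.mem_Ico] at hx
          exact hDx _ (by omega)
    _ = 2 * G * ((M : ℝ) ^ (-(3 / 4) : ℝ) * D) := by
        rw [Finset.sum_const, Nat.card_Ico, nsmul_eq_mul]
        have : (M : ℝ) ^ (-(3 / 4) : ℝ) = M * (M : ℝ) ^ (-(7 / 4) : ℝ) := by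
          nth_rewrite 2 [← Real.rpow_one (M : ℝ)]
          rw [← Real.rpow_add hM0]; norm_num
        rw [this, show 2 * M - M = M by omega]; ring
    _ = _ := by
        have e1 : (M : ℝ) ^ (-(3 / 4) : ℝ) * (M : ℝ) ^ (1 / 4 : ℝ) * (M : ℝ) ^ (1 / 2 : ℝ) = 1 := by
          rw [← Real.rpow_add hM0, ← Real.rpow_add hM0]; norm_num
        have e2 : (M : ℝ) ^ (-(3 / 4) : ℝ) * (M : ℝ) ^ (1 / 4 : ℝ) * (M : ℝ) ^ (3 / 4 : ℝ)
            = (M : ℝ) ^ (1 / 4 : ℝ) := by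
          rw [← Real.rpow_add hM0, ← Real.rpow_add hM0]; norm_num
        calc 2 * G * ((M : ℝ) ^ (-(3 / 4) : ℝ) * D)
            = 2 * G * (10 ^ 10 * L ^ 3) * (a ^ (1 / 3 : ℝ) * ((M : ℝ) ^ (-(3 / 4) : ℝ) *
              (M : ℝ) ^ (1 / 4 : ℝ) * (M : ℝ) ^ (1 / 2 : ℝ)) + (M : ℝ) ^ (-(3 / 4) : ℝ) *
              (M : ℝ) ^ (1 / 4 : ℝ) * (M : ℝ) ^ (3 / 4 : ℝ)) := by rw [hD]; ring
          _ = _ := by rw [e1, e2, hG]; ring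

/-- The exponential sum carrying the oscillatory part of the lattice point discrepancy,
over the box `|ξᵢ| ≤ X` of frequencies, by dyadic blocks in the squared length. -/
theorem norm_sum_box_le {a A σ κ : ℝ} (hκ0 : 0 < κ) (hκ1 : κ ≤ 1) (haA : a ≤ (1 - κ) * A)
    (hσ : |σ| ≤ 1) {X : ℕ} (hX : 1 ≤ X) (ha0 : 0 < a) (hXa : 192 * (X : ℝ) ^ 2 ≤ a ^ 2) {c : ℤ → ℂ}
    (hc : ∀ ν, ‖c ν‖ ≤ 1) {d : ℤ × ℤ → ℂ} (hd : ∀ ξ, ‖d ξ‖ ≤ 1) {B : Finset (ℤ × ℤ)}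
    (hB : ∀ ξ ∈ B, ξ ≠ 0 ∧ ξ.1.natAbs ≤ X ∧ ξ.2.natAbs ≤ X) {W : Finset ℤ}
    (hW : ∀ ν ∈ W, ν.natAbs ≤ X) :
    ‖∑ ξ ∈ B, d ξ * ((normSqNat ξ : ℝ) ^ (-(1 / 4) : ℝ) : ℝ) * ∑ ν ∈ W,
        c ν * (amplitude a A σ (normSqNat ξ) (normSqNat ξ + ν.natAbs ^ 2) : ℂ) *
          ee (a * Real.sqrt ((normSqNat ξ + ν.natAbs ^ 2 : ℕ)))‖
      ≤ 10 ^ 11 * Real.sqrt (A / κ) * (Nat.clog 2 (6 * X ^ 2) + 1 : ℕ) ^ 4 *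
        (a ^ (1 / 3 : ℝ) + (X : ℝ) ^ (1 / 2 : ℝ)) := by
  set T : ℤ × ℤ → ℤ → ℂ := fun ξ ν =>
    c ν * (amplitude a A σ (normSqNat ξ) (normSqNat ξ + ν.natAbs ^ 2) : ℂ) *
          ee (a * Real.sqrt ((normSqNat ξ + ν.natAbs ^ 2 : ℕ))) with hT
  set J := Nat.log 2 (3 * X ^ 2) + 1 with hJ
  set L : ℕ := Nat.clog 2 (6 * X ^ 2) + 1 with hL
  have hX0 : (1 : ℝ) ≤ X := by exact_mod_cast hX
  have hX2 : 1 ≤ X ^ 2 := Nat.one_le_pow _ _ hX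
  have hJL : J ≤ L := by
    have h1 : Nat.log 2 (3 * X ^ 2) ≤ Nat.clog 2 (3 * X ^ 2) := Nat.log_le_clog 2 _
    have h2 : Nat.clog 2 (3 * X ^ 2) ≤ Nat.clog 2 (6 * X ^ 2) := Nat.clog_mono_right 2 (by omega)
    omega
  have hsplit : ∀ ξ ∈ B, ∀ ν ∈ W, T ξ ν = ∑ j ∈ Finset.range J,
      if normSqNat ξ + ν.natAbs ^ 2 ∈ Finset.Ico (2 ^ j) (2 * 2 ^ j) then T ξ ν else 0 := by
    intro ξ hξ ν hν
    obtain ⟨h1, h2, h3⟩ := hB ξ hξ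
    have h4 := hW ν hν
    have h5 := normSqNat_pos h1
    set m := normSqNat ξ + ν.natAbs ^ 2 with hm
    have h6 : m ≤ 3 * X ^ 2 := by
      rw [hm]; unfold normSqNat
      have := Nat.pow_le_pow_left h2 2
      have := Nat.pow_le_pow_left h3 2
      have := Nat.pow_le_pow_left h4 2
      omega
    have h7 : ∀ j, m ∈ Finset.Ico (2 ^ j) (2 * 2 ^ j) ↔ Nat.log 2 m = j := by
      intro j
      rw [Finset.mem_Ico, Nat.log_eq_iff (Or.inr ⟨one_lt_two, by omega⟩), pow_succ, mul_comm 2]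
    simp only [h7]
    rw [Finset.sum_ite_eq, if_pos]
    rw [Finset.mem_range, hJ, Nat.lt_succ_iff]
    exact Nat.log_mono_right h6
  have hsum : ∑ ξ ∈ B, d ξ * ((normSqNat ξ : ℝ) ^ (-(1 / 4) : ℝ) : ℝ) * ∑ ν ∈ W, T ξ ν
      = ∑ j ∈ Finset.range J, ∑ ξ ∈ B, d ξ * ((normSqNat ξ : ℝ) ^ (-(1 / 4) : ℝ) : ℝ) * ∑ ν ∈ W,
        if normSqNat ξ + ν.natAbs ^ 2 ∈ Finset.Ico (2 ^ j) (2 * 2 ^ j) then T ξ ν else 0 := by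
    rw [Finset.sum_comm]
    refine Finset.sum_congr rfl fun ξ hξ => ?_
    rw [← Finset.mul_sum, Finset.sum_comm (s := Finset.range J)]
    congr 1
    exact Finset.sum_congr rfl fun ν hν => hsplit ξ hξ ν hν
  rw [hsum]
  have hblock : ∀ j ∈ Finset.range J, ‖∑ ξ ∈ B,
      d ξ * ((normSqNat ξ : ℝ) ^ (-(1 / 4) : ℝ) : ℝ) * ∑ ν ∈ W,
        if normSqNat ξ + ν.natAbs ^ 2 ∈ Finset.Ico (2 ^ j) (2 * 2 ^ j) then T ξ ν else 0‖
      ≤ 4 * 10 ^ 10 * Real.sqrt (A / κ) * (L : ℝ) ^ 3 *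
        (a ^ (1 / 3 : ℝ) + 2 * (X : ℝ) ^ (1 / 2 : ℝ)) := by
    intro j hj
    rw [Finset.mem_range, hJ, Nat.lt_succ_iff] at hj
    have hj3 : 2 ^ j ≤ 3 * X ^ 2 := by
      rw [← Nat.le_log_iff_pow_le one_lt_two (by omega)]; exact hj
    have hj3' : ((2 ^ j : ℕ) : ℝ) ≤ 3 * (X : ℝ) ^ 2 := by exact_mod_cast hj3
    have hsq : 8 * Real.sqrt ((2 ^ j : ℕ) : ℝ) ≤ a := by
      apply le_of_sq_le_sq _ ha0.le
      rw [mul_pow, Real.sq_sqrt (by positivity)]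
      linarith
    refine (norm_sum_block_le hκ0 hκ1 haA hσ Nat.one_le_two_pow hsq W hc (fun ξ hξ => (hB ξ hξ).1)
      hd).trans ?_
    have h1 : Nat.clog 2 (2 * 2 ^ j) + 1 ≤ L := by
      have := Nat.clog_mono_right 2 (show 2 * 2 ^ j ≤ 6 * X ^ 2 by omega)
      omega
    have h2 : ((2 ^ j : ℕ) : ℝ) ^ (1 / 4 : ℝ) ≤ 2 * (X : ℝ) ^ (1 / 2 : ℝ) := by
      calc ((2 ^ j : ℕ) : ℝ) ^ (1 / 4 : ℝ) ≤ (16 * (X : ℝ) ^ 2) ^ (1 / 4 : ℝ) := by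
            gcongr; nlinarith
        _ = 2 * (X : ℝ) ^ (1 / 2 : ℝ) := by
            rw [Real.mul_rpow (by norm_num) (by positivity), ← Real.rpow_natCast (X : ℝ),
              ← Real.rpow_mul (by positivity), show (16 : ℝ) = 2 ^ (4 : ℝ) by norm_num,
              ← Real.rpow_mul (by norm_num)]
            norm_num
    gcongr
  have hq := Real.sqrt_nonneg (A / κ)
  calc _ ≤ _ := norm_sum_le_of_le _ hblock
    _ = J * (4 * 10 ^ 10 * Real.sqrt (A / κ) * (L : ℝ) ^ 3 *
        (a ^ (1 / 3 : ℝ) + 2 * (X : ℝ) ^ (1 / 2 : ℝ))) := by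
        rw [Finset.sum_const, Finset.card_range, nsmul_eq_mul]
    _ ≤ L * (4 * 10 ^ 10 * Real.sqrt (A / κ) * (L : ℝ) ^ 3 *
        (2 * (a ^ (1 / 3 : ℝ) + (X : ℝ) ^ (1 / 2 : ℝ)))) := by
        have : 0 ≤ a ^ (1 / 3 : ℝ) := by positivity
        gcongr
        linarith
    _ = 8 * 10 ^ 10 * Real.sqrt (A / κ) * (L : ℝ) ^ 4 *
        (a ^ (1 / 3 : ℝ) + (X : ℝ) ^ (1 / 2 : ℝ)) := by ring
    _ ≤ _ := by gcongr; norm_num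

/-! ### Bessel functions -/

lemma besselJ_zero_eq (x : ℝ) :
    besselJ 0 x = (1 / Real.pi) * ∫ θ in (0 : ℝ)..Real.pi, Real.cos (x * Real.sin θ) := by
  unfold besselJ
  congr 1
  refine intervalIntegral.integral_congr fun θ _ => ?_
  simp

lemma integral_cos_mul_cos_mul_sin (x : ℝ) :
    ∫ θ in (0 : ℝ)..Real.pi, Real.cos θ * Real.cos (x * Real.sin θ) = 0 := by
  have h := intervalIntegral.integral_comp_sub_left
    (fun θ => Real.cos θ * Real.cos (x * Real.sin θ)) Real.pi (a := 0) (b := Real.pi)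
  simp only [Real.cos_pi_sub, Real.sin_pi_sub, sub_self, sub_zero, neg_mul,
    intervalIntegral.integral_neg] at h
  linarith

lemma besselJ_one_eq (x : ℝ) : besselJ 1 x =
    (1 / Real.pi) * ∫ θ in (0 : ℝ)..Real.pi, Real.sin θ * Real.sin (x * Real.sin θ) := by
  unfold besselJ
  congr 1
  have : ∀ θ : ℝ, Real.cos (((1 : ℤ) : ℝ) * θ - x * Real.sin θ)
      = Real.cos θ * Real.cos (x * Real.sin θ) + Real.sin θ * Real.sin (x * Real.sin θ) := by
    intro θ; rw [Int.cast_one, one_mul, Real.cos_sub]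
  simp only [this]
  rw [intervalIntegral.integral_add (Continuous.intervalIntegrable (by fun_prop) _ _)
    (Continuous.intervalIntegrable (by fun_prop) _ _), integral_cos_mul_cos_mul_sin, zero_add]

lemma integral_sin_mul_sin_eq (x : ℝ) :
    ∫ θ in (0 : ℝ)..Real.pi, Real.sin θ * Real.sin (x * Real.sin θ) =
      x * ∫ θ in (0 : ℝ)..Real.pi, Real.cos θ ^ 2 * Real.cos (x * Real.sin θ) := by
  have hd : ∀ θ ∈ Set.uIcc (0 : ℝ) Real.pi, HasDerivAt
      (fun θ => Real.cos θ * Real.sin (x * Real.sin θ))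
      (x * (Real.cos θ ^ 2 * Real.cos (x * Real.sin θ)) - Real.sin θ * Real.sin (x * Real.sin θ)) θ := by
    intro θ _
    have h1 := (Real.hasDerivAt_cos θ).fun_mul (((Real.hasDerivAt_sin θ).const_mul x).sin)
    exact h1.congr_deriv (by ring)
  have h := intervalIntegral.integral_eq_sub_of_hasDerivAt hd
    (Continuous.intervalIntegrable (by fun_prop) _ _)
  rw [intervalIntegral.integral_sub (Continuous.intervalIntegrable (by fun_prop) _ _)
    (Continuous.intervalIntegrable (by fun_prop) _ _), intervalIntegral.integral_const_mul] at h
  simp at h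
  linarith

lemma besselJ_one_eq_mul_integral (x : ℝ) : besselJ 1 x =
    x / Real.pi * ∫ θ in (0 : ℝ)..Real.pi, Real.cos θ ^ 2 * Real.cos (x * Real.sin θ) := by
  rw [besselJ_one_eq, integral_sin_mul_sin_eq]; ring

lemma hasDerivAt_integral_of_continuous {f f' : ℝ → ℝ → ℝ} (hf : ∀ x, Continuous (f x))
    (hf' : ∀ x, Continuous (f' x)) (hd : ∀ x θ, HasDerivAt (fun x => f x θ) (f' x θ) x)
    (hb : ∀ x θ, |f' x θ| ≤ 1) (x a b : ℝ) :
    HasDerivAt (fun x => ∫ θ in a..b, f x θ) (∫ θ in a..b, f' x θ) x := by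
  refine (intervalIntegral.hasDerivAt_integral_of_dominated_loc_of_deriv_le (μ := volume)
    (s := Set.univ) (bound := fun _ => 1) Filter.univ_mem
    (Filter.Eventually.of_forall fun x => (hf x).aestronglyMeasurable)
    ((hf x).intervalIntegrable _ _) (hf' x).aestronglyMeasurable
    (Filter.Eventually.of_forall fun θ _ x _ => hb x θ) intervalIntegrable_const
    (Filter.Eventually.of_forall fun θ _ x _ => hd x θ)).2

lemma hasDerivAt_besselJ_zero (x : ℝ) : HasDerivAt (besselJ 0) (-besselJ 1 x) x := by
  have h := (hasDerivAt_integral_of_continuous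
    (f := fun x θ => Real.cos (x * Real.sin θ))
    (f' := fun x θ => -(Real.sin θ * Real.sin (x * Real.sin θ))) (fun x => by fun_prop)
    (fun x => by fun_prop) (fun x θ => ?_) (fun x θ => ?_) x 0 Real.pi).const_mul (1 / Real.pi)
  · rw [intervalIntegral.integral_neg, mul_neg, ← besselJ_one_eq] at h
    exact h.congr_of_eventuallyEq (Filter.Eventually.of_forall besselJ_zero_eq)
  · exact (hasDerivAt_mul_const (Real.sin θ)).cos.congr_deriv (by ring)
  · rw [abs_neg, abs_mul]
    exact mul_le_one₀ (Real.abs_sin_le_one _) (abs_nonneg _) (Real.abs_sin_le_one _)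

lemma hasDerivAt_besselJ_one {x : ℝ} (hx : x ≠ 0) :
    HasDerivAt (besselJ 1) (besselJ 0 x - besselJ 1 x / x) x := by
  have h := (hasDerivAt_integral_of_continuous
    (f := fun x θ => Real.sin θ * Real.sin (x * Real.sin θ))
    (f' := fun x θ => Real.sin θ * (Real.sin θ * Real.cos (x * Real.sin θ))) (fun x => by fun_prop)
    (fun x => by fun_prop) (fun x θ => ?_) (fun x θ => ?_) x 0 Real.pi).const_mul (1 / Real.pi)
  · have e : besselJ 0 x - besselJ 1 x / x = 1 / Real.pi *
        ∫ θ in (0 : ℝ)..Real.pi, Real.sin θ * (Real.sin θ * Real.cos (x * Real.sin θ)) := by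
      rw [besselJ_zero_eq, besselJ_one_eq_mul_integral]
      have h2 : ∀ θ : ℝ, Real.sin θ * (Real.sin θ * Real.cos (x * Real.sin θ)) =
          Real.cos (x * Real.sin θ) - Real.cos θ ^ 2 * Real.cos (x * Real.sin θ) := by
        intro θ
        have := Real.sin_sq_add_cos_sq θ
        have h3 : Real.cos θ ^ 2 = 1 - Real.sin θ ^ 2 := by linarith
        rw [h3]; ring
      simp only [h2]
      rw [intervalIntegral.integral_sub (Continuous.intervalIntegrable (by fun_prop) _ _)
        (Continuous.intervalIntegrable (by fun_prop) _ _)]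
      field_simp
    rw [e]
    exact h.congr_of_eventuallyEq (Filter.Eventually.of_forall besselJ_one_eq)
  · exact ((hasDerivAt_mul_const (Real.sin θ)).sin.const_mul (Real.sin θ)).congr_deriv (by ring)
  · rw [abs_mul, abs_mul]
    exact mul_le_one₀ (Real.abs_sin_le_one _) (by positivity)
      (mul_le_one₀ (Real.abs_sin_le_one _) (abs_nonneg _) (Real.abs_cos_le_one _))

lemma continuous_besselJ_one : Continuous (besselJ 1) := by
  rw [continuous_iff_continuousAt]
  intro x
  have h := (hasDerivAt_integral_of_continuous
    (f := fun x θ => Real.sin θ * Real.sin (x * Real.sin θ))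
    (f' := fun x θ => Real.sin θ * (Real.sin θ * Real.cos (x * Real.sin θ))) (fun x => by fun_prop)
    (fun x => by fun_prop) (fun x θ => ?_) (fun x θ => ?_) x 0 Real.pi).const_mul (1 / Real.pi)
  · exact (h.congr_of_eventuallyEq (Filter.Eventually.of_forall besselJ_one_eq)).continuousAt
  · exact ((hasDerivAt_mul_const (Real.sin θ)).sin.const_mul (Real.sin θ)).congr_deriv (by ring)
  · rw [abs_mul, abs_mul]
    exact mul_le_one₀ (Real.abs_sin_le_one _) (by positivity)
      (mul_le_one₀ (Real.abs_sin_le_one _) (abs_nonneg _) (Real.abs_cos_le_one _))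

lemma abs_besselJ_le_one (k : ℤ) (x : ℝ) : |besselJ k x| ≤ 1 := by
  unfold besselJ
  have h := intervalIntegral.norm_integral_le_of_norm_le_const (a := 0) (b := Real.pi) (C := 1)
    (f := fun θ => Real.cos ((k : ℝ) * θ - x * Real.sin θ))
    (fun θ _ => by rw [Real.norm_eq_abs]; exact Real.abs_cos_le_one _)
  rw [Real.norm_eq_abs, sub_zero, abs_of_pos Real.pi_pos, one_mul] at h
  rw [abs_mul, abs_of_pos (by positivity : 0 < 1 / Real.pi)]
  calc _ ≤ 1 / Real.pi * Real.pi := by gcongr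
    _ = 1 := by field_simp

/-- `√x (J₀(x) + i J₁(x))`, which is asymptotic to a multiple of `exp (i x)`. -/
noncomputable def besselW (x : ℝ) : ℂ := Real.sqrt x * (besselJ 0 x + besselJ 1 x * Complex.I)

lemma hasDerivAt_besselW {x : ℝ} (hx : 0 < x) : HasDerivAt besselW
    (Complex.I * besselW x + (starRingEnd ℂ) (besselW x) / (2 * x)) x := by
  have h0 := (hasDerivAt_besselJ_zero x).ofReal_comp
  have h1 := ((hasDerivAt_besselJ_one hx.ne').ofReal_comp).mul_const Complex.I
  have hs := (Real.hasDerivAt_sqrt hx.ne').ofReal_comp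
  have h := hs.fun_mul (h0.fun_add h1)
  refine h.congr_deriv ?_
  unfold besselW
  have hs2 : (Real.sqrt x : ℂ) ^ 2 = x := by
    rw [← Complex.ofReal_pow, Real.sq_sqrt hx.le]
  have hs0 : (Real.sqrt x : ℂ) ≠ 0 := by exact_mod_cast (Real.sqrt_pos.mpr hx).ne'
  simp only [map_mul, map_add, Complex.conj_ofReal, Complex.conj_I]
  push_cast
  have hI := Complex.I_sq
  set s : ℂ := (Real.sqrt x : ℂ)
  rw [← hs2]
  field_simp
  linear_combination (-2 * s ^ 2 * besselJ 1 x) * hI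

/-- Energy estimate: `u² + v² - u v / x` is nearly conserved, where `w = u + i v`. -/
lemma exists_norm_besselW_le : ∃ K : ℝ, 0 < K ∧ ∀ x : ℝ, 1 ≤ x → ‖besselW x‖ ≤ K := by
  set u : ℝ → ℝ := fun x => (besselW x).re with hu
  set v : ℝ → ℝ := fun x => (besselW x).im with hv
  have hdu : ∀ x, 0 < x → HasDerivAt u (-v x + u x / (2 * x)) x := by
    intro x hx
    have h := (hasDerivAt_besselW hx)
    have h2 := (Complex.reCLM.hasFDerivAt.comp_hasDerivAt x h)
    refine h2.congr_deriv ?_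
    have e : (2 * (x : ℂ)) = ((2 * x : ℝ) : ℂ) := by push_cast; ring
    have e2 : ((starRingEnd ℂ) (besselW x) / (2 * (x : ℂ))).re = (besselW x).re / (2 * x) := by
      rw [e, Complex.div_ofReal_re, Complex.conj_re]
    simp only [Complex.reCLM_apply, Complex.add_re, e2, Complex.I_mul_re, hu, hv]
  have hdv : ∀ x, 0 < x → HasDerivAt v (u x - v x / (2 * x)) x := by
    intro x hx
    have h := (hasDerivAt_besselW hx)
    have h2 := (Complex.imCLM.hasFDerivAt.comp_hasDerivAt x h)
    refine h2.congr_deriv ?_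
    have e : (2 * (x : ℂ)) = ((2 * x : ℝ) : ℂ) := by push_cast; ring
    have e2 : ((starRingEnd ℂ) (besselW x) / (2 * (x : ℂ))).im = -(besselW x).im / (2 * x) := by
      rw [e, Complex.div_ofReal_im, Complex.conj_im]
    simp only [Complex.imCLM_apply, Complex.add_im, e2, Complex.I_mul_im, hu, hv]
    ring
  set E : ℝ → ℝ := fun x => (u x ^ 2 + v x ^ 2 - u x * v x / x) * Real.exp (1 / x) with hE
  have hdE : ∀ x, 0 < x → HasDerivAt E (Real.exp (1 / x) * (u x * v x / x ^ 2 -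
      (u x ^ 2 + v x ^ 2 - u x * v x / x) / x ^ 2)) x := by
    intro x hx
    have h1 := (((hdu x hx).fun_pow 2).fun_add ((hdv x hx).fun_pow 2)).fun_sub
      (((hdu x hx).fun_mul (hdv x hx)).fun_div (hasDerivAt_id x) hx.ne')
    have h2 := ((hasDerivAt_id x).fun_inv hx.ne').exp
    have h3 := h1.fun_mul h2
    simp only [id, ← one_div] at h3
    refine h3.congr_deriv ?_
    field_simp
    ring
  have hE1 : ∀ x, 1 ≤ x → E x ≤ E 1 := by
    intro x hx
    have hanti : AntitoneOn E (Set.Ici 1) := by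
      apply antitoneOn_of_hasDerivWithinAt_nonpos (convex_Ici 1)
        (fun y hy => (hdE y (by linarith [Set.mem_Ici.mp hy])).continuousAt.continuousWithinAt)
        (fun y hy => (hdE y ?_).hasDerivWithinAt)
      · intro y hy
        rw [interior_Ici, Set.mem_Ioi] at hy
        have hy0 : 0 < y := by linarith
        apply mul_nonpos_of_nonneg_of_nonpos (Real.exp_pos _).le
        rw [← sub_div]
        apply div_nonpos_of_nonpos_of_nonneg _ (by positivity)
        have h4 : |u y * v y / y| ≤ |u y * v y| := by
          rw [abs_div, abs_of_pos hy0]; exact div_le_self (abs_nonneg _) hy.le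
        have h5 := (abs_le.mp h4).2
        have h6 : |u y * v y| ≤ (u y ^ 2 + v y ^ 2) / 2 := by
          rw [abs_le]; constructor <;> nlinarith [sq_nonneg (u y - v y), sq_nonneg (u y + v y)]
        have h7 := le_abs_self (u y * v y)
        linarith
      · rw [interior_Ici, Set.mem_Ioi] at hy; linarith
    exact hanti (Set.mem_Ici.mpr le_rfl) (Set.mem_Ici.mpr hx) hx
  have hsq : ∀ x, 1 ≤ x → ‖besselW x‖ ^ 2 ≤ 2 * E 1 := by
    intro x hx
    have hx0 : 0 < x := by linarith
    have h1 : ‖besselW x‖ ^ 2 = u x ^ 2 + v x ^ 2 := by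
      rw [Complex.sq_norm, Complex.normSq_apply]; simp only [hu, hv]; ring
    have h4 : |u x * v x / x| ≤ |u x * v x| := by
      rw [abs_div, abs_of_pos hx0]; exact div_le_self (abs_nonneg _) hx
    have h5 := (abs_le.mp h4).2
    have h6 : |u x * v x| ≤ (u x ^ 2 + v x ^ 2) / 2 := by
      rw [abs_le]; constructor <;> nlinarith [sq_nonneg (u x - v x), sq_nonneg (u x + v x)]
    have h7 : (u x ^ 2 + v x ^ 2) / 2 ≤ E x := by
      have h8 : (u x ^ 2 + v x ^ 2) / 2 ≤ u x ^ 2 + v x ^ 2 - u x * v x / x := by linarith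
      have h9 : 1 ≤ Real.exp (1 / x) := Real.one_le_exp (by positivity)
      calc _ ≤ (u x ^ 2 + v x ^ 2 - u x * v x / x) * 1 := by linarith
        _ ≤ _ := by
          apply mul_le_mul_of_nonneg_left h9
          have : 0 ≤ (u x ^ 2 + v x ^ 2) / 2 := by positivity
          linarith
    rw [h1]; linarith [hE1 x hx]
  refine ⟨Real.sqrt (2 * E 1) + 1, by positivity, fun x hx => ?_⟩
  have := Real.le_sqrt_of_sq_le (hsq x hx)
  linarith

/-- Asymptotic expansion of the Bessel functions of orders zero and one. -/
theorem exists_besselW_asymptotic : ∃ (b : ℂ) (K : ℝ), 0 < K ∧ ∀ x : ℝ, 1 ≤ x →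
    ‖besselW x - b * Complex.exp (x * Complex.I)‖ ≤ K / x := by
  obtain ⟨K, hK, hb⟩ := exists_norm_besselW_le
  set Z : ℝ → ℂ := fun x => Complex.exp (-(x * Complex.I)) *
    (besselW x - Complex.I / (4 * x) * (starRingEnd ℂ) (besselW x)) with hZ
  set Z' : ℝ → ℂ := fun x => Complex.exp (-(x * Complex.I)) *
    (Complex.I / (4 * x ^ 2) * (starRingEnd ℂ) (besselW x) - Complex.I / (8 * x ^ 2) * besselW x)
  have hdZ : ∀ x, 0 < x → HasDerivAt Z (Z' x) x := by
    intro x hx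
    have hx0 : (x : ℂ) ≠ 0 := by exact_mod_cast hx.ne'
    have hw := hasDerivAt_besselW hx
    have hcw := hw.star
    have hid : HasDerivAt (fun y : ℝ => (y : ℂ)) 1 x := (hasDerivAt_id x).ofReal_comp
    have h4 := (hid.const_mul (4 : ℂ))
    have hq := (hasDerivAt_const x Complex.I).fun_div h4 (by simpa using hx.ne')
    have he := ((hid.mul_const Complex.I).fun_neg).cexp
    have h := he.fun_mul (hw.fun_sub (hq.fun_mul hcw))
    refine h.congr_deriv ?_
    simp only [Z', star_add, star_mul', Complex.star_def, map_div₀, Complex.conj_conj, map_mul,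
      Complex.conj_I, Complex.conj_ofReal, map_ofNat]
    have hI := Complex.I_sq
    set e := Complex.exp (-(x * Complex.I))
    set w := besselW x
    set cw := (starRingEnd ℂ) w
    field_simp
    linear_combination (32 * e * x * cw) * hI
  have hb' : ∀ x, 1 ≤ x → ‖Z' x‖ ≤ K / x ^ 2 := by
    intro x hx
    have hx0 : 0 < x := by linarith
    have h1 := hb x hx
    have e : ‖Complex.exp (-(x * Complex.I))‖ = 1 := by
      have : -((x : ℂ) * Complex.I) = ((-x : ℝ) : ℂ) * Complex.I := by push_cast; ring
      rw [this, Complex.norm_exp_ofReal_mul_I]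
    simp only [Z', norm_mul, e, one_mul]
    refine (norm_sub_le _ _).trans ?_
    simp only [norm_mul, norm_div, norm_pow, Complex.norm_I, RCLike.norm_conj, Complex.norm_real,
      Real.norm_eq_abs, abs_of_pos hx0, Complex.norm_ofNat]
    calc _ = (3 / 8) * ‖besselW x‖ / x ^ 2 := by field_simp; ring
      _ ≤ K / x ^ 2 := by
        gcongr
        nlinarith [norm_nonneg (besselW x)]
  have hdiff : ∀ x y, 1 ≤ x → x ≤ y → ‖Z y - Z x‖ ≤ K / x - K / y := by
    intro x y hx hxy
    have hx0 : 0 < x := by linarith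
    have h := image_norm_le_of_norm_deriv_right_le_deriv_boundary' (a := x) (b := y)
      (f := fun t => Z t - Z x) (f' := Z') (B := fun t => K / x - K / t) (B' := fun t => K / t ^ 2)
      (fun t ht => ((hdZ t (by linarith [ht.1])).continuousAt.sub
        continuousAt_const).continuousWithinAt)
      (fun t ht => ((hdZ t (by linarith [ht.1])).sub_const _).hasDerivWithinAt) (by simp)
      (fun t ht => by
        have : t ≠ 0 := by linarith [ht.1]
        exact (by fun_prop (disch := assumption) :
          ContinuousAt (fun t => K / x - K / t) t).continuousWithinAt)
      (fun t ht => by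
        have : t ≠ 0 := by linarith [ht.1]
        have h1 := ((hasDerivAt_const t (K / x)).fun_sub ((hasDerivAt_const t K).fun_div
          (hasDerivAt_id t) this))
        refine (h1.congr_deriv ?_).hasDerivWithinAt
        simp only [id]; ring)
      (fun t ht => hb' t (hx.trans ht.1))
    exact h (Set.right_mem_Icc.mpr hxy)
  have hcau : CauchySeq fun n : ℕ => Z (n + 1) := by
    refine cauchySeq_of_le_tendsto_0 (fun n : ℕ => K / (n + 1)) (fun n m N hn hm => ?_) ?_
    · have key : ∀ n m : ℕ, N ≤ n → n ≤ m → dist (Z (n + 1)) (Z (m + 1)) ≤ K / (N + 1) := by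
        intro n m hn hnm
        have hn' : (N : ℝ) ≤ n := by exact_mod_cast hn
        have hnm' : (n : ℝ) ≤ m := by exact_mod_cast hnm
        rw [dist_comm, dist_eq_norm]
        refine (hdiff (n + 1) (m + 1) (by linarith [Nat.cast_nonneg (α := ℝ) n])
          (by linarith)).trans ?_
        have h1 : 0 ≤ K / ((m : ℝ) + 1) := by positivity
        have h2 : K / ((n : ℝ) + 1) ≤ K / (N + 1) := by gcongr
        linarith
      rcases le_total n m with h | h
      · exact key n m hn h
      · rw [dist_comm]; exact key m n hm h
    · have := tendsto_one_div_add_atTop_nhds_zero_nat (𝕜 := ℝ)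
      have := this.const_mul K
      simpa [div_eq_mul_inv] using this
  obtain ⟨b, hlim⟩ := cauchySeq_tendsto_of_complete hcau
  refine ⟨b, 2 * K, by positivity, fun x hx => ?_⟩
  have hx0 : 0 < x := by linarith
  have h1 : ‖b - Z x‖ ≤ K / x := by
    refine le_of_tendsto ((hlim.sub_const (Z x)).norm) ?_
    filter_upwards [Filter.eventually_ge_atTop ⌈x⌉₊] with n hn
    have hn' : x ≤ n := (Nat.le_ceil x).trans (by exact_mod_cast hn)
    refine (hdiff x (n + 1) hx (by linarith)).trans ?_
    have : 0 ≤ K / ((n : ℝ) + 1) := by positivity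
    linarith
  have e : ‖Complex.exp (x * Complex.I)‖ = 1 := Complex.norm_exp_ofReal_mul_I x
  have h2 : besselW x - b * Complex.exp (x * Complex.I) =
      (Z x - b) * Complex.exp (x * Complex.I)
        + Complex.I / (4 * x) * (starRingEnd ℂ) (besselW x) := by
    have : Complex.exp (-(x * Complex.I)) * Complex.exp (x * Complex.I) = 1 := by
      rw [← Complex.exp_add]; simp
    simp only [hZ]
    linear_combination (-(besselW x) + Complex.I / (4 * x) * (starRingEnd ℂ) (besselW x)) * this
  rw [h2]
  refine (norm_add_le _ _).trans ?_
  rw [norm_mul, e, mul_one, norm_sub_rev]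
  have h3 : ‖Complex.I / (4 * x) * (starRingEnd ℂ) (besselW x)‖ ≤ K / x := by
    simp only [norm_mul, norm_div, Complex.norm_I, RCLike.norm_conj, Complex.norm_real,
      Real.norm_eq_abs, abs_of_pos hx0, Complex.norm_ofNat]
    have := hb x hx
    calc _ = (1 / 4) * ‖besselW x‖ / x := by field_simp
      _ ≤ K / x := by gcongr; nlinarith [norm_nonneg (besselW x)]
  calc _ ≤ K / x + K / x := add_le_add h1 h3
    _ = _ := by ring

/-- Decay of the Bessel functions of orders zero and one on the whole half-line. -/
lemma exists_norm_bessel_le : ∃ K : ℝ, 0 < K ∧ ∀ x : ℝ, 0 < x →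
    |besselJ 0 x| ≤ K / Real.sqrt x ∧ |besselJ 1 x| ≤ K / Real.sqrt x := by
  obtain ⟨K, hK, hb⟩ := exists_norm_besselW_le
  refine ⟨K + 1, by positivity, fun x hx => ?_⟩
  have hs0 := Real.sqrt_pos.mpr hx
  rcases le_total 1 x with h | h
  · have h1 := hb x h
    unfold besselW at h1
    rw [norm_mul, Complex.norm_real, Real.norm_of_nonneg hs0.le] at h1
    have h2 := Complex.abs_re_le_norm (besselJ 0 x + besselJ 1 x * Complex.I)
    have h3 := Complex.abs_im_le_norm (besselJ 0 x + besselJ 1 x * Complex.I)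
    simp at h2 h3
    constructor <;> rw [le_div_iff₀ hs0] <;> nlinarith
  · have hs1 : Real.sqrt x ≤ 1 := Real.sqrt_le_one.mpr h
    have h2 : 1 ≤ (K + 1) / Real.sqrt x := by rw [le_div_iff₀ hs0]; linarith
    exact ⟨(abs_besselJ_le_one 0 x).trans h2, (abs_besselJ_le_one 1 x).trans h2⟩

/-! ### Stationary phase on the circle -/

lemma hasDerivAt_ee_mul_cos (σ γ : ℝ) : HasDerivAt (fun γ => ee (σ * Real.cos γ))
    (-(2 * Real.pi * Complex.I * σ * Real.sin γ) * ee (σ * Real.cos γ)) γ := by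
  have h := (hasDerivAt_ee (σ * Real.cos γ)).scomp γ ((Real.hasDerivAt_cos γ).const_mul σ)
  refine h.congr_deriv ?_
  rw [Complex.real_smul]; push_cast; ring

lemma abs_le_of_abs_deriv_le {f f' : ℝ → ℝ} {D : ℝ} (hf : ∀ x, HasDerivAt f (f' x) x)
    (hD : ∀ x, |f' x| ≤ D) (x y : ℝ) : |f y - f x| ≤ D * |y - x| :=
  (convex_univ (𝕜 := ℝ)).norm_image_sub_le_of_norm_hasDerivWithin_le (f := f) (f' := f')
    (fun x _ => (hf x).hasDerivWithinAt) (fun x _ => hD x) (Set.mem_univ x) (Set.mem_univ y)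

/-- An amplitude vanishing at the stationary point of the phase: one quarter of the circle. -/
lemma norm_integral_quarter_le {f f' : ℝ → ℝ} {D N σ : ℝ} (hN : 1 ≤ N)
    (hf : ∀ x, HasDerivAt f (f' x) x) (hf' : Continuous f') (hD : ∀ x, |f' x| ≤ D) (h0 : f 0 = 0)
    (hσ : |σ| = N) :
    ‖∫ γ in (0 : ℝ)..(Real.pi / 2), (f γ : ℂ) * ee (σ * Real.cos γ)‖
      ≤ 3 * D * (1 + Real.log N) / N := by
  have hN0 : 0 < N := by linarith
  have hlog := Real.log_nonneg hN
  have hpi := Real.pi_gt_three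
  have hpi' := Real.pi_lt_d2
  have hD0 : 0 ≤ D := (abs_nonneg _).trans (hD 0)
  have hfc : Continuous f := continuous_iff_continuousAt.mpr fun x => (hf x).continuousAt
  have hfx : ∀ x, 0 ≤ x → |f x| ≤ D * x := by
    intro x hx
    have := abs_le_of_abs_deriv_le hf hD 0 x
    rwa [h0, sub_zero, sub_zero, abs_of_nonneg hx] at this
  have hσ0 : σ ≠ 0 := by rintro rfl; rw [abs_zero] at hσ; linarith
  set η := 1 / N with hη
  have hη0 : 0 < η := by positivity
  have hη1 : η ≤ 1 := by rw [hη, div_le_one hN0]; exact hN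
  have hcont : Continuous fun γ => (f γ : ℂ) * ee (σ * Real.cos γ) := by fun_prop
  rw [← intervalIntegral.integral_add_adjacent_intervals (b := η) (hcont.intervalIntegrable _ _)
    (hcont.intervalIntegrable _ _)]
  have h1 : ‖∫ γ in (0 : ℝ)..η, (f γ : ℂ) * ee (σ * Real.cos γ)‖ ≤ D / N := by
    have := intervalIntegral.norm_integral_le_of_norm_le_const (a := 0) (b := η) (C := D)
      (f := fun γ => (f γ : ℂ) * ee (σ * Real.cos γ)) (fun γ hγ => by
        rw [Set.uIoc_of_le hη0.le] at hγ
        rw [norm_mul, norm_ee, mul_one, Complex.norm_real, Real.norm_eq_abs]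
        refine (hfx γ hγ.1.le).trans ?_
        nlinarith [hγ.2])
    rw [sub_zero, abs_of_pos hη0] at this
    refine this.trans (le_of_eq ?_)
    rw [hη]; ring
  set g' : ℝ → ℝ := fun γ => (f' γ * Real.sin γ - f γ * Real.cos γ) / Real.sin γ ^ 2 with hg'
  have hsin : ∀ γ ∈ Set.Icc η (Real.pi / 2), 0 < Real.sin γ := fun γ hγ =>
    Real.sin_pos_of_pos_of_lt_pi (hη0.trans_le hγ.1) (by linarith [hγ.2])
  have hIcc : Set.uIcc η (Real.pi / 2) = Set.Icc η (Real.pi / 2) := Set.uIcc_of_le (by linarith)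
  have hG : ∀ γ ∈ Set.uIcc η (Real.pi / 2), HasDerivAt
      (fun γ => ((f γ / Real.sin γ : ℝ) : ℂ) * ee (σ * Real.cos γ))
      ((g' γ : ℂ) * ee (σ * Real.cos γ) - 2 * Real.pi * Complex.I * σ *
        ((f γ : ℂ) * ee (σ * Real.cos γ))) γ := by
    intro γ hγ
    rw [hIcc] at hγ
    have hs := (hsin γ hγ).ne'
    have hs' : (Real.sin γ : ℂ) ≠ 0 := by exact_mod_cast hs
    have h := (((hf γ).fun_div (Real.hasDerivAt_sin γ) hs).ofReal_comp).fun_mul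
      (hasDerivAt_ee_mul_cos σ γ)
    refine h.congr_deriv ?_
    simp only [hg']
    have e : ((f γ / Real.sin γ : ℝ) : ℂ) * Real.sin γ = f γ := by
      rw [← Complex.ofReal_mul, div_mul_cancel₀ _ hs]
    linear_combination (-(2 * Real.pi * Complex.I * σ) * ee (σ * Real.cos γ)) * e
  have hg'c : ContinuousOn g' (Set.uIcc η (Real.pi / 2)) := by
    rw [hIcc]
    refine ContinuousOn.div (by fun_prop) (by fun_prop) fun γ hγ => ?_
    have := hsin γ hγ
    positivity
  have hi1 : IntervalIntegrable (fun γ => (g' γ : ℂ) * ee (σ * Real.cos γ)) volume η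
      (Real.pi / 2) := by
    apply ContinuousOn.intervalIntegrable
    exact (Complex.continuous_ofReal.comp_continuousOn hg'c).mul (by fun_prop)
  have hi2 : IntervalIntegrable (fun γ => 2 * Real.pi * Complex.I * σ *
      ((f γ : ℂ) * ee (σ * Real.cos γ))) volume η (Real.pi / 2) :=
    (hcont.intervalIntegrable _ _).const_mul _
  have hFTC := intervalIntegral.integral_eq_sub_of_hasDerivAt hG (hi1.sub hi2)
  rw [intervalIntegral.integral_sub hi1 hi2, intervalIntegral.integral_const_mul] at hFTC
  set I2 := ∫ γ in η..(Real.pi / 2), (f γ : ℂ) * ee (σ * Real.cos γ) with hI2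
  have hg'b : ‖∫ γ in η..(Real.pi / 2), (g' γ : ℂ) * ee (σ * Real.cos γ)‖
      ≤ 5 * D * (1 + Real.log N) := by
    have hb : ∀ γ ∈ Set.Ioc η (Real.pi / 2), ‖(g' γ : ℂ) * ee (σ * Real.cos γ)‖
        ≤ 5 * D * (1 / γ) := by
      intro γ hγ
      have hγ0 : 0 < γ := hη0.trans hγ.1
      have hs := hsin γ ⟨hγ.1.le, hγ.2⟩
      have hs1 : 2 / Real.pi * γ ≤ Real.sin γ := Real.mul_le_sin hγ0.le hγ.2
      have hs2 : Real.sin γ ≤ γ := Real.sin_le hγ0.le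
      rw [norm_mul, norm_ee, mul_one, Complex.norm_real, Real.norm_eq_abs, hg', abs_div,
        abs_of_pos (show 0 < Real.sin γ ^ 2 by positivity)]
      have hnum : |f' γ * Real.sin γ - f γ * Real.cos γ| ≤ 2 * D * γ := by
        refine (abs_sub _ _).trans ?_
        rw [abs_mul, abs_mul, abs_of_pos hs]
        have a1 : |f' γ| * Real.sin γ ≤ D * γ := mul_le_mul (hD γ) hs2 hs.le hD0
        have a2 : |f γ| * |Real.cos γ| ≤ D * γ * 1 :=
          mul_le_mul (hfx γ hγ0.le) (Real.abs_cos_le_one _) (abs_nonneg _) (by positivity)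
        linarith
      have hden : (2 / Real.pi * γ) ^ 2 ≤ Real.sin γ ^ 2 := by gcongr
      calc _ ≤ 2 * D * γ / (2 / Real.pi * γ) ^ 2 := by gcongr
        _ = (Real.pi ^ 2 / 2) * D * (1 / γ) := by field_simp
        _ ≤ 5 * D * (1 / γ) := by gcongr; nlinarith
    have := intervalIntegral.norm_integral_le_of_norm_le (μ := volume) (a := η) (b := Real.pi / 2)
      (g := fun γ => 5 * D * (1 / γ)) (by linarith) (Filter.Eventually.of_forall hb)
      (ContinuousOn.intervalIntegrable (by
        rw [hIcc]
        refine ContinuousOn.mul continuousOn_const (continuousOn_const.div continuousOn_id ?_)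
        intro γ hγ; exact (hη0.trans_le hγ.1).ne'))
    refine this.trans ?_
    rw [intervalIntegral.integral_const_mul, integral_one_div_of_pos hη0 (by linarith)]
    gcongr
    have e : Real.pi / 2 / η = (Real.pi / 2) * N := by rw [hη]; field_simp
    rw [e, Real.log_mul (by positivity) hN0.ne']
    have := Real.log_le_sub_one_of_pos (show 0 < Real.pi / 2 by positivity)
    linarith
  have hbd : ∀ γ ∈ Set.Icc η (Real.pi / 2),
      ‖((f γ / Real.sin γ : ℝ) : ℂ) * ee (σ * Real.cos γ)‖ ≤ 2 * D := by
    intro γ hγ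
    have hγ0 : 0 < γ := hη0.trans_le hγ.1
    have hs := hsin γ hγ
    have hs1 : 2 / Real.pi * γ ≤ Real.sin γ := Real.mul_le_sin hγ0.le hγ.2
    rw [norm_mul, norm_ee, mul_one, Complex.norm_real, Real.norm_eq_abs, abs_div, abs_of_pos hs,
      div_le_iff₀ hs]
    refine (hfx γ hγ0.le).trans ?_
    have : γ ≤ 2 * Real.sin γ := by
      calc γ = Real.pi / 2 * (2 / Real.pi * γ) := by field_simp
        _ ≤ 2 * Real.sin γ := by gcongr; linarith
    nlinarith
  have hI2b : ‖I2‖ ≤ (5 * D * (1 + Real.log N) + (2 * D + 2 * D)) / (2 * Real.pi * N) := by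
    rw [le_div_iff₀ (by positivity)]
    have hn : ‖2 * Real.pi * Complex.I * σ * I2‖ = ‖I2‖ * (2 * Real.pi * N) := by
      simp only [norm_mul, Complex.norm_I, Complex.norm_real, Complex.norm_ofNat, Real.norm_eq_abs,
        hσ, abs_of_pos Real.pi_pos]
      ring
    rw [← hn]
    have e : 2 * Real.pi * Complex.I * σ * I2 =
        (∫ γ in η..(Real.pi / 2), (g' γ : ℂ) * ee (σ * Real.cos γ)) -
        (((f (Real.pi / 2) / Real.sin (Real.pi / 2) : ℝ) : ℂ) * ee (σ * Real.cos (Real.pi / 2)) -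
          ((f η / Real.sin η : ℝ) : ℂ) * ee (σ * Real.cos η)) := by
      rw [← hFTC]; ring
    rw [e]
    refine (norm_sub_le _ _).trans (add_le_add hg'b ((norm_sub_le _ _).trans (add_le_add ?_ ?_)))
    · exact hbd _ ⟨by linarith, le_rfl⟩
    · exact hbd _ ⟨le_rfl, by linarith⟩
  calc _ ≤ D / N + (5 * D * (1 + Real.log N) + (2 * D + 2 * D)) / (2 * Real.pi * N) :=
        (norm_add_le _ _).trans (add_le_add h1 hI2b)
    _ ≤ D / N + (5 * D * (1 + Real.log N) + (2 * D + 2 * D)) / (2 * 3 * N) := by gcongr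
    _ = (D + (5 * D * (1 + Real.log N) + 4 * D) / 6) / N := by field_simp; ring
    _ ≤ _ := by
        gcongr
        nlinarith

lemma integral_circle_split {h : ℝ → ℂ} (hh : Continuous h) :
    ∫ γ in (0 : ℝ)..(2 * Real.pi), h γ =
      (∫ γ in (0 : ℝ)..(Real.pi / 2), h γ) + (∫ γ in (0 : ℝ)..(Real.pi / 2), h (Real.pi - γ)) +
      (∫ γ in (0 : ℝ)..(Real.pi / 2), h (Real.pi + γ)) +
      ∫ γ in (0 : ℝ)..(Real.pi / 2), h (2 * Real.pi - γ) := by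
  have hi : ∀ a b, IntervalIntegrable h volume a b := fun a b => hh.intervalIntegrable a b
  rw [intervalIntegral.integral_comp_sub_left (f := h), intervalIntegral.integral_comp_add_left
    (f := h), intervalIntegral.integral_comp_sub_left (f := h)]
  have e1 : Real.pi - Real.pi / 2 = Real.pi / 2 := by ring
  have e2 : Real.pi + Real.pi / 2 = 2 * Real.pi - Real.pi / 2 := by ring
  rw [e1, e2, sub_zero, add_zero, sub_zero,
    intervalIntegral.integral_add_adjacent_intervals (hi _ _) (hi _ _),
    intervalIntegral.integral_add_adjacent_intervals (hi _ _) (hi _ _),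
    intervalIntegral.integral_add_adjacent_intervals (hi _ _) (hi _ _)]

lemma ee_re (x : ℝ) : (ee x).re = Real.cos (2 * Real.pi * x) := by
  rw [ee_eq, Complex.exp_ofReal_mul_I_re]

lemma ee_im (x : ℝ) : (ee x).im = Real.sin (2 * Real.pi * x) := by
  rw [ee_eq, Complex.exp_ofReal_mul_I_im]

lemma integral_comp_sin_zero_pi {G : ℝ → ℂ} (hG : Continuous G) :
    ∫ θ in (0 : ℝ)..Real.pi, G (Real.sin θ) = 2 * ∫ θ in (0 : ℝ)..(Real.pi / 2), G (Real.sin θ) := by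
  have hc : Continuous fun θ => G (Real.sin θ) := by fun_prop
  have h := intervalIntegral.integral_comp_sub_left (fun θ => G (Real.sin θ)) Real.pi
    (a := 0) (b := Real.pi / 2)
  simp only [Real.sin_pi_sub] at h
  rw [show Real.pi - Real.pi / 2 = Real.pi / 2 by ring, sub_zero] at h
  rw [← intervalIntegral.integral_add_adjacent_intervals (b := Real.pi / 2)
    (hc.intervalIntegrable _ _) (hc.intervalIntegrable _ _), ← h]
  ring

lemma integral_comp_cos_circle {H : ℝ → ℂ} (hH : Continuous H) :
    ∫ γ in (0 : ℝ)..(2 * Real.pi), H (Real.cos γ) =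
      ∫ θ in (0 : ℝ)..Real.pi, (H (Real.sin θ) + H (-Real.sin θ)) := by
  rw [integral_circle_split (h := fun γ => H (Real.cos γ)) (by fun_prop),
    integral_comp_sin_zero_pi (G := fun s => H s + H (-s)) (by fun_prop)]
  have h : ∀ F : ℝ → ℂ, ∫ γ in (0 : ℝ)..(Real.pi / 2), F (Real.cos γ)
      = ∫ γ in (0 : ℝ)..(Real.pi / 2), F (Real.sin γ) := by
    intro F
    have h := intervalIntegral.integral_comp_sub_left (fun θ => F (Real.sin θ)) (Real.pi / 2)
      (a := 0) (b := Real.pi / 2)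
    simpa only [Real.sin_pi_div_two_sub, sub_self, sub_zero] using h
  have e : ∀ γ, Real.cos (Real.pi + γ) = -Real.cos γ := fun γ => by
    rw [add_comm, Real.cos_add_pi]
  simp only [Real.cos_pi_sub, Real.cos_two_pi_sub, e]
  rw [h H, h (fun s => H (-s)), intervalIntegral.integral_add
    (Continuous.intervalIntegrable (by fun_prop) _ _)
    (Continuous.intervalIntegrable (by fun_prop) _ _)]
  ring

lemma integral_ee_mul_cos (N : ℝ) :
    ∫ γ in (0 : ℝ)..(2 * Real.pi), ee (N * Real.cos γ) = 2 * Real.pi * besselJ 0 (2 * Real.pi * N) := by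
  rw [integral_comp_cos_circle (H := fun s => ee (N * s)) (by fun_prop), besselJ_zero_eq]
  push_cast
  rw [← intervalIntegral.integral_ofReal]
  have e : ∀ θ : ℝ, ee (N * Real.sin θ) + ee (N * -Real.sin θ)
      = 2 * ((Real.cos (2 * Real.pi * N * Real.sin θ) : ℝ) : ℂ) := by
    intro θ
    rw [mul_neg, ee_neg, Complex.add_conj, ee_re, ← mul_assoc]
    push_cast
    rfl
  simp only [e]
  rw [intervalIntegral.integral_const_mul]
  have : (Real.pi : ℂ) ≠ 0 := by exact_mod_cast Real.pi_ne_zero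
  field_simp

lemma integral_cos_mul_ee_mul_cos (N : ℝ) :
    ∫ γ in (0 : ℝ)..(2 * Real.pi), ((Real.cos γ : ℝ) : ℂ) * ee (N * Real.cos γ)
      = 2 * Real.pi * Complex.I * besselJ 1 (2 * Real.pi * N) := by
  rw [integral_comp_cos_circle (H := fun s => (s : ℂ) * ee (N * s)) (by fun_prop), besselJ_one_eq]
  push_cast
  rw [← intervalIntegral.integral_ofReal]
  have e : ∀ θ : ℝ, (Real.sin θ : ℂ) * ee (N * Real.sin θ) + -(Real.sin θ : ℂ) * ee (N * -Real.sin θ)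
      = 2 * Complex.I * ((Real.sin θ * Real.sin (2 * Real.pi * N * Real.sin θ) : ℝ) : ℂ) := by
    intro θ
    have h : ee (N * Real.sin θ) - (starRingEnd ℂ) (ee (N * Real.sin θ))
        = 2 * Complex.I * ((Real.sin (2 * Real.pi * N * Real.sin θ) : ℝ) : ℂ) := by
      rw [Complex.sub_conj, ee_im, ← mul_assoc]
      push_cast
      ring
    rw [mul_neg, ee_neg]
    push_cast at h ⊢
    linear_combination (Complex.sin θ) * h
  have e' : ∀ θ : ℝ, (Complex.sin (θ : ℂ)) * ee (N * Real.sin θ) +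
      -(Complex.sin (θ : ℂ)) * ee (N * -Real.sin θ)
      = 2 * Complex.I * ((Real.sin θ * Real.sin (2 * Real.pi * N * Real.sin θ) : ℝ) : ℂ) := by
    intro θ; rw [← e]; push_cast; rfl
  simp only [e']
  rw [intervalIntegral.integral_const_mul]
  have : (Real.pi : ℂ) ≠ 0 := by exact_mod_cast Real.pi_ne_zero
  generalize (∫ θ in (0 : ℝ)..Real.pi,
    ((Real.sin θ * Real.sin (2 * Real.pi * N * Real.sin θ) : ℝ) : ℂ)) = I
  field_simp

/-- Stationary phase with the phase `N cos γ`. -/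
lemma norm_integral_circle_sub_le {P P' : ℝ → ℝ} {D N : ℝ} (hN : 1 ≤ N)
    (hP : ∀ x, HasDerivAt P (P' x) x) (hP' : Continuous P') (hD : ∀ x, |P' x| ≤ D)
    (hper : P (2 * Real.pi) = P 0) :
    ‖(∫ γ in (0 : ℝ)..(2 * Real.pi), (P γ : ℂ) * ee (N * Real.cos γ)) -
      2 * Real.pi * ((P 0 + P Real.pi) / 2 * besselJ 0 (2 * Real.pi * N) +
        (P 0 - P Real.pi) / 2 * besselJ 1 (2 * Real.pi * N) * Complex.I)‖
      ≤ 36 * D * (1 + Real.log N) / N := by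
  set α := (P 0 + P Real.pi) / 2 with hα
  set β := (P 0 - P Real.pi) / 2 with hβ
  set f : ℝ → ℝ := fun γ => P γ - α - β * Real.cos γ with hf
  set f' : ℝ → ℝ := fun γ => P' γ + β * Real.sin γ with hf'
  have hD0 : 0 ≤ D := (abs_nonneg _).trans (hD 0)
  have hpi' := Real.pi_lt_d2
  have hβD : |β| ≤ 2 * D := by
    have h := abs_le_of_abs_deriv_le hP hD Real.pi 0
    rw [zero_sub, abs_neg, abs_of_pos Real.pi_pos] at h
    rw [hβ, abs_div, abs_of_pos (show (0 : ℝ) < 2 by norm_num)]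
    nlinarith
  have hdf : ∀ x, HasDerivAt f (f' x) x := fun x => by
    have := ((hP x).fun_sub (hasDerivAt_const x α)).fun_sub ((Real.hasDerivAt_cos x).const_mul β)
    exact this.congr_deriv (by simp only [hf']; ring)
  have hdf' : Continuous f' := by fun_prop
  have hfD : ∀ x, |f' x| ≤ 3 * D := fun x => by
    refine (abs_add_le _ _).trans ?_
    rw [abs_mul]
    have := mul_le_mul hβD (Real.abs_sin_le_one x) (abs_nonneg _) (by positivity)
    linarith [hD x]
  have hPc : Continuous P := continuous_iff_continuousAt.mpr fun x => (hP x).continuousAt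
  have hfc : Continuous f := by fun_prop
  have hc : Continuous fun γ => (f γ : ℂ) * ee (N * Real.cos γ) := by fun_prop
  have key : (∫ γ in (0 : ℝ)..(2 * Real.pi), (P γ : ℂ) * ee (N * Real.cos γ)) -
      2 * Real.pi * (α * besselJ 0 (2 * Real.pi * N) + β * besselJ 1 (2 * Real.pi * N) * Complex.I)
      = ∫ γ in (0 : ℝ)..(2 * Real.pi), (f γ : ℂ) * ee (N * Real.cos γ) := by
    have e : ∀ γ, (f γ : ℂ) * ee (N * Real.cos γ) = (P γ : ℂ) * ee (N * Real.cos γ) -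
        α * ee (N * Real.cos γ) - β * (((Real.cos γ : ℝ) : ℂ) * ee (N * Real.cos γ)) := by
      intro γ; simp only [hf]; push_cast; ring
    simp only [e]
    rw [intervalIntegral.integral_sub (Continuous.intervalIntegrable (by fun_prop) _ _)
      (Continuous.intervalIntegrable (by fun_prop) _ _),
      intervalIntegral.integral_sub (Continuous.intervalIntegrable (by fun_prop) _ _)
      (Continuous.intervalIntegrable (by fun_prop) _ _), intervalIntegral.integral_const_mul,
      intervalIntegral.integral_const_mul, integral_ee_mul_cos, integral_cos_mul_ee_mul_cos]
    ring
  have hαc : (α : ℂ) = (P 0 + P Real.pi) / 2 := by rw [hα]; push_cast; ring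
  have hβc : (β : ℂ) = (P 0 - P Real.pi) / 2 := by rw [hβ]; push_cast; ring
  rw [← hαc, ← hβc, key, integral_circle_split hc]
  have hN0 : |N| = N := abs_of_pos (by linarith)
  have hN1 : |(-N)| = N := by rw [abs_neg, hN0]
  have b1 := norm_integral_quarter_le hN hdf hdf' hfD (by simp [hf, hα, hβ]; ring) hN0
  have hsub : ∀ c x, HasDerivAt (fun γ => f (c - γ)) (-f' (c - x)) x := fun c x =>
    HasDerivAt.comp_const_sub c x (hdf (c - x))
  have hadd : ∀ c x, HasDerivAt (fun γ => f (c + γ)) (f' (c + x)) x := fun c x =>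
    HasDerivAt.comp_const_add c x (hdf (c + x))
  have b2 := norm_integral_quarter_le (f := fun γ => f (Real.pi - γ)) hN (hsub Real.pi)
    (by fun_prop) (fun x => by rw [abs_neg]; exact hfD _) (by simp [hf, hα, hβ]; ring) hN1
  have b3 := norm_integral_quarter_le (f := fun γ => f (Real.pi + γ)) hN (hadd Real.pi)
    (by fun_prop) (fun x => hfD _) (by simp [hf, hα, hβ]; ring) hN1
  have b4 := norm_integral_quarter_le (f := fun γ => f (2 * Real.pi - γ)) hN (hsub (2 * Real.pi))
    (by fun_prop) (fun x => by rw [abs_neg]; exact hfD _) (by simp [hf, hα, hβ, hper]; ring) hN0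
  simp only [Real.cos_pi_sub, Real.cos_two_pi_sub, add_comm Real.pi, Real.cos_add_pi]
  simp only [add_comm Real.pi, neg_mul, mul_neg] at b2 b3 ⊢
  refine (norm_add_le _ _).trans ?_
  refine (add_le_add ((norm_add_le _ _).trans (add_le_add ((norm_add_le _ _).trans
    (add_le_add b1 b2)) b3)) b4).trans (le_of_eq ?_)
  ring

/-! ### Asymptotics of the Fourier transform of the torus -/

lemma integral_circle_reflect (h : ℝ → ℂ) :
    ∫ β in (0 : ℝ)..(2 * Real.pi), h (2 * Real.pi - β) = ∫ β in (0 : ℝ)..(2 * Real.pi), h β := by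
  rw [intervalIntegral.integral_comp_sub_left (f := h)]; simp

lemma integral_comp_cos_mul_ee_sin {h : ℝ → ℂ} (hh : Continuous h) (w : ℝ) :
    ∫ β in (0 : ℝ)..(2 * Real.pi), ee (w * Real.sin β) * h (Real.cos β) =
      ∫ β in (0 : ℝ)..(2 * Real.pi),
        ((Real.cos (2 * Real.pi * (w * Real.sin β)) : ℝ) : ℂ) * h (Real.cos β) := by
  have h1 := integral_circle_reflect (fun β => ee (w * Real.sin β) * h (Real.cos β))
  simp only [Real.sin_two_pi_sub, Real.cos_two_pi_sub, mul_neg] at h1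
  have h2 : ∀ β : ℝ, ((Real.cos (2 * Real.pi * (w * Real.sin β)) : ℝ) : ℂ) * h (Real.cos β)
      = (1 / 2) * (ee (w * Real.sin β) * h (Real.cos β) + ee (-(w * Real.sin β)) * h (Real.cos β)) := by
    intro β
    rw [← add_mul, ee_neg, Complex.add_conj, ee_re]; push_cast; ring
  simp only [h2]
  rw [intervalIntegral.integral_const_mul, intervalIntegral.integral_add
    (Continuous.intervalIntegrable (by fun_prop) _ _)
    (Continuous.intervalIntegrable (by fun_prop) _ _), h1]
  ring

lemma intervalIntegral_im (f : ℝ → ℂ) (hf : Continuous f) (a b : ℝ) :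
    ∫ x in a..b, (f x).im = (∫ x in a..b, f x).im := by
  have := Complex.imCLM.intervalIntegral_comp_comm (μ := volume) (hf.intervalIntegrable a b)
  simpa using this

/-- Rotation of the circle turning the phase `ν sin β + q cos β` into `√(q² + ν²) cos γ`. -/
lemma exists_rotation {q ν s : ℝ} (hs : 0 < s) (hqs : q ^ 2 + ν ^ 2 = s ^ 2) :
    ∃ β₀ : ℝ, Real.cos β₀ = q / s ∧ ∀ γ : ℝ,
      ν * Real.sin (γ + β₀) + q * Real.cos (γ + β₀) = s * Real.cos γ := by
  set z : ℂ := ⟨q, ν⟩ with hz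
  have hz0 : z ≠ 0 := by
    intro h
    have h1 := congrArg Complex.re h
    have h2 := congrArg Complex.im h
    simp only [hz, Complex.zero_re, Complex.zero_im] at h1 h2
    rw [h1, h2] at hqs
    nlinarith
  have hnorm : ‖z‖ = s := by
    rw [Complex.norm_def, Complex.normSq_apply, Real.sqrt_eq_iff_mul_self_eq
      (add_nonneg (mul_self_nonneg _) (mul_self_nonneg _)) hs.le]
    simp only [hz]; nlinarith
  have hc : Real.cos z.arg = q / s := by rw [Complex.cos_arg hz0, hnorm]
  have hsn : Real.sin z.arg = ν / s := by rw [Complex.sin_arg, hnorm]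
  refine ⟨z.arg, hc, fun γ => ?_⟩
  rw [Real.sin_add, Real.cos_add, hc, hsn]
  field_simp
  linear_combination (Real.cos γ) * hqs

/-- The Fourier transform of the solid torus of radii `a` and `A` at a frequency at distance `q`
from the axis and of height `ν`, as an integral over the angle of the meridian circle. -/
noncomputable def torusHat (a A q : ℝ) (ν : ℝ) : ℂ :=
  (∫ β in (0 : ℝ)..(2 * Real.pi), ee (ν * a * Real.sin β) *
    (((A + a * Real.cos β) * besselJ 1 (2 * Real.pi * q * (A + a * Real.cos β)) *
      (a * Real.cos β) : ℝ) : ℂ)) / q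

section

variable {a A κ : ℝ}

lemma tube_mem (ha : 0 < a) (haA : a ≤ (1 - κ) * A) (x : ℝ) (hx : |x| ≤ 1) :
    κ * A ≤ A + a * x ∧ A + a * x ≤ A + a := by
  obtain ⟨h1, h2⟩ := abs_le.mp hx
  constructor <;> nlinarith

lemma sqrt_mul_mul_sqrt_div (hA : 0 < A) (hκ0 : 0 < κ) :
    Real.sqrt (A / κ) * Real.sqrt (κ * A) = A := by
  rw [← Real.sqrt_mul (by positivity), Real.sqrt_eq_iff_mul_self_eq (by positivity) hA.le]
  field_simp

/-- The meridian integral with the amplitude `x √(A + a x)`, `x = cos β`. After rotation the phase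
is `a s cos γ`, with stationary points at `γ = 0` and `γ = π`, where `cos β` is `q / s` and
`-q / s`. -/
lemma norm_meridian_integral_sub_le (ha : 0 < a) (hκ0 : 0 < κ) (hκ1 : κ ≤ 1)
    (haA : a ≤ (1 - κ) * A) {q ν s : ℝ} (hs : 0 < s) (hqs : q ^ 2 + ν ^ 2 = s ^ 2)
    (has : 1 ≤ a * s) :
    ‖(∫ β in (0 : ℝ)..(2 * Real.pi), ee (ν * a * Real.sin β) *
        (((Real.cos β * Real.sqrt (A + a * Real.cos β) : ℝ) : ℂ) * ee (q * (a * Real.cos β))))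
      - Real.pi * ((q / s * Real.sqrt (A + a * (q / s)) : ℝ) *
          (besselJ 0 (2 * Real.pi * (a * s)) + besselJ 1 (2 * Real.pi * (a * s)) * Complex.I)
        - (q / s * Real.sqrt (A - a * (q / s)) : ℝ) *
          (besselJ 0 (2 * Real.pi * (a * s)) - besselJ 1 (2 * Real.pi * (a * s)) * Complex.I))‖
      ≤ 72 * Real.sqrt (A / κ) * (1 + Real.log (a * s)) / (a * s) := by
  obtain ⟨hA, haA'⟩ := le_of_le_one_sub_mul ha hκ0 hκ1 haA
  obtain ⟨β₀, hβ₀, hrot⟩ := exists_rotation hs hqs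
  set P : ℝ → ℝ := fun γ => Real.cos (γ + β₀) * Real.sqrt (A + a * Real.cos (γ + β₀)) with hP
  set P' : ℝ → ℝ := fun γ => -Real.sin (γ + β₀) * Real.sqrt (A + a * Real.cos (γ + β₀)) +
    Real.cos (γ + β₀) * (a * -Real.sin (γ + β₀) / (2 * Real.sqrt (A + a * Real.cos (γ + β₀))))
    with hP'
  have hrad : ∀ x, 0 < A + a * Real.cos x := fun x => by
    have := (tube_mem ha haA _ (Real.abs_cos_le_one x)).1
    have : 0 < κ * A := by positivity
    linarith
  have hdP : ∀ x, HasDerivAt P (P' x) x := by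
    intro x
    have hc : HasDerivAt (fun γ => Real.cos (γ + β₀)) (-Real.sin (x + β₀)) x :=
      HasDerivAt.comp_add_const x β₀ (Real.hasDerivAt_cos (x + β₀))
    have hr := ((hc.const_mul a).const_add A).sqrt (hrad (x + β₀)).ne'
    exact hc.fun_mul hr
  have hcP' : Continuous P' := by
    have : ∀ x, 2 * Real.sqrt (A + a * Real.cos (x + β₀)) ≠ 0 := fun x => by
      have := Real.sqrt_pos.mpr (hrad (x + β₀)); positivity
    simp only [hP']
    fun_prop (disch := exact this _)
  have hAκ : A ≤ A / κ := le_div_self hA.le hκ0 hκ1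
  have hDP : ∀ x, |P' x| ≤ 2 * Real.sqrt (A / κ) := by
    intro x
    set r := Real.sqrt (A + a * Real.cos (x + β₀)) with hr
    have hr0 : 0 < r := Real.sqrt_pos.mpr (hrad _)
    obtain ⟨t1, t2⟩ := tube_mem ha haA _ (Real.abs_cos_le_one (x + β₀))
    have hr1 : r ≤ 3 / 2 * Real.sqrt (A / κ) := by
      rw [hr, Real.sqrt_le_left (by positivity), mul_pow, Real.sq_sqrt (by positivity)]
      linarith
    have hr2 : Real.sqrt (κ * A) ≤ r := Real.sqrt_le_sqrt t1
    have hr3 := Real.sqrt_pos.mpr (show 0 < κ * A by positivity)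
    have hsc := sqrt_mul_mul_sqrt_div (A := A) (κ := κ) hA hκ0
    have h1 : |-Real.sin (x + β₀) * r| ≤ 3 / 2 * Real.sqrt (A / κ) := by
      rw [abs_mul, abs_neg, abs_of_pos hr0]
      have := mul_le_mul (Real.abs_sin_le_one (x + β₀)) hr1 hr0.le zero_le_one
      linarith
    have h2 : |Real.cos (x + β₀) * (a * -Real.sin (x + β₀) / (2 * r))| ≤
        1 / 2 * Real.sqrt (A / κ) := by
      rw [abs_mul, abs_div, abs_mul, abs_neg, abs_of_pos ha, abs_of_pos (show 0 < 2 * r by positivity)]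
      calc _ ≤ 1 * (A * 1 / (2 * Real.sqrt (κ * A))) := by
            gcongr
            · exact Real.abs_cos_le_one _
            · exact Real.abs_sin_le_one _
        _ = 1 / 2 * (A / Real.sqrt (κ * A)) := by field_simp
        _ = 1 / 2 * Real.sqrt (A / κ) := by
            congr 1
            rw [div_eq_iff hr3.ne', hsc]
    calc _ ≤ _ := abs_add_le _ _
      _ ≤ _ := add_le_add h1 h2
      _ = _ := by ring
  have hSP := norm_integral_circle_sub_le has hdP hcP' hDP (by
    simp only [hP, add_comm (2 * Real.pi) β₀, Real.cos_add_two_pi, zero_add])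
  have hP0 : P 0 = q / s * Real.sqrt (A + a * (q / s)) := by
    simp only [hP, zero_add, hβ₀]
  have hPpi : P Real.pi = -(q / s * Real.sqrt (A - a * (q / s))) := by
    simp only [hP, add_comm Real.pi, Real.cos_add_pi, hβ₀]
    rw [mul_neg, ← sub_eq_add_neg]; ring
  have hshift : ∫ β in (0 : ℝ)..(2 * Real.pi), ee (ν * a * Real.sin β) *
        (((Real.cos β * Real.sqrt (A + a * Real.cos β) : ℝ) : ℂ) * ee (q * (a * Real.cos β)))
      = ∫ γ in (0 : ℝ)..(2 * Real.pi), (P γ : ℂ) * ee (a * s * Real.cos γ) := by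
    set g : ℝ → ℂ := fun β => ee (ν * a * Real.sin β) *
        (((Real.cos β * Real.sqrt (A + a * Real.cos β) : ℝ) : ℂ) * ee (q * (a * Real.cos β)))
    have hg : Function.Periodic g (2 * Real.pi) := fun β => by
      simp only [g, Real.sin_add_two_pi, Real.cos_add_two_pi]
    have h1 := hg.intervalIntegral_add_eq 0 β₀
    rw [zero_add] at h1
    rw [h1]
    have h2 := intervalIntegral.integral_comp_add_right g β₀ (a := 0) (b := 2 * Real.pi)
    rw [zero_add, add_comm (2 * Real.pi)] at h2
    rw [← h2]
    refine intervalIntegral.integral_congr fun γ _ => ?_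
    simp only [g, hP]
    have h3 : a * s * Real.cos γ = ν * a * Real.sin (γ + β₀) + q * (a * Real.cos (γ + β₀)) := by
      rw [mul_assoc, ← hrot]; ring
    rw [h3, ee_add]; ring
  rw [hshift]
  have hfin : 36 * (2 * Real.sqrt (A / κ)) * (1 + Real.log (a * s)) / (a * s)
      = 72 * Real.sqrt (A / κ) * (1 + Real.log (a * s)) / (a * s) := by ring
  rw [← hfin]
  refine le_trans (le_of_eq ?_) hSP
  congr 2
  rw [hP0, hPpi]
  push_cast
  ring

end

set_option maxHeartbeats 1000000 in
/-- Asymptotic expansion of the Fourier transform of the solid torus off its axis: the Bessel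
function in the meridian integral is replaced by its leading term, and the resulting oscillatory
integral is evaluated by stationary phase. -/
theorem exists_torusHat_asymptotic : ∃ (b : ℂ) (C : ℝ), 0 < C ∧ ∀ (a A κ q ν s : ℝ), 1 ≤ a → 0 < κ →
    κ ≤ 1 → a ≤ (1 - κ) * A → 1 ≤ κ * A → 1 ≤ q → 0 < s → q ^ 2 + ν ^ 2 = s ^ 2 →
    ‖torusHat a A q ν - ((1 / 2 * Real.sqrt a / Real.sqrt q / (s * Real.sqrt s) *
      (b * ee (q * A) * (b * Real.sqrt (A + a * (q / s)) * ee (a * s) -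
        (starRingEnd ℂ) b * Real.sqrt (A - a * (q / s)) * ee (-(a * s)))).im : ℝ) : ℂ)‖
      ≤ C * Real.sqrt (A / κ) * (1 + Real.log (a * s)) / q ^ 2 := by
  obtain ⟨b, K, hK, hW⟩ := exists_besselW_asymptotic
  refine ⟨b, 2 * Real.pi * K + ‖b‖ * (72 + 2 * K), by positivity, ?_⟩
  intro a A κ q ν s ha1 hκ0 hκ1 haA hκA hq1 hs hqs
  have ha : 0 < a := by linarith
  have hq : 0 < q := by linarith
  obtain ⟨hA, haA'⟩ := le_of_le_one_sub_mul ha hκ0 hκ1 haA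
  have hpi := Real.pi_gt_three
  have hqs' : q ≤ s := by nlinarith [sq_nonneg ν]
  have hN : 1 ≤ a * s := by nlinarith
  have hlog := Real.log_nonneg hN
  set S := Real.sqrt (A / κ) with hS
  have hS0 : 0 ≤ S := Real.sqrt_nonneg _
  have hκA0 : 0 < κ * A := by linarith
  set rκ := Real.sqrt (κ * A) with hrκ
  have hrκ0 : 0 < rκ := Real.sqrt_pos.mpr hκA0
  have hsc : S * rκ = A := sqrt_mul_mul_sqrt_div hA hκ0
  set p := Real.sqrt (2 * Real.pi) with hp
  have hp1 : 1 ≤ p := Real.one_le_sqrt.mpr (by linarith)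
  have hp0 : 0 < p := by linarith
  have hp2 : p ^ 2 = 2 * Real.pi := Real.sq_sqrt (by positivity)
  have hsq1 : 1 ≤ Real.sqrt q := Real.one_le_sqrt.mpr hq1
  have hsq0 : 0 < Real.sqrt q := by linarith
  -- the Bessel function replaced by its leading term, for `t` between `κ A` and `2 A`
  have hstep1 : ∀ t, κ * A ≤ t → |t * besselJ 1 (2 * Real.pi * q * t) -
      Real.sqrt t / (p * Real.sqrt q) * (b * ee (q * t)).im| ≤ K / (q * rκ) := by
    intro t ht
    have ht1 : 1 ≤ t := hκA.trans ht
    have ht0 : 0 < t := by linarith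
    set x := 2 * Real.pi * q * t with hx
    have hx1 : 1 ≤ x := by
      have : 1 ≤ q * t := by nlinarith
      rw [hx]; nlinarith
    have hx0 : 0 < x := by linarith
    have hsx : Real.sqrt x = p * Real.sqrt q * Real.sqrt t := by
      rw [hx, Real.sqrt_mul (by positivity), Real.sqrt_mul (by positivity)]
    have h1 := hW x hx1
    have h2 : b * Complex.exp (x * Complex.I) = b * ee (q * t) := by
      rw [ee_eq]; congr 3; rw [hx]; push_cast; ring
    rw [h2] at h1
    have h3 : |(besselW x).im - (b * ee (q * t)).im| ≤ K / x := by
      rw [← Complex.sub_im]; exact (Complex.abs_im_le_norm _).trans h1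
    have h4 : (besselW x).im = Real.sqrt x * besselJ 1 x := by
      unfold besselW; simp
    have hst : 0 < Real.sqrt t := Real.sqrt_pos.mpr ht0
    have htt : Real.sqrt t ^ 2 = t := Real.sq_sqrt ht0.le
    have h5 : t * besselJ 1 x = Real.sqrt t / (p * Real.sqrt q) * (besselW x).im := by
      rw [h4, hsx]; field_simp; rw [htt]; ring
    rw [h5, ← mul_sub, abs_mul, abs_of_pos (show 0 < Real.sqrt t / (p * Real.sqrt q) by positivity)]
    have hrt : rκ ≤ Real.sqrt t := Real.sqrt_le_sqrt ht
    calc _ ≤ Real.sqrt t / (p * Real.sqrt q) * (K / x) := by gcongr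
      _ = K / (p * Real.sqrt q * (2 * Real.pi * q * Real.sqrt t)) := by
          rw [hx]; nth_rewrite 2 [← htt]; field_simp
      _ ≤ K / (1 * 1 * (1 * q * rκ)) := by
          gcongr
          linarith
      _ = _ := by ring
  set I := ∫ β in (0 : ℝ)..(2 * Real.pi), ee (ν * a * Real.sin β) *
        (((Real.cos β * Real.sqrt (A + a * Real.cos β) : ℝ) : ℂ) * ee (q * (a * Real.cos β)))
    with hI
  have hJc := continuous_besselJ_one
  have hE1 : ‖torusHat a A q ν - ((a / (p * Real.sqrt q) * (b * ee (q * A) * I).im / q : ℝ) : ℂ)‖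
      ≤ 2 * Real.pi * K * S / q ^ 2 := by
    have hM : ∫ β in (0 : ℝ)..(2 * Real.pi), ee (ν * a * Real.sin β) *
        ((Real.sqrt (A + a * Real.cos β) / (p * Real.sqrt q) *
          (b * ee (q * (A + a * Real.cos β))).im * (a * Real.cos β) : ℝ) : ℂ)
        = ((a / (p * Real.sqrt q) * (b * ee (q * A) * I).im : ℝ) : ℂ) := by
      rw [integral_comp_cos_mul_ee_sin (h := fun x => ((Real.sqrt (A + a * x) / (p * Real.sqrt q) *
          (b * ee (q * (A + a * x))).im * (a * x) : ℝ) : ℂ)) (by fun_prop)]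
      rw [hI, integral_comp_cos_mul_ee_sin (h := fun x => ((x * Real.sqrt (A + a * x) : ℝ) : ℂ) *
        ee (q * (a * x))) (by fun_prop), ← intervalIntegral.integral_const_mul,
        ← intervalIntegral_im _ (by fun_prop), ← intervalIntegral.integral_const_mul,
        ← intervalIntegral.integral_ofReal]
      refine intervalIntegral.integral_congr fun β _ => ?_
      rw [← Complex.ofReal_mul]
      congr 1
      have h1 : b * ee (q * A) * (((Real.cos (2 * Real.pi * (ν * a * Real.sin β)) : ℝ) : ℂ) *
          (((Real.cos β * Real.sqrt (A + a * Real.cos β) : ℝ) : ℂ) * ee (q * (a * Real.cos β)))) =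
          ((Real.cos (2 * Real.pi * (ν * a * Real.sin β)) *
            (Real.cos β * Real.sqrt (A + a * Real.cos β)) : ℝ) : ℂ) *
              (b * ee (q * (A + a * Real.cos β))) := by
        rw [mul_add q, ee_add,
          Complex.ofReal_mul (Real.cos (2 * Real.pi * (ν * a * Real.sin β)))]; ring
      rw [h1, Complex.im_ofReal_mul]
      ring
    have h1 : torusHat a A q ν - ((a / (p * Real.sqrt q) * (b * ee (q * A) * I).im / q : ℝ) : ℂ)
        = (∫ β in (0 : ℝ)..(2 * Real.pi), ee (ν * a * Real.sin β) *
          ((((A + a * Real.cos β) * besselJ 1 (2 * Real.pi * q * (A + a * Real.cos β)) -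
            Real.sqrt (A + a * Real.cos β) / (p * Real.sqrt q) *
              (b * ee (q * (A + a * Real.cos β))).im) * (a * Real.cos β) : ℝ) : ℂ)) / q := by
      rw [Complex.ofReal_div, ← hM, torusHat, ← sub_div, ← intervalIntegral.integral_sub
        (Continuous.intervalIntegrable (by fun_prop) _ _)
        (Continuous.intervalIntegrable (by fun_prop) _ _)]
      congr 1
      refine intervalIntegral.integral_congr fun β _ => ?_
      rw [← mul_sub, ← Complex.ofReal_sub]
      congr 2
      ring
    rw [h1, norm_div, Complex.norm_real, Real.norm_of_nonneg hq.le, div_le_iff₀ hq]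
    have h2 := intervalIntegral.norm_integral_le_of_norm_le_const (a := 0) (b := 2 * Real.pi)
      (C := K * S / q) (f := fun β => ee (ν * a * Real.sin β) *
          ((((A + a * Real.cos β) * besselJ 1 (2 * Real.pi * q * (A + a * Real.cos β)) -
            Real.sqrt (A + a * Real.cos β) / (p * Real.sqrt q) *
              (b * ee (q * (A + a * Real.cos β))).im) * (a * Real.cos β) : ℝ) : ℂ))
      (fun β _ => by
        rw [norm_mul, norm_ee, one_mul, Complex.norm_real, Real.norm_eq_abs, abs_mul, abs_mul,
          abs_of_pos ha]
        have h3 := hstep1 _ (tube_mem ha haA _ (Real.abs_cos_le_one β)).1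
        calc _ ≤ K / (q * rκ) * (A * 1) := by
              gcongr
              exact Real.abs_cos_le_one β
          _ = K * S / q := by rw [← hsc]; field_simp)
    refine h2.trans (le_of_eq ?_)
    rw [sub_zero, abs_of_pos (by positivity)]
    field_simp
  have hmer := norm_meridian_integral_sub_le ha hκ0 hκ1 haA hs hqs hN
  rw [← hI] at hmer
  set N := a * s with hNdef
  have hN0 : 0 < N := by linarith
  set y := 2 * Real.pi * N with hy
  have hy1 : 1 ≤ y := by
    rw [hy]; exact one_le_mul_of_one_le_of_one_le (by linarith) hN
  have hy0 : 0 < y := by linarith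
  have hsy1 : 1 ≤ Real.sqrt y := Real.one_le_sqrt.mpr hy1
  have hsy0 : 0 < Real.sqrt y := by linarith
  set R1 := Real.sqrt (A + a * (q / s)) with hR1
  set R2 := Real.sqrt (A - a * (q / s)) with hR2
  have hAκ : A ≤ A / κ := le_div_self hA.le hκ0 hκ1
  have hqs1 : q / s ≤ 1 := (div_le_one hs).mpr hqs'
  have hqs0 : 0 < q / s := by positivity
  have hRb : ∀ σ : ℝ, |σ| ≤ a → q / s * Real.sqrt (A + σ * (q / s)) ≤ 3 / 2 * S := by
    intro σ hσ
    have h1 : Real.sqrt (A + σ * (q / s)) ≤ 3 / 2 * S := by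
      rw [Real.sqrt_le_left (by positivity), mul_pow, hS, Real.sq_sqrt (by positivity)]
      have h2 : σ * (q / s) ≤ a * 1 := by
        calc σ * (q / s) ≤ |σ| * (q / s) := by gcongr; exact le_abs_self σ
          _ ≤ a * 1 := by gcongr
      linarith
    calc q / s * Real.sqrt (A + σ * (q / s)) ≤ 1 * Real.sqrt (A + σ * (q / s)) := by gcongr
      _ ≤ 3 / 2 * S := by rw [one_mul]; exact h1
  have hr1 : q / s * R1 ≤ 3 / 2 * S := hRb a (abs_of_pos ha).le
  have hr2 : q / s * R2 ≤ 3 / 2 * S := by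
    have := hRb (-a) (by rw [abs_neg, abs_of_pos ha])
    rwa [neg_mul, ← sub_eq_add_neg] at this
  set r1 := q / s * R1 with hr1d
  set r2 := q / s * R2 with hr2d
  have hr10 : 0 ≤ r1 := by positivity
  have hr20 : 0 ≤ r2 := by positivity
  have hee : Complex.exp (y * Complex.I) = ee N := by rw [ee_eq, hy]
  have hWy := hW y hy1
  rw [hee] at hWy
  set Main : ℂ := (Real.pi / Real.sqrt y : ℝ) * (r1 * (b * ee N) - r2 * ((starRingEnd ℂ) b * ee (-N)))
    with hMain
  have hstep4 : ‖I - Main‖ ≤ (72 + 2 * K) * S * (1 + Real.log N) / N := by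
    have h1 : Real.pi * ((r1 : ℂ) * (besselJ 0 y + besselJ 1 y * Complex.I) -
        r2 * (besselJ 0 y - besselJ 1 y * Complex.I)) - Main =
        (Real.pi / Real.sqrt y : ℝ) * (r1 * (besselW y - b * ee N) -
          r2 * (starRingEnd ℂ) (besselW y - b * ee N)) := by
      have hs0 : (Real.sqrt y : ℂ) ≠ 0 := by exact_mod_cast hsy0.ne'
      simp only [hMain, besselW, map_sub, map_mul, map_add, Complex.conj_ofReal, Complex.conj_I,
        ee_neg]
      push_cast
      field_simp
      ring
    have h2 : ‖Real.pi * ((r1 : ℂ) * (besselJ 0 y + besselJ 1 y * Complex.I) -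
        r2 * (besselJ 0 y - besselJ 1 y * Complex.I)) - Main‖ ≤ 2 * K * S / N := by
      rw [h1, norm_mul, Complex.norm_real, Real.norm_of_nonneg (by positivity)]
      have h3 : ‖(r1 : ℂ) * (besselW y - b * ee N) - r2 * (starRingEnd ℂ) (besselW y - b * ee N)‖
          ≤ 3 / 2 * S * (K / y) + 3 / 2 * S * (K / y) := by
        refine (norm_sub_le _ _).trans ?_
        rw [norm_mul, norm_mul, RCLike.norm_conj, Complex.norm_real, Complex.norm_real,
          Real.norm_of_nonneg hr10, Real.norm_of_nonneg hr20]
        gcongr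
      calc _ ≤ Real.pi / 1 * (3 / 2 * S * (K / y) + 3 / 2 * S * (K / y)) := by gcongr
        _ = 3 / 2 * K * S / N := by rw [hy]; field_simp; ring
        _ ≤ _ := by gcongr; norm_num
    have h3 : I - Main = (I - Real.pi * ((r1 : ℂ) * (besselJ 0 y + besselJ 1 y * Complex.I) -
        r2 * (besselJ 0 y - besselJ 1 y * Complex.I))) + (Real.pi * ((r1 : ℂ) *
        (besselJ 0 y + besselJ 1 y * Complex.I) - r2 * (besselJ 0 y - besselJ 1 y * Complex.I))
          - Main) := by ring
    rw [h3]
    refine (norm_add_le _ _).trans ((add_le_add hmer h2).trans ?_)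
    rw [← add_div]
    gcongr
    have : 0 ≤ K * S * Real.log N := by positivity
    linarith
  have hcoef : a / (p * Real.sqrt q) * (b * ee (q * A) * Main).im / q =
      1 / 2 * Real.sqrt a / Real.sqrt q / (s * Real.sqrt s) *
      (b * ee (q * A) * (b * R1 * ee N - (starRingEnd ℂ) b * R2 * ee (-N))).im := by
    have h1 : b * ee (q * A) * Main = ((Real.pi / Real.sqrt y * (q / s) : ℝ) : ℂ) *
        (b * ee (q * A) * (b * R1 * ee N - (starRingEnd ℂ) b * R2 * ee (-N))) := by
      simp only [hMain, hr1d, hr2d]; push_cast; ring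
    rw [h1, Complex.im_ofReal_mul]
    have hsy : Real.sqrt y = p * (Real.sqrt a * Real.sqrt s) := by
      rw [hy, Real.sqrt_mul (by positivity), hNdef, Real.sqrt_mul ha.le]
    have haa : Real.sqrt a ^ 2 = a := Real.sq_sqrt ha.le
    have hsa : 0 < Real.sqrt a := Real.sqrt_pos.mpr ha
    have hss : 0 < Real.sqrt s := Real.sqrt_pos.mpr hs
    have hpi2 : Real.pi = p ^ 2 / 2 := by rw [hp2]; ring
    rw [hsy, hpi2]
    nth_rewrite 1 [← haa]
    field_simp
  rw [← hcoef]
  have hsplit : torusHat a A q ν - ((a / (p * Real.sqrt q) * (b * ee (q * A) * Main).im / q : ℝ) : ℂ)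
      = (torusHat a A q ν - ((a / (p * Real.sqrt q) * (b * ee (q * A) * I).im / q : ℝ) : ℂ)) +
        ((a / (p * Real.sqrt q) * (b * ee (q * A) * (I - Main)).im / q : ℝ) : ℂ) := by
    have : (b * ee (q * A) * (I - Main)).im = (b * ee (q * A) * I).im -
        (b * ee (q * A) * Main).im := by rw [mul_sub, Complex.sub_im]
    rw [this]; push_cast; ring
  have hE2 : ‖((a / (p * Real.sqrt q) * (b * ee (q * A) * (I - Main)).im / q : ℝ) : ℂ)‖
      ≤ ‖b‖ * (72 + 2 * K) * S * (1 + Real.log N) / q ^ 2 := by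
    rw [Complex.norm_real, Real.norm_eq_abs, abs_div, abs_mul, abs_of_pos hq,
      abs_of_pos (show 0 < a / (p * Real.sqrt q) by positivity)]
    have h1 : |(b * ee (q * A) * (I - Main)).im| ≤
        ‖b‖ * ((72 + 2 * K) * S * (1 + Real.log N) / N) := by
      refine (Complex.abs_im_le_norm _).trans ?_
      rw [norm_mul, norm_mul, norm_ee, mul_one]
      gcongr
    calc _ ≤ a / (1 * 1) * (‖b‖ * ((72 + 2 * K) * S * (1 + Real.log N) / N)) / q := by gcongr
      _ = ‖b‖ * (72 + 2 * K) * S * (1 + Real.log N) / (s * q) := by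
          rw [hNdef]; field_simp
      _ ≤ ‖b‖ * (72 + 2 * K) * S * (1 + Real.log N) / (q * q) := by gcongr
      _ = _ := by ring
  rw [hsplit]
  refine (norm_add_le _ _).trans ((add_le_add hE1 hE2).trans ?_)
  rw [← add_div]
  gcongr
  have : 0 ≤ Real.pi * K * S * Real.log N := by positivity
  linarith

/-! ### The Fourier transform of the solid torus -/

/-- The solid torus of tube radius `a` and central radius `A` around the last axis, in the model
`(ℝ × ℝ) × ℝ` of space. -/
def torusSet (a A : ℝ) : Set ((ℝ × ℝ) × ℝ) :=
  {p | (A - Real.sqrt (p.1.1 ^ 2 + p.1.2 ^ 2)) ^ 2 + p.2 ^ 2 ≤ a ^ 2}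

/-- The closed annulus with radii `r₁ ≤ r₂`. -/
def annulus (r₁ r₂ : ℝ) : Set (ℝ × ℝ) :=
  {v | r₁ ≤ Real.sqrt (v.1 ^ 2 + v.2 ^ 2) ∧ Real.sqrt (v.1 ^ 2 + v.2 ^ 2) ≤ r₂}

lemma isClosed_annulus (r₁ r₂ : ℝ) : IsClosed (annulus r₁ r₂) := by
  have h1 : IsClosed {v : ℝ × ℝ | r₁ ≤ Real.sqrt (v.1 ^ 2 + v.2 ^ 2)} :=
    isClosed_le (by fun_prop) (by fun_prop)
  have h2 : IsClosed {v : ℝ × ℝ | Real.sqrt (v.1 ^ 2 + v.2 ^ 2) ≤ r₂} :=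
    isClosed_le (by fun_prop) (by fun_prop)
  exact h1.inter h2

lemma abs_le_of_sqrt_le {x y r : ℝ} (h : Real.sqrt (x ^ 2 + y ^ 2) ≤ r) : |x| ≤ r ∧ |y| ≤ r := by
  have h0 : 0 ≤ r := (Real.sqrt_nonneg _).trans h
  rw [Real.sqrt_le_left h0] at h
  constructor <;> apply abs_le_of_sq_le_sq _ h0 <;> nlinarith [sq_nonneg x, sq_nonneg y]

lemma isClosed_torusSet (a A : ℝ) : IsClosed (torusSet a A) :=
  isClosed_le (by fun_prop) continuous_const

lemma mem_torusSet_iff {a A : ℝ} (ha : 0 ≤ a) (v : ℝ × ℝ) (z : ℝ) : (v, z) ∈ torusSet a A ↔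
    z ∈ Set.Icc (-a) a ∧
      v ∈ annulus (A - Real.sqrt (a ^ 2 - z ^ 2)) (A + Real.sqrt (a ^ 2 - z ^ 2)) := by
  unfold torusSet annulus
  simp only [Set.mem_ofPred_eq, Set.mem_Icc]
  set r := Real.sqrt (v.1 ^ 2 + v.2 ^ 2)
  constructor
  · intro h
    have hz : |z| ≤ a := abs_le_of_sq_le_sq (by nlinarith [sq_nonneg (A - r)]) ha
    have h1 : |A - r| ≤ Real.sqrt (a ^ 2 - z ^ 2) := Real.abs_le_sqrt (by linarith)
    obtain ⟨h2, h3⟩ := abs_le.mp h1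
    exact ⟨abs_le.mp hz, by linarith, by linarith⟩
  · rintro ⟨hz, h1, h2⟩
    have hz' : z ^ 2 ≤ a ^ 2 := sq_le_sq' hz.1 hz.2
    have h3 := Real.sq_sqrt (show 0 ≤ a ^ 2 - z ^ 2 by linarith)
    have h4 : (A - r) ^ 2 ≤ Real.sqrt (a ^ 2 - z ^ 2) ^ 2 := sq_le_sq' (by linarith) (by linarith)
    linarith

lemma torusSet_subset {a A : ℝ} (ha : 0 ≤ a) : torusSet a A ⊆
    (Set.Icc (-(A + a)) (A + a) ×ˢ Set.Icc (-(A + a)) (A + a)) ×ˢ Set.Icc (-a) a := by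
  rintro ⟨v, z⟩ h
  rw [mem_torusSet_iff ha] at h
  obtain ⟨hz, -, h2⟩ := h
  have h3 : Real.sqrt (a ^ 2 - z ^ 2) ≤ a := by
    rw [Real.sqrt_le_left ha]; nlinarith [sq_nonneg z]
  obtain ⟨h4, h5⟩ := abs_le_of_sqrt_le h2
  refine ⟨⟨abs_le.mp (h4.trans (by linarith)), abs_le.mp (h5.trans (by linarith))⟩, hz⟩

lemma isCompact_torusSet {a : ℝ} (A : ℝ) (ha : 0 ≤ a) : IsCompact (torusSet a A) :=
  ((isCompact_Icc.prod isCompact_Icc).prod isCompact_Icc).of_isClosed_subset (isClosed_torusSet a A)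
    (torusSet_subset ha)

lemma setIntegral_annulus {r₁ r₂ : ℝ} (h1 : 0 < r₁) (h12 : r₁ ≤ r₂) {f : ℝ × ℝ → ℂ}
    (hf : Continuous f) : ∫ v in annulus r₁ r₂, f v =
      ∫ r in r₁..r₂, ∫ θ in (-Real.pi)..Real.pi, (r : ℂ) * f (r * Real.cos θ, r * Real.sin θ) := by
  rw [← integral_indicator (isClosed_annulus r₁ r₂).measurableSet, ← integral_comp_polarCoord_symm]
  have hsq : ∀ r θ : ℝ, 0 < r → Real.sqrt ((r * Real.cos θ) ^ 2 + (r * Real.sin θ) ^ 2) = r := by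
    intro r θ hr
    have : (r * Real.cos θ) ^ 2 + (r * Real.sin θ) ^ 2 = r ^ 2 := by
      have := Real.sin_sq_add_cos_sq θ
      linear_combination r ^ 2 * this
    rw [this, Real.sqrt_sq hr.le]
  have hset : ∀ p ∈ polarCoord.target, p.1 • (annulus r₁ r₂).indicator f (polarCoord.symm p) =
      (Set.Icc r₁ r₂ ×ˢ (Set.univ : Set ℝ)).indicator
        (fun p : ℝ × ℝ => (p.1 : ℂ) * f (p.1 * Real.cos p.2, p.1 * Real.sin p.2)) p := by
    intro p hp
    rw [polarCoord_target] at hp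
    have hp1 : 0 < p.1 := hp.1
    rw [polarCoord_symm_apply]
    by_cases h : p.1 ∈ Set.Icc r₁ r₂
    · rw [Set.indicator_of_mem, Set.indicator_of_mem (show p ∈ Set.Icc r₁ r₂ ×ˢ Set.univ from
        ⟨h, Set.mem_univ _⟩), Complex.real_smul]
      change _ ∧ _
      simp only
      rw [hsq _ _ hp1]; exact h
    · rw [Set.indicator_of_notMem, Set.indicator_of_notMem (fun h' => h h'.1), smul_zero]
      intro h'
      apply h
      change _ ∧ _ at h'
      simp only at h'
      rw [hsq _ _ hp1] at h'; exact h'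
  rw [setIntegral_congr_fun polarCoord.open_target.measurableSet hset,
    setIntegral_indicator (measurableSet_Icc.prod MeasurableSet.univ), polarCoord_target]
  have hinter : Set.Ioi (0 : ℝ) ×ˢ Set.Ioo (-Real.pi) Real.pi ∩ Set.Icc r₁ r₂ ×ˢ Set.univ
      = Set.Icc r₁ r₂ ×ˢ Set.Ioo (-Real.pi) Real.pi := by
    ext p
    simp only [Set.mem_inter_iff, Set.mem_prod, Set.mem_Ioi, Set.mem_Icc, Set.mem_univ, and_true]
    constructor
    · rintro ⟨⟨_, h2⟩, h3⟩; exact ⟨h3, h2⟩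
    · rintro ⟨h3, h2⟩; exact ⟨⟨h1.trans_le h3.1, h2⟩, h3⟩
  rw [hinter]
  have hcont : Continuous fun p : ℝ × ℝ => (p.1 : ℂ) * f (p.1 * Real.cos p.2, p.1 * Real.sin p.2) := by
    fun_prop
  have hint : IntegrableOn (fun p : ℝ × ℝ => (p.1 : ℂ) * f (p.1 * Real.cos p.2, p.1 * Real.sin p.2))
      (Set.Icc r₁ r₂ ×ˢ Set.Ioo (-Real.pi) Real.pi) (volume.prod volume) :=
    (hcont.continuousOn.integrableOn_compact (isCompact_Icc.prod isCompact_Icc)).mono_set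
      (Set.prod_mono subset_rfl Set.Ioo_subset_Icc_self)
  rw [Measure.volume_eq_prod, setIntegral_prod _ hint, integral_Icc_eq_integral_Ioc,
    ← intervalIntegral.integral_of_le h12]
  refine intervalIntegral.integral_congr fun r _ => ?_
  simp only
  rw [← integral_Ioc_eq_integral_Ioo, ← intervalIntegral.integral_of_le (by linarith [Real.pi_pos])]

/-- The mean of a character over a circle does not depend on the direction of the frequency. -/
lemma integral_ee_direction {x y q : ℝ} (hq : 0 < q) (hxy : x ^ 2 + y ^ 2 = q ^ 2) (r : ℝ) :
    ∫ θ in (-Real.pi)..Real.pi, ee (x * (r * Real.cos θ) + y * (r * Real.sin θ))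
      = 2 * Real.pi * besselJ 0 (2 * Real.pi * (r * q)) := by
  obtain ⟨β₀, -, hrot⟩ := exists_rotation hq hxy
  set g : ℝ → ℂ := fun θ => ee (x * (r * Real.cos θ) + y * (r * Real.sin θ))
  have hg : Function.Periodic g (2 * Real.pi) := fun β => by
    simp only [g, Real.sin_add_two_pi, Real.cos_add_two_pi]
  have h1 := hg.intervalIntegral_add_eq (-Real.pi) β₀
  rw [show -Real.pi + 2 * Real.pi = Real.pi by ring] at h1
  rw [h1]
  have h2 := intervalIntegral.integral_comp_add_right g β₀ (a := 0) (b := 2 * Real.pi)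
  rw [zero_add, add_comm (2 * Real.pi)] at h2
  rw [← h2, ← integral_ee_mul_cos]
  refine intervalIntegral.integral_congr fun γ _ => ?_
  simp only [g]
  congr 1
  linear_combination r * hrot γ

lemma setIntegral_annulus_ee {r₁ r₂ : ℝ} (h1 : 0 < r₁) (h12 : r₁ ≤ r₂) {x y q : ℝ} (hq : 0 < q)
    (hxy : x ^ 2 + y ^ 2 = q ^ 2) : ∫ v in annulus r₁ r₂, ee (x * v.1 + y * v.2) =
      ((r₂ * besselJ 1 (2 * Real.pi * q * r₂) - r₁ * besselJ 1 (2 * Real.pi * q * r₁) : ℝ) : ℂ) / q := by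
  rw [setIntegral_annulus h1 h12 (by fun_prop)]
  simp only [intervalIntegral.integral_const_mul, integral_ee_direction hq hxy]
  have hd : ∀ r ∈ Set.uIcc r₁ r₂, HasDerivAt
      (fun r => r * besselJ 1 (2 * Real.pi * q * r) / q)
      (r * (2 * Real.pi * besselJ 0 (2 * Real.pi * (r * q)))) r := by
    intro r hr
    rw [Set.uIcc_of_le h12] at hr
    have hr0 : 0 < r := h1.trans_le hr.1
    have hx : 2 * Real.pi * q * r ≠ 0 := by positivity
    have h3 : HasDerivAt (fun r : ℝ => 2 * Real.pi * q * r) (2 * Real.pi * q) r := by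
      simpa using (hasDerivAt_id r).const_mul (2 * Real.pi * q)
    have h4 := ((hasDerivAt_id r).fun_mul ((hasDerivAt_besselJ_one hx).comp r h3)).div_const q
    refine h4.congr_deriv ?_
    simp only [Function.comp, id]
    have : 2 * Real.pi * (r * q) = 2 * Real.pi * q * r := by ring
    rw [this]
    field_simp
    ring
  have hJ0 : Continuous (besselJ 0) := continuous_iff_continuousAt.mpr fun x =>
    (hasDerivAt_besselJ_zero x).continuousAt
  have h := intervalIntegral.integral_eq_sub_of_hasDerivAt hd
    (Continuous.intervalIntegrable (by fun_prop) _ _)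
  have e : ∀ r : ℝ, (r : ℂ) * (2 * Real.pi * besselJ 0 (2 * Real.pi * (r * q))) =
      ((r * (2 * Real.pi * besselJ 0 (2 * Real.pi * (r * q))) : ℝ) : ℂ) := fun r => by push_cast; rfl
  simp only [e]
  rw [intervalIntegral.integral_ofReal, h]
  push_cast
  ring

lemma setIntegral_annulus_one {r₁ r₂ : ℝ} (h1 : 0 < r₁) (h12 : r₁ ≤ r₂) :
    ∫ _ in annulus r₁ r₂, (1 : ℂ) = ((Real.pi * (r₂ ^ 2 - r₁ ^ 2) : ℝ) : ℂ) := by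
  rw [setIntegral_annulus h1 h12 continuous_const]
  simp only [mul_one, intervalIntegral.integral_const, Complex.real_smul]
  rw [intervalIntegral.integral_const_mul, intervalIntegral.integral_ofReal, integral_id]
  push_cast
  ring

/-- Integration over the torus by horizontal slices. -/
lemma setIntegral_torusSet {a A : ℝ} (ha : 0 ≤ a) {g : ℝ × ℝ → ℂ} {h : ℝ → ℂ} (hg : Continuous g)
    (hh : Continuous h) : ∫ p in torusSet a A, g p.1 * h p.2 =
      ∫ z in (-a)..a, h z *
        ∫ v in annulus (A - Real.sqrt (a ^ 2 - z ^ 2)) (A + Real.sqrt (a ^ 2 - z ^ 2)), g v := by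
  have hm := (isClosed_torusSet a A).measurableSet
  have hint : Integrable ((torusSet a A).indicator fun p => g p.1 * h p.2)
      (volume.prod volume) := by
    rw [integrable_indicator_iff hm]
    exact (by fun_prop : Continuous fun p : (ℝ × ℝ) × ℝ => g p.1 * h p.2).continuousOn.integrableOn_compact
      (isCompact_torusSet A ha)
  rw [← integral_indicator hm, Measure.volume_eq_prod, integral_prod_symm _ hint,
    intervalIntegral.integral_of_le (by linarith), ← integral_Icc_eq_integral_Ioc,
    ← integral_indicator measurableSet_Icc]
  congr 1
  ext z
  by_cases hz : z ∈ Set.Icc (-a) a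
  · rw [Set.indicator_of_mem hz, mul_comm, ← integral_mul_const,
      ← integral_indicator (isClosed_annulus _ _).measurableSet]
    congr 1
    ext v
    by_cases hv : v ∈ annulus (A - Real.sqrt (a ^ 2 - z ^ 2)) (A + Real.sqrt (a ^ 2 - z ^ 2))
    · rw [Set.indicator_of_mem hv, Set.indicator_of_mem ((mem_torusSet_iff ha v z).mpr ⟨hz, hv⟩)]
    · rw [Set.indicator_of_notMem hv,
        Set.indicator_of_notMem fun h => hv ((mem_torusSet_iff ha v z).mp h).2]
  · rw [Set.indicator_of_notMem hz]
    rw [integral_eq_zero_of_ae]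
    filter_upwards with v
    exact Set.indicator_of_notMem (fun h => hz ((mem_torusSet_iff ha v z).mp h).1) _

/-- The substitution `z = a sin β` in the height. -/
lemma integral_height_eq {a : ℝ} (ha : 0 ≤ a) {h G : ℝ → ℂ} (hh : Continuous h) (hG : Continuous G) :
    ∫ z in (-a)..a, h z * G (Real.sqrt (a ^ 2 - z ^ 2)) =
      ∫ β in (-(Real.pi / 2))..(Real.pi / 2),
        h (a * Real.sin β) * G (a * Real.cos β) * ((a * Real.cos β : ℝ) : ℂ) := by
  have hs := intervalIntegral.integral_deriv_smul_comp (a := -(Real.pi / 2)) (b := Real.pi / 2)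
    (f := fun β => a * Real.sin β) (f' := fun β => a * Real.cos β)
    (g := fun z => h z * G (Real.sqrt (a ^ 2 - z ^ 2)))
    (fun β _ => (Real.hasDerivAt_sin β).const_mul a) (by fun_prop) (by fun_prop)
  simp only [Real.sin_neg, Real.sin_pi_div_two, mul_neg, mul_one] at hs
  rw [← hs]
  refine intervalIntegral.integral_congr fun β hβ => ?_
  rw [Set.uIcc_of_le (by linarith [Real.pi_pos])] at hβ
  have hc : 0 ≤ a * Real.cos β := mul_nonneg ha (Real.cos_nonneg_of_mem_Icc hβ)
  have e : Real.sqrt (a ^ 2 - (a * Real.sin β) ^ 2) = a * Real.cos β := by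
    rw [Real.sqrt_eq_iff_mul_self_eq _ hc]
    · have := Real.sin_sq_add_cos_sq β
      linear_combination (-a ^ 2) * this
    · have : a ^ 2 - (a * Real.sin β) ^ 2 = (a * Real.cos β) ^ 2 := by
        have := Real.sin_sq_add_cos_sq β
        linear_combination (-a ^ 2) * this
      rw [this]; positivity
  simp only [Function.comp, e, Complex.real_smul]
  ring

/-- The Fourier transform of the solid torus off the axis. -/
theorem setIntegral_torusSet_ee {a A : ℝ} (ha : 0 < a) (haA : a < A) {x y q : ℝ} (hq : 0 < q)
    (hxy : x ^ 2 + y ^ 2 = q ^ 2) (ν : ℝ) :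
    ∫ p in torusSet a A, ee (x * p.1.1 + y * p.1.2) * ee (ν * p.2) = torusHat a A q ν := by
  rw [setIntegral_torusSet ha.le (g := fun v => ee (x * v.1 + y * v.2)) (h := fun z => ee (ν * z))
    (by fun_prop) (by fun_prop)]
  have hJ := continuous_besselJ_one
  set F : ℝ → ℝ := fun t => t * besselJ 1 (2 * Real.pi * q * t) with hF
  have hFc : Continuous F := by fun_prop
  have h1 : ∀ z ∈ Set.uIcc (-a) a, ee (ν * z) * ∫ v in annulus (A - Real.sqrt (a ^ 2 - z ^ 2))
      (A + Real.sqrt (a ^ 2 - z ^ 2)), ee (x * v.1 + y * v.2) =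
      ee (ν * z) * (((F (A + Real.sqrt (a ^ 2 - z ^ 2)) - F (A - Real.sqrt (a ^ 2 - z ^ 2)) : ℝ) : ℂ)
        / q) := by
    intro z _
    have h3 : Real.sqrt (a ^ 2 - z ^ 2) ≤ a := by
      rw [Real.sqrt_le_left ha.le]; nlinarith [sq_nonneg z]
    have h4 := Real.sqrt_nonneg (a ^ 2 - z ^ 2)
    rw [setIntegral_annulus_ee (by linarith) (by linarith) hq hxy]
  rw [intervalIntegral.integral_congr h1, integral_height_eq ha.le
    (h := fun z => ee (ν * z)) (G := fun s => ((F (A + s) - F (A - s) : ℝ) : ℂ) / q) (by fun_prop)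
    (by fun_prop)]
  set k : ℝ → ℂ := fun β => ee (ν * a * Real.sin β) * ((F (A + a * Real.cos β) *
    (a * Real.cos β) : ℝ) : ℂ) with hk
  have hkc : Continuous k := by fun_prop
  have hkp : Function.Periodic k (2 * Real.pi) := fun β => by
    simp only [hk, Real.sin_add_two_pi, Real.cos_add_two_pi]
  have h2 : torusHat a A q ν = (∫ β in (0 : ℝ)..(2 * Real.pi), k β) / q := rfl
  have h3 := hkp.intervalIntegral_add_eq 0 (-(Real.pi / 2))
  rw [zero_add] at h3
  -- The reflection `β ↦ π - β` exchanges the outer and the inner half of the meridian circle, on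
  -- which the two boundary circles of the annulus lie.
  have h4 := intervalIntegral.integral_comp_sub_left k Real.pi (a := -(Real.pi / 2))
    (b := Real.pi / 2)
  rw [show Real.pi - Real.pi / 2 = Real.pi / 2 by ring, show Real.pi - -(Real.pi / 2) =
    -(Real.pi / 2) + 2 * Real.pi by ring] at h4
  rw [h2, h3, ← intervalIntegral.integral_add_adjacent_intervals (b := Real.pi / 2)
    (hkc.intervalIntegrable _ _) (hkc.intervalIntegrable _ _), ← h4,
    ← intervalIntegral.integral_add (hkc.intervalIntegrable _ _)
      (Continuous.intervalIntegrable (by fun_prop) _ _), ← intervalIntegral.integral_div]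
  refine intervalIntegral.integral_congr fun β _ => ?_
  simp only [hk, Real.sin_pi_sub, Real.cos_pi_sub, mul_neg, ← sub_eq_add_neg]
  rw [mul_assoc ν]
  push_cast
  ring

/-- Symmetry in `β` leaves the cosine, and periodicity moves the range to the one in Poisson's
integral for `J₁`. -/
lemma integral_cos_sq_mul_ee (w : ℝ) :
    ∫ β in (-(Real.pi / 2))..(Real.pi / 2), ee (w * Real.sin β) * ((Real.cos β ^ 2 : ℝ) : ℂ) =
      ((∫ θ in (0 : ℝ)..Real.pi, Real.cos θ ^ 2 * Real.cos (2 * Real.pi * w * Real.sin θ) : ℝ) : ℂ) := by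
  set f : ℝ → ℂ := fun β => ee (w * Real.sin β) * ((Real.cos β ^ 2 : ℝ) : ℂ) with hf
  have hfc : Continuous f := by fun_prop
  have h1 := intervalIntegral.integral_comp_neg f (a := -(Real.pi / 2)) (b := Real.pi / 2)
  rw [neg_neg] at h1
  set k : ℝ → ℂ := fun θ => ((Real.cos θ ^ 2 * Real.cos (2 * Real.pi * w * Real.sin θ) : ℝ) : ℂ)
    with hk
  have hkc : Continuous k := by fun_prop
  have h2 : ∀ β, f β + f (-β) = 2 * k β := by
    intro β
    simp only [hf, hk, Real.sin_neg, Real.cos_neg, mul_neg, ee_neg]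
    rw [← add_mul, Complex.add_conj, ee_re, ← mul_assoc (2 * Real.pi)]
    push_cast; ring
  have h3 : ∫ β in (-(Real.pi / 2))..(Real.pi / 2), f β
      = ∫ β in (-(Real.pi / 2))..(Real.pi / 2), k β := by
    have h4 : (∫ β in (-(Real.pi / 2))..(Real.pi / 2), f β) +
        ∫ β in (-(Real.pi / 2))..(Real.pi / 2), f (-β)
        = 2 * ∫ β in (-(Real.pi / 2))..(Real.pi / 2), k β := by
      rw [← intervalIntegral.integral_add (hfc.intervalIntegrable _ _)
        (Continuous.intervalIntegrable (by fun_prop) _ _)]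
      simp only [h2]
      rw [intervalIntegral.integral_const_mul]
    rw [h1] at h4
    linear_combination h4 / 2
  have hkp : Function.Periodic k Real.pi := fun β => by
    simp only [hk, Real.sin_add_pi, Real.cos_add_pi, mul_neg, Real.cos_neg, neg_sq]
  have h5 := hkp.intervalIntegral_add_eq (-(Real.pi / 2)) 0
  rw [zero_add, show -(Real.pi / 2) + Real.pi = Real.pi / 2 by ring] at h5
  rw [h3, h5, ← intervalIntegral.integral_ofReal]

/-- The Fourier transform of the solid torus on the axis. -/
theorem setIntegral_torusSet_ee_axis {a A : ℝ} (ha : 0 < a) (haA : a < A) (ν : ℝ) :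
    ∫ p in torusSet a A, ee (ν * p.2) = if ν = 0 then ((2 * Real.pi ^ 2 * A * a ^ 2 : ℝ) : ℂ)
      else ((2 * Real.pi * A * a * besselJ 1 (2 * Real.pi * ν * a) / ν : ℝ) : ℂ) := by
  have h0 := setIntegral_torusSet (A := A) ha.le (g := fun _ => 1) (h := fun z => ee (ν * z))
    (by fun_prop) (by fun_prop)
  simp only [one_mul] at h0
  have h1 : ∀ z ∈ Set.uIcc (-a) a, ee (ν * z) * ∫ _ in annulus (A - Real.sqrt (a ^ 2 - z ^ 2))
      (A + Real.sqrt (a ^ 2 - z ^ 2)), (1 : ℂ) =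
      ee (ν * z) * ((4 * Real.pi * A * Real.sqrt (a ^ 2 - z ^ 2) : ℝ) : ℂ) := by
    intro z _
    have h3 : Real.sqrt (a ^ 2 - z ^ 2) ≤ a := by
      rw [Real.sqrt_le_left ha.le]; nlinarith [sq_nonneg z]
    have h4 := Real.sqrt_nonneg (a ^ 2 - z ^ 2)
    rw [setIntegral_annulus_one (by linarith) (by linarith)]
    congr 2
    ring
  rw [h0, intervalIntegral.integral_congr h1, integral_height_eq ha.le
    (h := fun z => ee (ν * z)) (G := fun s => ((4 * Real.pi * A * s : ℝ) : ℂ)) (by fun_prop)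
    (by fun_prop)]
  have h2 : ∀ β : ℝ, ee (ν * (a * Real.sin β)) * ((4 * Real.pi * A * (a * Real.cos β) : ℝ) : ℂ) *
      ((a * Real.cos β : ℝ) : ℂ) = ((4 * Real.pi * A * a ^ 2 : ℝ) : ℂ) *
        (ee (ν * a * Real.sin β) * ((Real.cos β ^ 2 : ℝ) : ℂ)) := by
    intro β; rw [mul_assoc ν]; push_cast; ring
  simp only [h2]
  rw [intervalIntegral.integral_const_mul, integral_cos_sq_mul_ee, ← Complex.ofReal_mul]
  split_ifs with hν
  · congr 1
    rw [hν]
    simp only [zero_mul, mul_zero, Real.cos_zero, mul_one]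
    rw [integral_cos_sq]
    simp
    ring
  · congr 1
    rw [besselJ_one_eq_mul_integral]
    have e : ∀ θ, 2 * Real.pi * (ν * a) * Real.sin θ = 2 * Real.pi * ν * a * Real.sin θ :=
      fun θ => by ring
    simp only [e]
    have := Real.pi_ne_zero
    field_simp
    ring

/-! ### Smoothing and Poisson summation -/

open scoped FourierTransform in
/-- A nonnegative smooth bump `χ` supported in `[-1, 1]`, with the properties of its Fourier
transform `W` that the argument uses; the last one is Poisson summation for the rescaled
bump `δ⁻¹ χ(·/δ)`. -/
theorem exists_bump_fourier : ∃ (χ : ℝ → ℝ) (W : ℝ → ℂ), Continuous χ ∧ (∀ x, 0 ≤ χ x) ∧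
    (∀ x, 1 ≤ |x| → χ x = 0) ∧ (∫ x, χ x = 1) ∧ W 0 = 1 ∧ (∀ t, ‖W t‖ ≤ 1) ∧
    (∀ t, ‖W t - 1‖ ≤ 2 * Real.pi * |t|) ∧
    (∀ p : ℕ, ∃ C > 0, ∀ t, |t| ^ p * ‖W t‖ ≤ C) ∧
    (∀ δ > 0, ∀ x : ℝ, ((∑' n : ℤ, δ⁻¹ * χ ((x - n) / δ) : ℝ) : ℂ)
      = ∑' j : ℤ, W (δ * j) * ee (j * x)) := by
  let b : ContDiffBump (0 : ℝ) := ⟨1 / 2, 1, by norm_num, by norm_num⟩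
  set χ : ℝ → ℝ := b.normed volume with hχ
  have hsupp : ∀ x, 1 ≤ |x| → χ x = 0 := by
    intro x hx
    by_contra h
    have h1 : x ∈ Function.support (b.normed volume) := h
    rw [b.support_normed_eq] at h1
    have h2 : b.rOut = 1 := rfl
    rw [h2, Metric.mem_ball, dist_zero_right, Real.norm_eq_abs] at h1
    linarith
  have hsm : ContDiff ℝ (⊤ : ℕ∞) (fun x => (χ x : ℂ)) :=
    Complex.ofRealCLM.contDiff.comp b.contDiff_normed
  have hcs : HasCompactSupport (fun x => (χ x : ℂ)) :=
    (b.hasCompactSupport_normed (μ := volume)).comp_left (g := fun x : ℝ => (x : ℂ)) (by simp)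
  have hcont : Continuous χ := b.continuous_normed
  have hint : Integrable χ := b.integrable_normed
  have hint1 : ∫ x, χ x = 1 := b.integral_normed
  have hnn : ∀ x, 0 ≤ χ x := b.nonneg_normed
  let F : SchwartzMap ℝ ℂ := hcs.toSchwartzMap hsm
  set W : ℝ → ℂ := fun t => (𝓕 F) t with hWdef
  have hW : ∀ t, W t = ∫ v, ee (-(v * t)) * (χ v : ℂ) := by
    intro t
    rw [hWdef]
    simp only [SchwartzMap.fourier_coe]
    rw [Real.fourier_eq' ]
    congr 1; ext v
    rw [ee_eq, smul_eq_mul]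
    congr 2
    simp
    ring
  have hWi : ∀ t, Integrable (fun v => ee (-(v * t)) * (χ v : ℂ)) := by
    intro t
    refine (hint.ofReal (𝕜 := ℂ)).bdd_mul (c := 1) (by fun_prop) ?_
    exact Filter.Eventually.of_forall fun v => (norm_ee _).le
  refine ⟨χ, W, hcont, hnn, hsupp, hint1, ?_, ?_, ?_, ?_, ?_⟩
  · rw [hW]; simp only [mul_zero, neg_zero, ee_zero, one_mul]
    rw [integral_complex_ofReal, hint1]; simp
  · intro t
    rw [hW, ← hint1]
    refine (norm_integral_le_integral_norm _).trans (le_of_eq ?_)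
    congr 1; ext v
    rw [norm_mul, norm_ee, one_mul, Complex.norm_real, Real.norm_of_nonneg (hnn v)]
  · intro t
    have h1 : (1 : ℂ) = ∫ v, (χ v : ℂ) := by rw [integral_complex_ofReal, hint1]; simp
    have hi : Integrable (fun v => (χ v : ℂ)) := hint.ofReal
    rw [hW, h1, ← integral_sub (hWi t) hi]
    refine (norm_integral_le_integral_norm _).trans ?_
    have h2 : 2 * Real.pi * |t| = ∫ v, χ v * (2 * Real.pi * |t|) := by
      rw [integral_mul_const, hint1, one_mul]
    rw [h2]
    refine integral_mono_of_nonneg (Filter.Eventually.of_forall fun v => norm_nonneg _)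
      (hint.mul_const _) (Filter.Eventually.of_forall fun v => ?_)
    simp only
    rw [show ee (-(v * t)) * (χ v : ℂ) - (χ v : ℂ) = (ee (-(v * t)) - 1) * (χ v : ℂ) by ring,
      norm_mul, Complex.norm_real, Real.norm_of_nonneg (hnn v), mul_comm]
    by_cases hv : 1 ≤ |v|
    · rw [hsupp v hv]; simp
    · refine mul_le_mul_of_nonneg_left ?_ (hnn v)
      have h3 : ‖ee (-(v * t)) - 1‖ ≤ |2 * Real.pi * (-(v * t))| := by
        have := Real.norm_exp_I_mul_ofReal_sub_one_le (x := 2 * Real.pi * (-(v * t)))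
        rw [ee_eq, mul_comm _ Complex.I]
        simpa using this
      refine h3.trans ?_
      rw [abs_mul, abs_neg, abs_mul v, abs_of_pos Real.two_pi_pos]
      have := Real.two_pi_pos
      have h4 : |v| * |t| ≤ 1 * |t| := by gcongr; exact (not_le.mp hv).le
      rw [one_mul] at h4
      gcongr
  · intro p
    obtain ⟨C, hC, h⟩ := (𝓕 F).decay p 0
    refine ⟨C, hC, fun t => ?_⟩
    have := h t
    rwa [norm_iteratedFDeriv_zero, Real.norm_eq_abs] at this
  · intro δ hδ x
    have hsm' : ContDiff ℝ (⊤ : ℕ∞) (fun x => ((δ⁻¹ * χ (x / δ) : ℝ) : ℂ)) := by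
      have e : (fun x => ((δ⁻¹ * χ (x / δ) : ℝ) : ℂ)) = fun x => (δ⁻¹ : ℂ) * (χ (x / δ) : ℂ) := by
        ext x; push_cast; rfl
      rw [e]
      exact contDiff_const.mul (hsm.comp (contDiff_id.div_const δ))
    have hcs' : HasCompactSupport (fun x => ((δ⁻¹ * χ (x / δ) : ℝ) : ℂ)) := by
      refine HasCompactSupport.intro (K := Set.Icc (-δ) δ) isCompact_Icc fun y hy => ?_
      rw [hsupp, mul_zero, Complex.ofReal_zero]
      rw [abs_div, abs_of_pos hδ, one_le_div hδ]
      by_contra h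
      exact hy (Set.mem_Icc.mpr (abs_le.mp (not_le.mp h).le))
    have hP := SchwartzMap.tsum_eq_tsum_fourier (hcs'.toSchwartzMap hsm') x
    have hl : ((∑' n : ℤ, δ⁻¹ * χ ((x - n) / δ) : ℝ) : ℂ)
        = ∑' n : ℤ, (hcs'.toSchwartzMap hsm') (x + n) := by
      rw [Complex.ofReal_tsum, ← (Equiv.neg ℤ).tsum_eq]
      congr 1; ext n
      simp [sub_eq_add_neg]
    rw [hl, hP]
    congr 1; ext j
    congr 1
    · simp only [SchwartzMap.fourier_coe]
      rw [Real.fourier_eq', hW]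
      have h5 := Measure.integral_comp_div (fun v => ee (-(v * (δ * j))) * (χ v : ℂ)) δ
      have h6 : ∫ v, ee (-(v * (δ * j))) * (χ v : ℂ) =
          (δ⁻¹ : ℂ) * ∫ v, ee (-(v / δ * (δ * j))) * (χ (v / δ) : ℂ) := by
        rw [h5, abs_of_pos hδ, Complex.real_smul, ← mul_assoc, inv_mul_cancel₀, one_mul]
        exact_mod_cast hδ.ne'
      rw [h6, ← integral_const_mul]
      congr 1; ext v
      rw [ee_eq, smul_eq_mul]
      have h7 : v / δ * (δ * j) = v * j := by field_simp
      rw [h7]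
      have h9 : (-2 * Real.pi * (inner ℝ v (j : ℝ)) : ℝ) = 2 * Real.pi * (-(v * j)) := by
        simp; ring
      rw [h9, show (hcs'.toSchwartzMap hsm') v = ((δ⁻¹ * χ (v / δ) : ℝ) : ℂ) from rfl]
      push_cast
      ring
    · rw [fourier_coe_apply, ee]
      congr 1; push_cast; ring

/-- Moving each coordinate by at most `δ` changes the tube radius by at most `2 δ`. -/
lemma mem_torusSet_of_abs_sub_le {a A δ : ℝ} (ha : 0 ≤ a) (hδ : 0 ≤ δ) {p q : (ℝ × ℝ) × ℝ}
    (hp : p ∈ torusSet a A) (h1 : |q.1.1 - p.1.1| ≤ δ) (h2 : |q.1.2 - p.1.2| ≤ δ)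
    (h3 : |q.2 - p.2| ≤ δ) : q ∈ torusSet (a + 2 * δ) A := by
  simp only [torusSet, Set.mem_ofPred_eq] at hp ⊢
  set r := Real.sqrt (p.1.1 ^ 2 + p.1.2 ^ 2) with hr
  set r' := Real.sqrt (q.1.1 ^ 2 + q.1.2 ^ 2) with hr'
  have k1 : (r' - r) ^ 2 ≤ 2 * δ ^ 2 := by
    have e1 := Complex.norm_add_mul_I p.1.1 p.1.2
    have e2 := Complex.norm_add_mul_I q.1.1 q.1.2
    have e3 := Complex.norm_add_mul_I (q.1.1 - p.1.1) (q.1.2 - p.1.2)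
    have e4 := abs_norm_sub_norm_le ((q.1.1 : ℂ) + q.1.2 * Complex.I)
      ((p.1.1 : ℂ) + p.1.2 * Complex.I)
    rw [e1, e2, ← hr, ← hr', show ((q.1.1 : ℂ) + q.1.2 * Complex.I) -
      ((p.1.1 : ℂ) + p.1.2 * Complex.I) = ((q.1.1 - p.1.1 : ℝ) : ℂ) +
        ((q.1.2 - p.1.2 : ℝ) : ℂ) * Complex.I by push_cast; ring, e3] at e4
    have e8 := Real.sqrt_nonneg ((q.1.1 - p.1.1) ^ 2 + (q.1.2 - p.1.2) ^ 2)
    have e5 := pow_le_pow_left₀ (abs_nonneg _) e4 2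
    rw [sq_abs, Real.sq_sqrt (by positivity)] at e5
    have e6 := pow_le_pow_left₀ (abs_nonneg _) h1 2
    have e7 := pow_le_pow_left₀ (abs_nonneg _) h2 2
    rw [sq_abs] at e6 e7
    linarith
  have k2 : (q.2 - p.2) ^ 2 ≤ δ ^ 2 := by
    have e6 := pow_le_pow_left₀ (abs_nonneg _) h3 2
    rwa [sq_abs] at e6
  have k3 : (A - r) * (r - r') + p.2 * (q.2 - p.2) ≤ 2 * (a * δ) := by
    refine (le_abs_self _).trans (abs_le_of_sq_le_sq ?_ (by positivity))
    have e1 : ((A - r) * (r - r') + p.2 * (q.2 - p.2)) ^ 2 ≤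
        ((A - r) ^ 2 + p.2 ^ 2) * ((r' - r) ^ 2 + (q.2 - p.2) ^ 2) := by
      nlinarith [sq_nonneg ((A - r) * (q.2 - p.2) - p.2 * (r - r'))]
    have e2 : ((A - r) ^ 2 + p.2 ^ 2) * ((r' - r) ^ 2 + (q.2 - p.2) ^ 2) ≤
        a ^ 2 * (3 * δ ^ 2) := by
      gcongr
      linarith
    have e3 : 0 ≤ a ^ 2 * δ ^ 2 := by positivity
    linarith
  nlinarith [sq_nonneg δ]

/-- The Fourier transform of the solid torus at integer frequencies. -/
noncomputable def torusFourier (a A : ℝ) (ω : (ℤ × ℤ) × ℤ) : ℂ :=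
  ∫ p in torusSet a A, ee (ω.1.1 * p.1.1 + ω.1.2 * p.1.2) * ee (ω.2 * p.2)

/-- The integer points of the solid torus with tube radius `a` and central radius `A`. -/
def torusIntPoints (a A : ℝ) : Set ((ℤ × ℤ) × ℤ) :=
  {n | (((n.1.1 : ℝ), (n.1.2 : ℝ)), (n.2 : ℝ)) ∈ torusSet a A}

lemma torusIntPoints_finite {a : ℝ} (A : ℝ) (ha : 0 ≤ a) : (torusIntPoints a A).Finite := by
  have h : torusIntPoints a A ⊆ ((Set.Icc ⌈-(A + a)⌉ ⌊A + a⌋ ×ˢ Set.Icc ⌈-(A + a)⌉ ⌊A + a⌋) ×ˢ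
      Set.Icc ⌈-a⌉ ⌊a⌋) := by
    rintro n hn
    obtain ⟨⟨h1, h2⟩, h3⟩ := torusSet_subset ha hn
    simp only [Set.mem_Icc] at h1 h2 h3
    refine ⟨⟨?_, ?_⟩, ?_⟩
    · exact ⟨Int.ceil_le.mpr h1.1, Int.le_floor.mpr h1.2⟩
    · exact ⟨Int.ceil_le.mpr h2.1, Int.le_floor.mpr h2.2⟩
    · exact ⟨Int.ceil_le.mpr h3.1, Int.le_floor.mpr h3.2⟩
  exact (((Set.finite_Icc _ _).prod (Set.finite_Icc _ _)).prod (Set.finite_Icc _ _)).subset h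

/-- The triple product weight attached to a function of one variable. -/
def tripleWeight (w : ℤ → ℂ) (ω : (ℤ × ℤ) × ℤ) : ℂ := w ω.1.1 * w ω.1.2 * w ω.2

lemma summable_norm_tripleWeight {w : ℤ → ℂ} (hw : Summable fun j => ‖w j‖) :
    Summable fun ω => ‖tripleWeight w ω‖ := by
  have h1 : Summable fun ξ : ℤ × ℤ => ‖w ξ.1 * w ξ.2‖ := hw.mul_norm hw
  exact h1.mul_norm hw

/-- Integrating a product of three absolutely convergent Fourier series over the torus. -/
theorem setIntegral_torusSet_tsum {a : ℝ} (A : ℝ) (ha : 0 ≤ a) {w : ℤ → ℂ}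
    (hw : Summable fun j => ‖w j‖) {κ : ℝ → ℂ} (hκ : ∀ x, κ x = ∑' j : ℤ, w j * ee (j * x)) :
    Continuous κ ∧ ∫ p in torusSet a A, κ p.1.1 * κ p.1.2 * κ p.2
      = ∑' ω, tripleWeight w ω * torusFourier a A ω := by
  have hsum : ∀ x, Summable fun j : ℤ => ‖w j * ee (j * x)‖ := by
    intro x; simpa only [norm_mul, norm_ee, mul_one] using hw
  refine ⟨?_, ?_⟩
  · have e : κ = fun x => ∑' j : ℤ, w j * ee (j * x) := funext hκ
    rw [e]
    exact continuous_tsum (fun j => by fun_prop) hw fun j x => by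
      rw [norm_mul, norm_ee, mul_one]
  · have hK : ∀ p : (ℝ × ℝ) × ℝ, κ p.1.1 * κ p.1.2 * κ p.2 = ∑' ω : (ℤ × ℤ) × ℤ,
        tripleWeight w ω * (ee (ω.1.1 * p.1.1 + ω.1.2 * p.1.2) * ee (ω.2 * p.2)) := by
      intro p
      rw [hκ, hκ, hκ, tsum_mul_tsum_of_summable_norm (hsum _) (hsum _),
        tsum_mul_tsum_of_summable_norm ((hsum p.1.1).mul_norm (hsum p.1.2)) (hsum _)]
      congr 1; ext ω
      rw [tripleWeight, ee_add]; ring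
    have hc := isCompact_torusSet A ha
    have hn : ∀ (ω : (ℤ × ℤ) × ℤ) (p : (ℝ × ℝ) × ℝ), ‖tripleWeight w ω *
        (ee (ω.1.1 * p.1.1 + ω.1.2 * p.1.2) * ee (ω.2 * p.2))‖ = ‖tripleWeight w ω‖ := by
      intro ω p; simp only [norm_mul, norm_ee, mul_one]
    simp only [hK]
    rw [← (hasSum_integral_of_summable_integral_norm
      (F := fun (ω : (ℤ × ℤ) × ℤ) (p : (ℝ × ℝ) × ℝ) => tripleWeight w ω *
        (ee (ω.1.1 * p.1.1 + ω.1.2 * p.1.2) * ee (ω.2 * p.2)))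
      (μ := volume.restrict (torusSet a A)) ?_ ?_).tsum_eq]
    · congr 1; ext ω
      rw [torusFourier, integral_const_mul]
    · intro ω
      exact ContinuousOn.integrableOn_compact hc (Continuous.continuousOn (by fun_prop))
    · simp only [hn, integral_const, smul_eq_mul]
      exact (summable_norm_tripleWeight hw).mul_left _

lemma norm_torusFourier_le {a : ℝ} (A : ℝ) (ha : 0 ≤ a) (ω : (ℤ × ℤ) × ℤ) :
    ‖torusFourier a A ω‖ ≤ volume.real (torusSet a A) := by
  have := norm_setIntegral_le_of_norm_le_const (μ := volume) (s := torusSet a A) (C := 1)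
    (f := fun p : (ℝ × ℝ) × ℝ => ee (ω.1.1 * p.1.1 + ω.1.2 * p.1.2) * ee (ω.2 * p.2))
    (isCompact_torusSet A ha).measure_lt_top
    fun p _ => by rw [norm_mul, norm_ee, norm_ee, one_mul]
  rwa [one_mul] at this

/-- Smoothing at scale `δ` compares the number of lattice points of a torus with the
Fourier series weighted by `W(δ ·)` of tori whose tube radius differs by `2 δ`. -/
theorem exists_fourier_weight : ∃ W : ℝ → ℂ, W 0 = 1 ∧ (∀ t, ‖W t‖ ≤ 1) ∧
    (∀ t, ‖W t - 1‖ ≤ 2 * Real.pi * |t|) ∧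
    (∀ p : ℕ, ∃ C > 0, ∀ t, |t| ^ p * ‖W t‖ ≤ C) ∧
    ∀ a A δ : ℝ, 0 ≤ a → 0 < δ → (Summable fun j : ℤ => ‖W (δ * j)‖) ∧
      ((torusIntPoints a A).ncard : ℝ) ≤
        (∑' ω, tripleWeight (fun j => W (δ * j)) ω * torusFourier (a + 2 * δ) A ω).re ∧
      (∑' ω, tripleWeight (fun j => W (δ * j)) ω * torusFourier a A ω).re ≤
        ((torusIntPoints (a + 2 * δ) A).ncard : ℝ) := by
  obtain ⟨χ, W, hχc, hχ0, hχs, hχ1, hW0, hW1, hWl, hWd, hP⟩ := exists_bump_fourier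
  refine ⟨W, hW0, hW1, hWl, hWd, fun a A δ ha hδ => ?_⟩
  have hw : Summable fun j : ℤ => ‖W (δ * j)‖ := by
    obtain ⟨C, hC, h⟩ := hWd 2
    refine Summable.of_norm_bounded_eventually (g := fun j : ℤ => C / δ ^ 2 * (1 / (j : ℝ) ^ 2))
      ((Real.summable_one_div_int_pow.mpr one_lt_two).mul_left _) ?_
    filter_upwards [(Set.finite_singleton (0 : ℤ)).compl_mem_cofinite] with j hj
    have hj0 : (j : ℝ) ≠ 0 := by exact_mod_cast hj
    have h2 := h (δ * j)
    rw [sq_abs] at h2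
    rw [norm_norm, div_mul_div_comm, mul_one, le_div_iff₀ (by positivity)]
    linarith
  refine ⟨hw, ?_⟩
  -- the rescaled bump on the line and in space
  set f : ℝ → ℝ := fun x => δ⁻¹ * χ (x / δ) with hf
  set g : (ℤ × ℤ) × ℤ → (ℝ × ℝ) × ℝ → ℝ := fun n p =>
    f (p.1.1 - n.1.1) * f (p.1.2 - n.1.2) * f (p.2 - n.2) with hg
  have hf0 : ∀ x, 0 ≤ f x := fun x => by rw [hf]; have := hχ0 (x / δ); positivity
  have hfc : Continuous f := by rw [hf]; fun_prop
  have hfs : ∀ x, δ ≤ |x| → f x = 0 := by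
    intro x hx
    rw [hf]; simp only
    rw [hχs, mul_zero]
    rwa [abs_div, abs_of_pos hδ, one_le_div hδ]
  have hfcs : HasCompactSupport f := by
    refine HasCompactSupport.intro (K := Set.Icc (-δ) δ) isCompact_Icc fun y hy => hfs y ?_
    by_contra h
    exact hy (Set.mem_Icc.mpr (abs_le.mp (not_le.mp h).le))
  have hfi : Integrable f := hfc.integrable_of_hasCompactSupport hfcs
  have hf1 : ∀ c : ℝ, ∫ x, f (x - c) = 1 := by
    intro c
    rw [integral_sub_right_eq_self f c, hf, integral_const_mul,
      Measure.integral_comp_div χ δ, hχ1, abs_of_pos hδ]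
    simp [hδ.ne']
  have hg0 : ∀ n p, 0 ≤ g n p := fun n p =>
    mul_nonneg (mul_nonneg (hf0 _) (hf0 _)) (hf0 _)
  have hgc : ∀ n, Continuous (g n) := fun n => by rw [hg]; fun_prop
  have hgi : ∀ n, Integrable (g n) := fun n =>
    ((hfi.comp_sub_right (n.1.1 : ℝ)).mul_prod (hfi.comp_sub_right (n.1.2 : ℝ))).mul_prod
      (hfi.comp_sub_right (n.2 : ℝ))
  have hg1 : ∀ n, ∫ p, g n p = 1 := by
    intro n
    have h1 := integral_prod_mul (μ := (volume : Measure (ℝ × ℝ))) (ν := (volume : Measure ℝ))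
      (fun v : ℝ × ℝ => f (v.1 - n.1.1) * f (v.2 - n.1.2)) (fun z => f (z - n.2))
    have h2 := integral_prod_mul (μ := (volume : Measure ℝ)) (ν := (volume : Measure ℝ))
      (fun x => f (x - n.1.1)) (fun y => f (y - n.1.2))
    rw [hf1, hf1, mul_one] at h2
    rw [← Measure.volume_eq_prod] at h1 h2
    rw [h2, hf1, mul_one] at h1
    exact h1
  -- the support of the bump
  have hgs : ∀ n p, g n p ≠ 0 → |(n.1.1 : ℝ) - p.1.1| ≤ δ ∧ |(n.1.2 : ℝ) - p.1.2| ≤ δ ∧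
      |(n.2 : ℝ) - p.2| ≤ δ := by
    intro n p h
    have h1 : ∀ u v : ℝ, f (u - v) ≠ 0 → |v - u| ≤ δ := fun u v h => by
      by_contra h'
      exact h (hfs _ (by rw [abs_sub_comm]; linarith))
    have h2 := left_ne_zero_of_mul h
    exact ⟨h1 _ _ (left_ne_zero_of_mul h2), h1 _ _ (right_ne_zero_of_mul h2),
      h1 _ _ (right_ne_zero_of_mul h)⟩
  set κ : ℝ → ℝ := fun x => ∑' n : ℤ, f (x - n) with hκ
  have hκfin : ∀ (x : ℝ) (I : Finset ℤ), Finset.Icc ⌊x - δ⌋ ⌈x + δ⌉ ⊆ I →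
      κ x = ∑ n ∈ I, f (x - n) := by
    intro x I hI
    refine tsum_eq_sum fun n hn => hfs _ ?_
    by_contra h
    have h1 := abs_lt.mp (not_le.mp h)
    refine hn (hI (Finset.mem_Icc.mpr ⟨?_, ?_⟩))
    · exact_mod_cast (Int.floor_le (x - δ)).trans (by linarith : x - δ ≤ n)
    · exact_mod_cast (by linarith : (n : ℝ) ≤ x + δ).trans (Int.le_ceil (x + δ))
  set K : (ℝ × ℝ) × ℝ → ℝ := fun p => κ p.1.1 * κ p.1.2 * κ p.2 with hK
  have hKsum : ∀ (S : Finset ((ℤ × ℤ) × ℤ)) p, ∃ F : Finset ((ℤ × ℤ) × ℤ), S ⊆ F ∧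
      K p = ∑ n ∈ F, g n p := by
    intro S p
    let I1 := Finset.Icc ⌊p.1.1 - δ⌋ ⌈p.1.1 + δ⌉ ∪ S.image (fun n => n.1.1)
    let I2 := Finset.Icc ⌊p.1.2 - δ⌋ ⌈p.1.2 + δ⌉ ∪ S.image (fun n => n.1.2)
    let I3 := Finset.Icc ⌊p.2 - δ⌋ ⌈p.2 + δ⌉ ∪ S.image (fun n => n.2)
    refine ⟨(I1 ×ˢ I2) ×ˢ I3, ?_, ?_⟩
    · intro n hn
      simp only [Finset.mem_product]
      exact ⟨⟨Finset.mem_union_right _ (Finset.mem_image_of_mem _ hn),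
        Finset.mem_union_right _ (Finset.mem_image_of_mem _ hn)⟩,
        Finset.mem_union_right _ (Finset.mem_image_of_mem _ hn)⟩
    · rw [hK]; simp only
      rw [hκfin _ I1 Finset.subset_union_left, hκfin _ I2 Finset.subset_union_left,
        hκfin _ I3 Finset.subset_union_left, Finset.sum_mul_sum, ← Finset.sum_product',
        Finset.sum_mul_sum, ← Finset.sum_product']
  have hκC : ∀ x, (κ x : ℂ) = ∑' j : ℤ, W (δ * j) * ee (j * x) := hP δ hδ
  have hKc : Continuous K := by
    have h1 := (setIntegral_torusSet_tsum A ha hw hκC).1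
    have h2 : Continuous κ := by
      have : κ = fun x => (κ x : ℂ).re := by ext; simp
      rw [this]; exact Complex.continuous_re.comp h1
    rw [hK]; fun_prop
  have hKint : ∀ a' : ℝ, 0 ≤ a' → ∫ p in torusSet a' A, K p =
      (∑' ω, tripleWeight (fun j => W (δ * j)) ω * torusFourier a' A ω).re := by
    intro a' ha'
    rw [← (setIntegral_torusSet_tsum A ha' hw hκC).2]
    have h1 : ∀ p : (ℝ × ℝ) × ℝ, (κ p.1.1 : ℂ) * κ p.1.2 * κ p.2 = (K p : ℂ) := fun p => by
      rw [hK]; push_cast; rfl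
    simp only [h1]
    rw [integral_complex_ofReal, Complex.ofReal_re]
  have hKi : ∀ a' : ℝ, 0 ≤ a' → IntegrableOn K (torusSet a' A) := fun a' ha' =>
    hKc.continuousOn.integrableOn_compact (isCompact_torusSet A ha')
  have hmeas : ∀ a', MeasurableSet (torusSet a' A) := fun a' =>
    (isClosed_torusSet a' A).measurableSet
  constructor
  · have ha2 : 0 ≤ a + 2 * δ := by linarith
    rw [← hKint _ ha2]
    set S := (torusIntPoints_finite A ha).toFinset with hS
    have h1 : ∀ n ∈ S, ∫ p in torusSet (a + 2 * δ) A, g n p = 1 := by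
      intro n hn
      rw [setIntegral_eq_integral_of_forall_compl_eq_zero, hg1]
      intro p hp
      by_contra h
      obtain ⟨k1, k2, k3⟩ := hgs n p h
      rw [abs_sub_comm] at k1 k2 k3
      exact hp (mem_torusSet_of_abs_sub_le ha hδ.le
        ((torusIntPoints_finite A ha).mem_toFinset.mp hn) k1 k2 k3)
    calc ((torusIntPoints a A).ncard : ℝ) = ∑ n ∈ S, ∫ p in torusSet (a + 2 * δ) A, g n p := by
          rw [Finset.sum_congr rfl h1, Set.ncard_eq_toFinset_card _ (torusIntPoints_finite A ha)]
          simp [hS]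
      _ = ∫ p in torusSet (a + 2 * δ) A, ∑ n ∈ S, g n p :=
          (integral_finsetSum _ fun n _ => (hgi n).integrableOn).symm
      _ ≤ _ := by
          refine setIntegral_mono (integrable_finsetSum _ fun n _ => (hgi n).integrableOn)
            (hKi _ ha2) fun p => ?_
          obtain ⟨F, hF, e⟩ := hKsum S p
          rw [e]
          exact Finset.sum_le_sum_of_subset_of_nonneg hF fun n _ _ => hg0 n p
  · rw [← hKint _ ha]
    have ha2 : 0 ≤ a + 2 * δ := by linarith
    set S := (torusIntPoints_finite A ha2).toFinset with hS
    calc ∫ p in torusSet a A, K p ≤ ∫ p in torusSet a A, ∑ n ∈ S, g n p := by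
          refine setIntegral_mono_on (hKi _ ha)
            (integrable_finsetSum _ fun n _ => (hgi n).integrableOn) (hmeas a) fun p hp => ?_
          obtain ⟨F, hF, e⟩ := hKsum S p
          rw [e]
          refine (Finset.sum_subset hF fun n _ hn => ?_).ge
          by_contra h
          obtain ⟨k1, k2, k3⟩ := hgs n p h
          exact hn ((torusIntPoints_finite A ha2).mem_toFinset.mpr
            (mem_torusSet_of_abs_sub_le (q := (((n.1.1 : ℝ), (n.1.2 : ℝ)), (n.2 : ℝ)))
              ha hδ.le hp k1 k2 k3))
      _ = ∑ n ∈ S, ∫ p in torusSet a A, g n p :=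
          integral_finsetSum _ fun n _ => (hgi n).integrableOn
      _ ≤ ∑ n ∈ S, (1 : ℝ) := Finset.sum_le_sum fun n _ => by
          rw [← hg1 n]
          exact setIntegral_le_integral (hgi n) (Filter.Eventually.of_forall (hg0 n))
      _ = _ := by
          rw [Set.ncard_eq_toFinset_card _ (torusIntPoints_finite A ha2)]
          simp [hS]

/-! ### The frequencies in a box -/

/-- The nonzero integer points of the square `|ξᵢ| ≤ X`. -/
noncomputable def planeBox (X : ℕ) : Finset (ℤ × ℤ) :=
  (Finset.Icc (-X : ℤ) X ×ˢ Finset.Icc (-X : ℤ) X).erase 0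

lemma natAbs_le_of_mem_Icc {X : ℕ} {ν : ℤ} (h : ν ∈ Finset.Icc (-X : ℤ) X) : ν.natAbs ≤ X := by
  rw [Finset.mem_Icc] at h; omega

lemma mem_planeBox {X : ℕ} {ξ : ℤ × ℤ} (h : ξ ∈ planeBox X) :
    ξ ≠ 0 ∧ ξ.1.natAbs ≤ X ∧ ξ.2.natAbs ≤ X := by
  rw [planeBox, Finset.mem_erase, Finset.mem_product] at h
  exact ⟨h.1, natAbs_le_of_mem_Icc h.2.1, natAbs_le_of_mem_Icc h.2.2⟩

/-- The bound of `norm_sum_box_le`. -/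
noncomputable def boxBound (a A κ : ℝ) (X : ℕ) : ℝ :=
  10 ^ 11 * Real.sqrt (A / κ) * (Nat.clog 2 (6 * X ^ 2) + 1 : ℕ) ^ 4 *
    (a ^ (1 / 3 : ℝ) + (X : ℝ) ^ (1 / 2 : ℝ))

/-- `norm_sum_box_le` for either sign of the phase and for coefficients of any size. -/
theorem norm_sum_planeBox_le {a A σ κ : ℝ} (hκ0 : 0 < κ) (hκ1 : κ ≤ 1) (haA : a ≤ (1 - κ) * A)
    (hσ : |σ| ≤ 1) {X : ℕ} (hX : 1 ≤ X) (ha0 : 0 < a) (hXa : 192 * (X : ℝ) ^ 2 ≤ a ^ 2) {c : ℤ → ℂ}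
    (hc : ∀ ν, ‖c ν‖ ≤ 1) {d : ℤ × ℤ → ℂ} {D : ℝ} (hd : ∀ ξ, ‖d ξ‖ ≤ D) :
    ‖∑ ξ ∈ planeBox X, d ξ * ((normSqNat ξ : ℝ) ^ (-(1 / 4) : ℝ) : ℝ) *
        ∑ ν ∈ Finset.Icc (-X : ℤ) X,
        c ν * (amplitude a A σ (normSqNat ξ) (normSqNat ξ + ν.natAbs ^ 2) : ℂ) *
          ee (a * Real.sqrt ((normSqNat ξ + ν.natAbs ^ 2 : ℕ)))‖ ≤ D * boxBound a A κ X ∧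
    ‖∑ ξ ∈ planeBox X, d ξ * ((normSqNat ξ : ℝ) ^ (-(1 / 4) : ℝ) : ℝ) *
        ∑ ν ∈ Finset.Icc (-X : ℤ) X,
        c ν * (amplitude a A σ (normSqNat ξ) (normSqNat ξ + ν.natAbs ^ 2) : ℂ) *
          ee (-(a * Real.sqrt ((normSqNat ξ + ν.natAbs ^ 2 : ℕ))))‖ ≤ D * boxBound a A κ X := by
  have hD0 : 0 ≤ D := (norm_nonneg _).trans (hd 0)
  have key : ∀ (c : ℤ → ℂ) (d : ℤ × ℤ → ℂ), (∀ ν, ‖c ν‖ ≤ 1) → (∀ ξ, ‖d ξ‖ ≤ D) →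
      ‖∑ ξ ∈ planeBox X, d ξ * ((normSqNat ξ : ℝ) ^ (-(1 / 4) : ℝ) : ℝ) *
        ∑ ν ∈ Finset.Icc (-X : ℤ) X,
        c ν * (amplitude a A σ (normSqNat ξ) (normSqNat ξ + ν.natAbs ^ 2) : ℂ) *
          ee (a * Real.sqrt ((normSqNat ξ + ν.natAbs ^ 2 : ℕ)))‖ ≤ D * boxBound a A κ X := by
    intro c d hc hd
    rcases hD0.eq_or_lt with h0 | hD
    · have h1 : ∀ ξ, d ξ = 0 := fun ξ => norm_le_zero_iff.mp (h0 ▸ hd ξ)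
      simp [h1, ← h0]
    · have h1 := norm_sum_box_le hκ0 hκ1 haA hσ hX ha0 hXa hc (d := fun ξ => d ξ / D)
        (fun ξ => by
          rw [norm_div, Complex.norm_real, Real.norm_of_nonneg hD0, div_le_one hD]; exact hd ξ)
        (B := planeBox X) (fun ξ hξ => mem_planeBox hξ) (W := Finset.Icc (-X : ℤ) X)
        (fun ν hν => natAbs_le_of_mem_Icc hν)
      have hDc : (D : ℂ) ≠ 0 := by exact_mod_cast hD.ne'
      have h2 := mul_le_mul_of_nonneg_left h1 hD0
      rw [boxBound]
      refine le_trans (le_of_eq ?_) h2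
      rw [← Real.norm_of_nonneg hD0, ← Complex.norm_real, ← norm_mul, Finset.mul_sum,
        Complex.norm_real, Real.norm_of_nonneg hD0]
      congr 1
      refine Finset.sum_congr rfl fun ξ _ => ?_
      field_simp
  refine ⟨key c d hc hd, ?_⟩
  rw [← Complex.norm_conj]
  refine le_trans (le_of_eq ?_) (key (fun ν => (starRingEnd ℂ) (c ν)) (fun ξ => (starRingEnd ℂ) (d ξ))
    (fun ν => by rw [Complex.norm_conj]; exact hc ν) (fun ξ => by rw [Complex.norm_conj]; exact hd ξ))
  simp only [map_sum, map_mul, Complex.conj_ofReal, ← ee_neg, neg_neg]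

lemma one_div_normSqNat_le {ξ : ℤ × ℤ} (h : ξ ≠ 0) :
    1 / (normSqNat ξ : ℝ) ≤ 1 / max 1 |(ξ.1 : ℝ)| * (1 / max 1 |(ξ.2 : ℝ)|) := by
  have hk : (1 : ℝ) ≤ normSqNat ξ := by exact_mod_cast normSqNat_pos h
  rw [div_mul_div_comm, one_mul]
  refine one_div_le_one_div_of_le (by positivity) ?_
  rw [cast_normSqNat] at hk ⊢
  have h1 : ∀ j : ℤ, |(j : ℝ)| = 0 ∨ 1 ≤ |(j : ℝ)| := by
    intro j
    rcases eq_or_ne j 0 with rfl | hj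
    · left; simp
    · right; exact_mod_cast Int.one_le_abs hj
  have e1 := sq_abs (ξ.1 : ℝ)
  have e2 := sq_abs (ξ.2 : ℝ)
  rcases h1 ξ.1 with h | h <;> rcases h1 ξ.2 with h' | h'
  · rw [h, h']; rw [h] at e1; rw [h'] at e2; norm_num; nlinarith
  · rw [max_eq_right h', max_eq_left (by linarith)]; nlinarith
  · rw [max_eq_right h, max_eq_left (by linarith)]; nlinarith
  · rw [max_eq_right h, max_eq_right h']; nlinarith [sq_nonneg (|(ξ.1 : ℝ)| - |(ξ.2 : ℝ)|)]

lemma sum_Icc_one_div_max_le (X : ℕ) :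
    ∑ j ∈ Finset.Icc (-X : ℤ) X, 1 / max 1 |(j : ℝ)| ≤ 3 + 2 * Real.log X := by
  have h1 : ∑ j ∈ Finset.Icc (-X : ℤ) X, 1 / max 1 |(j : ℝ)|
      ≤ 1 + 2 * ∑ n ∈ Finset.Icc 1 X, 1 / (n : ℝ) := by
    induction X with
    | zero => simp
    | succ n ih =>
      have e : Finset.Icc (-((n + 1 : ℕ) : ℤ)) ((n + 1 : ℕ) : ℤ) =
          insert (-((n + 1 : ℕ) : ℤ)) (insert ((n + 1 : ℕ) : ℤ) (Finset.Icc (-n : ℤ) n)) := by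
        ext j; simp only [Finset.mem_insert, Finset.mem_Icc]; push_cast; omega
      rw [e, Finset.sum_insert, Finset.sum_insert, Finset.sum_Icc_succ_top (by omega)]
      · have hm : (1 : ℝ) ≤ |((n + 1 : ℕ) : ℝ)| := by
          rw [Nat.abs_cast]; push_cast; linarith [n.cast_nonneg (α := ℝ)]
        push_cast at hm ⊢
        rw [abs_neg, max_eq_right hm, abs_of_nonneg (by positivity)]
        linarith
      · simp
      · simp only [Finset.mem_insert, Finset.mem_Icc]; push_cast; omega
  linarith [sum_Icc_one_div_le X]

lemma sum_planeBox_one_div_le (X : ℕ) :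
    ∑ ξ ∈ planeBox X, 1 / (normSqNat ξ : ℝ) ≤ (3 + 2 * Real.log X) ^ 2 := by
  have hlog := Real.log_natCast_nonneg X
  calc ∑ ξ ∈ planeBox X, 1 / (normSqNat ξ : ℝ)
      ≤ ∑ ξ ∈ planeBox X, 1 / max 1 |(ξ.1 : ℝ)| * (1 / max 1 |(ξ.2 : ℝ)|) :=
        Finset.sum_le_sum fun ξ hξ => one_div_normSqNat_le (mem_planeBox hξ).1
    _ ≤ ∑ ξ ∈ Finset.Icc (-X : ℤ) X ×ˢ Finset.Icc (-X : ℤ) X,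
          1 / max 1 |(ξ.1 : ℝ)| * (1 / max 1 |(ξ.2 : ℝ)|) :=
        Finset.sum_le_sum_of_subset_of_nonneg (Finset.erase_subset _ _) fun ξ _ _ => by positivity
    _ = (∑ j ∈ Finset.Icc (-X : ℤ) X, 1 / max 1 |(j : ℝ)|) ^ 2 := by
        rw [pow_two, Finset.sum_mul_sum, Finset.sum_product]
    _ ≤ _ := by
        gcongr
        exact sum_Icc_one_div_max_le X

/-- The contribution to the smoothed lattice point count of the off-axis frequencies in the box
`|ωᵢ| ≤ X`. -/
theorem exists_norm_sum_planeBox_torusFourier_le : ∃ C > 0, ∀ (a A κ : ℝ) (X : ℕ) (w : ℤ → ℂ),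
    1 ≤ a → 0 < κ → κ ≤ 1 → a ≤ (1 - κ) * A → 1 ≤ κ * A → 1 ≤ X → 192 * (X : ℝ) ^ 2 ≤ a ^ 2 →
    (∀ j, ‖w j‖ ≤ 1) →
    ‖∑ ξ ∈ planeBox X, ∑ ν ∈ Finset.Icc (-X : ℤ) X,
        tripleWeight w (ξ, ν) * torusFourier a A (ξ, ν)‖
      ≤ C * (Real.sqrt a * boxBound a A κ X + Real.sqrt (A / κ) * (1 + Real.log (2 * a * X)) *
        (3 + 2 * Real.log X) ^ 2 * X) := by
  obtain ⟨b, C, hC, hasymp⟩ := exists_torusHat_asymptotic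
  refine ⟨‖b‖ ^ 2 + 3 * C, by positivity, ?_⟩
  intro a A κ X w ha1 hκ0 hκ1 haA hκA hX hXa hw
  have ha : 0 < a := by linarith
  obtain ⟨hA, haA'⟩ := le_of_le_one_sub_mul ha hκ0 hκ1 haA
  have haA2 : a < A := by nlinarith
  set Bd := boxBound a A κ X with hBd
  have hBd0 : 0 ≤ Bd := by rw [hBd, boxBound]; positivity
  have hX1 : (1 : ℝ) ≤ X := by exact_mod_cast hX
  set m : ℤ × ℤ → ℤ → ℕ := fun ξ ν => normSqNat ξ + ν.natAbs ^ 2 with hm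
  set β : ℂ := (starRingEnd ℂ) b with hβ
  have hβn : ‖β‖ = ‖b‖ := Complex.norm_conj b
  -- the oscillating main term
  set M : ℤ × ℤ → ℤ → ℝ := fun ξ ν =>
    1 / 2 * Real.sqrt a / Real.sqrt (Real.sqrt (normSqNat ξ)) /
      (Real.sqrt (m ξ ν) * Real.sqrt (Real.sqrt (m ξ ν))) *
      (b * ee (Real.sqrt (normSqNat ξ) * A) *
        (b * Real.sqrt (A + a * (Real.sqrt (normSqNat ξ) / Real.sqrt (m ξ ν))) *
          ee (a * Real.sqrt (m ξ ν)) -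
        β * Real.sqrt (A - a * (Real.sqrt (normSqNat ξ) / Real.sqrt (m ξ ν))) *
          ee (-(a * Real.sqrt (m ξ ν))))).im with hM
  have herr : ∀ ξ ∈ planeBox X, ∀ ν ∈ Finset.Icc (-X : ℤ) X,
      ‖torusFourier a A (ξ, ν) - M ξ ν‖ ≤
        C * Real.sqrt (A / κ) * (1 + Real.log (2 * a * X)) * (1 / (normSqNat ξ : ℝ)) := by
    intro ξ hξ ν hν
    obtain ⟨h0, h1, h2⟩ := mem_planeBox hξ
    have h3 := natAbs_le_of_mem_Icc hν
    have hk1 : (1 : ℝ) ≤ normSqNat ξ := by exact_mod_cast normSqNat_pos h0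
    have hmcast : ((m ξ ν : ℕ) : ℝ) = normSqNat ξ + (ν : ℝ) ^ 2 := by
      rw [hm]; push_cast; rw [Nat.cast_natAbs]; push_cast; rw [sq_abs]
    have hq : 1 ≤ Real.sqrt (normSqNat ξ) := Real.one_le_sqrt.mpr hk1
    have hm0 : (0 : ℝ) < m ξ ν := by rw [hmcast]; positivity
    have hs : 0 < Real.sqrt (m ξ ν) := Real.sqrt_pos.mpr hm0
    have hqs : Real.sqrt (normSqNat ξ) ^ 2 + (ν : ℝ) ^ 2 = Real.sqrt (m ξ ν) ^ 2 := by
      rw [Real.sq_sqrt (by positivity), Real.sq_sqrt hm0.le, hmcast]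
    have h4 := hasymp a A κ _ ν _ ha1 hκ0 hκ1 haA hκA hq hs hqs
    have h5 : torusFourier a A (ξ, ν) = torusHat a A (Real.sqrt (normSqNat ξ)) ν :=
      setIntegral_torusSet_ee ha haA2 (by linarith)
        (by rw [Real.sq_sqrt (by positivity), cast_normSqNat]) ν
    rw [h5]
    refine h4.trans ?_
    rw [Real.sq_sqrt (by positivity), mul_one_div]
    have hsX : Real.sqrt (m ξ ν) ≤ 2 * X := by
      rw [Real.sqrt_le_left (by positivity), hmcast, cast_normSqNat]
      have k : ∀ j : ℤ, j.natAbs ≤ X → (j : ℝ) ^ 2 ≤ (X : ℝ) ^ 2 := fun j hj => by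
        rw [← sq_abs (j : ℝ)]
        gcongr
        have : ((j.natAbs : ℕ) : ℝ) ≤ X := by exact_mod_cast hj
        rwa [Nat.cast_natAbs, Int.cast_abs] at this
      nlinarith [k _ h1, k _ h2, k _ h3]
    have hlog : Real.log (a * Real.sqrt (m ξ ν)) ≤ Real.log (2 * a * X) :=
      Real.log_le_log (by positivity) (by nlinarith)
    gcongr
  have hsplit : ∑ ξ ∈ planeBox X, ∑ ν ∈ Finset.Icc (-X : ℤ) X,
        tripleWeight w (ξ, ν) * torusFourier a A (ξ, ν) =
      ∑ ξ ∈ planeBox X, ∑ ν ∈ Finset.Icc (-X : ℤ) X, tripleWeight w (ξ, ν) * M ξ ν +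
      ∑ ξ ∈ planeBox X, ∑ ν ∈ Finset.Icc (-X : ℤ) X,
        tripleWeight w (ξ, ν) * (torusFourier a A (ξ, ν) - M ξ ν) := by
    simp only [← Finset.sum_add_distrib]
    refine Finset.sum_congr rfl fun ξ _ => Finset.sum_congr rfl fun ν _ => by ring
  have htw : ∀ ω, ‖tripleWeight w ω‖ ≤ 1 := by
    intro ω
    rw [tripleWeight, norm_mul, norm_mul]
    exact mul_le_one₀ (mul_le_one₀ (hw _) (norm_nonneg _) (hw _)) (norm_nonneg _) (hw _)
  -- the error terms
  have hE : ‖∑ ξ ∈ planeBox X, ∑ ν ∈ Finset.Icc (-X : ℤ) X,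
        tripleWeight w (ξ, ν) * (torusFourier a A (ξ, ν) - M ξ ν)‖ ≤
      3 * C * (Real.sqrt (A / κ) * (1 + Real.log (2 * a * X)) *
        (3 + 2 * Real.log X) ^ 2 * X) := by
    have hlog0 : 0 ≤ Real.log (2 * a * X) := Real.log_nonneg (by nlinarith)
    calc _ ≤ ∑ ξ ∈ planeBox X, ∑ ν ∈ Finset.Icc (-X : ℤ) X,
          C * Real.sqrt (A / κ) * (1 + Real.log (2 * a * X)) * (1 / (normSqNat ξ : ℝ)) := by
          refine (norm_sum_le _ _).trans (Finset.sum_le_sum fun ξ hξ => ?_)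
          refine (norm_sum_le _ _).trans (Finset.sum_le_sum fun ν hν => ?_)
          rw [norm_mul]
          exact (mul_le_of_le_one_left (norm_nonneg _) (htw _)).trans (herr ξ hξ ν hν)
      _ = (2 * X + 1) * (C * Real.sqrt (A / κ) * (1 + Real.log (2 * a * X))) *
          ∑ ξ ∈ planeBox X, 1 / (normSqNat ξ : ℝ) := by
          simp only [Finset.sum_const, Int.card_Icc, nsmul_eq_mul, Finset.mul_sum]
          refine Finset.sum_congr rfl fun ξ _ => ?_
          rw [show ((X : ℤ) + 1 - -X).toNat = 2 * X + 1 by omega]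
          push_cast; ring
      _ ≤ (3 * X) * (C * Real.sqrt (A / κ) * (1 + Real.log (2 * a * X))) *
          (3 + 2 * Real.log X) ^ 2 := by
          have := sum_planeBox_one_div_le X
          gcongr
          linarith
      _ = _ := by ring
  -- the main terms
  have hMain : ‖∑ ξ ∈ planeBox X, ∑ ν ∈ Finset.Icc (-X : ℤ) X, tripleWeight w (ξ, ν) * M ξ ν‖
      ≤ ‖b‖ ^ 2 * (Real.sqrt a * Bd) := by
    have hbound : ∀ (σ : ℝ) (D : ℝ → ℂ), |σ| ≤ 1 → (∀ x, ‖D x‖ ≤ ‖b‖ ^ 2) → _ :=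
      fun σ D hσ hD => norm_sum_planeBox_le (σ := σ) hκ0 hκ1 haA hσ hX ha hXa hw
        (d := fun ξ => w ξ.1 * w ξ.2 * D (Real.sqrt (normSqNat ξ))) (D := ‖b‖ ^ 2) (fun ξ => by
          rw [norm_mul, norm_mul]
          exact (mul_le_of_le_one_left (norm_nonneg _)
            (mul_le_one₀ (hw _) (norm_nonneg _) (hw _))).trans (hD _))
    obtain ⟨b1, -⟩ := hbound 1 (fun x => b * b * ee (x * A)) (by norm_num)
      (fun x => by simp only [norm_mul, norm_ee]; exact le_of_eq (by ring))
    obtain ⟨-, b2⟩ := hbound 1 (fun x => -(β * β * ee (-(x * A)))) (by norm_num)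
      (fun x => by simp only [norm_neg, norm_mul, norm_ee, hβn]; exact le_of_eq (by ring))
    obtain ⟨-, b3⟩ := hbound (-1) (fun x => -(b * β * ee (x * A))) (by norm_num)
      (fun x => by simp only [norm_neg, norm_mul, norm_ee, hβn]; exact le_of_eq (by ring))
    obtain ⟨b4, -⟩ := hbound (-1) (fun x => b * β * ee (-(x * A))) (by norm_num)
      (fun x => by simp only [norm_mul, norm_ee, hβn]; exact le_of_eq (by ring))
    rw [← hBd] at b1 b2 b3 b4
    have hterm : ∀ ξ ∈ planeBox X, ∀ ν ∈ Finset.Icc (-X : ℤ) X, tripleWeight w (ξ, ν) * M ξ ν =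
        (Real.sqrt a / (4 * Complex.I)) * (
        (w ξ.1 * w ξ.2 * (b * b * ee (Real.sqrt (normSqNat ξ) * A)) *
          ((normSqNat ξ : ℝ) ^ (-(1 / 4) : ℝ) : ℝ) *
          (w ν * (amplitude a A 1 (normSqNat ξ) (normSqNat ξ + ν.natAbs ^ 2) : ℂ) *
          ee (a * Real.sqrt ((normSqNat ξ + ν.natAbs ^ 2 : ℕ))))) +
        (w ξ.1 * w ξ.2 * (-(β * β * ee (-(Real.sqrt (normSqNat ξ) * A)))) *
          ((normSqNat ξ : ℝ) ^ (-(1 / 4) : ℝ) : ℝ) *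
          (w ν * (amplitude a A 1 (normSqNat ξ) (normSqNat ξ + ν.natAbs ^ 2) : ℂ) *
          ee (-(a * Real.sqrt ((normSqNat ξ + ν.natAbs ^ 2 : ℕ)))))) +
        (w ξ.1 * w ξ.2 * (-(b * β * ee (Real.sqrt (normSqNat ξ) * A))) *
          ((normSqNat ξ : ℝ) ^ (-(1 / 4) : ℝ) : ℝ) *
          (w ν * (amplitude a A (-1) (normSqNat ξ) (normSqNat ξ + ν.natAbs ^ 2) : ℂ) *
          ee (-(a * Real.sqrt ((normSqNat ξ + ν.natAbs ^ 2 : ℕ)))))) +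
        (w ξ.1 * w ξ.2 * (b * β * ee (-(Real.sqrt (normSqNat ξ) * A))) *
          ((normSqNat ξ : ℝ) ^ (-(1 / 4) : ℝ) : ℝ) *
          (w ν * (amplitude a A (-1) (normSqNat ξ) (normSqNat ξ + ν.natAbs ^ 2) : ℂ) *
          ee (a * Real.sqrt ((normSqNat ξ + ν.natAbs ^ 2 : ℕ)))))) := by
      intro ξ hξ ν hν
      have hk : 0 < normSqNat ξ := normSqNat_pos (mem_planeBox hξ).1
      have hk0 : (0 : ℝ) < normSqNat ξ := by exact_mod_cast hk
      have hm0 : (0 : ℝ) < (m ξ ν : ℕ) := by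
        have : 0 < m ξ ν := by rw [hm]; simp only; omega
        exact_mod_cast this
      have hroot : ∀ x : ℝ, 0 < x → 1 / Real.sqrt (Real.sqrt x) = x ^ (-(1 / 4) : ℝ) := by
        intro x hx
        rw [Real.sqrt_eq_rpow, Real.sqrt_eq_rpow, ← Real.rpow_mul hx.le, one_div,
          ← Real.rpow_neg hx.le]
        norm_num
      have hroot' : ∀ x : ℝ, 0 < x →
          1 / (Real.sqrt x * Real.sqrt (Real.sqrt x)) = x ^ (-(3 / 4) : ℝ) := by
        intro x hx
        rw [← div_div, ← mul_one_div, hroot x hx, Real.sqrt_eq_rpow, one_div,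
          ← Real.rpow_neg hx.le, ← Real.rpow_add hx]
        norm_num
      have hamp : ∀ σ : ℝ, amplitude a A σ (normSqNat ξ) (m ξ ν) =
          1 / (Real.sqrt (m ξ ν) * Real.sqrt (Real.sqrt (m ξ ν))) *
            Real.sqrt (A + σ * a * (Real.sqrt (normSqNat ξ) / Real.sqrt (m ξ ν))) := by
        intro σ
        rw [amplitude, hroot' _ hm0, Real.sqrt_div hk0.le]
      have hmv : normSqNat ξ + ν.natAbs ^ 2 = m ξ ν := rfl
      rw [hmv, hamp, hamp, ← hroot _ hk0, tripleWeight, hM]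
      have e1 : A + 1 * a * (Real.sqrt (normSqNat ξ) / Real.sqrt (m ξ ν)) =
        A + a * (Real.sqrt (normSqNat ξ) / Real.sqrt (m ξ ν)) := by ring
      have e2 : A + -1 * a * (Real.sqrt (normSqNat ξ) / Real.sqrt (m ξ ν)) =
        A - a * (Real.sqrt (normSqNat ξ) / Real.sqrt (m ξ ν)) := by ring
      rw [e1, e2]
      have him : ∀ z : ℂ, (z.im : ℂ) = (z - (starRingEnd ℂ) z) / (2 * Complex.I) := fun z => by
        rw [Complex.sub_conj]
        have := Complex.I_ne_zero
        field_simp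
        push_cast; ring
      have hI := Complex.I_ne_zero
      rw [Complex.ofReal_mul, him]
      simp only [map_mul, map_sub, Complex.conj_ofReal, ← ee_neg, neg_neg, hβ, Complex.conj_conj]
      rw [← hβ]
      push_cast
      field_simp
      ring
    rw [Finset.sum_congr rfl fun ξ hξ => Finset.sum_congr rfl (hterm ξ hξ)]
    simp only [← Finset.mul_sum, Finset.sum_add_distrib]
    rw [norm_mul]
    have hc4 : ‖(Real.sqrt a : ℂ) / (4 * Complex.I)‖ = Real.sqrt a / 4 := by
      rw [norm_div, norm_mul, Complex.norm_I, Complex.norm_real,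
        Real.norm_of_nonneg (Real.sqrt_nonneg _)]
      norm_num
    rw [hc4]
    have h4 := (norm_add_le_of_le (norm_add_le_of_le (norm_add_le_of_le b1 b2) b3) b4)
    refine (mul_le_mul_of_nonneg_left h4 (by positivity)).trans (le_of_eq (by ring))
  rw [hsplit]
  refine (norm_add_le_of_le hMain hE).trans ?_
  have hlog0 : 0 ≤ Real.log (2 * a * X) := Real.log_nonneg (by nlinarith)
  have hP : 0 ≤ Real.sqrt a * Bd := by positivity
  have hQ : 0 ≤ Real.sqrt (A / κ) * (1 + Real.log (2 * a * X)) * (3 + 2 * Real.log X) ^ 2 * X := by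
    positivity
  linarith [mul_nonneg hC.le hP, mul_nonneg (sq_nonneg ‖b‖) hQ]

/-! ### The frequencies on the axis -/

lemma besselJ_one_neg (x : ℝ) : besselJ 1 (-x) = -besselJ 1 x := by
  rw [besselJ_one_eq_mul_integral, besselJ_one_eq_mul_integral]
  simp only [neg_mul, Real.cos_neg]
  ring

lemma hasDerivAt_mul_besselJ_one {c x : ℝ} (hc : c ≠ 0) (hx : x ≠ 0) :
    HasDerivAt (fun x => x * besselJ 1 (c * x)) (c * x * besselJ 0 (c * x)) x := by
  have h1 : HasDerivAt (fun x => besselJ 1 (c * x))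
      ((besselJ 0 (c * x) - besselJ 1 (c * x) / (c * x)) * c) x :=
    (hasDerivAt_besselJ_one (mul_ne_zero hc hx)).comp x (hasDerivAt_const_mul c)
  refine ((hasDerivAt_id x).fun_mul h1).congr_deriv ?_
  simp only [id]
  field_simp
  ring

/-- Size and modulus of continuity of `a ↦ a J₁(2 π n a)`. -/
theorem exists_abs_mul_besselJ_one_le : ∃ K > 0, ∀ n a₀ : ℝ, 0 < n → 0 < a₀ →
    (∀ a, 0 < a → a ≤ 2 * a₀ → |a * besselJ 1 (2 * Real.pi * n * a)|
      ≤ K * (Real.sqrt a₀ / Real.sqrt n)) ∧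
    (∀ a, 0 < a → a ≤ 2 * a₀ →
      |a * besselJ 1 (2 * Real.pi * n * a) - a₀ * besselJ 1 (2 * Real.pi * n * a₀)|
        ≤ 4 * K * (|a - a₀| * (Real.sqrt n * Real.sqrt a₀))) := by
  obtain ⟨K, hK, hJ⟩ := exists_norm_bessel_le
  refine ⟨K, hK, fun n a₀ hn ha₀ => ?_⟩
  have hpi := Real.pi_gt_three
  have hpi4 := Real.pi_lt_four
  constructor
  · intro a ha ha2
    have h1 := (hJ (2 * Real.pi * n * a) (by positivity)).2
    rw [abs_mul, abs_of_pos ha]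
    have h2 : Real.sqrt n * Real.sqrt a ≤ Real.sqrt (2 * Real.pi * n * a) := by
      rw [← Real.sqrt_mul hn.le]
      exact Real.sqrt_le_sqrt (by nlinarith [mul_pos hn ha])
    have hsa := Real.sq_sqrt ha.le
    have hsa0 := Real.sqrt_pos.mpr ha
    have hsn := Real.sqrt_pos.mpr hn
    have hs2 : Real.sqrt (2 * Real.pi * n * a) = Real.sqrt (2 * Real.pi) * Real.sqrt n *
        Real.sqrt a := by
      rw [Real.sqrt_mul (by positivity), Real.sqrt_mul (by positivity)]
    have h6 : Real.sqrt a ≤ Real.sqrt (2 * Real.pi) * Real.sqrt a₀ := by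
      rw [← Real.sqrt_mul (by positivity)]
      exact Real.sqrt_le_sqrt (by nlinarith)
    have hs2p : 0 < Real.sqrt (2 * Real.pi) := Real.sqrt_pos.mpr (by positivity)
    calc a * |besselJ 1 (2 * Real.pi * n * a)| ≤ a * (K / Real.sqrt (2 * Real.pi * n * a)) := by
          gcongr
      _ = K * (Real.sqrt a / (Real.sqrt (2 * Real.pi) * Real.sqrt n)) := by
          rw [hs2]; field_simp; linarith
      _ ≤ K * ((Real.sqrt (2 * Real.pi) * Real.sqrt a₀) /
            (Real.sqrt (2 * Real.pi) * Real.sqrt n)) := by gcongr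
      _ = _ := by rw [mul_div_mul_left _ _ hs2p.ne']
  · intro a ha ha2
    have hder : ∀ x ∈ Set.Ioc (0 : ℝ) (2 * a₀), HasDerivWithinAt
        (fun x => x * besselJ 1 (2 * Real.pi * n * x))
        (2 * Real.pi * n * x * besselJ 0 (2 * Real.pi * n * x)) (Set.Ioc (0 : ℝ) (2 * a₀)) x :=
      fun x hx => (hasDerivAt_mul_besselJ_one (by positivity) hx.1.ne').hasDerivWithinAt
    have hb : ∀ x ∈ Set.Ioc (0 : ℝ) (2 * a₀),
        ‖2 * Real.pi * n * x * besselJ 0 (2 * Real.pi * n * x)‖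
          ≤ 4 * K * (Real.sqrt n * Real.sqrt a₀) := by
      intro x hx
      have hx0 := hx.1
      have h1 := (hJ (2 * Real.pi * n * x) (by positivity)).1
      have hy : 0 < 2 * Real.pi * n * x := by positivity
      have hsy := Real.sqrt_pos.mpr hy
      have hsq := Real.sq_sqrt hy.le
      rw [Real.norm_eq_abs, abs_mul, abs_of_pos hy]
      calc 2 * Real.pi * n * x * |besselJ 0 (2 * Real.pi * n * x)|
          ≤ 2 * Real.pi * n * x * (K / Real.sqrt (2 * Real.pi * n * x)) := by gcongr
        _ = K * Real.sqrt (2 * Real.pi * n * x) := by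
            field_simp; linarith
        _ ≤ K * (4 * (Real.sqrt n * Real.sqrt a₀)) := by
            gcongr
            rw [← Real.sqrt_mul hn.le, Real.sqrt_le_left (by positivity), mul_pow,
              Real.sq_sqrt (by positivity)]
            calc 2 * Real.pi * n * x ≤ 2 * 4 * n * (2 * a₀) := by
                  gcongr; exact hx.2
              _ = _ := by ring
        _ = _ := by ring
    have := (convex_Ioc (0 : ℝ) (2 * a₀)).norm_image_sub_le_of_norm_hasDerivWithin_le hder hb
      (show a₀ ∈ Set.Ioc (0 : ℝ) (2 * a₀) from ⟨ha₀, by linarith⟩) (show a ∈ _ from ⟨ha, ha2⟩)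
    rw [Real.norm_eq_abs, Real.norm_eq_abs] at this
    exact this.trans (le_of_eq (by ring))

/-- The Fourier transform of the solid torus at the integer point `l` of its axis. -/
noncomputable def axisTerm (a A : ℝ) (l : ℤ) : ℝ :=
  if l = 0 then 2 * Real.pi ^ 2 * A * a ^ 2
  else 2 * Real.pi * A * (a * besselJ 1 (2 * Real.pi * |(l : ℝ)| * a) / |(l : ℝ)|)

lemma torusFourier_axis {a A : ℝ} (ha : 0 < a) (haA : a < A) (l : ℤ) :
    torusFourier a A (0, l) = axisTerm a A l := by
  have h := setIntegral_torusSet_ee_axis ha haA l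
  have e : torusFourier a A (0, l) = ∫ p in torusSet a A, ee (l * p.2) := by
    simp [torusFourier, ee_zero]
  rw [e, h, axisTerm]
  simp only [Int.cast_eq_zero]
  split_ifs with h0
  · rfl
  · congr 1
    rcases abs_cases (l : ℝ) with ⟨h1, -⟩ | ⟨h1, -⟩
    · rw [h1]; ring
    · rw [h1, show 2 * Real.pi * -(l : ℝ) * a = -(2 * Real.pi * l * a) by ring, besselJ_one_neg]
      rw [neg_eq_neg_one_mul (l : ℝ)]
      have : (l : ℝ) ≠ 0 := by exact_mod_cast h0
      field_simp

/-- Smoothing at scale `δ`, together with a change of the tube radius by `O(δ)`, alters the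
contribution of the axis frequencies by little. -/
theorem exists_norm_tsum_axis_sub_le : ∃ C > 0, ∀ (a a₀ A δ : ℝ) (w : ℤ → ℂ), 0 < δ → 0 < a →
    0 < a₀ → a ≤ 2 * a₀ → a < A → |a - a₀| ≤ 2 * δ → w 0 = 1 → (∀ j, ‖w j‖ ≤ 1) →
    (∀ j : ℤ, ‖w j - 1‖ ≤ 2 * Real.pi * (δ * |(j : ℝ)|)) →
    ‖∑' l : ℤ, tripleWeight w (0, l) * torusFourier a A (0, l) -
      ((2 * Real.pi ^ 2 * A * a₀ ^ 2 + 4 * Real.pi * A * a₀ *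
        ∑' k : ℕ, besselJ 1 (2 * Real.pi * a₀ * ((k : ℝ) + 1)) / ((k : ℝ) + 1) : ℝ) : ℂ)‖
      ≤ C * (A * a₀ * δ + A * Real.sqrt a₀ * δ ^ (1 / 3 : ℝ)) := by
  obtain ⟨K, hK, hJ⟩ := exists_abs_mul_besselJ_one_le
  have hpi := Real.pi_pos
  have hpi4 := Real.pi_lt_four
  have hS : Summable fun n : ℤ => |(n : ℝ)| ^ (-(7 / 6) : ℝ) :=
    Real.summable_abs_int_rpow (by norm_num)
  set S := ∑' n : ℤ, |(n : ℝ)| ^ (-(7 / 6) : ℝ) with hSdef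
  have hS0 : 0 ≤ S := tsum_nonneg fun n => by positivity
  refine ⟨12 * Real.pi ^ 2 + 32 * Real.pi * K * S, by positivity, ?_⟩
  intro a a₀ A δ w hδ ha ha₀ ha2 haA haδ hw0 hw1 hwl
  have hA : 0 < A := ha.trans haA
  have htw : ∀ l : ℤ, tripleWeight w (0, l) * torusFourier a A (0, l) = w l * axisTerm a A l := by
    intro l
    rw [torusFourier_axis ha haA, tripleWeight]
    simp [hw0]
  simp only [htw]
  -- convergence
  have hbd : ∀ x, 0 < x → x ≤ 2 * a₀ → ∀ l : ℤ, |axisTerm x A l| ≤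
      (if l = 0 then |2 * Real.pi ^ 2 * A * x ^ 2| else 0) +
        2 * Real.pi * A * K * Real.sqrt a₀ * |(l : ℝ)| ^ (-(3 / 2) : ℝ) := by
    intro x hx hx2 l
    rw [axisTerm]
    split_ifs with h
    · have : 0 ≤ 2 * Real.pi * A * K * Real.sqrt a₀ * |(l : ℝ)| ^ (-(3 / 2) : ℝ) := by positivity
      linarith
    · have hl : 0 < |(l : ℝ)| := abs_pos.mpr (by exact_mod_cast h)
      have h1 := (hJ |(l : ℝ)| a₀ hl ha₀).1 x hx hx2
      rw [zero_add, abs_mul, abs_of_pos (by positivity : 0 < 2 * Real.pi * A), abs_div, abs_abs]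
      have e : |(l : ℝ)| ^ (-(3 / 2) : ℝ) = 1 / Real.sqrt |(l : ℝ)| / |(l : ℝ)| := by
        rw [Real.sqrt_eq_rpow, one_div, ← Real.rpow_neg hl.le, ← Real.rpow_sub_one hl.ne']
        norm_num
      rw [e]
      calc 2 * Real.pi * A * (|x * besselJ 1 (2 * Real.pi * |(l : ℝ)| * x)| / |(l : ℝ)|)
          ≤ 2 * Real.pi * A * (K * (Real.sqrt a₀ / Real.sqrt |(l : ℝ)|) / |(l : ℝ)|) := by gcongr
        _ = _ := by ring
  have hsummable : ∀ x, 0 < x → x ≤ 2 * a₀ → Summable fun l : ℤ => |axisTerm x A l| := by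
    intro x hx hx2
    refine Summable.of_nonneg_of_le (fun _ => abs_nonneg _) (hbd x hx hx2) (Summable.add ?_ ?_)
    · exact (hasSum_ite_eq (0 : ℤ) _).summable
    · exact (Real.summable_abs_int_rpow (by norm_num)).mul_left _
  have hs0 : Summable fun l : ℤ => axisTerm a₀ A l := (hsummable a₀ ha₀ (by linarith)).of_abs
  have hs1 : Summable fun l : ℤ => w l * axisTerm a A l := by
    refine Summable.of_norm_bounded (hsummable a ha ha2) fun l => ?_
    rw [norm_mul, Complex.norm_real, Real.norm_eq_abs]
    exact mul_le_of_le_one_left (abs_nonneg _) (hw1 l)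
  -- the value of the sum at `a₀`
  have hval : 2 * Real.pi ^ 2 * A * a₀ ^ 2 + 4 * Real.pi * A * a₀ *
        ∑' k : ℕ, besselJ 1 (2 * Real.pi * a₀ * ((k : ℝ) + 1)) / ((k : ℝ) + 1)
      = ∑' l : ℤ, axisTerm a₀ A l := by
    rw [tsum_int_eq_zero_add_two_mul_tsum_pnat (f := axisTerm a₀ A)
      (fun l => by simp [axisTerm]) hs0]
    have e1 := tsum_pnat_eq_tsum_succ (f := fun n : ℕ => axisTerm a₀ A (n : ℤ))
    have e2 : ∑' n : ℕ+, axisTerm a₀ A ((n : ℕ) : ℤ) = ∑' k : ℕ, 2 * Real.pi * A * a₀ *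
        (besselJ 1 (2 * Real.pi * a₀ * ((k : ℝ) + 1)) / ((k : ℝ) + 1)) := by
      rw [e1]
      congr 1; ext k
      have hk : (0 : ℝ) ≤ (k : ℝ) + 1 := by positivity
      rw [axisTerm, if_neg (by omega)]
      push_cast
      rw [abs_of_nonneg hk, show 2 * Real.pi * ((k : ℝ) + 1) * a₀ = 2 * Real.pi * a₀ * (k + 1) by
        ring]
      ring
    rw [e2, tsum_mul_left]
    simp only [axisTerm, if_true]
    ring
  have hs0c : Summable fun l : ℤ => (axisTerm a₀ A l : ℂ) := Complex.ofRealCLM.summable hs0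
  rw [hval, Complex.ofReal_tsum, ← hs1.tsum_sub hs0c]
  -- comparison of the terms
  set B := 32 * Real.pi * A * K * Real.sqrt a₀ * δ ^ (1 / 3 : ℝ) with hB
  have hterm : ∀ l : ℤ, ‖w l * axisTerm a A l - axisTerm a₀ A l‖ ≤
      (if l = 0 then 12 * Real.pi ^ 2 * (A * a₀ * δ) else 0) + B * |(l : ℝ)| ^ (-(7 / 6) : ℝ) := by
    intro l
    by_cases h : l = 0
    · subst h
      rw [hw0, one_mul, if_pos rfl, ← Complex.ofReal_sub, Complex.norm_real, Real.norm_eq_abs]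
      simp only [axisTerm, if_true]
      have h1 : |a ^ 2 - a₀ ^ 2| ≤ 2 * δ * (3 * a₀) := by
        rw [show a ^ 2 - a₀ ^ 2 = (a - a₀) * (a + a₀) by ring, abs_mul,
          abs_of_pos (by positivity : 0 < a + a₀)]
        gcongr
        linarith
      rw [show 2 * Real.pi ^ 2 * A * a ^ 2 - 2 * Real.pi ^ 2 * A * a₀ ^ 2 =
        2 * Real.pi ^ 2 * A * (a ^ 2 - a₀ ^ 2) by ring, abs_mul,
        abs_of_pos (by positivity : 0 < 2 * Real.pi ^ 2 * A)]
      have h2 : 0 ≤ B * |((0 : ℤ) : ℝ)| ^ (-(7 / 6) : ℝ) := by positivity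
      calc 2 * Real.pi ^ 2 * A * |a ^ 2 - a₀ ^ 2| ≤ 2 * Real.pi ^ 2 * A * (2 * δ * (3 * a₀)) := by
            gcongr
        _ = 12 * Real.pi ^ 2 * (A * a₀ * δ) := by ring
        _ ≤ _ := by linarith
    · rw [if_neg h, zero_add]
      set n := |(l : ℝ)| with hn
      have hn0 : 0 < n := abs_pos.mpr (by exact_mod_cast h)
      obtain ⟨h1, h2⟩ := hJ n a₀ hn0 ha₀
      have k1 := h1 a ha ha2
      have k2 := h1 a₀ ha₀ (by linarith)
      have k3 := h2 a ha ha2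
      set u := a * besselJ 1 (2 * Real.pi * n * a) with hu
      set v := a₀ * besselJ 1 (2 * Real.pi * n * a₀) with hv
      set t := Real.sqrt a₀ / Real.sqrt n with ht
      have ht0 : 0 < t := div_pos (Real.sqrt_pos.mpr ha₀) (Real.sqrt_pos.mpr hn0)
      have hnt : Real.sqrt n * Real.sqrt a₀ = n * t := by
        rw [ht]
        have := Real.sq_sqrt hn0.le
        have := Real.sqrt_pos.mpr hn0
        field_simp; linarith
      have m1 : ‖w l * u - v‖ ≤ 16 * K * t * 1 := by
        have : ‖w l * (u : ℂ)‖ ≤ K * t := by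
          rw [norm_mul, Complex.norm_real, Real.norm_eq_abs]
          exact (mul_le_of_le_one_left (abs_nonneg _) (hw1 l)).trans k1
        have h3 : ‖(v : ℂ)‖ ≤ K * t := by rwa [Complex.norm_real, Real.norm_eq_abs]
        have h4 : 0 < K * t := by positivity
        linarith [norm_sub_le_of_le this h3]
      have m2 : ‖w l * u - v‖ ≤ 16 * K * t * (δ * n) := by
        have e : w l * (u : ℂ) - v = w l * ((u - v : ℝ) : ℂ) + (w l - 1) * v := by
          push_cast; ring
        have i1 : ‖w l * ((u - v : ℝ) : ℂ)‖ ≤ 8 * K * t * (δ * n) := by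
          rw [norm_mul, Complex.norm_real, Real.norm_eq_abs]
          refine (mul_le_of_le_one_left (abs_nonneg _) (hw1 l)).trans (k3.trans ?_)
          rw [hnt]
          calc 4 * K * (|a - a₀| * (n * t)) ≤ 4 * K * (2 * δ * (n * t)) := by gcongr
            _ = _ := by ring
        have i2 : ‖(w l - 1) * (v : ℂ)‖ ≤ 8 * K * t * (δ * n) := by
          rw [norm_mul, Complex.norm_real, Real.norm_eq_abs]
          calc ‖w l - 1‖ * |v| ≤ (2 * 4 * (δ * n)) * (K * t) := by
                gcongr
                exact (hwl l).trans (by gcongr)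
            _ = _ := by ring
        rw [e]
        linarith [norm_add_le_of_le i1 i2]
      have m3 : ‖w l * u - v‖ ≤ 16 * K * t * (δ * n) ^ (1 / 3 : ℝ) := by
        have hδn : 0 < δ * n := by positivity
        rcases le_total (δ * n) 1 with hc | hc
        · refine m2.trans (mul_le_mul_of_nonneg_left ?_ (by positivity))
          exact Real.self_le_rpow_of_le_one hδn.le hc (by norm_num)
        · refine m1.trans (mul_le_mul_of_nonneg_left ?_ (by positivity))
          exact Real.one_le_rpow hc (by norm_num)
      have e : w l * (axisTerm a A l : ℂ) - axisTerm a₀ A l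
          = ((2 * Real.pi * A / n : ℝ) : ℂ) * (w l * u - v) := by
        rw [axisTerm, axisTerm, if_neg h, if_neg h, ← hn, ← hu, ← hv]
        push_cast; ring
      rw [e, norm_mul, Complex.norm_real, Real.norm_of_nonneg (by positivity)]
      calc 2 * Real.pi * A / n * ‖w l * u - v‖
          ≤ 2 * Real.pi * A / n * (16 * K * t * (δ * n) ^ (1 / 3 : ℝ)) := by gcongr
        _ = B * (n ^ (1 / 3 : ℝ) * (1 / Real.sqrt n / n)) := by
            rw [Real.mul_rpow hδ.le hn0.le, hB, ht]; ring
        _ = _ := by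
            congr 1
            rw [Real.sqrt_eq_rpow, one_div (n ^ _), ← Real.rpow_neg hn0.le,
              ← Real.rpow_sub_one hn0.ne', ← Real.rpow_add hn0]
            norm_num
  have hsum1 : HasSum (fun l : ℤ => if l = 0 then 12 * Real.pi ^ 2 * (A * a₀ * δ) else 0)
      (12 * Real.pi ^ 2 * (A * a₀ * δ)) := hasSum_ite_eq 0 _
  have hsum := hsum1.add (hS.hasSum.mul_left B)
  refine (tsum_of_norm_bounded hsum hterm).trans ?_
  rw [← hSdef, hB]
  have p1 : 0 ≤ A * a₀ * δ := by positivity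
  have p2 : 0 ≤ A * Real.sqrt a₀ * δ ^ (1 / 3 : ℝ) := by positivity
  have p3 : 0 ≤ 32 * Real.pi * K * S := by positivity
  have p4 : 0 ≤ 12 * Real.pi ^ 2 := by positivity
  linarith [mul_nonneg p3 p1, mul_nonneg p4 p2]

/-! ### The remaining frequencies, and the smoothed lattice point count -/

lemma volume_real_torusSet_le {a A : ℝ} (ha : 0 ≤ a) (haA : a ≤ A) :
    volume.real (torusSet a A) ≤ 32 * A ^ 3 := by
  have hsub := torusSet_subset (A := A) ha
  have hfin : volume ((Set.Icc (-(A + a)) (A + a) ×ˢ Set.Icc (-(A + a)) (A + a)) ×ˢ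
      Set.Icc (-a) a) ≠ ⊤ :=
    ((isCompact_Icc.prod isCompact_Icc).prod isCompact_Icc).measure_lt_top.ne
  refine (measureReal_mono hsub hfin).trans ?_
  rw [Measure.volume_eq_prod, measureReal_prod_prod, Measure.volume_eq_prod, measureReal_prod_prod,
    Real.volume_real_Icc_of_le (by linarith), Real.volume_real_Icc_of_le (by linarith)]
  calc (A + a - -(A + a)) * (A + a - -(A + a)) * (a - -a)
      ≤ (A + A + (A + A)) * (A + A + (A + A)) * (A + A) := by
        have : 0 ≤ A := ha.trans haA
        gcongr <;> linarith
    _ = _ := by ring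

lemma summable_one_div_one_add_sq : Summable fun j : ℤ => 1 / (1 + (j : ℝ) ^ 2) := by
  refine Summable.of_norm_bounded_eventually (g := fun j : ℤ => 1 / (j : ℝ) ^ 2)
    (Real.summable_one_div_int_pow.mpr one_lt_two) ?_
  filter_upwards [(Set.finite_singleton (0 : ℤ)).compl_mem_cofinite] with j hj
  have hj0 : (j : ℝ) ≠ 0 := by exact_mod_cast hj
  rw [Real.norm_of_nonneg (by positivity)]
  exact one_div_le_one_div_of_le (by positivity) (by linarith)

/-- Splitting off the axis and a box from the Fourier series; what is left is controlled by the
decay of the weight outside the box. -/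
theorem norm_tsum_sub_axis_sub_box_le {a : ℝ} (A : ℝ) (ha : 0 ≤ a) {w : ℤ → ℂ}
    (hw : Summable fun j => ‖w j‖) {X : ℕ} {Q τ : ℝ} (hQ : ∀ j : ℤ, (1 + (j : ℝ) ^ 2) * ‖w j‖ ≤ Q)
    (hτ0 : 0 ≤ τ) (hτ : ∀ j ∉ Finset.Icc (-X : ℤ) X, (1 + (j : ℝ) ^ 2) * ‖w j‖ ≤ τ) :
    ‖∑' ω, tripleWeight w ω * torusFourier a A ω -
      ∑' l : ℤ, tripleWeight w (0, l) * torusFourier a A (0, l) -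
      ∑ ξ ∈ planeBox X, ∑ ν ∈ Finset.Icc (-X : ℤ) X,
        tripleWeight w (ξ, ν) * torusFourier a A (ξ, ν)‖
      ≤ volume.real (torusSet a A) * (Q ^ 2 * τ) * (∑' j : ℤ, 1 / (1 + (j : ℝ) ^ 2)) ^ 3 := by
  classical
  set V := volume.real (torusSet a A) with hV
  have hV0 : 0 ≤ V := measureReal_nonneg
  have hQ0 : 0 ≤ Q := le_trans (by positivity) (hQ 0)
  set g : ℤ → ℝ := fun j => 1 / (1 + (j : ℝ) ^ 2) with hg
  have hgs : Summable g := summable_one_div_one_add_sq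
  have hg0 : ∀ j, 0 ≤ g j := fun j => by rw [hg]; positivity
  set F : (ℤ × ℤ) × ℤ → ℂ := fun ω => tripleWeight w ω * torusFourier a A ω with hF
  set Bx : Finset ((ℤ × ℤ) × ℤ) := planeBox X ×ˢ Finset.Icc (-X : ℤ) X with hBx
  set F1 : (ℤ × ℤ) × ℤ → ℂ := fun ω => if ω.1 = 0 then F ω else 0 with hF1
  set F2 : (ℤ × ℤ) × ℤ → ℂ := fun ω => if ω ∈ Bx then F ω else 0 with hF2
  have hFs : Summable fun ω => ‖F ω‖ := by
    refine Summable.of_nonneg_of_le (fun _ => norm_nonneg _) (fun ω => ?_)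
      ((summable_norm_tripleWeight hw).mul_right V)
    rw [hF]; simp only; rw [norm_mul]
    gcongr
    exact norm_torusFourier_le A ha ω
  have hF1s : Summable F1 := Summable.of_norm_bounded hFs fun ω => by
    rw [hF1]; simp only
    split_ifs
    · exact le_rfl
    · rw [norm_zero]; exact norm_nonneg _
  have hF2s : Summable F2 := Summable.of_norm_bounded hFs fun ω => by
    rw [hF2]; simp only
    split_ifs
    · exact le_rfl
    · rw [norm_zero]; exact norm_nonneg _
  have h1 : ∑' l : ℤ, tripleWeight w (0, l) * torusFourier a A (0, l) = ∑' ω, F1 ω := by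
    have hinj : Function.Injective (fun l : ℤ => ((0, l) : (ℤ × ℤ) × ℤ)) :=
      Prod.mk_right_injective 0
    rw [← hinj.tsum_eq (f := F1)]
    · simp [hF1, hF]
    · intro ω hω
      have : ω.1 = 0 := by
        by_contra h
        exact hω (if_neg h)
      exact ⟨ω.2, by rw [← this]⟩
  have h2 : ∑ ξ ∈ planeBox X, ∑ ν ∈ Finset.Icc (-X : ℤ) X,
        tripleWeight w (ξ, ν) * torusFourier a A (ξ, ν) = ∑' ω, F2 ω := by
    rw [tsum_eq_sum (s := Bx) fun ω hω => if_neg hω, ← Finset.sum_product']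
    exact Finset.sum_congr rfl fun ω hω => (if_pos hω).symm
  rw [h1, h2, ← hFs.of_norm.tsum_sub hF1s, ← (hFs.of_norm.sub hF1s).tsum_sub hF2s]
  have hgg : Summable fun ξ : ℤ × ℤ => g ξ.1 * g ξ.2 :=
    hgs.mul_of_nonneg hgs hg0 hg0
  have hggg : Summable fun ω : (ℤ × ℤ) × ℤ => g ω.1.1 * g ω.1.2 * g ω.2 :=
    hgg.mul_of_nonneg (f := fun ξ : ℤ × ℤ => g ξ.1 * g ξ.2) hgs
      (fun ξ => mul_nonneg (hg0 _) (hg0 _)) hg0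
  have hval : ∑' ω : (ℤ × ℤ) × ℤ, g ω.1.1 * g ω.1.2 * g ω.2 = (∑' j, g j) ^ 3 := by
    have e1 := hgs.tsum_mul_tsum hgs hgg
    have e2 := hgg.tsum_mul_tsum hgs hggg
    rw [← e2, ← e1]; ring
  have hsum := hggg.hasSum.mul_left (V * (Q ^ 2 * τ))
  rw [hval] at hsum
  refine tsum_of_norm_bounded hsum fun ω => ?_
  -- bounds for the weight
  have hwQ : ∀ j : ℤ, ‖w j‖ ≤ Q * g j := fun j => by
    rw [hg]; simp only
    rw [mul_one_div, le_div_iff₀ (by positivity), mul_comm]; exact hQ j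
  have hwτ : ∀ j ∉ Finset.Icc (-X : ℤ) X, ‖w j‖ ≤ τ * g j := fun j hj => by
    rw [hg]; simp only
    rw [mul_one_div, le_div_iff₀ (by positivity), mul_comm]; exact hτ j hj
  have hnn : 0 ≤ V * (Q ^ 2 * τ) * (g ω.1.1 * g ω.1.2 * g ω.2) :=
    mul_nonneg (by positivity) (mul_nonneg (mul_nonneg (hg0 _) (hg0 _)) (hg0 _))
  by_cases ha0 : ω.1 = 0
  · have hnb : ω ∉ Bx := fun h => (mem_planeBox (Finset.mem_product.mp h).1).1 ha0
    simp only [hF1, hF2, if_pos ha0, if_neg hnb, sub_self, norm_zero]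
    exact hnn
  by_cases hb : ω ∈ Bx
  · simp only [hF1, hF2, if_neg ha0, if_pos hb, sub_zero, sub_self, norm_zero]
    exact hnn
  simp only [hF1, hF2, if_neg ha0, if_neg hb, sub_zero]
  have htri : ‖tripleWeight w ω‖ ≤ Q ^ 2 * τ * (g ω.1.1 * g ω.1.2 * g ω.2) := by
    rw [tripleWeight, norm_mul, norm_mul]
    have hout : ω.1.1 ∉ Finset.Icc (-X : ℤ) X ∨ ω.1.2 ∉ Finset.Icc (-X : ℤ) X ∨
        ω.2 ∉ Finset.Icc (-X : ℤ) X := by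
      by_contra! h
      refine hb (Finset.mem_product.mpr ⟨?_, h.2.2⟩)
      rw [planeBox, Finset.mem_erase, Finset.mem_product]
      exact ⟨ha0, h.1, h.2.1⟩
    have k1 := hwQ ω.1.1
    have k2 := hwQ ω.1.2
    have k3 := hwQ ω.2
    have g1 := hg0 ω.1.1
    have g2 := hg0 ω.1.2
    have g3 := hg0 ω.2
    rcases hout with h | h | h
    · calc _ ≤ (τ * g ω.1.1) * (Q * g ω.1.2) * (Q * g ω.2) := by
            have := hwτ _ h
            gcongr
        _ = _ := by ring
    · calc _ ≤ (Q * g ω.1.1) * (τ * g ω.1.2) * (Q * g ω.2) := by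
            have := hwτ _ h
            gcongr
        _ = _ := by ring
    · calc _ ≤ (Q * g ω.1.1) * (Q * g ω.1.2) * (τ * g ω.2) := by
            have := hwτ _ h
            gcongr
        _ = _ := by ring
  rw [hF]; simp only
  rw [norm_mul]
  calc ‖tripleWeight w ω‖ * ‖torusFourier a A ω‖
      ≤ Q ^ 2 * τ * (g ω.1.1 * g ω.1.2 * g ω.2) * V := by
        have := norm_torusFourier_le A ha ω
        gcongr
    _ = _ := by ring

lemma clog_add_one_le {X : ℕ} (hX : 1 ≤ X) :
    ((Nat.clog 2 (6 * X ^ 2) + 1 : ℕ) : ℝ) ≤ 8 + 4 * Real.log X := by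
  have hX2 : 1 ≤ X ^ 2 := Nat.one_le_pow _ _ hX
  have h1 := Nat.pow_pred_clog_lt_self (b := 2) (by norm_num) (x := 6 * X ^ 2) (by omega)
  have h2 : ((2 : ℝ) ^ (Nat.clog 2 (6 * X ^ 2)).pred) ≤ 6 * (X : ℝ) ^ 2 := by
    exact_mod_cast h1.le
  have hX0 : (0 : ℝ) < X := by exact_mod_cast hX
  have h3 := Real.log_le_log (by positivity) h2
  rw [Real.log_pow, Real.log_mul (by norm_num) (by positivity), Real.log_pow] at h3
  have hl2 := Real.log_two_gt_d9
  have hl6 : Real.log 6 ≤ 3 * Real.log 2 := by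
    calc Real.log 6 ≤ Real.log (2 ^ 3) := Real.log_le_log (by norm_num) (by norm_num)
      _ = 3 * Real.log 2 := by rw [Real.log_pow]; norm_num
  have h4 : ((Nat.clog 2 (6 * X ^ 2) : ℕ) : ℝ) ≤ (Nat.clog 2 (6 * X ^ 2)).pred + 1 := by
    exact_mod_cast (show Nat.clog 2 (6 * X ^ 2) ≤ (Nat.clog 2 (6 * X ^ 2)).pred + 1 by
      rw [Nat.pred_eq_sub_one]; omega)
  have h5 : (0 : ℝ) ≤ Real.log X := Real.log_natCast_nonneg X
  have h6 : ((Nat.clog 2 (6 * X ^ 2)).pred : ℝ) ≤ 3 + 4 * Real.log X := by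
    by_contra h
    push Not at h
    have := mul_le_mul_of_nonneg_right h.le (show 0 ≤ Real.log 2 by linarith)
    push_cast at h3
    nlinarith
  push_cast
  linarith

/-- Logarithms are smaller than any power. -/
lemma exists_log_bounds (c : ℝ) (hc : 0 < c) {s : ℝ} (hs : 0 < s) : ∃ C > 0, ∀ (R a : ℝ) (X : ℕ),
    1 ≤ R → 1 ≤ X → (X : ℝ) ≤ R → 1 ≤ a → a ≤ c * R →
    ((Nat.clog 2 (6 * X ^ 2) + 1 : ℕ) : ℝ) ≤ C * R ^ s ∧ 1 + Real.log (2 * a * X) ≤ C * R ^ s ∧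
      3 + 2 * Real.log X ≤ C * R ^ s := by
  refine ⟨8 + |Real.log (2 * c)| + 4 / s, by positivity, fun R a X hR hX hXR ha1 haR => ?_⟩
  have hX0 : (0 : ℝ) < X := by exact_mod_cast hX
  have hR0 : 0 < R := by linarith
  have hlX : Real.log X ≤ Real.log R := Real.log_le_log hX0 hXR
  have hlR : Real.log R ≤ R ^ s / s := Real.log_le_rpow_div hR0.le hs
  have hRs : 1 ≤ R ^ s := Real.one_le_rpow hR hs.le
  have h1 := clog_add_one_le hX
  have h2 : Real.log (2 * a * X) ≤ Real.log (2 * c) + 2 * Real.log R := by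
    rw [two_mul (Real.log R), ← add_assoc, ← Real.log_mul (by positivity) hR0.ne',
      ← Real.log_mul (by positivity) hR0.ne']
    refine Real.log_le_log (by positivity) ?_
    calc 2 * a * X ≤ 2 * (c * R) * R := by gcongr
      _ = _ := by ring
  have h3 := le_abs_self (Real.log (2 * c))
  have h4 := abs_nonneg (Real.log (2 * c))
  have e : (8 + |Real.log (2 * c)| + 4 / s) * R ^ s =
    8 * R ^ s + |Real.log (2 * c)| * R ^ s + 4 * (R ^ s / s) := by ring
  have h5 : |Real.log (2 * c)| ≤ |Real.log (2 * c)| * R ^ s := le_mul_of_one_le_right h4 hRs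
  have h6 : 0 ≤ Real.log R := Real.log_nonneg hR
  rw [e]
  refine ⟨?_, ?_, ?_⟩ <;> linarith

set_option maxHeartbeats 1600000 in
/-- The smoothed lattice point count at smoothing scale `R ^ (-2/3)`. -/
theorem exists_norm_tsum_sub_main_le {ρ ρ' ε : ℝ} (hρ : 0 < ρ) (hρρ' : ρ < ρ') (hε : 0 < ε)
    {W : ℝ → ℂ} (hW0 : W 0 = 1) (hW1 : ∀ t, ‖W t‖ ≤ 1)
    (hWl : ∀ t, ‖W t - 1‖ ≤ 2 * Real.pi * |t|)
    (hWd : ∀ p : ℕ, ∃ C > 0, ∀ t, |t| ^ p * ‖W t‖ ≤ C)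
    (hWs : ∀ δ > 0, Summable fun j : ℤ => ‖W (δ * j)‖) :
    ∃ C > 0, ∀ R a : ℝ, 1 ≤ R → 4 ≤ ρ * R → 4 ≤ (ρ' - ρ) * R → 768 ≤ ρ ^ 2 * R ^ (7 / 12 : ℝ) →
      |a - ρ * R| ≤ 2 * R ^ (-(2 / 3) : ℝ) →
      ‖∑' ω, tripleWeight (fun j => W (R ^ (-(2 / 3) : ℝ) * j)) ω * torusFourier a (ρ' * R) ω -
        (torusMainTerm ρ ρ' R : ℂ)‖ ≤ C * R ^ (4 / 3 + ε : ℝ) := by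
  have hρ' : 0 < ρ' := hρ.trans hρρ'
  -- The box of frequencies is `|ωᵢ| ≤ X` with `X` about `R ^ (2/3 + η)`. Beyond it the weight is
  -- smaller than any power of `R`, and `p ≥ 6 / η` saves enough.
  set η := min ε (1 / 24) with hη
  have hη0 : 0 < η := lt_min hε (by norm_num)
  have hηε : η ≤ ε := min_le_left _ _
  have hη24 : η ≤ 1 / 24 := min_le_right _ _
  obtain ⟨p, hp⟩ := exists_nat_ge (6 / η)
  have hpη : 6 ≤ η * p := by rw [div_le_iff₀ hη0] at hp; linarith
  obtain ⟨C1, hC1, haxis⟩ := exists_norm_tsum_axis_sub_le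
  obtain ⟨C2, hC2, hbox⟩ := exists_norm_sum_planeBox_torusFourier_le
  obtain ⟨D2, hD2, hWd2⟩ := hWd 2
  obtain ⟨Dp, hDp, hWdp⟩ := hWd (p + 2)
  obtain ⟨L1, hL1, hlog1⟩ := exists_log_bounds (2 * ρ) (by positivity) (s := η / 8) (by positivity)
  obtain ⟨L2, hL2, hlog2⟩ := exists_log_bounds (2 * ρ) (by positivity) (s := η) hη0
  set κ := (ρ' - ρ) / (2 * ρ') with hκ
  have hκ0 : 0 < κ := div_pos (by linarith) (by positivity)
  have hκ1 : κ ≤ 1 := by rw [hκ, div_le_one (by positivity)]; linarith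
  set S := ∑' j : ℤ, 1 / (1 + (j : ℝ) ^ 2) with hS
  have hS0 : 0 ≤ S := tsum_nonneg fun j => by positivity
  set c0 := Real.sqrt (ρ' / κ) with hc0
  set B1 := C1 * (ρ' * ρ + ρ' * Real.sqrt ρ) with hB1
  set B2 := C2 * (Real.sqrt (2 * ρ) * (10 ^ 11 * c0 * L1 ^ 4 * ((2 * ρ) ^ (1 / 3 : ℝ) + 1)) +
    c0 * L2 * L2 ^ 2) with hB2
  set B3 := 32 * ρ' ^ 3 * ((1 + D2) ^ 2 * (2 * Dp)) * S ^ 3 with hB3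
  have hB10 : 0 < B1 := by positivity
  have hB20 : 0 ≤ B2 := by positivity
  have hB30 : 0 ≤ B3 := by positivity
  refine ⟨B1 + B2 + B3, by positivity, ?_⟩
  intro R a hR1 hρR hρ'R hR3 ha
  have hR0 : 0 < R := by linarith
  set δ := R ^ (-(2 / 3) : ℝ) with hδ
  have hδ0 : 0 < δ := Real.rpow_pos_of_pos hR0 _
  have hδ1 : δ ≤ 1 := Real.rpow_le_one_of_one_le_of_nonpos hR1 (by norm_num)
  have hmono : ∀ x : ℝ, x ≤ 4 / 3 + ε → R ^ x ≤ R ^ (4 / 3 + ε : ℝ) := fun x hx =>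
    Real.rpow_le_rpow_of_exponent_le hR1 hx
  set a₀ := ρ * R with ha₀
  set A := ρ' * R with hA
  have ha₀0 : 0 < a₀ := by positivity
  have hA0 : 0 < A := by positivity
  obtain ⟨hal, hau⟩ := abs_le.mp ha
  have ha2 : a₀ / 2 ≤ a := by linarith
  have ha1 : 1 ≤ a := by linarith
  have ha0 : 0 < a := by linarith
  have ha4 : a ≤ 2 * a₀ := by linarith
  have haA : a ≤ (1 - κ) * A := by
    have e : (1 - κ) * A = (ρ + ρ') / 2 * R := by
      rw [hκ, hA]; field_simp; ring
    rw [e]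
    have : (ρ' - ρ) * R = ρ' * R - ρ * R := by ring
    linarith
  have hκA : 1 ≤ κ * A := by
    have e : κ * A = (ρ' - ρ) * R / 2 := by rw [hκ, hA]; field_simp
    rw [e]; linarith
  have haA' : a < A := by linarith [sub_mul 1 κ A]
  set Y := R ^ (2 / 3 + η : ℝ) with hY
  set X := ⌊Y⌋₊ with hX
  have hY1 : 1 ≤ Y := Real.one_le_rpow hR1 (by positivity)
  have hX1 : 1 ≤ X := Nat.le_floor (by exact_mod_cast hY1)
  have hXY : (X : ℝ) ≤ Y := Nat.floor_le (by linarith)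
  have hYR : Y ≤ R := by
    calc Y ≤ R ^ (1 : ℝ) := Real.rpow_le_rpow_of_exponent_le hR1 (by linarith)
      _ = R := Real.rpow_one R
  have hX0 : (0 : ℝ) < X := by exact_mod_cast hX1
  have hXa : 192 * (X : ℝ) ^ 2 ≤ a ^ 2 := by
    have e1 : (X : ℝ) ^ 2 ≤ R ^ (17 / 12 : ℝ) := by
      calc (X : ℝ) ^ 2 ≤ Y ^ 2 := by gcongr
        _ = R ^ ((2 / 3 + η) * 2 : ℝ) := by
            rw [hY, ← Real.rpow_natCast, ← Real.rpow_mul hR0.le]; norm_num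
        _ ≤ _ := Real.rpow_le_rpow_of_exponent_le hR1 (by linarith)
    have e2 : R ^ (7 / 12 : ℝ) * R ^ (17 / 12 : ℝ) = R ^ 2 := by
      rw [← Real.rpow_add hR0, ← Real.rpow_natCast]; norm_num
    have e3 : 0 < R ^ (17 / 12 : ℝ) := Real.rpow_pos_of_pos hR0 _
    calc 192 * (X : ℝ) ^ 2 ≤ 192 * R ^ (17 / 12 : ℝ) := by gcongr
      _ = 768 * R ^ (17 / 12 : ℝ) / 4 := by ring
      _ ≤ (ρ ^ 2 * R ^ (7 / 12 : ℝ)) * R ^ (17 / 12 : ℝ) / 4 := by gcongr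
      _ = (a₀ / 2) ^ 2 := by rw [mul_assoc, e2, ha₀]; ring
      _ ≤ a ^ 2 := by gcongr
  set w : ℤ → ℂ := fun j => W (δ * j) with hw
  have hw0 : w 0 = 1 := by simp [hw, hW0]
  have hw1 : ∀ j, ‖w j‖ ≤ 1 := fun j => hW1 _
  have hwl : ∀ j : ℤ, ‖w j - 1‖ ≤ 2 * Real.pi * (δ * |(j : ℝ)|) := fun j => by
    have := hWl (δ * j)
    rwa [abs_mul, abs_of_pos hδ0] at this
  have hws : Summable fun j => ‖w j‖ := hWs δ hδ0
  have hδinv : δ⁻¹ ^ 2 = R ^ (4 / 3 : ℝ) := by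
    rw [hδ, ← Real.rpow_neg hR0.le, ← Real.rpow_natCast, ← Real.rpow_mul hR0.le]; norm_num
  have hcA : Real.sqrt (A / κ) = c0 * R ^ (1 / 2 : ℝ) := by
    rw [hA, hc0, ← Real.sqrt_eq_rpow, ← Real.sqrt_mul (by positivity)]
    congr 1; ring
  -- the axis
  have H1 : ‖∑' l : ℤ, tripleWeight w (0, l) * torusFourier a A (0, l) - (torusMainTerm ρ ρ' R : ℂ)‖
      ≤ B1 * R ^ (4 / 3 + ε : ℝ) := by
    have h := haxis a a₀ A δ w hδ0 ha0 ha₀0 ha4 haA' ha hw0 hw1 hwl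
    have e : 2 * Real.pi ^ 2 * A * a₀ ^ 2 + 4 * Real.pi * A * a₀ *
        ∑' k : ℕ, besselJ 1 (2 * Real.pi * a₀ * ((k : ℝ) + 1)) / ((k : ℝ) + 1) =
        torusMainTerm ρ ρ' R := by
      unfold torusMainTerm torusBesselTerm
      have e' : ∀ k : ℕ, 2 * Real.pi * a₀ * ((k : ℝ) + 1) = 2 * Real.pi * ρ * R * ((k : ℝ) + 1) :=
        fun k => by rw [ha₀]; ring
      simp only [e']
      rw [hA, ha₀]; ring
    rw [e] at h
    refine h.trans ?_
    have e1 : A * a₀ * δ ≤ ρ' * ρ * R ^ (4 / 3 + ε : ℝ) := by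
      have : A * a₀ * δ = ρ' * ρ * R ^ (4 / 3 : ℝ) := by
        rw [show (4 / 3 : ℝ) = 1 + 1 + -(2 / 3) by norm_num, Real.rpow_add hR0,
          Real.rpow_add hR0, Real.rpow_one, hA, ha₀]; ring
      rw [this]
      exact mul_le_mul_of_nonneg_left (hmono _ (by linarith)) (by positivity)
    have e2 : A * Real.sqrt a₀ * δ ^ (1 / 3 : ℝ) ≤ ρ' * Real.sqrt ρ * R ^ (4 / 3 + ε : ℝ) := by
      have : A * Real.sqrt a₀ * δ ^ (1 / 3 : ℝ) = ρ' * Real.sqrt ρ * R ^ (23 / 18 : ℝ) := by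
        rw [show (23 / 18 : ℝ) = 1 + 1 / 2 + -(2 / 3) * (1 / 3) by norm_num, Real.rpow_add hR0,
          Real.rpow_add hR0, Real.rpow_one, ← Real.sqrt_eq_rpow, Real.rpow_mul hR0.le, hA, ha₀,
          Real.sqrt_mul hρ.le]; ring
      rw [this]
      exact mul_le_mul_of_nonneg_left (hmono _ (by linarith)) (by positivity)
    rw [hB1]
    calc _ ≤ C1 * (ρ' * ρ * R ^ (4 / 3 + ε : ℝ) + ρ' * Real.sqrt ρ * R ^ (4 / 3 + ε : ℝ)) := by
          gcongr
      _ = _ := by ring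
  -- the box
  have H2 : ‖∑ ξ ∈ planeBox X, ∑ ν ∈ Finset.Icc (-X : ℤ) X,
        tripleWeight w (ξ, ν) * torusFourier a A (ξ, ν)‖ ≤ B2 * R ^ (4 / 3 + ε : ℝ) := by
    refine (hbox a A κ X w ha1 hκ0 hκ1 haA hκA hX1 hXa hw1).trans ?_
    have ha4' : a ≤ 2 * ρ * R := by rw [ha₀] at ha4; linarith
    obtain ⟨l1, -, -⟩ := hlog1 R a X hR1 hX1 (hXY.trans hYR) ha1 ha4'
    obtain ⟨-, l2, l3⟩ := hlog2 R a X hR1 hX1 (hXY.trans hYR) ha1 ha4'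
    have hlX := Real.log_natCast_nonneg X
    have hla : 0 ≤ Real.log (2 * a * X) := Real.log_nonneg (by
      have : (1 : ℝ) ≤ X := by exact_mod_cast hX1
      linarith [one_le_mul_of_one_le_of_one_le ha1 this])
    have f1 : Real.sqrt a ≤ Real.sqrt (2 * ρ) * R ^ (1 / 2 : ℝ) := by
      rw [← Real.sqrt_eq_rpow, ← Real.sqrt_mul (by positivity)]
      exact Real.sqrt_le_sqrt ha4'
    have f2 : a ^ (1 / 3 : ℝ) + (X : ℝ) ^ (1 / 2 : ℝ)
        ≤ ((2 * ρ) ^ (1 / 3 : ℝ) + 1) * R ^ (1 / 3 + η / 2 : ℝ) := by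
      have g1 : a ^ (1 / 3 : ℝ) ≤ (2 * ρ) ^ (1 / 3 : ℝ) * R ^ (1 / 3 + η / 2 : ℝ) := by
        calc a ^ (1 / 3 : ℝ) ≤ (2 * ρ * R) ^ (1 / 3 : ℝ) := by gcongr
          _ = (2 * ρ) ^ (1 / 3 : ℝ) * R ^ (1 / 3 : ℝ) := Real.mul_rpow (by positivity) hR0.le
          _ ≤ _ := by
            refine mul_le_mul_of_nonneg_left ?_ (by positivity)
            exact Real.rpow_le_rpow_of_exponent_le hR1 (by linarith)
      have g2 : (X : ℝ) ^ (1 / 2 : ℝ) ≤ R ^ (1 / 3 + η / 2 : ℝ) := by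
        calc (X : ℝ) ^ (1 / 2 : ℝ) ≤ Y ^ (1 / 2 : ℝ) := by gcongr
          _ = _ := by rw [hY, ← Real.rpow_mul hR0.le]; congr 1; ring
      linarith
    have f3 : ((Nat.clog 2 (6 * X ^ 2) + 1 : ℕ) : ℝ) ^ 4 ≤ L1 ^ 4 * R ^ (η / 2 : ℝ) := by
      calc _ ≤ (L1 * R ^ (η / 8 : ℝ)) ^ 4 := by gcongr
        _ = L1 ^ 4 * R ^ (η / 2 : ℝ) := by
          rw [mul_pow, ← Real.rpow_natCast (R ^ _), ← Real.rpow_mul hR0.le]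
          congr 2; push_cast; ring
    have f4 : Real.sqrt a * boxBound a A κ X ≤ Real.sqrt (2 * ρ) *
        (10 ^ 11 * c0 * L1 ^ 4 * ((2 * ρ) ^ (1 / 3 : ℝ) + 1)) * R ^ (4 / 3 + ε : ℝ) := by
      rw [boxBound, hcA]
      have hsplit : R ^ (4 / 3 + η : ℝ) = R ^ (1 / 2 : ℝ) * R ^ (1 / 2 : ℝ) * R ^ (η / 2 : ℝ) *
          R ^ (1 / 3 + η / 2 : ℝ) := by
        rw [← Real.rpow_add hR0, ← Real.rpow_add hR0, ← Real.rpow_add hR0]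
        congr 1; ring
      calc _ ≤ (Real.sqrt (2 * ρ) * R ^ (1 / 2 : ℝ)) * (10 ^ 11 * (c0 * R ^ (1 / 2 : ℝ)) *
            (L1 ^ 4 * R ^ (η / 2 : ℝ)) *
            (((2 * ρ) ^ (1 / 3 : ℝ) + 1) * R ^ (1 / 3 + η / 2 : ℝ))) := by gcongr
        _ = Real.sqrt (2 * ρ) * (10 ^ 11 * c0 * L1 ^ 4 * ((2 * ρ) ^ (1 / 3 : ℝ) + 1)) *
            R ^ (4 / 3 + η : ℝ) := by rw [hsplit]; ring
        _ ≤ _ := by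
            exact mul_le_mul_of_nonneg_left (hmono _ (by linarith)) (by positivity)
    have f5 : Real.sqrt (A / κ) * (1 + Real.log (2 * a * X)) * (3 + 2 * Real.log X) ^ 2 * X ≤
        c0 * L2 * L2 ^ 2 * R ^ (4 / 3 + ε : ℝ) := by
      rw [hcA]
      have hsplit : R ^ (7 / 6 + 4 * η : ℝ) = R ^ (1 / 2 : ℝ) * R ^ η * (R ^ η) ^ 2 * Y := by
        rw [hY, pow_two, ← Real.rpow_add hR0, ← Real.rpow_add hR0, ← Real.rpow_add hR0,
          ← Real.rpow_add hR0]
        congr 1; ring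
      calc _ ≤ c0 * R ^ (1 / 2 : ℝ) * (L2 * R ^ η) * (L2 * R ^ η) ^ 2 * Y := by gcongr
        _ = c0 * L2 * L2 ^ 2 * R ^ (7 / 6 + 4 * η : ℝ) := by rw [hsplit]; ring
        _ ≤ _ := by
            exact mul_le_mul_of_nonneg_left (hmono _ (by linarith)) (by positivity)
    rw [hB2]
    calc _ ≤ C2 * (Real.sqrt (2 * ρ) *
          (10 ^ 11 * c0 * L1 ^ 4 * ((2 * ρ) ^ (1 / 3 : ℝ) + 1)) * R ^ (4 / 3 + ε : ℝ) +
          c0 * L2 * L2 ^ 2 * R ^ (4 / 3 + ε : ℝ)) := by gcongr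
      _ = _ := by ring
  -- the other frequencies
  have hQ : ∀ j : ℤ, (1 + (j : ℝ) ^ 2) * ‖w j‖ ≤ (1 + D2) * R ^ (4 / 3 : ℝ) := by
    intro j
    have k1 := hWd2 (δ * j)
    rw [sq_abs, mul_pow] at k1
    have k2 : (j : ℝ) ^ 2 * ‖w j‖ ≤ D2 * R ^ (4 / 3 : ℝ) := by
      rw [← hδinv, inv_pow, ← div_eq_mul_inv, le_div_iff₀ (by positivity)]
      linarith
    have k3 : 1 ≤ R ^ (4 / 3 : ℝ) := Real.one_le_rpow hR1 (by norm_num)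
    linarith [hw1 j]
  have hτ : ∀ j ∉ Finset.Icc (-X : ℤ) X, (1 + (j : ℝ) ^ 2) * ‖w j‖ ≤
      2 * Dp * R ^ (4 / 3 - 6 : ℝ) := by
    intro j hj
    have hjX : (X : ℝ) + 1 ≤ |(j : ℝ)| := by
      have : (X : ℤ) + 1 ≤ |j| := by
        rw [Finset.mem_Icc, ← abs_le] at hj; omega
      exact_mod_cast this
    have hjY : Y ≤ |(j : ℝ)| := (Nat.lt_floor_add_one Y).le.trans hjX
    set t := δ * |(j : ℝ)| with ht
    have htU : R ^ η ≤ t := by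
      calc R ^ η = δ * Y := by rw [hδ, hY, ← Real.rpow_add hR0]; congr 1; ring
        _ ≤ t := by rw [ht]; gcongr
    have hUp : R ^ (6 : ℝ) ≤ t ^ p := by
      calc R ^ (6 : ℝ) ≤ R ^ (η * p) := Real.rpow_le_rpow_of_exponent_le hR1 hpη
        _ = (R ^ η) ^ p := by rw [Real.rpow_mul hR0.le, Real.rpow_natCast]
        _ ≤ t ^ p := by gcongr
    have k1 := hWdp (δ * j)
    rw [abs_mul, abs_of_pos hδ0, ← ht] at k1
    have hj2 : 1 + (j : ℝ) ^ 2 ≤ 2 * (R ^ (4 / 3 : ℝ) * t ^ 2) := by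
      have e : R ^ (4 / 3 : ℝ) * t ^ 2 = (j : ℝ) ^ 2 := by
        rw [← hδinv, ht, mul_pow, sq_abs]; field_simp
      rw [e]
      have : 1 ≤ |(j : ℝ)| := by linarith
      linarith [one_le_pow₀ this (n := 2), sq_abs (j : ℝ)]
    have hR6 : 0 < R ^ (6 : ℝ) := Real.rpow_pos_of_pos hR0 _
    rw [Real.rpow_sub hR0, ← mul_div_assoc, le_div_iff₀ hR6]
    have hR43 : 0 ≤ R ^ (4 / 3 : ℝ) := by positivity
    have ht0 : 0 ≤ t := by positivity
    calc (1 + (j : ℝ) ^ 2) * ‖w j‖ * R ^ (6 : ℝ)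
        ≤ 2 * (R ^ (4 / 3 : ℝ) * t ^ 2) * ‖w j‖ * t ^ p := by gcongr
      _ = 2 * R ^ (4 / 3 : ℝ) * (t ^ (p + 2) * ‖w j‖) := by ring
      _ ≤ 2 * R ^ (4 / 3 : ℝ) * Dp := by gcongr
      _ = _ := by ring
  have H3 := norm_tsum_sub_axis_sub_box_le A ha0.le hws hQ (by positivity) hτ
  have H3' : volume.real (torusSet a A) * (((1 + D2) * R ^ (4 / 3 : ℝ)) ^ 2 *
      (2 * Dp * R ^ (4 / 3 - 6 : ℝ))) * S ^ 3 ≤ B3 * R ^ (4 / 3 + ε : ℝ) := by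
    have hv := volume_real_torusSet_le ha0.le haA'.le
    have hsplit : R ^ (1 : ℝ) = R ^ 3 * (R ^ (4 / 3 : ℝ)) ^ 2 * R ^ (4 / 3 - 6 : ℝ) := by
      rw [pow_two, ← Real.rpow_natCast R 3, ← Real.rpow_add hR0, ← Real.rpow_add hR0,
        ← Real.rpow_add hR0]
      norm_num
    calc _ ≤ 32 * A ^ 3 * (((1 + D2) * R ^ (4 / 3 : ℝ)) ^ 2 *
          (2 * Dp * R ^ (4 / 3 - 6 : ℝ))) * S ^ 3 := by gcongr
      _ = B3 * R ^ (1 : ℝ) := by rw [hsplit, hB3, hA]; ring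
      _ ≤ _ := by
          exact mul_le_mul_of_nonneg_left (hmono _ (by linarith)) (by positivity)
  have hfin := norm_add_le_of_le (norm_add_le_of_le (H3.trans H3') H2) H1
  refine (le_of_eq ?_).trans (hfin.trans (le_of_eq (by ring)))
  congr 1
  ring

/-! ### The lattice point count -/

lemma abs_torusBesselTerm_le {K ρ : ℝ} (hK : 0 < K)
    (hJ : ∀ x > 0, |besselJ 0 x| ≤ K / Real.sqrt x ∧ |besselJ 1 x| ≤ K / Real.sqrt x)
    (hρ : 0 < ρ) {R : ℝ} (hR : 1 ≤ R) (k : ℕ) :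
    |torusBesselTerm ρ R k| ≤ K / Real.sqrt ρ * ((k + 1 : ℕ) : ℝ) ^ (-(3 / 2) : ℝ) := by
  have hR0 : 0 < R := by linarith
  have hk : (0 : ℝ) < (k : ℝ) + 1 := by positivity
  have hpi := Real.pi_gt_three
  rw [torusBesselTerm, abs_div, abs_of_pos hk]
  have h1 := (hJ (2 * Real.pi * ρ * R * ((k : ℝ) + 1)) (by positivity)).2
  have h2 : Real.sqrt ρ * Real.sqrt ((k : ℝ) + 1) ≤
      Real.sqrt (2 * Real.pi * ρ * R * ((k : ℝ) + 1)) := by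
    rw [← Real.sqrt_mul hρ.le]
    refine Real.sqrt_le_sqrt ?_
    have h3 : 1 * 1 ≤ (2 * Real.pi) * R := by gcongr; linarith
    calc ρ * ((k : ℝ) + 1) = 1 * 1 * (ρ * ((k : ℝ) + 1)) := by ring
      _ ≤ (2 * Real.pi) * R * (ρ * ((k : ℝ) + 1)) := by gcongr
      _ = _ := by ring
  have hs1 := Real.sqrt_pos.mpr hρ
  have hs2 := Real.sqrt_pos.mpr hk
  have e : ((k + 1 : ℕ) : ℝ) ^ (-(3 / 2) : ℝ) = 1 / Real.sqrt ((k : ℝ) + 1) / ((k : ℝ) + 1) := by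
    push_cast
    rw [Real.sqrt_eq_rpow, one_div (_ ^ _), ← Real.rpow_neg hk.le, ← Real.rpow_sub_one hk.ne']
    norm_num
  rw [e]
  calc |besselJ 1 (2 * Real.pi * ρ * R * ((k : ℝ) + 1))| / ((k : ℝ) + 1)
      ≤ K / (Real.sqrt ρ * Real.sqrt ((k : ℝ) + 1)) / ((k : ℝ) + 1) := by
        gcongr
        exact h1.trans (by gcongr)
    _ = _ := by field_simp

lemma mem_torusLatticePoints_iff {ρ ρ' R : ℝ} (hR : 0 < R) (n : Fin 3 → ℤ) :
    n ∈ torusLatticePoints ρ ρ' R ↔ ((n 0, n 1), n 2) ∈ torusIntPoints (ρ * R) (ρ' * R) := by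
  simp only [torusLatticePoints, solidTorus, torusIntPoints, torusSet, Set.mem_ofPred_eq,
    Pi.smul_apply, smul_eq_mul]
  have e : Real.sqrt ((R⁻¹ * (n 0 : ℝ)) ^ 2 + (R⁻¹ * (n 1 : ℝ)) ^ 2) =
      R⁻¹ * Real.sqrt ((n 0 : ℝ) ^ 2 + (n 1 : ℝ) ^ 2) := by
    rw [mul_pow, mul_pow, ← mul_add, Real.sqrt_mul (by positivity),
      Real.sqrt_sq (by positivity)]
  rw [e]
  have h1 : (ρ' - R⁻¹ * Real.sqrt ((n 0 : ℝ) ^ 2 + (n 1 : ℝ) ^ 2)) ^ 2 + (R⁻¹ * (n 2 : ℝ)) ^ 2 =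
      ((ρ' * R - Real.sqrt ((n 0 : ℝ) ^ 2 + (n 1 : ℝ) ^ 2)) ^ 2 + (n 2 : ℝ) ^ 2) / R ^ 2 := by
    field_simp
  rw [h1, div_le_iff₀ (by positivity), mul_pow]

/-- Integer triples as an iterated product. -/
def tripleEquiv : (Fin 3 → ℤ) ≃ (ℤ × ℤ) × ℤ where
  toFun n := ((n 0, n 1), n 2)
  invFun ω := ![ω.1.1, ω.1.2, ω.2]
  left_inv n := by ext i; fin_cases i <;> rfl
  right_inv _ := rfl

lemma torusLatticePoints_eq_preimage {ρ ρ' R : ℝ} (hR : 0 < R) :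
    torusLatticePoints ρ ρ' R = tripleEquiv ⁻¹' torusIntPoints (ρ * R) (ρ' * R) :=
  Set.ext fun n => mem_torusLatticePoints_iff hR n

lemma torusCount_eq {ρ ρ' R : ℝ} (hR : 0 < R) :
    torusCount ρ ρ' R = (torusIntPoints (ρ * R) (ρ' * R)).ncard := by
  rw [torusCount, torusLatticePoints_eq_preimage hR,
    ← Set.ncard_image_of_injective _ tripleEquiv.injective,
    Set.image_preimage_eq _ tripleEquiv.surjective]

/-- A solid torus lies in a ball about the origin, which is the degenerate torus with central
radius `0`. -/
lemma torusIntPoints_subset {a A r : ℝ} (ha : 0 ≤ a) (hA : 0 ≤ A) (hr : a + A ≤ r) :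
    torusIntPoints a A ⊆ torusIntPoints r 0 := by
  intro n hn
  simp only [torusIntPoints, torusSet, Set.mem_ofPred_eq] at hn ⊢
  set s := Real.sqrt ((n.1.1 : ℝ) ^ 2 + (n.1.2 : ℝ) ^ 2)
  have h1 : |A - s| ≤ a := abs_le_of_sq_le_sq (by nlinarith [sq_nonneg (n.2 : ℝ)]) ha
  have h2 := (abs_le.mp h1).1
  nlinarith

theorem theorem1 (ρ ρ' : ℝ) (hρ : 0 < ρ) (hρρ' : ρ < ρ') :
    (∀ R : ℝ, 1 < R → (torusLatticePoints ρ ρ' R).Finite) ∧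
    (∀ R : ℝ, 1 < R → Summable (torusBesselTerm ρ R)) ∧
    (∀ ε : ℝ, 0 < ε → ∃ C : ℝ, ∀ R : ℝ, 1 < R →
      |(torusCount ρ ρ' R : ℝ) - torusMainTerm ρ ρ' R| ≤ C * R ^ ((4 : ℝ) / 3 + ε)) := by
  have hρ' : 0 < ρ' := hρ.trans hρρ'
  obtain ⟨K, hK, hJ⟩ := exists_norm_bessel_le
  have hmaj : Summable fun k : ℕ => K / Real.sqrt ρ * ((k + 1 : ℕ) : ℝ) ^ (-(3 / 2) : ℝ) :=
    ((summable_nat_add_iff 1).mpr (Real.summable_nat_rpow.mpr (by norm_num))).mul_left _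
  have hterm : ∀ R : ℝ, 1 ≤ R → ∀ k, |torusBesselTerm ρ R k| ≤
      K / Real.sqrt ρ * ((k + 1 : ℕ) : ℝ) ^ (-(3 / 2) : ℝ) := fun R hR k =>
    abs_torusBesselTerm_le hK hJ hρ hR k
  refine ⟨fun R hR => ?_, fun R hR => ?_, fun ε hε => ?_⟩
  · have hR0 : 0 < R := by linarith
    rw [torusLatticePoints_eq_preimage hR0]
    exact (torusIntPoints_finite _ (by positivity)).preimage tripleEquiv.injective.injOn
  · exact Summable.of_norm_bounded hmaj (hterm R hR.le)
  · obtain ⟨W, hW0, hW1, hWl, hWd, hcount⟩ := exists_fourier_weight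
    obtain ⟨C, hC, hmain⟩ := exists_norm_tsum_sub_main_le hρ hρρ' hε hW0 hW1 hWl hWd
      fun δ hδ => (hcount 0 0 δ le_rfl hδ).1
    -- from `R₀` on the asymptotic estimate applies
    set R₀ := max 1 (max (4 / ρ) (max (4 / (ρ' - ρ)) ((768 / ρ ^ 2) ^ 2))) with hR₀
    set S := ∑' k : ℕ, K / Real.sqrt ρ * ((k + 1 : ℕ) : ℝ) ^ (-(3 / 2) : ℝ) with hS
    have hS0 : 0 ≤ S := tsum_nonneg fun k => by positivity
    have hR₀1 : 1 ≤ R₀ := le_max_left _ _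
    set M : ℝ := ((torusIntPoints (ρ * R₀ + ρ' * R₀) 0).ncard : ℝ) +
      (2 * Real.pi ^ 2 * ρ ^ 2 * ρ' * R₀ ^ 3 + 4 * Real.pi * ρ * ρ' * R₀ ^ 2 * S) with hM
    have hM0 : 0 ≤ M := by positivity
    refine ⟨C + M, fun R hR => ?_⟩
    have hR0 : 0 < R := by linarith
    have hRpow : 1 ≤ R ^ (4 / 3 + ε : ℝ) := Real.one_le_rpow hR.le (by positivity)
    rw [torusCount_eq hR0]
    rcases le_total R₀ R with hbig | hsmall
    · have hge := max_le_iff.mp hbig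
      have hge2 := max_le_iff.mp hge.2
      have hge3 := max_le_iff.mp hge2.2
      have c1 : 4 ≤ ρ * R := by
        have := (div_le_iff₀ hρ).mp hge2.1; linarith
      have c2 : 4 ≤ (ρ' - ρ) * R := by
        have := (div_le_iff₀ (by linarith : 0 < ρ' - ρ)).mp hge3.1; linarith
      have c3 : 768 ≤ ρ ^ 2 * R ^ (7 / 12 : ℝ) := by
        have h1 : 768 / ρ ^ 2 ≤ R ^ (7 / 12 : ℝ) := by
          calc 768 / ρ ^ 2 ≤ Real.sqrt R := Real.le_sqrt_of_sq_le hge3.2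
            _ = R ^ (1 / 2 : ℝ) := Real.sqrt_eq_rpow R
            _ ≤ _ := Real.rpow_le_rpow_of_exponent_le hR.le (by norm_num)
        have := (div_le_iff₀ (by positivity : 0 < ρ ^ 2)).mp h1; linarith
      set δ := R ^ (-(2 / 3) : ℝ) with hδ
      have hδ0 : 0 < δ := Real.rpow_pos_of_pos hR0 _
      have hδ1 : δ ≤ 1 := Real.rpow_le_one_of_one_le_of_nonpos hR.le (by norm_num)
      have hre : ∀ a : ℝ, |a - ρ * R| ≤ 2 * δ →
          |(∑' ω, tripleWeight (fun j => W (δ * j)) ω * torusFourier a (ρ' * R) ω).re -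
            torusMainTerm ρ ρ' R| ≤ C * R ^ (4 / 3 + ε : ℝ) := fun a ha => by
        have h1 := hmain R a hR.le c1 c2 c3 ha
        have h2 := (Complex.abs_re_le_norm _).trans h1
        rwa [Complex.sub_re, Complex.ofReal_re] at h2
      have hup := (hcount (ρ * R) (ρ' * R) δ (by positivity) hδ0).2.1
      have hlow := (hcount (ρ * R - 2 * δ) (ρ' * R) δ (by linarith) hδ0).2.2
      rw [sub_add_cancel] at hlow
      have u1 := hre (ρ * R + 2 * δ) (by rw [add_sub_cancel_left, abs_of_pos (by positivity)])
      have u2 := hre (ρ * R - 2 * δ) (by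
        rw [sub_sub_cancel_left, abs_neg, abs_of_pos (by positivity)])
      have hMR : 0 ≤ M * R ^ (4 / 3 + ε : ℝ) := by positivity
      rw [add_mul, abs_le]
      constructor
      · linarith [(abs_le.mp u2).1]
      · linarith [(abs_le.mp u1).2]
    · have h1 : ((torusIntPoints (ρ * R) (ρ' * R)).ncard : ℝ) ≤
          ((torusIntPoints (ρ * R₀ + ρ' * R₀) 0).ncard : ℝ) := by
        have := Set.ncard_le_ncard (torusIntPoints_subset (a := ρ * R) (A := ρ' * R)
          (r := ρ * R₀ + ρ' * R₀) (by positivity) (by positivity) (by gcongr))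
          (torusIntPoints_finite 0 (by positivity))
        exact_mod_cast this
      have h2 : |∑' k, torusBesselTerm ρ R k| ≤ S := by
        rw [← Real.norm_eq_abs]
        exact tsum_of_norm_bounded hmaj.hasSum (hterm R hR.le)
      have h3 : |torusMainTerm ρ ρ' R| ≤
          2 * Real.pi ^ 2 * ρ ^ 2 * ρ' * R₀ ^ 3 + 4 * Real.pi * ρ * ρ' * R₀ ^ 2 * S := by
        have hpi := Real.pi_pos
        rw [torusMainTerm]
        refine (abs_add_le _ _).trans ?_
        rw [abs_mul (4 * Real.pi * ρ * ρ' * R ^ 2), abs_of_pos (by positivity),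
          abs_of_pos (by positivity : 0 < 4 * Real.pi * ρ * ρ' * R ^ 2)]
        gcongr
      have h4 : |((torusIntPoints (ρ * R) (ρ' * R)).ncard : ℝ) - torusMainTerm ρ ρ' R| ≤ M := by
        refine (abs_sub _ _).trans ?_
        rw [Nat.abs_cast]
        linarith
      have h5 : M ≤ M * R ^ (4 / 3 + ε : ℝ) := le_mul_of_one_le_right hM0 hRpow
      have h6 : 0 ≤ C * R ^ (4 / 3 + ε : ℝ) := by positivity
      rw [add_mul]
      linarith
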